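/- **Conventions.** An *oriented graded poset* is a finite poset $P$ with a dimension function (minimal elements have dimension $0$; if $y$ covers $x$ then $\dim y=\dim x+1$) and a label $o(y\to x)\in\{+,-\}$ for each covering pair. For closed (downward closed) $U\subseteq P$, $n\ge 0$ and $\alpha\in\{+,-\}$, let $\Delta_n^\alpha U$ be the set of $n$-dimensional $x\in U$ such that every $y\in U$ covering $x$ has $o(y\to x)=\alpha$, and let $$\partial_n^\alpha U=\mathrm{cl}(\Delta_n^\alpha U)\cup\{x\in U\mid \dim y\le n\text{ for all }y\in U\text{ with }y\ge x\},\qquad \partial_nU=\partial^+_nU\cup\partial^-_nU,\quad \partial_{-1}U=\emptyset,$$ and $\partial_n^\alpha x=\partial_n^\alpha\,\mathrm{cl}\{x\}$. *Molecules* of $P$ are generated inductively: $\mathrm{cl}\{x\}$ is a molecule (an *atom*), and if $U,V$ are molecules properly contained in $U\cup V$ with $U\cap V=\partial_n^+U=\partial_n^-V$ for some $n$, then $U\cup V$ is a molecule. $P$ is a *regular directed complex* if for all $x\in P$: $\partial_k^+x\cap\partial_k^-x=\partial_{k-1}x$ for all $0\le k<\dim x$; $\partial_{n}^\alpha x$ is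 a molecule if $\dim x=n+1$; and $\partial_{n}^\alpha(\partial_{n+1}^\beta x)=\partial_{n}^\alpha x$ if $\dim x=n+2$. A *map* $f:P\to Q$ of regular directed complexes is a function with $\partial_n^\alpha f(x)=f(\partial_n^\alpha x)$ for all $x,n,\alpha$. This gives a (small) category $\mathbf{DCpx}$. Let $\mathbf{Atom}$ be a skeleton of its full subcategory on the complexes with a greatest element. A *diagrammatic set* is a presheaf of sets on $\mathbf{Atom}$; they form a category $\mathbf{DgmSet}$, and $\mathbf{DCpx}$ embeds in it by $Q\mapsto \mathbf{DCpx}(-,Q)|_{\mathbf{Atom}}$. For a regular directed complex $Q$, let $\mathrm{Mol}(Q)^*$ be the strict $\omega$-category generated by an $n$-cell for each molecule $U\subseteq Q$ with $\dim U\le n$ (for each $n$), subject to: the $k$-boundaries of $U$ are $\partial_k^\pm U$, the units on $U$ are $U$, and $U\#_kV=U\cup V$ whenever $U\cap V=\partial_k^+U=\partial_k^-V$. The *$2$-coskeleton* $\mathrm{coskel}_2X$ of a strict $\omega$-category $X$ is its reflection into strict $2$-categories ($\omega$-categories in which every cell of dimension $>2$ is a unit on a $2$-cell). A *bicoloured pro*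 is a strict $2$-category $T$ with a set $\mathcal T_1$ of $1$-cells such that the underlying category of $0$- and $1$-cells is free on the graph with all $0$-cells as vertices and $\mathcal T_1$ as edges. A *morphism* $(T,\mathcal T_1)\to(S,\mathcal S_1)$ is a strict $2$-functor sending each element of $\mathcal T_1$ to an element of $\mathcal S_1$ or to the unit on a $0$-cell. These form a category $\mathbf{biPro}$. **Proposition.** There is a unique functor $\mathsf P:\mathbf{DCpx}\to\mathbf{biPro}$ such that $\mathsf PQ$ is $\mathrm{coskel}_2(\mathrm{Mol}(Q)^*)$ with the $1$-dimensional atoms of $Q$ as generating $1$-cells, and $\mathsf Pf$ sends $\mathrm{cl}\{x\}$ to $\mathrm{cl}\{f(x)\}$ for every map $f:Q\to R$ and every $x\in Q$. Its left Kan extension $\mathsf P:\mathbf{DgmSet}\to\mathbf{biPro}$ along the embedding $\mathbf{DCpx}\hookrightarrow\mathbf{DgmSet}$ exists and has a right adjoint $\mathsf N:\mathbf{biPro}\to\mathbf{DgmSet}$, the *diagrammatic nerve of bicoloured pros*. The functor $\mathsf N$ is full and faithful. -/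

import Mathlib

open CategoryTheory

namespace DiagNerve

/-- The two polarities `-` (input) and `+` (output). -/
inductive Pol : Type
  | minus
  | plus

/-! ### Oriented graded posets, molecules, regular directed complexes -/

/-- A graded poset with an orientation. The poset is graded exactly when there is a function `dim`
with the two listed properties, and then `dim` is unique. The orientation labels the edges of the
Hasse diagram, i.e. the pairs `x ⋖ y`. (Finiteness is imposed on regular directed complexes.) -/
class OGPoset (P : Type) extends PartialOrder P where
  dim : P → ℕ
  dim_of_isMin : ∀ x : P, IsMin x → dim x = 0
  dim_of_covBy : ∀ x y : P, x ⋖ y → dim y = dim x + 1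
  orient : ∀ {x y : P}, x ⋖ y → Pol

section Poset

variable {P : Type} [OGPoset P]

/-- `Δ_n^α U`: the `n`-dimensional elements of `U` all of whose covers in `U` have label `α`. -/
def sbord (n : ℕ) (α : Pol) (U : Set P) : Set P :=
  {x | x ∈ U ∧ OGPoset.dim x = n ∧ ∀ y ∈ U, ∀ h : x ⋖ y, OGPoset.orient h = α}

/-- `∂_n^α U`: the input (`α = -`) or output (`α = +`) `n`-boundary of the closed subset `U`. -/
def bord (n : ℕ) (α : Pol) (U : Set P) : Set P :=
  {x | ∃ y ∈ sbord n α U, x ≤ y} ∪ {x | x ∈ U ∧ ∀ y ∈ U, x ≤ y → OGPoset.dim y ≤ n}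

/-- The molecules of `P`. A closed subset with greatest element `x` is `Set.Iic x`. -/
inductive IsMolecule : Set P → Prop
  | atom (x : P) : IsMolecule (Set.Iic x)
  | paste (n : ℕ) (U V : Set P) : IsMolecule U → IsMolecule V → U ⊂ U ∪ V → V ⊂ U ∪ V →
      U ∩ V = bord n Pol.plus U → U ∩ V = bord n Pol.minus V → IsMolecule (U ∪ V)

end Poset

/-- The conditions for a (finite) oriented graded poset to be a regular directed complex. The first
two say that `cl{x}` has spherical boundary (with the convention that the `(-1)`-boundary is
empty). -/
structure IsRDC (P : Type) [OGPoset P] : Prop where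
  spherical_zero : ∀ x : P, 0 < OGPoset.dim x →
    bord 0 Pol.plus (Set.Iic x) ∩ bord 0 Pol.minus (Set.Iic x) = ∅
  spherical_succ : ∀ (x : P) (k : ℕ), k + 1 < OGPoset.dim x →
    bord (k + 1) Pol.plus (Set.Iic x) ∩ bord (k + 1) Pol.minus (Set.Iic x) =
      bord k Pol.plus (Set.Iic x) ∪ bord k Pol.minus (Set.Iic x)
  molecule : ∀ (x : P) (n : ℕ) (α : Pol), OGPoset.dim x = n + 1 → IsMolecule (bord n α (Set.Iic x))
  globular : ∀ (x : P) (n : ℕ) (α β : Pol), OGPoset.dim x = n + 2 →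
    bord n α (bord (n + 1) β (Set.Iic x)) = bord n α (Set.Iic x)

/-- Regular directed complexes. In order to have a small category, the underlying finite set is
taken to be of the form `Fin size` (with an arbitrary partial order, not the usual one). -/
structure RDCpx : Type where
  size : ℕ
  str : OGPoset (Fin size)
  isRDC : @IsRDC (Fin size) str

namespace RDCpx

/-- The elements of a regular directed complex (a type synonym which hides the usual order). -/
def El (Q : RDCpx) : Type := Fin Q.size

instance (Q : RDCpx) : OGPoset Q.El := Q.str

instance (Q : RDCpx) : Finite Q.El := inferInstanceAs (Finite (Fin Q.size))

/-- Maps of regular directed complexes: functions with `∂_n^α f(x) = f(∂_n^α x)`. -/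
@[ext]
structure Hom (Q R : RDCpx) : Type where
  fn : Q.El → R.El
  bord_fn : ∀ (x : Q.El) (n : ℕ) (α : Pol),
    bord n α (Set.Iic (fn x)) = fn '' bord n α (Set.Iic x)

instance : Category RDCpx where
  Hom := Hom
  id Q := ⟨fun x => x, fun x n α => by simp⟩
  comp f g := ⟨fun x => g.fn (f.fn x), fun x n α => by
    rw [g.bord_fn, f.bord_fn, Set.image_image]⟩

/-- Maps do not raise dimension. -/
theorem Hom.dim_le {Q R : RDCpx} (f : Hom Q R) (x : Q.El) :
    OGPoset.dim (f.fn x) ≤ OGPoset.dim x := by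
  have hx : x ∈ bord (OGPoset.dim x) Pol.plus (Set.Iic x) := by
    refine Or.inr ⟨le_refl x, fun y hy hxy => ?_⟩
    rw [le_antisymm hy hxy]
  have h : f.fn x ∈ bord (OGPoset.dim x) Pol.plus (Set.Iic (f.fn x)) := by
    rw [f.bord_fn]; exact ⟨x, hx, rfl⟩
  rcases h with ⟨y, ⟨hy, hd, -⟩, hxy⟩ | ⟨-, h⟩
  · rw [le_antisymm hxy hy, hd]
  · exact h _ (le_refl _) (le_refl _)

/-- The atoms: regular directed complexes with a greatest element. -/
def isAtomShape : ObjectProperty RDCpx := fun Q => ∃ t : Q.El, ∀ x : Q.El, x ≤ t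

end RDCpx

/-- A skeleton of the full subcategory of regular directed complexes on the atoms. -/
abbrev Atom : Type := Skeleton RDCpx.isAtomShape.FullSubcategory

/-- The inclusion of the category of atoms into regular directed complexes. -/
noncomputable def atomInclusion : Atom ⥤ RDCpx :=
  fromSkeleton RDCpx.isAtomShape.FullSubcategory ⋙ RDCpx.isAtomShape.ι

/-- Diagrammatic sets: presheaves on the category of atoms. -/
abbrev DgmSet : Type 1 := Atomᵒᵖ ⥤ Type

/-- The embedding of regular directed complexes into diagrammatic sets, which sends `Q` to the
presheaf of maps from atoms into `Q`. -/
noncomputable def embedding : RDCpx ⥤ DgmSet :=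
  yoneda ⋙ (Functor.whiskeringLeft Atomᵒᵖ RDCpxᵒᵖ Type).obj atomInclusion.op

/-! ### Strict ω-categories -/

/-- (Strict) ω-categories: reflexive ω-graphs with `k`-boundaries `bd` and units `unit`, together
with `k`-compositions `x #_k y` of `n`-cells, `k < n`, defined exactly when `∂_k^+ x = ∂_k^- y`. -/
structure OmegaCat : Type 1 where
  cell : ℕ → Type
  bd : ∀ (_ : Pol) {k n : ℕ}, k < n → cell n → cell k
  unit : ∀ {k n : ℕ}, k < n → cell k → cell n
  comp : ∀ {k n : ℕ} (h : k < n) (x y : cell n), bd Pol.plus h x = bd Pol.minus h y → cell n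
  bd_bd : ∀ (α β : Pol) {j k n : ℕ} (h : j < k) (h' : k < n) (x : cell n),
    bd β h (bd α h' x) = bd β (h.trans h') x
  unit_unit : ∀ {j k n : ℕ} (h : j < k) (h' : k < n) (x : cell j),
    unit h' (unit h x) = unit (h.trans h') x
  bd_unit_lt : ∀ (α : Pol) {k m n : ℕ} (h : k < m) (h' : m < n) (x : cell m),
    bd α (h.trans h') (unit h' x) = bd α h x
  bd_unit_eq : ∀ (α : Pol) {m n : ℕ} (h : m < n) (x : cell m), bd α h (unit h x) = x
  bd_unit_gt : ∀ (α : Pol) {m k n : ℕ} (h : m < k) (h' : k < n) (x : cell m),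
    bd α h' (unit (h.trans h') x) = unit h x
  unit_comp : ∀ {k n m : ℕ} (h : k < n) (h' : n < m) (x y : cell n) (e) (e'),
    unit h' (comp h x y e) = comp (h.trans h') (unit h' x) (unit h' y) e'
  comp_unit_right : ∀ {k n : ℕ} (h : k < n) (x : cell n) (e),
    comp h x (unit h (bd Pol.plus h x)) e = x
  comp_unit_left : ∀ {k n : ℕ} (h : k < n) (x : cell n) (e),
    comp h (unit h (bd Pol.minus h x)) x e = x
  bd_minus_comp : ∀ {k n : ℕ} (h : k < n) (x y : cell n) (e),
    bd Pol.minus h (comp h x y e) = bd Pol.minus h x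
  bd_plus_comp : ∀ {k n : ℕ} (h : k < n) (x y : cell n) (e),
    bd Pol.plus h (comp h x y e) = bd Pol.plus h y
  bd_comp : ∀ (α : Pol) {k j n : ℕ} (h : k < j) (h' : j < n) (x y : cell n) (e) (e'),
    bd α h' (comp (h.trans h') x y e) = comp h (bd α h' x) (bd α h' y) e'
  assoc : ∀ {k n : ℕ} (h : k < n) (x y z : cell n) (e₁) (e₂) (e₃) (e₄),
    comp h (comp h x y e₁) z e₂ = comp h x (comp h y z e₃) e₄
  interchange : ∀ {k j n : ℕ} (h : k < j) (h' : j < n) (x x' y y' : cell n)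
    (e₁) (e₂) (e₃) (e₄) (e₅) (e₆),
    comp (h.trans h') (comp h' x x' e₁) (comp h' y y' e₂) e₃ =
      comp h' (comp (h.trans h') x y e₄) (comp (h.trans h') x' y' e₅) e₆

namespace OmegaCat

/-- Functors of ω-categories. -/
@[ext]
structure Hom (X Y : OmegaCat) : Type where
  fn : ∀ {n : ℕ}, X.cell n → Y.cell n
  fn_bd : ∀ (α : Pol) {k n : ℕ} (h : k < n) (x : X.cell n), fn (X.bd α h x) = Y.bd α h (fn x)
  fn_unit : ∀ {k n : ℕ} (h : k < n) (x : X.cell k), fn (X.unit h x) = Y.unit h (fn x)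
  fn_comp : ∀ {k n : ℕ} (h : k < n) (x y : X.cell n) (e) (e'),
    fn (X.comp h x y e) = Y.comp h (fn x) (fn y) e'

instance : Category OmegaCat where
  Hom := Hom
  id X := ⟨fun x => x, fun _ _ _ _ _ => rfl, fun _ _ => rfl, fun _ _ _ _ _ => rfl⟩
  comp {X Y Z} f g :=
    ⟨fun x => g.fn (f.fn x), fun α _ _ h x => by rw [f.fn_bd, g.fn_bd],
      fun h x => by rw [f.fn_unit, g.fn_unit],
      fun h x y e e' => by
        have e'' : Y.bd Pol.plus h (f.fn x) = Y.bd Pol.minus h (f.fn y) := by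
          rw [← f.fn_bd, ← f.fn_bd, e]
        rw [f.fn_comp h x y e e'', g.fn_comp h _ _ e'' e']⟩

/-- An `N`-category is an ω-category all of whose cells have rank at most `N`. -/
def IsNCat (N : ℕ) (X : OmegaCat) : Prop :=
  ∀ {m : ℕ} (h : N < m) (x : X.cell m), ∃ y : X.cell N, x = X.unit h y

end OmegaCat

/-! ### ω-categories presented by generators and relations -/

/-- Formal expressions of the language of ω-categories on a graded set `G` of generators. -/
inductive Term (G : ℕ → Type) : ℕ → Type
  | gen {n : ℕ} (g : G n) : Term G n
  | bd (α : Pol) {k n : ℕ} (h : k < n) (x : Term G n) : Term G k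
  | unit {k n : ℕ} (h : k < n) (x : Term G k) : Term G n
  | comp {k n : ℕ} (h : k < n) (x y : Term G n) : Term G n

/-- The formal equations of the theory of ω-categories. -/
inductive Law {G : ℕ → Type} : ∀ {n : ℕ}, Term G n → Term G n → Prop
  | bd_bd (α β : Pol) {j k n : ℕ} (h : j < k) (h' : k < n) (x : Term G n) :
      Law (.bd β h (.bd α h' x)) (.bd β (h.trans h') x)
  | unit_unit {j k n : ℕ} (h : j < k) (h' : k < n) (x : Term G j) :
      Law (.unit h' (.unit h x)) (.unit (h.trans h') x)
  | bd_unit_lt (α : Pol) {k m n : ℕ} (h : k < m) (h' : m < n) (x : Term G m) :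
      Law (.bd α (h.trans h') (.unit h' x)) (.bd α h x)
  | bd_unit_eq (α : Pol) {m n : ℕ} (h : m < n) (x : Term G m) : Law (.bd α h (.unit h x)) x
  | bd_unit_gt (α : Pol) {m k n : ℕ} (h : m < k) (h' : k < n) (x : Term G m) :
      Law (.bd α h' (.unit (h.trans h') x)) (.unit h x)
  | unit_comp {k n m : ℕ} (h : k < n) (h' : n < m) (x y : Term G n) :
      Law (.unit h' (.comp h x y)) (.comp (h.trans h') (.unit h' x) (.unit h' y))
  | comp_unit_right {k n : ℕ} (h : k < n) (x : Term G n) :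
      Law (.comp h x (.unit h (.bd Pol.plus h x))) x
  | comp_unit_left {k n : ℕ} (h : k < n) (x : Term G n) :
      Law (.comp h (.unit h (.bd Pol.minus h x)) x) x
  | bd_minus_comp {k n : ℕ} (h : k < n) (x y : Term G n) :
      Law (.bd Pol.minus h (.comp h x y)) (.bd Pol.minus h x)
  | bd_plus_comp {k n : ℕ} (h : k < n) (x y : Term G n) :
      Law (.bd Pol.plus h (.comp h x y)) (.bd Pol.plus h y)
  | bd_comp (α : Pol) {k j n : ℕ} (h : k < j) (h' : j < n) (x y : Term G n) :
      Law (.bd α h' (.comp (h.trans h') x y)) (.comp h (.bd α h' x) (.bd α h' y))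
  | assoc {k n : ℕ} (h : k < n) (x y z : Term G n) :
      Law (.comp h (.comp h x y) z) (.comp h x (.comp h y z))
  | interchange {k j n : ℕ} (h : k < j) (h' : j < n) (x x' y y' : Term G n) :
      Law (.comp (h.trans h') (.comp h' x x') (.comp h' y y'))
        (.comp h' (.comp (h.trans h') x y) (.comp (h.trans h') x' y'))

/-- A presentation of an ω-category: generators and formal equations between expressions. -/
structure Presentation : Type 1 where
  G : ℕ → Type
  R : ∀ {n : ℕ}, Term G n → Term G n → Prop

namespace Presentation

variable (p : Presentation)

/-- `p.Rel s t`: the expressions `s` and `t` are both defined and are equal in the presented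
ω-category. In particular `p.Rel s s` says that `s` is defined; a composition is defined when the
boundaries of the two factors match. -/
inductive Rel : ∀ {n : ℕ}, Term p.G n → Term p.G n → Prop
  | gen {n : ℕ} (g : p.G n) : Rel (.gen g) (.gen g)
  | symm {n : ℕ} {s t : Term p.G n} : Rel s t → Rel t s
  | trans {n : ℕ} {s t u : Term p.G n} : Rel s t → Rel t u → Rel s u
  | bd (α : Pol) {k n : ℕ} (h : k < n) {s t : Term p.G n} :
      Rel s t → Rel (.bd α h s) (.bd α h t)
  | unit {k n : ℕ} (h : k < n) {s t : Term p.G k} : Rel s t → Rel (.unit h s) (.unit h t)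
  | comp {k n : ℕ} (h : k < n) {s s' t t' : Term p.G n} : Rel s s' → Rel t t' →
      Rel (.bd Pol.plus h s) (.bd Pol.minus h t) → Rel (.comp h s t) (.comp h s' t')
  | law {n : ℕ} {s t : Term p.G n} : Law s t → Rel s s → Rel t t → Rel s t
  | rel {n : ℕ} {s t : Term p.G n} : p.R s t → Rel s s → Rel t t → Rel s t

/-- The defined expressions of dimension `n`, up to equality. -/
def cellSetoid (n : ℕ) : Setoid {t : Term p.G n // p.Rel t t} where
  r s t := p.Rel s.1 t.1
  iseqv := ⟨fun s => s.2, fun h => h.symm, fun h h' => h.trans h'⟩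

/-- The `n`-cells of the presented ω-category. -/
def Cell (n : ℕ) : Type := Quotient (p.cellSetoid n)

variable {p}

/-- The cell denoted by a defined expression. -/
def cls {n : ℕ} (t : Term p.G n) (h : p.Rel t t) : p.Cell n := Quotient.mk (p.cellSetoid n) ⟨t, h⟩

theorem cls_eq {n : ℕ} {s t : Term p.G n} {hs : p.Rel s s} {ht : p.Rel t t} :
    cls s hs = cls t ht ↔ p.Rel s t :=
  ⟨fun h => Quotient.exact (s := p.cellSetoid n) h,
    fun h => Quotient.sound (s := p.cellSetoid n) h⟩

theorem ind {n : ℕ} {motive : p.Cell n → Prop}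
    (h : ∀ (t : Term p.G n) (ht : p.Rel t t), motive (cls t ht)) (x : p.Cell n) : motive x :=
  Quotient.ind (fun t => h t.1 t.2) x

/-- A representative of a cell. -/
noncomputable def rep {n : ℕ} (x : p.Cell n) : Term p.G n := (Quotient.out x).1

theorem rep_def {n : ℕ} (x : p.Cell n) : p.Rel (rep x) (rep x) := (Quotient.out x).2

theorem rep_cls {n : ℕ} (t : Term p.G n) (h : p.Rel t t) : p.Rel (rep (cls t h)) t :=
  Quotient.mk_out (s := p.cellSetoid n) (⟨t, h⟩ : {t : Term p.G n // p.Rel t t})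

/-- Boundaries of cells. -/
noncomputable def cbd (α : Pol) {k n : ℕ} (h : k < n) (x : p.Cell n) : p.Cell k :=
  cls (.bd α h (rep x)) (.bd α h (rep_def x))

/-- Units on cells. -/
noncomputable def cunit {k n : ℕ} (h : k < n) (x : p.Cell k) : p.Cell n :=
  cls (.unit h (rep x)) (.unit h (rep_def x))

/-- Composition of cells with matching boundaries. -/
noncomputable def ccomp {k n : ℕ} (h : k < n) (x y : p.Cell n)
    (e : cbd Pol.plus h x = cbd Pol.minus h y) : p.Cell n :=
  cls (.comp h (rep x) (rep y)) (.comp h (rep_def x) (rep_def y) (cls_eq.1 e))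

theorem cbd_cls (α : Pol) {k n : ℕ} (h : k < n) (t : Term p.G n) (ht : p.Rel t t) :
    cbd α h (cls t ht) = cls (.bd α h t) (.bd α h ht) :=
  cls_eq.2 (.bd α h (rep_cls t ht))

theorem cunit_cls {k n : ℕ} (h : k < n) (t : Term p.G k) (ht : p.Rel t t) :
    cunit h (cls t ht) = cls (.unit h t) (.unit h ht) :=
  cls_eq.2 (.unit h (rep_cls t ht))

theorem ccomp_cls {k n : ℕ} (h : k < n) (s t : Term p.G n) (hs : p.Rel s s) (ht : p.Rel t t)
    (e : cbd Pol.plus h (cls s hs) = cbd Pol.minus h (cls t ht)) :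
    ∃ hst : p.Rel (.comp h s t) (.comp h s t), ccomp h (cls s hs) (cls t ht) e = cls _ hst := by
  have e' : p.Rel (.bd Pol.plus h s) (.bd Pol.minus h t) := by
    rw [cbd_cls, cbd_cls] at e; exact cls_eq.1 e
  exact ⟨.comp h hs ht e', cls_eq.2 (.comp h (rep_cls s hs) (rep_cls t ht) (cls_eq.1 e))⟩

variable (p)

/-- The ω-category presented by `p`. -/
noncomputable def toOmegaCat : OmegaCat where
  cell := p.Cell
  bd := cbd
  unit := cunit
  comp := ccomp
  bd_bd α β j k n h h' x := by
    induction x using ind with | h t ht => ?_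
    simp only [cbd_cls]
    exact cls_eq.2 (.law (.bd_bd α β h h' t) (.bd β h (.bd α h' ht)) (.bd _ _ ht))
  unit_unit h h' x := by
    induction x using ind with | h t ht => ?_
    simp only [cunit_cls]
    exact cls_eq.2 (.law (.unit_unit h h' t) (.unit _ (.unit _ ht)) (.unit _ ht))
  bd_unit_lt α k m n h h' x := by
    induction x using ind with | h t ht => ?_
    simp only [cunit_cls, cbd_cls]
    exact cls_eq.2 (.law (.bd_unit_lt α h h' t) (.bd _ _ (.unit _ ht)) (.bd _ _ ht))
  bd_unit_eq α m n h x := by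
    induction x using ind with | h t ht => ?_
    simp only [cunit_cls, cbd_cls]
    exact cls_eq.2 (.law (.bd_unit_eq α h t) (.bd _ _ (.unit _ ht)) ht)
  bd_unit_gt α m k n h h' x := by
    induction x using ind with | h t ht => ?_
    simp only [cunit_cls, cbd_cls]
    exact cls_eq.2 (.law (.bd_unit_gt α h h' t) (.bd _ _ (.unit _ ht)) (.unit _ ht))
  unit_comp h h' x y e e' := by
    induction x using ind with | h s hs => ?_
    induction y using ind with | h t ht => ?_
    obtain ⟨h₁, q₁⟩ := ccomp_cls h s t hs ht e
    rw [q₁]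
    simp only [cunit_cls] at e' ⊢
    obtain ⟨h₂, q₂⟩ := ccomp_cls (h.trans h') _ _ _ _ e'
    rw [q₂]
    exact cls_eq.2 (.law (.unit_comp h h' s t) (.unit _ h₁) h₂)
  comp_unit_right h x e := by
    induction x using ind with | h s hs => ?_
    simp only [cunit_cls, cbd_cls] at e ⊢
    obtain ⟨h₁, q₁⟩ := ccomp_cls h s (.unit h (.bd Pol.plus h s)) hs (.unit h (.bd _ h hs))
      (by simpa only [cbd_cls] using e)
    rw [q₁]
    exact cls_eq.2 (.law (.comp_unit_right h s) h₁ hs)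
  comp_unit_left h x e := by
    induction x using ind with | h s hs => ?_
    simp only [cunit_cls, cbd_cls] at e ⊢
    obtain ⟨h₁, q₁⟩ := ccomp_cls h (.unit h (.bd Pol.minus h s)) s (.unit h (.bd _ h hs)) hs
      (by simpa only [cbd_cls] using e)
    rw [q₁]
    exact cls_eq.2 (.law (.comp_unit_left h s) h₁ hs)
  bd_minus_comp h x y e := by
    induction x using ind with | h s hs => ?_
    induction y using ind with | h t ht => ?_
    obtain ⟨h₁, q₁⟩ := ccomp_cls h s t hs ht e
    rw [q₁]
    simp only [cbd_cls]
    exact cls_eq.2 (.law (.bd_minus_comp h s t) (.bd _ _ h₁) (.bd _ _ hs))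
  bd_plus_comp h x y e := by
    induction x using ind with | h s hs => ?_
    induction y using ind with | h t ht => ?_
    obtain ⟨h₁, q₁⟩ := ccomp_cls h s t hs ht e
    rw [q₁]
    simp only [cbd_cls]
    exact cls_eq.2 (.law (.bd_plus_comp h s t) (.bd _ _ h₁) (.bd _ _ ht))
  bd_comp α k j n h h' x y e e' := by
    induction x using ind with | h s hs => ?_
    induction y using ind with | h t ht => ?_
    obtain ⟨h₁, q₁⟩ := ccomp_cls (h.trans h') s t hs ht e
    rw [q₁]
    rw [cbd_cls]
    obtain ⟨h₂, q₂⟩ := ccomp_cls h (.bd α h' s) (.bd α h' t) (.bd α h' hs) (.bd α h' ht)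
      (by simpa only [cbd_cls] using e')
    simp only [cbd_cls]
    rw [q₂]
    exact cls_eq.2 (.law (.bd_comp α h h' s t) (.bd _ _ h₁) h₂)
  assoc h x y z e₁ e₂ e₃ e₄ := by
    induction x using ind with | h s hs => ?_
    induction y using ind with | h t ht => ?_
    induction z using ind with | h u hu => ?_
    obtain ⟨h₁, q₁⟩ := ccomp_cls h s t hs ht e₁
    obtain ⟨h₂, q₂⟩ := ccomp_cls h t u ht hu e₃
    simp only [q₁, q₂] at e₂ e₄ ⊢
    obtain ⟨h₃, q₃⟩ := ccomp_cls h _ _ _ _ e₂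
    obtain ⟨h₄, q₄⟩ := ccomp_cls h _ _ _ _ e₄
    rw [q₃, q₄]
    exact cls_eq.2 (.law (.assoc h s t u) h₃ h₄)
  interchange h h' x x' y y' e₁ e₂ e₃ e₄ e₅ e₆ := by
    induction x using ind with | h s hs => ?_
    induction x' using ind with | h s' hs' => ?_
    induction y using ind with | h t ht => ?_
    induction y' using ind with | h t' ht' => ?_
    obtain ⟨h₁, q₁⟩ := ccomp_cls h' s s' hs hs' e₁
    obtain ⟨h₂, q₂⟩ := ccomp_cls h' t t' ht ht' e₂
    obtain ⟨h₃, q₃⟩ := ccomp_cls (h.trans h') s t hs ht e₄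
    obtain ⟨h₄, q₄⟩ := ccomp_cls (h.trans h') s' t' hs' ht' e₅
    simp only [q₁, q₂, q₃, q₄] at e₃ e₆ ⊢
    obtain ⟨h₅, q₅⟩ := ccomp_cls (h.trans h') _ _ _ _ e₃
    obtain ⟨h₆, q₆⟩ := ccomp_cls h' _ _ _ _ e₆
    rw [q₅, q₆]
    exact cls_eq.2 (.law (.interchange h h' s s' t t') h₅ h₆)

end Presentation

/-! ### The ω-category of molecules and coskeleta -/

/-- The molecules of `P` of dimension at most `n`. -/
def Mol (P : Type) [OGPoset P] (n : ℕ) : Type :=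
  {U : Set P // IsMolecule U ∧ ∀ x ∈ U, OGPoset.dim x ≤ n}

/-- The equations that hold in the partial ω-category of molecules of `P`: `k`-boundaries are the
sets `∂_k^α U`, units are identities on subsets, and `U #_k V = U ∪ V`
whenever `U ∩ V = ∂_k^+ U = ∂_k^- V`. -/
inductive MolRel (P : Type) [OGPoset P] : ∀ {n : ℕ}, Term (Mol P) n → Term (Mol P) n → Prop
  | bd (α : Pol) {k n : ℕ} (h : k < n) (U : Mol P n) (V : Mol P k) :
      V.1 = bord k α U.1 → MolRel P (.bd α h (.gen U)) (.gen V)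
  | unit {k n : ℕ} (h : k < n) (U : Mol P k) (V : Mol P n) :
      V.1 = U.1 → MolRel P (.unit h (.gen U)) (.gen V)
  | comp {k n : ℕ} (h : k < n) (U V W : Mol P n) :
      U.1 ∩ V.1 = bord k Pol.plus U.1 → U.1 ∩ V.1 = bord k Pol.minus V.1 → W.1 = U.1 ∪ V.1 →
      MolRel P (.comp h (.gen U) (.gen V)) (.gen W)

/-- The ω-category freely generated by the partial ω-category of molecules of `P`. -/
noncomputable def molCat (P : Type) [OGPoset P] : OmegaCat :=
  Presentation.toOmegaCat ⟨Mol P, fun s t => MolRel P s t⟩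

/-- The equations defining the `N`-coskeleton of `X`: all those that hold in `X`, and moreover
every cell of dimension `m > N` is equal to the unit on its input `N`-boundary. -/
inductive CoskelRel (N : ℕ) (X : OmegaCat) : ∀ {n : ℕ}, Term X.cell n → Term X.cell n → Prop
  | bd (α : Pol) {k n : ℕ} (h : k < n) (x : X.cell n) :
      CoskelRel N X (.bd α h (.gen x)) (.gen (X.bd α h x))
  | unit {k n : ℕ} (h : k < n) (x : X.cell k) :
      CoskelRel N X (.unit h (.gen x)) (.gen (X.unit h x))
  | comp {k n : ℕ} (h : k < n) (x y : X.cell n) (e) :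
      CoskelRel N X (.comp h (.gen x) (.gen y)) (.gen (X.comp h x y e))
  | trunc {m : ℕ} (h : N < m) (t : Term X.cell m) :
      CoskelRel N X t (.unit h (.bd Pol.minus h t))

/-- The presentation of the `N`-coskeleton. -/
def coskelPres (N : ℕ) (X : OmegaCat) : Presentation := ⟨X.cell, fun s t => CoskelRel N X s t⟩

/-- The `N`-coskeleton of an ω-category: its reflection into `N`-categories. -/
noncomputable def coskel (N : ℕ) (X : OmegaCat) : OmegaCat := (coskelPres N X).toOmegaCat

/-- The unit of the reflection, on cells. -/
noncomputable def toCoskel (N : ℕ) (X : OmegaCat) {n : ℕ} (x : X.cell n) : (coskel N X).cell n :=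
  Presentation.cls (p := coskelPres N X) (.gen x)
    (Presentation.Rel.gen (p := coskelPres N X) x)

theorem coskel_isNCat (N : ℕ) (X : OmegaCat) : OmegaCat.IsNCat N (coskel N X) := by
  intro m h x
  refine ⟨(coskel N X).bd Pol.minus h x, ?_⟩
  revert x
  refine Presentation.ind fun t ht => ?_
  change _ = Presentation.cunit h (Presentation.cbd Pol.minus h (Presentation.cls t ht))
  rw [Presentation.cbd_cls, Presentation.cunit_cls]
  exact Presentation.cls_eq.2 (.rel (.trunc h t) ht (.unit h (.bd _ h ht)))

/-! ### Bicoloured pros -/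

/-- A 2-category with a set of distinguished 1-cells. -/
structure MarkedTwoCat : Type 1 where
  cat : OmegaCat
  isTwoCat : OmegaCat.IsNCat 2 cat
  gen : Set (cat.cell 1)

namespace MarkedTwoCat

/-- Functors of 2-categories that send each distinguished 1-cell to a distinguished 1-cell or to
the unit on a 0-cell. -/
@[ext]
structure Hom (T S : MarkedTwoCat) : Type where
  functor : T.cat ⟶ S.cat
  fn_gen : ∀ a ∈ T.gen, functor.fn a ∈ S.gen ∨
    ∃ x : S.cat.cell 0, functor.fn a = S.cat.unit Nat.zero_lt_one x

instance : Category MarkedTwoCat where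
  Hom := Hom
  id T := ⟨𝟙 T.cat, fun a ha => Or.inl ha⟩
  comp {T S W} f g := ⟨f.functor ≫ g.functor, fun a ha => by
    change g.functor.fn (f.functor.fn a) ∈ W.gen ∨
      ∃ x : W.cat.cell 0, g.functor.fn (f.functor.fn a) = W.cat.unit Nat.zero_lt_one x
    rcases f.fn_gen a ha with h | ⟨x, hx⟩
    · exact g.fn_gen _ h
    · exact Or.inr ⟨g.functor.fn x, by rw [hx, g.functor.fn_unit]⟩⟩

/-- The set of 1-cells of type `x ⇒ y`. -/
def OneCell (T : MarkedTwoCat) (x y : T.cat.cell 0) : Type :=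
  {c : T.cat.cell 1 // T.cat.bd Pol.minus Nat.zero_lt_one c = x ∧
    T.cat.bd Pol.plus Nat.zero_lt_one c = y}

/-- The 0-cells, seen as the vertices of the graph of distinguished 1-cells. -/
def Vertex (T : MarkedTwoCat) : Type := T.cat.cell 0

instance (T : MarkedTwoCat) : Quiver T.Vertex where
  Hom x y := {c : T.OneCell x y // c.1 ∈ T.gen}

/-- The composite of a path of distinguished 1-cells; the empty path gives the unit. -/
def pathComp (T : MarkedTwoCat) {x : T.Vertex} : ∀ {y : T.Vertex}, Quiver.Path x y → T.OneCell x y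
  | _, .nil => ⟨T.cat.unit Nat.zero_lt_one x, T.cat.bd_unit_eq _ _ _, T.cat.bd_unit_eq _ _ _⟩
  | _, .cons q a =>
    ⟨T.cat.comp Nat.zero_lt_one (T.pathComp q).1 a.1.1 ((T.pathComp q).2.2.trans a.1.2.1.symm),
      (T.cat.bd_minus_comp _ _ _ _).trans (T.pathComp q).2.1,
      (T.cat.bd_plus_comp _ _ _ _).trans a.1.2.2⟩

/-- The 1-skeleton is a 1-polygraph (the free category on a graph) whose generating 0-cells are all
the 0-cells and whose generating 1-cells are the distinguished ones: the 1-cells of type `x ⇒ y`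
are the finite paths of generating 1-cells from `x` to `y`. -/
def isBiPro : ObjectProperty MarkedTwoCat := fun T =>
  ∀ x y : T.Vertex, Function.Bijective (fun q : Quiver.Path x y => T.pathComp q)

end MarkedTwoCat

/-- The category of bicoloured pros. -/
abbrev BiPro : Type 1 := MarkedTwoCat.isBiPro.FullSubcategory

/-! ### The functor from regular directed complexes to bicoloured pros -/

theorem dim_mono {Q : RDCpx} (a b : Q.El) (hab : a ≤ b) : OGPoset.dim a ≤ OGPoset.dim b := by
  induction b using WellFoundedLT.induction with
  | ind b ih =>
    rcases hab.lt_or_eq with hlt | rfl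
    · obtain ⟨c, hac, hcb⟩ := exists_le_covBy_of_lt hlt
      rw [OGPoset.dim_of_covBy c b hcb]
      exact (ih c hcb.lt hac).trans (Nat.le_succ _)
    · exact le_rfl

/-- The atom `cl{x}` as an `n`-cell of the 2-coskeleton of the ω-category of molecules of `Q`. -/
noncomputable def atomCell (Q : RDCpx) {n : ℕ} (x : Q.El) (h : OGPoset.dim x ≤ n) :
    (coskel 2 (molCat Q.El)).cell n :=
  toCoskel 2 (molCat Q.El) (Presentation.cls
    (p := ⟨Mol Q.El, fun s t => MolRel Q.El s t⟩)
    (.gen ⟨Set.Iic x, IsMolecule.atom x, fun y hy => (dim_mono y x hy).trans h⟩) (.gen _))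

/-- The 2-coskeleton of the ω-category of molecules of `Q`, with the 1-dimensional atoms as
distinguished 1-cells. -/
noncomputable def proObj (Q : RDCpx) : MarkedTwoCat where
  cat := coskel 2 (molCat Q.El)
  isTwoCat := coskel_isNCat 2 _
  gen := {a | ∃ (x : Q.El) (h : OGPoset.dim x = 1), a = atomCell Q x h.le}

/-- The functor `P` from regular directed complexes to bicoloured pros, with its defining
properties: on objects it is the 2-coskeleton of the ω-category of molecules, with the atoms of
dimension at most 1 as generators (the field `isBiPro` says that these do form a bicoloured pro),
and `P f` sends every atom `cl{x}` to the atom `cl{f(x)}`. Since all cells are composites of atoms,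
there is at most one such functor. -/
structure ProFunctor : Type where
  isBiPro : ∀ Q : RDCpx, MarkedTwoCat.isBiPro (proObj Q)
  map : ∀ {Q R : RDCpx}, (Q ⟶ R) → (proObj Q ⟶ proObj R)
  map_id : ∀ Q : RDCpx, map (𝟙 Q) = 𝟙 (proObj Q)
  map_comp : ∀ {Q R S : RDCpx} (f : Q ⟶ R) (g : R ⟶ S), map (f ≫ g) = map f ≫ map g
  map_atom : ∀ {Q R : RDCpx} (f : Q ⟶ R) {n : ℕ} (x : Q.El) (h : OGPoset.dim x ≤ n),
    (map f).functor.fn (atomCell Q x h) = atomCell R (f.fn x) ((f.dim_le x).trans h)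

/-- The underlying functor of `P`. -/
noncomputable def ProFunctor.functor (P : ProFunctor) : RDCpx ⥤ BiPro where
  obj Q := ⟨proObj Q, P.isBiPro Q⟩
  map f := ObjectProperty.homMk (P.map f)
  map_id Q := by ext1; exact P.map_id Q
  map_comp f g := by ext1; exact P.map_comp f g

end DiagNerve

namespace DiagNerve

/-! ### The universal property of presentations -/

namespace OmegaCat

open Classical in
/-- Composition extended to a total operation. -/
noncomputable def tcomp (T : OmegaCat) {k n : ℕ} (h : k < n) (x y : T.cell n) : T.cell n :=
  if e : T.bd Pol.plus h x = T.bd Pol.minus h y then T.comp h x y e else x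

theorem tcomp_eq (T : OmegaCat) {k n : ℕ} (h : k < n) (x y : T.cell n)
    (e : T.bd Pol.plus h x = T.bd Pol.minus h y) : T.tcomp h x y = T.comp h x y e := by
  rw [tcomp, dif_pos e]

theorem comp_congr (T : OmegaCat) {k n : ℕ} (h : k < n) {x x' y y' : T.cell n} (hx : x = x')
    (hy : y = y') (e) (e') : T.comp h x y e = T.comp h x' y' e' := by
  subst hx; subst hy; rfl

end OmegaCat

namespace Term

variable (T : OmegaCat) {G : ℕ → Type} (g : ∀ n, G n → T.cell n)

/-- The value of an expression under an interpretation of the generators. -/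
noncomputable def ev : ∀ {n : ℕ}, Term G n → T.cell n
  | _, .gen a => g _ a
  | _, .bd α h x => T.bd α h (ev x)
  | _, .unit h x => T.unit h (ev x)
  | _, .comp h x y => T.tcomp h (ev x) (ev y)

/-- All compositions in the expression are defined under the interpretation. -/
def Ok : ∀ {n : ℕ}, Term G n → Prop
  | _, .gen _ => True
  | _, .bd _ _ x => Ok x
  | _, .unit _ x => Ok x
  | _, .comp h x y => Ok x ∧ Ok y ∧
      T.bd Pol.plus h (ev T g x) = T.bd Pol.minus h (ev T g y)

theorem Law.sound {n : ℕ} {s t : Term G n} (h : Law s t) (hs : Ok T g s) (ht : Ok T g t) :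
    ev T g s = ev T g t := by
  cases h with
  | bd_bd α β h h' x => exact T.bd_bd ..
  | unit_unit h h' x => exact T.unit_unit ..
  | bd_unit_lt α h h' x => exact T.bd_unit_lt ..
  | bd_unit_eq α h x => exact T.bd_unit_eq ..
  | bd_unit_gt α h h' x => exact T.bd_unit_gt ..
  | unit_comp h h' x y =>
    simp only [ev, Ok] at *
    rw [T.tcomp_eq _ _ _ hs.2.2, T.tcomp_eq _ _ _ ht.2.2]; exact T.unit_comp ..
  | comp_unit_right h x =>
    simp only [ev, Ok] at *
    rw [T.tcomp_eq _ _ _ hs.2.2]; exact T.comp_unit_right ..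
  | comp_unit_left h x =>
    simp only [ev, Ok] at *
    rw [T.tcomp_eq _ _ _ hs.2.2]; exact T.comp_unit_left ..
  | bd_minus_comp h x y =>
    simp only [ev, Ok] at *
    rw [T.tcomp_eq _ _ _ hs.2.2]; exact T.bd_minus_comp ..
  | bd_plus_comp h x y =>
    simp only [ev, Ok] at *
    rw [T.tcomp_eq _ _ _ hs.2.2]; exact T.bd_plus_comp ..
  | bd_comp α h h' x y =>
    simp only [ev, Ok] at *
    rw [T.tcomp_eq _ _ _ hs.2.2, T.tcomp_eq _ _ _ ht.2.2]; exact T.bd_comp ..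
  | assoc h x y z =>
    obtain ⟨⟨-, -, e₁⟩, -, e₂⟩ := hs
    obtain ⟨-, ⟨-, -, e₃⟩, e₄⟩ := ht
    simp only [ev] at *
    rw [T.tcomp_eq _ _ _ e₂, T.tcomp_eq _ _ _ e₄]
    rw [T.tcomp_eq _ _ _ e₁] at e₂
    rw [T.tcomp_eq _ _ _ e₃] at e₄
    refine (T.comp_congr _ (T.tcomp_eq _ _ _ e₁) rfl _ e₂).trans ?_
    refine Eq.trans ?_ (T.comp_congr _ rfl (T.tcomp_eq _ _ _ e₃) _ e₄).symm
    exact T.assoc ..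
  | interchange h h' x x' y y' =>
    obtain ⟨⟨-, -, e₁⟩, ⟨-, -, e₂⟩, e₃⟩ := hs
    obtain ⟨⟨-, -, e₄⟩, ⟨-, -, e₅⟩, e₆⟩ := ht
    simp only [ev] at *
    rw [T.tcomp_eq _ _ _ e₃, T.tcomp_eq _ _ _ e₆]
    rw [T.tcomp_eq _ _ _ e₁, T.tcomp_eq _ _ _ e₂] at e₃
    rw [T.tcomp_eq _ _ _ e₄, T.tcomp_eq _ _ _ e₅] at e₆
    refine (T.comp_congr _ (T.tcomp_eq _ _ _ e₁) (T.tcomp_eq _ _ _ e₂) _ e₃).trans ?_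
    refine Eq.trans ?_ (T.comp_congr _ (T.tcomp_eq _ _ _ e₄) (T.tcomp_eq _ _ _ e₅) _ e₆).symm
    exact T.interchange h h' ..

end Term

namespace Presentation

variable {p : Presentation}

theorem Rel.sound (T : OmegaCat) (g : ∀ n, p.G n → T.cell n)
    (hR : ∀ {n : ℕ} (s t : Term p.G n), p.R s t → s.Ok T g → t.Ok T g → s.ev T g = t.ev T g)
    {n : ℕ} {s t : Term p.G n} (h : p.Rel s t) :
    s.Ok T g ∧ t.Ok T g ∧ s.ev T g = t.ev T g := by
  induction h with
  | gen a => exact ⟨trivial, trivial, rfl⟩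
  | symm _ ih => exact ⟨ih.2.1, ih.1, ih.2.2.symm⟩
  | trans _ _ ih ih' => exact ⟨ih.1, ih'.2.1, ih.2.2.trans ih'.2.2⟩
  | bd α h _ ih => exact ⟨ih.1, ih.2.1, congrArg (T.bd α h) ih.2.2⟩
  | unit h _ ih => exact ⟨ih.1, ih.2.1, congrArg (T.unit h) ih.2.2⟩
  | comp h _ _ _ ih ih' ih'' =>
    refine ⟨⟨ih.1, ih'.1, ih''.2.2⟩, ⟨ih.2.1, ih'.2.1, ?_⟩, ?_⟩
    · rw [← ih.2.2, ← ih'.2.2]; exact ih''.2.2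
    · simp only [Term.ev]; rw [ih.2.2, ih'.2.2]
  | law h _ _ ih ih' => exact ⟨ih.1, ih'.1, Term.Law.sound T g h ih.1 ih'.1⟩
  | rel h _ _ ih ih' => exact ⟨ih.1, ih'.1, hR _ _ h ih.1 ih'.1⟩

/-- The functor out of a presented ω-category induced by an interpretation of the generators that
satisfies the relations. -/
noncomputable def lift (T : OmegaCat) (g : ∀ n, p.G n → T.cell n)
    (hR : ∀ {n : ℕ} (s t : Term p.G n), p.R s t → s.Ok T g → t.Ok T g → s.ev T g = t.ev T g) :
    p.toOmegaCat ⟶ T where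
  fn x := (rep x).ev T g
  fn_bd α k n h x := ((rep_cls _ _).sound T g hR).2.2
  fn_unit h x := ((rep_cls _ _).sound T g hR).2.2
  fn_comp h x y e e' := by
    refine ((rep_cls _ _).sound T g hR).2.2.trans ?_
    exact T.tcomp_eq _ _ _ e'

theorem lift_cls (T : OmegaCat) (g : ∀ n, p.G n → T.cell n)
    (hR : ∀ {n : ℕ} (s t : Term p.G n), p.R s t → s.Ok T g → t.Ok T g → s.ev T g = t.ev T g)
    {n : ℕ} (t : Term p.G n) (ht : p.Rel t t) :
    (lift T g hR).fn (cls t ht) = t.ev T g :=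
  ((rep_cls _ _).sound T g hR).2.2

/-- All subexpressions are defined. -/
def Sub : ∀ {n : ℕ}, Term p.G n → Prop
  | _, .gen _ => True
  | _, .bd _ _ x => Sub x ∧ p.Rel x x
  | _, .unit _ x => Sub x ∧ p.Rel x x
  | _, .comp h x y => (Sub x ∧ p.Rel x x) ∧ (Sub y ∧ p.Rel y y) ∧
      p.Rel (.bd Pol.plus h x) (.bd Pol.minus h y)

theorem Rel.sub {n : ℕ} {s t : Term p.G n} (h : p.Rel s t) : Sub s ∧ Sub t := by
  induction h with
  | gen a => exact ⟨trivial, trivial⟩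
  | symm _ ih => exact ⟨ih.2, ih.1⟩
  | trans _ _ ih ih' => exact ⟨ih.1, ih'.2⟩
  | bd α h r ih => exact ⟨⟨ih.1, r.trans r.symm⟩, ⟨ih.2, r.symm.trans r⟩⟩
  | unit h r ih => exact ⟨⟨ih.1, r.trans r.symm⟩, ⟨ih.2, r.symm.trans r⟩⟩
  | comp h r r' r'' ih ih' _ =>
    exact ⟨⟨⟨ih.1, r.trans r.symm⟩, ⟨ih'.1, r'.trans r'.symm⟩, r''⟩,
      ⟨⟨ih.2, r.symm.trans r⟩, ⟨ih'.2, r'.symm.trans r'⟩,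
        ((Rel.bd _ h r).symm.trans r'').trans (Rel.bd _ h r')⟩⟩
  | law h _ _ ih ih' => exact ⟨ih.1, ih'.1⟩
  | rel h _ _ ih ih' => exact ⟨ih.1, ih'.1⟩

/-- Every cell of a presented ω-category is generated by the generators. -/
theorem cell_induction {motive : ∀ {n : ℕ}, p.Cell n → Prop}
    (gen : ∀ {n : ℕ} (g : p.G n), motive (cls (.gen g) (.gen g)))
    (bd : ∀ (α : Pol) {k n : ℕ} (h : k < n) (x : p.Cell n), motive x → motive (cbd α h x))
    (unit : ∀ {k n : ℕ} (h : k < n) (x : p.Cell k), motive x → motive (cunit h x))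
    (comp : ∀ {k n : ℕ} (h : k < n) (x y : p.Cell n) (e), motive x → motive y →
      motive (ccomp h x y e)) {n : ℕ} (x : p.Cell n) : motive x := by
  induction x using ind with | h t ht => ?_
  have key : ∀ {n : ℕ} (t : Term p.G n) (ht : p.Rel t t), Sub t → motive (cls t ht) := by
    intro n t
    induction t with
    | gen g => exact fun _ _ => gen g
    | bd α h x ih =>
      intro ht hs
      have := bd α h _ (ih hs.2 hs.1)
      rwa [cbd_cls] at this
    | unit h x ih =>
      intro ht hs
      have := unit h _ (ih hs.2 hs.1)
      rwa [cunit_cls] at this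
    | comp h x y ih ih' =>
      intro ht hs
      obtain ⟨h₁, h₂, h₃⟩ := hs
      have e : cbd Pol.plus h (cls x h₁.2) = cbd Pol.minus h (cls y h₂.2) := by
        rw [cbd_cls, cbd_cls]; exact cls_eq.2 h₃
      obtain ⟨h₄, h₅⟩ := ccomp_cls h x y h₁.2 h₂.2 e
      have := comp h _ _ e (ih h₁.2 h₁.1) (ih' h₂.2 h₂.1)
      rwa [h₅] at this
  exact key t ht ht.sub.1

/-- Functors out of a presented ω-category are determined by the generators. -/
theorem hom_ext {T : OmegaCat} {F F' : p.toOmegaCat ⟶ T}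
    (h : ∀ {n : ℕ} (g : p.G n), F.fn (cls (.gen g) (.gen g) : p.Cell n) =
      F'.fn (cls (.gen g) (.gen g) : p.Cell n)) : F = F' := by
  refine OmegaCat.Hom.ext ?_
  funext n x
  refine cell_induction (motive := fun {n} x => F.fn x = F'.fn x) (fun g => h g) ?_ ?_ ?_ x
  · intro α k n h x ih
    exact (F.fn_bd α h x).trans ((congrArg _ ih).trans (F'.fn_bd α h x).symm)
  · intro k n h x ih
    exact (F.fn_unit h x).trans ((congrArg _ ih).trans (F'.fn_unit h x).symm)
  · intro k n h x y e ih ih'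
    have e₁ : T.bd Pol.plus h (F.fn x) = T.bd Pol.minus h (F.fn y) :=
      (F.fn_bd _ h x).symm.trans ((congrArg F.fn e).trans (F.fn_bd _ h y))
    have e₂ : T.bd Pol.plus h (F'.fn x) = T.bd Pol.minus h (F'.fn y) :=
      (F'.fn_bd _ h x).symm.trans ((congrArg F'.fn e).trans (F'.fn_bd _ h y))
    exact (F.fn_comp h x y e e₁).trans ((T.comp_congr h ih ih' _ _).trans
      (F'.fn_comp h x y e e₂).symm)

end Presentation

/-! ### One-sorted strict 2-categories -/

/-- One-sorted strict 2-categories: `b α k` is the unit on the `k`-boundary, and the composition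
`comp k` is a total operation, meaningful when the boundaries match. For `k ≥ 2` these operations
are trivial. -/
structure Two (C : Type) where
  b : Pol → ℕ → C → C
  comp : ℕ → C → C → C
  b_two_le : ∀ α {k} (x), 2 ≤ k → b α k x = x
  b_b_lt : ∀ α β {j k} (x), j < k → b β j (b α k x) = b β j x
  b_b_le : ∀ α β {j k} (x), k ≤ j → b β j (b α k x) = b α k x
  b_minus_comp : ∀ {k x y}, b Pol.plus k x = b Pol.minus k y →
    b Pol.minus k (comp k x y) = b Pol.minus k x
  b_plus_comp : ∀ {k x y}, b Pol.plus k x = b Pol.minus k y →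
    b Pol.plus k (comp k x y) = b Pol.plus k y
  b_comp : ∀ α {k j x y}, k < j → b Pol.plus k x = b Pol.minus k y →
    b α j (comp k x y) = comp k (b α j x) (b α j y)
  comp_unit_right : ∀ k x, comp k x (b Pol.plus k x) = x
  comp_unit_left : ∀ k x, comp k (b Pol.minus k x) x = x
  assoc : ∀ {k x y z}, b Pol.plus k x = b Pol.minus k y → b Pol.plus k y = b Pol.minus k z →
    comp k (comp k x y) z = comp k x (comp k y z)
  interchange : ∀ {k j x x' y y'}, k < j → b Pol.plus j x = b Pol.minus j x' →
    b Pol.plus j y = b Pol.minus j y' → b Pol.plus k x = b Pol.minus k y →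
    comp k (comp j x x') (comp j y y') = comp j (comp k x y) (comp k x' y')
  comp_two_le : ∀ {k} (x y), 2 ≤ k → comp k x y = x

namespace OmegaCat

variable (T : OmegaCat)

theorem unit_inj {k n : ℕ} (h : k < n) {x y : T.cell k} (e : T.unit h x = T.unit h y) : x = y := by
  rw [← T.bd_unit_eq Pol.minus h x, e, T.bd_unit_eq]

theorem unit_bd_inj {k n : ℕ} (h : k < n) {α β : Pol} {x y : T.cell n}
    (e : T.unit h (T.bd α h x) = T.unit h (T.bd β h y)) : T.bd α h x = T.bd β h y :=
  T.unit_inj h e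

open Classical in
/-- The one-sorted form of the 2-categorical part of an ω-category. -/
noncomputable def two : Two (T.cell 2) where
  b α k x := if h : k < 2 then T.unit h (T.bd α h x) else x
  comp k x y := if h : k < 2 then T.tcomp h x y else x
  b_two_le α _ x h := dif_neg (by omega)
  b_b_lt α β j k x h := by
    by_cases hk : k < 2
    · have hj : j < 2 := h.trans hk
      simp only [hk, hj, dite_true, T.bd_unit_lt β h hk, T.bd_bd]
    · simp only [hk, dite_false]
  b_b_le α β j k x h := by
    by_cases hj : j < 2
    · have hk : k < 2 := h.trans_lt hj
      simp only [hk, hj, dite_true]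
      rcases h.lt_or_eq with h | rfl
      · rw [T.bd_unit_gt β h hj, T.unit_unit]
      · rw [T.bd_unit_eq]
    · simp only [hj, dite_false]
  b_minus_comp := by
    intro k x y e
    by_cases hk : k < 2
    · simp only [hk, dite_true] at e ⊢
      have e := T.unit_bd_inj hk e
      rw [T.tcomp_eq _ _ _ e, T.bd_minus_comp]
    · simp only [hk, dite_false]
  b_plus_comp := by
    intro k x y e
    by_cases hk : k < 2
    · simp only [hk, dite_true] at e ⊢
      have e := T.unit_bd_inj hk e
      rw [T.tcomp_eq _ _ _ e, T.bd_plus_comp]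
    · simpa only [hk, dite_false] using e
  b_comp := by
    intro α k j x y h e
    by_cases hj : j < 2
    · have hk : k < 2 := h.trans hj
      simp only [hk, hj, dite_true] at e ⊢
      have e := T.unit_bd_inj hk e
      have e' : T.bd Pol.plus h (T.bd α hj x) = T.bd Pol.minus h (T.bd α hj y) := by
        rw [T.bd_bd, T.bd_bd]; exact e
      have e'' : T.bd Pol.plus hk (T.unit hj (T.bd α hj x)) =
          T.bd Pol.minus hk (T.unit hj (T.bd α hj y)) := by
        rw [T.bd_unit_lt _ h hj, T.bd_unit_lt _ h hj]; exact e'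
      rw [T.tcomp_eq _ _ _ e, T.tcomp_eq _ _ _ e'', T.bd_comp α h hj x y e e', T.unit_comp]
    · simp only [hj, dite_false]
  comp_unit_right k x := by
    by_cases hk : k < 2
    · simp only [hk, dite_true]
      rw [T.tcomp_eq _ _ _ (by rw [T.bd_unit_eq]), T.comp_unit_right]
    · simp only [hk, dite_false]
  comp_unit_left k x := by
    by_cases hk : k < 2
    · simp only [hk, dite_true]
      rw [T.tcomp_eq _ _ _ (by rw [T.bd_unit_eq]), T.comp_unit_left]
    · simp only [hk, dite_false]
  assoc := by
    intro k x y z e e'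
    by_cases hk : k < 2
    · simp only [hk, dite_true] at e e' ⊢
      have e := T.unit_bd_inj hk e
      have e' := T.unit_bd_inj hk e'
      rw [T.tcomp_eq _ _ _ e, T.tcomp_eq _ _ _ e',
        T.tcomp_eq _ _ _ (by rw [T.bd_plus_comp]; exact e'),
        T.tcomp_eq _ _ _ (by rw [T.bd_minus_comp]; exact e), T.assoc]
    · simp only [hk, dite_false]
  interchange := by
    intro k j x x' y y' h e₁ e₂ e₃
    by_cases hj : j < 2
    · have hk : k < 2 := h.trans hj
      simp only [hk, hj, dite_true] at e₁ e₂ e₃ ⊢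
      have e₁ := T.unit_bd_inj hj e₁
      have e₂ := T.unit_bd_inj hj e₂
      have e₃ := T.unit_bd_inj hk e₃
      have e₄ : T.bd Pol.plus hk x' = T.bd Pol.minus hk y' := by
        rw [← T.bd_bd Pol.minus _ h hj x', ← e₁, ← T.bd_bd Pol.minus _ h hj y', ← e₂]
        rw [T.bd_bd, T.bd_bd]; exact e₃
      rw [T.tcomp_eq _ _ _ e₁, T.tcomp_eq _ _ _ e₂, T.tcomp_eq _ _ _ e₃, T.tcomp_eq _ _ _ e₄,
        T.tcomp_eq _ _ _ ?_, T.tcomp_eq _ _ _ ?_]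
      · refine T.interchange h hj x x' y y' _ _ _ _ _ _
      · rw [T.bd_comp _ h hj x y e₃ (by rw [T.bd_bd, T.bd_bd]; exact e₃),
          T.bd_comp _ h hj x' y' e₄ (by rw [T.bd_bd, T.bd_bd]; exact e₄)]
        exact T.comp_congr _ e₁ e₂ _ _
      · rw [← T.bd_bd Pol.plus _ h hj, ← T.bd_bd Pol.minus _ h hj, T.bd_plus_comp,
          T.bd_minus_comp, T.bd_bd, T.bd_bd, ← T.bd_bd Pol.minus _ h hj x', ← e₁, T.bd_bd]
        exact e₃
    · by_cases hk : k < 2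
      · simp only [hj, dite_false]
      · simp only [hk, hj, dite_false]
  comp_two_le x y h := dif_neg (by omega)

theorem two_b {k : ℕ} (h : k < 2) (α : Pol) (x : T.cell 2) :
    T.two.b α k x = T.unit h (T.bd α h x) := by
  simp only [two, dif_pos h]

theorem two_comp {k : ℕ} (h : k < 2) (x y : T.cell 2)
    (e : T.bd Pol.plus h x = T.bd Pol.minus h y) : T.two.comp k x y = T.comp h x y e :=
  by simp only [two, dif_pos h, T.tcomp_eq _ _ _ e]

/-- A cell, seen as a 2-cell. -/
def up : ∀ {n : ℕ}, T.cell n → T.cell 2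
  | 0, x => T.unit (by omega) x
  | 1, x => T.unit (by omega) x
  | 2, x => x
  | _ + 3, x => T.bd Pol.minus (by omega) x

/-- A 2-cell, seen as an `n`-cell (meaningful if it is a unit on an `n`-cell). -/
def down : ∀ {n : ℕ}, T.cell 2 → T.cell n
  | 0, x => T.bd Pol.minus (by omega) x
  | 1, x => T.bd Pol.minus (by omega) x
  | 2, x => x
  | _ + 3, x => T.unit (by omega) x

variable {T}

theorem IsNCat.unit_bd (hT : IsNCat 2 T) {n : ℕ} (h : 2 < n) (α : Pol) (x : T.cell n) :
    T.unit h (T.bd α h x) = x := by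
  obtain ⟨y, rfl⟩ := hT h x
  rw [T.bd_unit_eq]

theorem down_up (hT : IsNCat 2 T) : ∀ {n : ℕ} (x : T.cell n), T.down (T.up x) = x
  | 0, _ => T.bd_unit_eq _ _ _
  | 1, _ => T.bd_unit_eq _ _ _
  | 2, _ => rfl
  | _ + 3, x => hT.unit_bd _ _ x

theorem up_inj (hT : IsNCat 2 T) {n : ℕ} {x y : T.cell n} (h : T.up x = T.up y) : x = y := by
  rw [← down_up hT x, h, down_up hT]

theorem up_down : ∀ {n : ℕ} (x : T.cell 2), T.two.b Pol.minus n x = x → T.up (T.down (n := n) x) = x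
  | 0, x, h => by rw [T.two_b (by omega)] at h; exact h
  | 1, x, h => by rw [T.two_b (by omega)] at h; exact h
  | 2, _, _ => rfl
  | _ + 3, x, _ => T.bd_unit_eq _ _ _

theorem up_unit : ∀ {k n : ℕ} (h : k < n) (x : T.cell k), T.up (T.unit h x) = T.up x
  | 0, 1, _, _ => T.unit_unit _ _ _
  | 0, 2, _, _ => rfl
  | 0, _ + 3, _, _ => T.bd_unit_gt Pol.minus (k := 2) (by omega) _ _
  | 1, 2, _, _ => rfl
  | 1, _ + 3, _, _ => T.bd_unit_gt Pol.minus (k := 2) (by omega) _ _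
  | 2, _ + 3, _, _ => T.bd_unit_eq _ _ _
  | _ + 3, n + 3, h, x => T.bd_unit_lt Pol.minus (k := 2) (by omega) h x
  | 1, 1, h, _ => absurd h (by omega)
  | 2, 1, h, _ => absurd h (by omega)
  | 2, 2, h, _ => absurd h (by omega)
  | _ + 3, 1, h, _ => absurd h (by omega)
  | _ + 3, 2, h, _ => absurd h (by omega)

theorem b_up (α : Pol) : ∀ {n : ℕ} (x : T.cell n), T.two.b α n (T.up x) = T.up x
  | 0, x => by rw [T.two_b (by omega)]; exact congrArg _ (T.bd_unit_eq _ _ _)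
  | 1, x => by rw [T.two_b (by omega)]; exact congrArg _ (T.bd_unit_eq _ _ _)
  | 2, x => T.two.b_two_le _ _ le_rfl
  | _ + 3, x => T.two.b_two_le _ _ (by omega)

theorem up_bd (hT : IsNCat 2 T) (α : Pol) : ∀ {k n : ℕ} (h : k < n) (x : T.cell n),
    T.up (T.bd α h x) = T.two.b α k (T.up x)
  | 0, 1, h, x => by
    rw [T.two_b (by omega)]
    exact congrArg (T.unit _) (T.bd_unit_lt α (m := 1) h (by omega) x).symm
  | 0, 2, h, x => (T.two_b h α x).symm
  | 0, _ + 3, h, x => by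
    rw [T.two_b (by omega)]; exact congrArg (T.unit _) (T.bd_bd _ _ (k := 2) _ _ _).symm
  | 1, 2, h, x => (T.two_b h α x).symm
  | 1, _ + 3, h, x => by
    rw [T.two_b (by omega)]; exact congrArg (T.unit _) (T.bd_bd _ _ (k := 2) _ _ _).symm
  | 2, n + 3, h, x => by
    rw [T.two.b_two_le _ _ le_rfl]
    obtain ⟨y, rfl⟩ := hT h x
    exact (T.bd_unit_eq _ _ _).trans (T.bd_unit_eq _ _ _).symm
  | k + 3, n + 3, h, x => by
    rw [T.two.b_two_le _ _ (by omega)]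
    exact T.bd_bd _ _ (k := k + 3) (by omega) _ _
  | 1, 1, h, _ => absurd h (by omega)
  | 2, 1, h, _ => absurd h (by omega)
  | 2, 2, h, _ => absurd h (by omega)
  | _ + 3, 1, h, _ => absurd h (by omega)
  | _ + 3, 2, h, _ => absurd h (by omega)

theorem cmp_up (hT : IsNCat 2 T) {k n : ℕ} (h : k < n) {x y : T.cell n} :
    T.two.b Pol.plus k (T.up x) = T.two.b Pol.minus k (T.up y) ↔
      T.bd Pol.plus h x = T.bd Pol.minus h y := by
  rw [← up_bd hT _ h, ← up_bd hT _ h]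
  exact ⟨fun e => up_inj hT e, fun e => congrArg _ e⟩

theorem up_comp (hT : IsNCat 2 T) : ∀ {k n : ℕ} (h : k < n) (x y : T.cell n) (e),
    T.up (T.comp h x y e) = T.two.comp k (T.up x) (T.up y)
  | 0, 1, h, x, y, e => by
    have e' := (cmp_up hT h).2 e
    rw [T.two_b (by omega), T.two_b (by omega)] at e'
    rw [T.two_comp (by omega) _ _ (T.unit_bd_inj _ e')]
    exact T.unit_comp _ _ _ _ _ _
  | 0, 2, h, x, y, e => (T.two_comp h x y e).symm
  | 0, n + 3, h, x, y, e => by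
    have e' := (cmp_up hT h).2 e
    rw [T.two_b (by omega), T.two_b (by omega)] at e'
    rw [T.two_comp (by omega) _ _ (T.unit_bd_inj _ e')]
    exact T.bd_comp _ _ _ _ _ _ _
  | 1, 2, h, x, y, e => (T.two_comp h x y e).symm
  | 1, n + 3, h, x, y, e => by
    have e' := (cmp_up hT h).2 e
    rw [T.two_b (by omega), T.two_b (by omega)] at e'
    rw [T.two_comp (by omega) _ _ (T.unit_bd_inj _ e')]
    exact T.bd_comp _ _ _ _ _ _ _
  | 2, n + 3, h, x, y, e => by
    rw [T.two.comp_two_le _ _ le_rfl]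
    exact T.bd_minus_comp _ _ _ _
  | k + 3, n + 3, h, x, y, e => by
    rw [T.two.comp_two_le _ _ (by omega)]
    change T.bd _ _ _ = T.bd _ _ _
    rw [← T.bd_bd Pol.minus _ (k := k + 3) (by omega) h, T.bd_minus_comp, T.bd_bd]
  | 1, 1, h, _, _, _ => absurd h (by omega)
  | 2, 1, h, _, _, _ => absurd h (by omega)
  | 2, 2, h, _, _, _ => absurd h (by omega)
  | _ + 3, 1, h, _, _, _ => absurd h (by omega)
  | _ + 3, 2, h, _, _, _ => absurd h (by omega)

theorem up_fn {S : OmegaCat} (F : T ⟶ S) : ∀ {n : ℕ} (x : T.cell n),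
    S.up (F.fn x) = F.fn (T.up x)
  | 0, _ => (F.fn_unit _ _).symm
  | 1, _ => (F.fn_unit _ _).symm
  | 2, _ => rfl
  | _ + 3, _ => (F.fn_bd _ _ _).symm

theorem fn_b {S : OmegaCat} (F : T ⟶ S) (α : Pol) (k : ℕ) (x : T.cell 2) :
    F.fn (T.two.b α k x) = S.two.b α k (F.fn x) := by
  by_cases h : k < 2
  · rw [two_b _ h, two_b _ h, F.fn_unit, F.fn_bd]
  · rw [T.two.b_two_le _ _ (by omega), S.two.b_two_le _ _ (by omega)]

theorem fn_comp {S : OmegaCat} (F : T ⟶ S) (k : ℕ) (x y : T.cell 2)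
    (e : T.two.b Pol.plus k x = T.two.b Pol.minus k y) :
    F.fn (T.two.comp k x y) = S.two.comp k (F.fn x) (F.fn y) := by
  by_cases h : k < 2
  · rw [two_b _ h, two_b _ h] at e
    have e := T.unit_bd_inj _ e
    have e' : S.bd Pol.plus h (F.fn x) = S.bd Pol.minus h (F.fn y) := by
      rw [← F.fn_bd, ← F.fn_bd, e]
    rw [two_comp _ h _ _ e, two_comp _ h _ _ e', F.fn_comp h x y e e']
  · rw [T.two.comp_two_le _ _ (by omega), S.two.comp_two_le _ _ (by omega)]

/-- Functors between 2-categories from maps of the one-sorted 2-categories. -/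
def homOfTwo {S : OmegaCat} (hT : IsNCat 2 T) (hS : IsNCat 2 S) (f : T.cell 2 → S.cell 2)
    (hb : ∀ α k x, k < 2 → f (T.two.b α k x) = S.two.b α k (f x))
    (hc : ∀ k x y, k < 2 → T.two.b Pol.plus k x = T.two.b Pol.minus k y →
      f (T.two.comp k x y) = S.two.comp k (f x) (f y)) : T ⟶ S :=
  have hb' : ∀ α k x, f (T.two.b α k x) = S.two.b α k (f x) := fun α k x => by
    by_cases h : k < 2
    · exact hb α k x h
    · rw [T.two.b_two_le _ _ (by omega), S.two.b_two_le _ _ (by omega)]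
  have hc' : ∀ k x y, T.two.b Pol.plus k x = T.two.b Pol.minus k y →
      f (T.two.comp k x y) = S.two.comp k (f x) (f y) := fun k x y e => by
    by_cases h : k < 2
    · exact hc k x y h e
    · rw [T.two.comp_two_le _ _ (by omega), S.two.comp_two_le _ _ (by omega)]
  have hu : ∀ {n : ℕ} (x : T.cell n), S.up (S.down (n := n) (f (T.up x))) = f (T.up x) :=
    fun x => up_down _ (by rw [← hb', b_up])
  { fn := fun x => S.down (f (T.up x))
    fn_bd := fun α k n h x => up_inj hS (by rw [hu, up_bd hS, hu, up_bd hT, hb'])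
    fn_unit := fun h x => up_inj hS (by rw [hu, up_unit, up_unit, hu])
    fn_comp := fun h x y e e' => up_inj hS (by
      rw [hu, up_comp hS, up_comp hT, hc' _ _ _ ((cmp_up hT h).2 e), hu, hu]) }

theorem hom_ext_two {S : OmegaCat} (hS : IsNCat 2 S) {F G : T ⟶ S}
    (h : ∀ x : T.cell 2, F.fn x = G.fn x) : F = G := by
  refine OmegaCat.Hom.ext ?_
  funext n x
  exact up_inj hS (by rw [up_fn, up_fn, h])

end OmegaCat

/-! ### Pasting of labelled paths and rewriting sequences in one-sorted 2-categories -/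

namespace Two

variable {C : Type} (D : Two C)

theorem comp_self {x : C} (h : ∀ α, D.b α 1 x = x) : D.comp 1 x x = x := by
  conv_lhs => rw [← h Pol.plus]
  rw [h, ← congrArg (D.comp 1 x) (h Pol.plus), D.comp_unit_right]

/-- Vertical composition commutes with left whiskering. -/
theorem whisker_left {a z z' : C} (ha : ∀ α, D.b α 1 a = a)
    (h : D.b Pol.plus 0 a = D.b Pol.minus 0 z) (hz : D.b Pol.plus 1 z = D.b Pol.minus 1 z') :
    D.comp 1 (D.comp 0 a z) (D.comp 0 a z') = D.comp 0 a (D.comp 1 z z') := by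
  rw [← D.interchange Nat.zero_lt_one (by rw [ha, ha]) hz h, D.comp_self ha]

theorem b_zero_b_one (α β : Pol) (x : C) : D.b α 0 (D.b β 1 x) = D.b α 0 x :=
  D.b_b_lt _ _ _ Nat.zero_lt_one

end Two

/-- Combinatorial data of a 2-dimensional directed complex: edges have a source and a target, and
faces have lists of input and output edges. -/
structure CxData (P : Type) where
  dim : P → ℕ
  src : P → P
  tgt : P → P
  inn : P → List P
  out : P → List P

namespace CxData

variable {P : Type} (K : CxData P)

/-- `K.Walk s l t`: the list `l` of edges is a directed path from `s` to `t`. -/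
def Walk : P → List P → P → Prop
  | s, [], t => s = t ∧ K.dim s = 0
  | s, e :: l, t => (K.src e = s ∧ K.dim e = 1 ∧ K.dim s = 0) ∧ Walk (K.tgt e) l t

/-- The input and output edges of every face form two parallel nonempty paths. -/
structure Ok : Prop where
  inn_walk : ∀ x, K.dim x = 2 → K.Walk (K.src x) (K.inn x) (K.tgt x)
  out_walk : ∀ x, K.dim x = 2 → K.Walk (K.src x) (K.out x) (K.tgt x)
  inn_ne : ∀ x, K.dim x = 2 → K.inn x ≠ []
  out_ne : ∀ x, K.dim x = 2 → K.out x ≠ []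

variable {K}

theorem Walk.dim_src {s t : P} {l : List P} (h : K.Walk s l t) : K.dim s = 0 := by
  cases l with
  | nil => exact h.2
  | cons e l => exact h.1.2.2

theorem Walk.dim_tgt {s t : P} {l : List P} (h : K.Walk s l t) : K.dim t = 0 := by
  induction l generalizing s with
  | nil => exact h.1 ▸ h.2
  | cons e l ih => exact ih h.2

theorem Walk.dim_edge {s t : P} {l : List P} (h : K.Walk s l t) {e : P} (he : e ∈ l) :
    K.dim e = 1 := by
  induction l generalizing s with
  | nil => simp at he
  | cons e' l ih =>
    rcases List.mem_cons.1 he with rfl | he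
    · exact h.1.2.1
    · exact ih h.2 he

theorem walk_append {s t : P} {l m : List P} :
    K.Walk s (l ++ m) t ↔ ∃ u, K.Walk s l u ∧ K.Walk u m t := by
  induction l generalizing s with
  | nil =>
    exact ⟨fun h => ⟨s, ⟨rfl, h.dim_src⟩, h⟩, fun ⟨u, h, h'⟩ => h.1 ▸ h'⟩
  | cons e l ih =>
    simp only [List.cons_append, Walk, ih]
    exact ⟨fun ⟨h, u, h', h''⟩ => ⟨u, ⟨h, h'⟩, h''⟩, fun ⟨u, ⟨h, h'⟩, h''⟩ => ⟨h, u, h', h''⟩⟩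

theorem Walk.unique_of_ne {s t s' t' : P} {l : List P} (h : K.Walk s l t) (h' : K.Walk s' l t')
    (hl : l ≠ []) : s = s' ∧ t = t' := by
  have tt : ∀ (l : List P) (s s' t t' : P), K.Walk s l t → K.Walk s' l t' → (l = [] → s = s') →
      t = t' := by
    intro l
    induction l with
    | nil => intro s s' t t' h h' e; rw [← h.1, ← h'.1, e rfl]
    | cons e l ih => intro s s' t t' h h' _; exact ih _ _ _ _ h.2 h'.2 (fun _ => rfl)
  refine ⟨?_, tt l s s' t t' h h' fun e => absurd e hl⟩
  cases l with
  | nil => exact absurd rfl hl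
  | cons e l => exact h.1.1.symm.trans h'.1.1

variable {C : Type} (D : Two C) (lam : P → C)

variable (K) in
/-- The composite of the labels along a path. -/
def pv : P → List P → C
  | s, [] => lam s
  | _, e :: l => D.comp 0 (lam e) (pv (K.tgt e) l)

variable (K) in
/-- A labelling of vertices and edges by the cells of a 2-category. -/
structure EdgeLab : Prop where
  zero : ∀ x, K.dim x = 0 → ∀ α, D.b α 0 (lam x) = lam x
  one : ∀ x, K.dim x = 1 → ∀ α, D.b α 1 (lam x) = lam x
  src : ∀ x, K.dim x = 1 → D.b Pol.minus 0 (lam x) = lam (K.src x)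
  tgt : ∀ x, K.dim x = 1 → D.b Pol.plus 0 (lam x) = lam (K.tgt x)

variable (K) in
/-- A labelling of vertices, edges and faces by the cells of a 2-category. -/
structure Lab : Prop extends K.EdgeLab D lam where
  inn : ∀ x, K.dim x = 2 → D.b Pol.minus 1 (lam x) = K.pv D lam (K.src x) (K.inn x)
  out : ∀ x, K.dim x = 2 → D.b Pol.plus 1 (lam x) = K.pv D lam (K.src x) (K.out x)

variable (K) in
/-- The label of a face, whiskered by two paths. -/
def wh (s : P) (a : List P) (x : P) (b : List P) : C :=
  D.comp 0 (K.pv D lam s a) (D.comp 0 (lam x) (K.pv D lam (K.tgt x) b))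

variable (K) in
/-- `K.Rw D lam s xs p q u`: the path `p` starting from `s` is rewritten to `q` by successively
replacing the inputs of the faces in the list `xs` by their outputs, and `u` is the composite of
the corresponding whiskered labels. -/
def Rw (s : P) : List P → List P → List P → C → Prop
  | [], p, q, u => p = q ∧ u = K.pv D lam s p
  | x :: xs, p, q, u => ∃ (a b : List P) (v : C), p = a ++ K.inn x ++ b ∧
      Rw s xs (a ++ K.out x ++ b) q v ∧ u = D.comp 1 (K.wh D lam s a x b) v

variable {D lam}

theorem EdgeLab.pv_b (L : K.EdgeLab D lam) {s t : P} {l : List P} (h : K.Walk s l t) :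
    (∀ α, D.b α 1 (K.pv D lam s l) = K.pv D lam s l) ∧
    D.b Pol.minus 0 (K.pv D lam s l) = lam s ∧ D.b Pol.plus 0 (K.pv D lam s l) = lam t := by
  induction l generalizing s with
  | nil =>
    obtain ⟨rfl, h⟩ := h
    refine ⟨fun α => ?_, L.zero s h _, L.zero s h _⟩
    rw [pv, ← L.zero s h α, D.b_b_le _ _ _ (Nat.zero_le _)]
  | cons e l ih =>
    obtain ⟨⟨rfl, he, -⟩, h⟩ := h
    obtain ⟨h₁, h₂, h₃⟩ := ih h
    have c : D.b Pol.plus 0 (lam e) = D.b Pol.minus 0 (K.pv D lam (K.tgt e) l) := by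
      rw [L.tgt e he, h₂]
    simp only [pv]
    refine ⟨fun α => ?_, ?_, ?_⟩
    · rw [D.b_comp α Nat.zero_lt_one c, L.one e he, h₁]
    · rw [D.b_minus_comp c, L.src e he]
    · rw [D.b_plus_comp c, h₃]

theorem EdgeLab.pv_append (L : K.EdgeLab D lam) {s t u : P} {l m : List P} (h : K.Walk s l t) (h' : K.Walk t m u) :
    K.pv D lam s (l ++ m) = D.comp 0 (K.pv D lam s l) (K.pv D lam t m) := by
  induction l generalizing s with
  | nil =>
    obtain ⟨rfl, hs⟩ := h
    rw [List.nil_append, pv, ← (L.pv_b h').2.1, D.comp_unit_left]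
  | cons e l ih =>
    obtain ⟨⟨rfl, he, -⟩, h⟩ := h
    rw [List.cons_append, pv, pv, ih h, D.assoc]
    · rw [L.tgt e he, (L.pv_b h).2.1]
    · rw [(L.pv_b h).2.2, (L.pv_b h').2.1]

theorem Lab.face_b (L : K.Lab D lam) (hK : K.Ok) {x : P} (hx : K.dim x = 2) :
    D.b Pol.minus 0 (lam x) = lam (K.src x) ∧ D.b Pol.plus 0 (lam x) = lam (K.tgt x) := by
  rw [← D.b_zero_b_one Pol.minus Pol.minus, ← D.b_zero_b_one Pol.plus Pol.minus, L.inn x hx]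
  exact (L.pv_b (hK.inn_walk x hx)).2

theorem Lab.wh_b (L : K.Lab D lam) (hK : K.Ok) {s t x : P} {a b : List P} (hx : K.dim x = 2)
    (ha : K.Walk s a (K.src x)) (hb : K.Walk (K.tgt x) b t) :
    D.b Pol.minus 1 (K.wh D lam s a x b) = K.pv D lam s (a ++ K.inn x ++ b) ∧
    D.b Pol.plus 1 (K.wh D lam s a x b) = K.pv D lam s (a ++ K.out x ++ b) := by
  have hi := hK.inn_walk x hx
  have ho := hK.out_walk x hx
  have c₁ : D.b Pol.plus 0 (lam x) = D.b Pol.minus 0 (K.pv D lam (K.tgt x) b) := by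
    rw [(L.face_b hK hx).2, (L.pv_b hb).2.1]
  have c₂ : D.b Pol.plus 0 (K.pv D lam s a) =
      D.b Pol.minus 0 (D.comp 0 (lam x) (K.pv D lam (K.tgt x) b)) := by
    rw [D.b_minus_comp c₁, (L.face_b hK hx).1, (L.pv_b ha).2.2]
  rw [List.append_assoc, List.append_assoc, L.pv_append ha (walk_append.2 ⟨_, hi, hb⟩),
    L.pv_append ha (walk_append.2 ⟨_, ho, hb⟩), L.pv_append hi hb, L.pv_append ho hb, wh]
  constructor
  · rw [D.b_comp _ Nat.zero_lt_one c₂, D.b_comp _ Nat.zero_lt_one c₁, (L.pv_b ha).1,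
      (L.pv_b hb).1, L.inn x hx]
  · rw [D.b_comp _ Nat.zero_lt_one c₂, D.b_comp _ Nat.zero_lt_one c₁, (L.pv_b ha).1,
      (L.pv_b hb).1, L.out x hx]

theorem Ok.walk_split (hK : K.Ok) {s t x : P} {a b : List P} (hx : K.dim x = 2)
    (h : K.Walk s (a ++ K.inn x ++ b) t) :
    K.Walk s a (K.src x) ∧ K.Walk (K.tgt x) b t := by
  obtain ⟨v, h, hb⟩ := walk_append.1 h
  obtain ⟨u, ha, h⟩ := walk_append.1 h
  obtain ⟨rfl, rfl⟩ := h.unique_of_ne (hK.inn_walk x hx) (hK.inn_ne x hx)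
  exact ⟨ha, hb⟩

theorem Ok.walk_step (hK : K.Ok) {s t x : P} {a b : List P} (hx : K.dim x = 2)
    (h : K.Walk s (a ++ K.inn x ++ b) t) : K.Walk s (a ++ K.out x ++ b) t :=
  have h' := hK.walk_split hx h
  walk_append.2 ⟨_, walk_append.2 ⟨_, h'.1, hK.out_walk x hx⟩, h'.2⟩

theorem Rw.b (L : K.Lab D lam) (hK : K.Ok) {s t : P} {xs p q : List P} {u : C} (hr : K.Rw D lam s xs p q u)
    (hx : ∀ x ∈ xs, K.dim x = 2) (h : K.Walk s p t) :
    D.b Pol.minus 1 u = K.pv D lam s p ∧ D.b Pol.plus 1 u = K.pv D lam s q ∧ K.Walk s q t := by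
  induction xs generalizing p u with
  | nil =>
    obtain ⟨rfl, rfl⟩ := hr
    exact ⟨(L.pv_b h).1 _, (L.pv_b h).1 _, h⟩
  | cons x xs ih =>
    obtain ⟨a, b, v, rfl, hr, rfl⟩ := hr
    have hx2 := hx x (by simp)
    have h' := hK.walk_split hx2 h
    obtain ⟨h₁, h₂, h₃⟩ := ih hr (fun y hy => hx y (by simp [hy])) (hK.walk_step hx2 h)
    have hw := L.wh_b hK hx2 h'.1 h'.2
    have c : D.b Pol.plus 1 (K.wh D lam s a x b) = D.b Pol.minus 1 v := by rw [hw.2, h₁]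
    exact ⟨by rw [D.b_minus_comp c, hw.1], by rw [D.b_plus_comp c, h₂], h₃⟩

/-- Two independent rewriting steps may be interchanged. -/
theorem Lab.swap (L : K.Lab D lam) (hK : K.Ok) {s t x y : P} {a m c : List P} (hx : K.dim x = 2) (hy : K.dim y = 2)
    (h : K.Walk s (a ++ K.inn x ++ (m ++ K.inn y ++ c)) t) :
    D.comp 1 (K.wh D lam s a x (m ++ K.inn y ++ c)) (K.wh D lam s (a ++ K.out x ++ m) y c) =
    D.comp 1 (K.wh D lam s (a ++ K.inn x ++ m) y c) (K.wh D lam s a x (m ++ K.out y ++ c)) := by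
  obtain ⟨ha, hmc⟩ := hK.walk_split hx h
  obtain ⟨hm, hc⟩ := hK.walk_split hy hmc
  have hix := hK.inn_walk x hx
  have hox := hK.out_walk x hx
  have hiy := hK.inn_walk y hy
  have hoy := hK.out_walk y hy
  have bx := L.face_b hK hx
  have by' := L.face_b hK hy
  have pa := L.pv_b ha
  have pm := L.pv_b hm
  have pc := L.pv_b hc
  have cyc : D.b Pol.plus 0 (lam y) = D.b Pol.minus 0 (K.pv D lam (K.tgt y) c) := by
    rw [by'.2, pc.2.1]
  have key : ∀ (w w' : List P) (_ : K.Walk (K.src x) w (K.tgt x))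
      (_ : K.Walk (K.src y) w' (K.tgt y)),
      K.wh D lam s (a ++ w ++ m) y c = D.comp 0 (K.pv D lam s a) (D.comp 0
        (K.pv D lam (K.src x) w) (D.comp 0 (K.pv D lam (K.tgt x) m)
          (D.comp 0 (lam y) (K.pv D lam (K.tgt y) c)))) ∧
      K.wh D lam s a x (m ++ w' ++ c) = D.comp 0 (K.pv D lam s a) (D.comp 0 (lam x)
        (D.comp 0 (K.pv D lam (K.tgt x) m) (D.comp 0 (K.pv D lam (K.src y) w')
          (K.pv D lam (K.tgt y) c)))) := by
    intro w w' hw hw'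
    constructor
    · rw [wh, L.pv_append (walk_append.2 ⟨_, ha, hw⟩) hm, L.pv_append ha hw, D.assoc, D.assoc]
      all_goals
        try rw [D.b_minus_comp (by rw [pm.2.2, D.b_minus_comp cyc, by'.1])]
        try rw [D.b_minus_comp (by rw [(L.pv_b hw).2.2, pm.2.1])]
        try rw [D.b_plus_comp (by rw [pa.2.2, (L.pv_b hw).2.1])]
        try rw [D.b_minus_comp cyc]
        simp only [pa.2, pm.2, (L.pv_b hw).2, by']
    · rw [wh, List.append_assoc, L.pv_append hm (walk_append.2 ⟨_, hw', hc⟩), L.pv_append hw' hc]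
  have nx : ∀ z, D.b Pol.plus 0 (lam x) = D.b Pol.minus 0 z → ∀ z',
      D.b Pol.plus 1 z = D.b Pol.minus 1 z' →
      D.comp 1 (D.comp 0 (lam x) z) (D.comp 0 (D.b Pol.plus 1 (lam x)) z') =
        D.comp 0 (lam x) (D.comp 1 z z') := by
    intro z hz z' hz'
    rw [← D.interchange Nat.zero_lt_one (by rw [D.b_b_le _ _ _ le_rfl]) hz' hz, D.comp_unit_right]
  have nx' : ∀ z, D.b Pol.plus 0 (lam x) = D.b Pol.minus 0 z → ∀ z',
      D.b Pol.plus 1 z = D.b Pol.minus 1 z' →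
      D.comp 1 (D.comp 0 (D.b Pol.minus 1 (lam x)) z) (D.comp 0 (lam x) z') =
        D.comp 0 (lam x) (D.comp 1 z z') := by
    intro z hz z' hz'
    rw [← D.interchange Nat.zero_lt_one (by rw [D.b_b_le _ _ _ le_rfl]) hz'
      (by rw [D.b_zero_b_one, hz]), D.comp_unit_left]
  rw [(key _ _ hox hiy).1, (key _ _ hox hiy).2, (key _ _ hix hoy).1, (key _ _ hix hoy).2,
    ← L.inn x hx, ← L.inn y hy, ← L.out x hx, ← L.out y hy]
  set A := K.pv D lam s a
  set M := K.pv D lam (K.tgt x) m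
  set Cc := K.pv D lam (K.tgt y) c
  set X := lam x
  set Y := lam y
  have cc : ∀ α, D.b Pol.plus 0 (D.b α 1 Y) = D.b Pol.minus 0 Cc := fun α => by
    rw [D.b_zero_b_one, cyc]
  have cm : ∀ α, D.b Pol.plus 0 M = D.b Pol.minus 0 (D.comp 0 (D.b α 1 Y) Cc) := fun α => by
    rw [D.b_minus_comp (cc α), D.b_zero_b_one, pm.2.2, by'.1]
  have cm' : D.b Pol.plus 0 M = D.b Pol.minus 0 (D.comp 0 Y Cc) := by
    rw [D.b_minus_comp cyc, pm.2.2, by'.1]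
  have v₁ : D.comp 1 (D.comp 0 (D.b Pol.minus 1 Y) Cc) (D.comp 0 Y Cc) = D.comp 0 Y Cc := by
    rw [← D.interchange Nat.zero_lt_one (by rw [D.b_b_le _ _ _ le_rfl]) (by rw [pc.1, pc.1])
      (cc _), D.comp_unit_left, D.comp_self pc.1]
  have v₂ : D.comp 1 (D.comp 0 Y Cc) (D.comp 0 (D.b Pol.plus 1 Y) Cc) = D.comp 0 Y Cc := by
    rw [← D.interchange Nat.zero_lt_one (by rw [D.b_b_le _ _ _ le_rfl]) (by rw [pc.1, pc.1])
      cyc, D.comp_unit_right, D.comp_self pc.1]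
  have w₁ : D.b Pol.plus 1 (D.comp 0 (D.b Pol.minus 1 Y) Cc) = D.b Pol.minus 1 (D.comp 0 Y Cc) := by
    rw [D.b_comp _ Nat.zero_lt_one (cc _), D.b_comp _ Nat.zero_lt_one cyc, pc.1, pc.1,
      D.b_b_le _ _ _ le_rfl]
  have w₂ : D.b Pol.plus 1 (D.comp 0 Y Cc) = D.b Pol.minus 1 (D.comp 0 (D.b Pol.plus 1 Y) Cc) := by
    rw [D.b_comp _ Nat.zero_lt_one (cc _), D.b_comp _ Nat.zero_lt_one cyc, pc.1, pc.1,
      D.b_b_le _ _ _ le_rfl]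
  have u₁ : D.b Pol.plus 1 (D.comp 0 M (D.comp 0 (D.b Pol.minus 1 Y) Cc)) =
      D.b Pol.minus 1 (D.comp 0 M (D.comp 0 Y Cc)) := by
    rw [D.b_comp _ Nat.zero_lt_one (cm _), D.b_comp _ Nat.zero_lt_one cm', w₁, pm.1, pm.1]
  have u₂ : D.b Pol.plus 1 (D.comp 0 M (D.comp 0 Y Cc)) =
      D.b Pol.minus 1 (D.comp 0 M (D.comp 0 (D.b Pol.plus 1 Y) Cc)) := by
    rw [D.b_comp _ Nat.zero_lt_one (cm _), D.b_comp _ Nat.zero_lt_one cm', w₂, pm.1, pm.1]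
  have cx : ∀ α, D.b Pol.plus 0 X =
      D.b Pol.minus 0 (D.comp 0 M (D.comp 0 (D.b α 1 Y) Cc)) := fun α => by
    rw [D.b_minus_comp (cm α), bx.2, pm.2.1]
  have cx' : D.b Pol.plus 0 X = D.b Pol.minus 0 (D.comp 0 M (D.comp 0 Y Cc)) := by
    rw [D.b_minus_comp cm', bx.2, pm.2.1]
  have e₁ : D.comp 1 (D.comp 0 X (D.comp 0 M (D.comp 0 (D.b Pol.minus 1 Y) Cc)))
      (D.comp 0 (D.b Pol.plus 1 X) (D.comp 0 M (D.comp 0 Y Cc))) =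
      D.comp 0 X (D.comp 0 M (D.comp 0 Y Cc)) := by
    rw [nx _ (cx _) _ u₁, D.whisker_left pm.1 (cm _) w₁, v₁]
  have e₂ : D.comp 1 (D.comp 0 (D.b Pol.minus 1 X) (D.comp 0 M (D.comp 0 Y Cc)))
      (D.comp 0 X (D.comp 0 M (D.comp 0 (D.b Pol.plus 1 Y) Cc))) =
      D.comp 0 X (D.comp 0 M (D.comp 0 Y Cc)) := by
    rw [nx' _ cx' _ u₂, D.whisker_left pm.1 cm' w₂, v₂]
  have cx'' : ∀ α, D.b Pol.plus 0 (D.b α 1 X) = D.b Pol.minus 0 (D.comp 0 M (D.comp 0 Y Cc)) :=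
    fun α => by rw [D.b_zero_b_one]; exact cx'
  rw [D.whisker_left pa.1, D.whisker_left pa.1, e₁, e₂]
  · rw [D.b_minus_comp (cx'' _), D.b_zero_b_one, pa.2.2, bx.1]
  · rw [D.b_comp _ Nat.zero_lt_one (cx'' _), D.b_comp _ Nat.zero_lt_one (cx _), u₂,
      D.b_b_le _ _ _ le_rfl]
  · rw [D.b_minus_comp (cx _), pa.2.2, bx.1]
  · rw [D.b_comp _ Nat.zero_lt_one (cx'' _), D.b_comp _ Nat.zero_lt_one (cx _), u₁,
      D.b_b_le _ _ _ le_rfl]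

end CxData

theorem append_disjoint_cases {α : Type} {a b a' b' I J : List α} (hI : I ≠ []) (hJ : J ≠ [])
    (hd : List.Disjoint I J) (h : a ++ I ++ b = a' ++ J ++ b') :
    (∃ m, a' = a ++ I ++ m ∧ b = m ++ J ++ b') ∨ (∃ m, a = a' ++ J ++ m ∧ b' = m ++ I ++ b) := by
  have aux : ∀ {b b' I J c : List α}, J ≠ [] → List.Disjoint I J → I ++ b = c ++ (J ++ b') →
      ∃ m, c = I ++ m ∧ b = m ++ J ++ b' := by
    intro b b' I J c hJ hd h
    rcases List.append_eq_append_iff.1 h with ⟨m, hc, h'⟩ | ⟨d, hc, h'⟩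
    · exact ⟨m, hc, by simpa using h'⟩
    · obtain ⟨j, J', rfl⟩ := List.exists_cons_of_ne_nil hJ
      cases d with
      | nil => exact ⟨[], by simpa using hc.symm, by simpa using h'.symm⟩
      | cons x d =>
        simp only [List.cons_append, List.cons.injEq] at h'
        exact (hd (a := j) (by simp [hc, h'.1]) (by simp)).elim
  rw [List.append_assoc, List.append_assoc] at h
  rcases List.append_eq_append_iff.1 h with ⟨c, rfl, h'⟩ | ⟨c, rfl, h'⟩
  · obtain ⟨m, rfl, rfl⟩ := aux hJ hd h'
    exact Or.inl ⟨m, by simp, rfl⟩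
  · obtain ⟨m, rfl, rfl⟩ := aux hI hd.symm h'
    exact Or.inr ⟨m, by simp, rfl⟩

theorem append_cons_inj_of_notMem {α : Type} {e : α} {a a' l l' : List α} (h : e ∉ a)
    (h' : e ∉ a') (he : a ++ e :: l = a' ++ e :: l') : a = a' ∧ l = l' := by
  induction a generalizing a' with
  | nil =>
    cases a' with
    | nil => simpa using he
    | cons x a' =>
      simp only [List.nil_append, List.cons_append, List.cons.injEq] at he
      exact absurd (by simp [he.1]) h'
  | cons x a ih =>
    cases a' with
    | nil =>
      simp only [List.nil_append, List.cons_append, List.cons.injEq] at he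
      exact absurd (by simp [he.1]) h
    | cons y a' =>
      simp only [List.cons_append, List.cons.injEq, List.mem_cons, not_or] at *
      obtain ⟨rfl, h₂⟩ := ih h.2 h'.2 he.2
      exact ⟨⟨he.1, rfl⟩, h₂⟩

theorem append_inj_of_count_eq_one {α : Type} [DecidableEq α] {e : α} {a b a' b' I : List α}
    (hI : I.head? = some e) (h : (a ++ I ++ b).count e = 1)
    (he : a ++ I ++ b = a' ++ I ++ b') : a = a' ∧ b = b' := by
  cases I with
  | nil => simp at hI
  | cons x I =>
    obtain rfl : x = e := by simpa using hI
    have h' := h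
    rw [he] at h'
    simp only [List.count_append, List.count_cons_self] at h h'
    have ha : x ∉ a := List.count_eq_zero.1 (by omega)
    have ha' : x ∉ a' := List.count_eq_zero.1 (by omega)
    obtain ⟨h₁, h₂⟩ := append_cons_inj_of_notMem ha ha' (by simpa using he)
    exact ⟨h₁, by simpa using h₂⟩

namespace CxData

variable {P : Type} {K : CxData P} {C : Type} {D : Two C} {lam : P → C}

/-- In a rewriting sequence, a face whose input is part of the initial path can be moved to the
front. -/
theorem Rw.front [DecidableEq P] (L : K.Lab D lam) (hK : K.Ok) {s t y e : P} {xs a b q : List P}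
    {u : C} (hr : K.Rw D lam s xs (a ++ K.inn y ++ b) q u) (hx : ∀ x ∈ xs, K.dim x = 2)
    (h : K.Walk s (a ++ K.inn y ++ b) t) (hy : y ∈ xs) (he : (K.inn y).head? = some e)
    (hc : (a ++ K.inn y ++ b).count e = 1)
    (hi : ∀ x ∈ xs, x ≠ y → List.Disjoint (K.inn y) (K.inn x)) (ho : ∀ x ∈ xs, e ∉ K.out x) :
    ∃ v, K.Rw D lam s (xs.erase y) (a ++ K.out y ++ b) q v ∧
      u = D.comp 1 (K.wh D lam s a y b) v := by
  induction xs generalizing a b u with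
  | nil => simp at hy
  | cons x xs ih =>
    obtain ⟨a', b', v, hp, hr, rfl⟩ := hr
    by_cases hxy : x = y
    · subst hxy
      obtain ⟨rfl, rfl⟩ := append_inj_of_count_eq_one he hc hp
      exact ⟨v, by rwa [List.erase_cons_head], rfl⟩
    have hy' : y ∈ xs := by simpa [Ne.symm hxy] using hy
    have hx2 := hx x (by simp)
    have hy2 := hx y hy
    have hd := hi x (by simp) hxy
    have hxs : ∀ z ∈ xs, K.dim z = 2 := fun z hz => hx z (by simp [hz])
    have hex : e ∉ K.inn x := fun h => hd (List.mem_of_mem_head? he) h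
    have heo : e ∉ K.out x := ho x (by simp)
    rw [List.erase_cons_tail (by simpa using hxy)]
    rcases append_disjoint_cases (hK.inn_ne y hy2) (hK.inn_ne x hx2) hd hp with
      ⟨m, rfl, rfl⟩ | ⟨m, rfl, rfl⟩
    · have hW := hK.walk_step hx2 (hp ▸ h)
      have hW' : K.Walk s (a ++ K.inn y ++ (m ++ K.out x ++ b')) t := by simpa using hW
      obtain ⟨v', hr', rfl⟩ := ih (a := a) (b := m ++ K.out x ++ b') (by simpa using hr) hxs hW' hy'
        (by
          simp only [List.count_append, List.count_eq_zero.2 hex, List.count_eq_zero.2 heo] at hc ⊢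
          omega)
        (fun z hz => hi z (by simp [hz])) (fun z hz => ho z (by simp [hz]))
      refine ⟨D.comp 1 (K.wh D lam s (a ++ K.out y ++ m) x b') v', ⟨a ++ K.out y ++ m, b', v',
        by simp, by simpa using hr', rfl⟩, ?_⟩
      have sw := L.swap hK hy2 hx2 h
      have h₁ := hK.walk_split hy2 h
      have h₂ := hK.walk_split hx2 (a := a ++ K.inn y ++ m) (b := b') (t := t) (s := s)
        (by simpa using h)
      have h₃ := hK.walk_split hx2 (a := a ++ K.out y ++ m) (b := b') (t := t) (s := s)
        (by simpa using hK.walk_step hy2 h)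
      have h₄ := hK.walk_split hy2 hW'
      have b₁ := L.wh_b hK hy2 h₁.1 h₁.2
      have b₂ := L.wh_b hK hx2 h₂.1 h₂.2
      have b₃ := L.wh_b hK hx2 h₃.1 h₃.2
      have b₄ := L.wh_b hK hy2 h₄.1 h₄.2
      have b₅ := Rw.b L hK hr' (fun z hz => hxs z (List.mem_of_mem_erase hz))
        (hK.walk_step hy2 hW')
      rw [← D.assoc, ← sw, D.assoc]
      · rw [b₁.2, b₃.1]; simp
      · rw [b₃.2, b₅.1]; simp
      · rw [b₂.2, b₄.1]; simp
      · rw [b₄.2, b₅.1]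
    · have hW := hK.walk_step hx2 (hp ▸ h)
      have hW' : K.Walk s (a' ++ K.out x ++ m ++ K.inn y ++ b) t := by simpa using hW
      have hh : K.Walk s (a' ++ K.inn x ++ (m ++ K.inn y ++ b)) t := by simpa using h
      obtain ⟨v', hr', rfl⟩ := ih (a := a' ++ K.out x ++ m) (b := b) (by simpa using hr) hxs hW' hy'
        (by
          simp only [List.count_append, List.count_eq_zero.2 hex, List.count_eq_zero.2 heo] at hc ⊢
          omega)
        (fun z hz => hi z (by simp [hz])) (fun z hz => ho z (by simp [hz]))
      refine ⟨D.comp 1 (K.wh D lam s a' x (m ++ K.out y ++ b)) v', ⟨a', m ++ K.out y ++ b, v',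
        by simp, by simpa using hr', rfl⟩, ?_⟩
      have sw := L.swap hK hx2 hy2 hh
      have h₁ := hK.walk_split hy2 h
      have h₂ := hK.walk_split hx2 hh
      have h₃ := hK.walk_split hx2 (a := a') (b := m ++ K.out y ++ b) (t := t) (s := s)
        (by simpa using hK.walk_step hy2 h)
      have h₄ := hK.walk_split hy2 hW'
      have b₁ := L.wh_b hK hy2 h₁.1 h₁.2
      have b₂ := L.wh_b hK hx2 h₂.1 h₂.2
      have b₃ := L.wh_b hK hx2 h₃.1 h₃.2
      have b₄ := L.wh_b hK hy2 h₄.1 h₄.2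
      have b₅ := Rw.b L hK hr' (fun z hz => hxs z (List.mem_of_mem_erase hz))
        (hK.walk_step hy2 hW')
      rw [← D.assoc, sw, D.assoc]
      · rw [b₁.2, b₃.1]; simp
      · rw [b₃.2, b₅.1]; simp
      · rw [b₂.2, b₄.1]; simp
      · rw [b₄.2, b₅.1]

theorem Rw.mem_of_forall_notMem_inn {s e : P} {xs p q : List P} {u : C}
    (hr : K.Rw D lam s xs p q u) (he : e ∈ p) (hx : ∀ x ∈ xs, e ∉ K.inn x) : e ∈ q := by
  induction xs generalizing p u with
  | nil => exact hr.1 ▸ he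
  | cons x xs ih =>
    obtain ⟨a, b, v, rfl, hr, -⟩ := hr
    have := hx x (by simp)
    exact ih hr (by simp at he ⊢; tauto) fun z hz => hx z (by simp [hz])

theorem Rw.mem_or_mem_out {s e x : P} {xs p q : List P} {u : C}
    (hr : K.Rw D lam s xs p q u) (hx : x ∈ xs) (he : e ∈ K.inn x) :
    e ∈ p ∨ ∃ y ∈ xs, e ∈ K.out y := by
  induction xs generalizing p u with
  | nil => simp at hx
  | cons z xs ih =>
    obtain ⟨a, b, v, rfl, hr, -⟩ := hr
    rcases List.mem_cons.1 hx with rfl | hx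
    · exact Or.inl (by simp [he])
    · rcases ih hr hx with h | ⟨y, hy, h⟩
      · simp only [List.mem_append] at h
        rcases h with (h | h) | h
        · exact Or.inl (by simp [h])
        · exact Or.inr ⟨z, by simp, h⟩
        · exact Or.inl (by simp [h])
      · exact Or.inr ⟨y, by simp [hy], h⟩

variable (K) in
/-- The conditions ensuring that every edge is created and consumed at most once when rewriting
`p` to `q` by the faces in `ys`. -/
structure Nice (ys p q : List P) : Prop where
  nodup_faces : ys.Nodup
  dim_face : ∀ y ∈ ys, K.dim y = 2
  nodup : p.Nodup
  out_nodup : ∀ y ∈ ys, (K.out y).Nodup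
  out_path : ∀ y ∈ ys, List.Disjoint (K.out y) p
  out_out : ∀ y ∈ ys, ∀ z ∈ ys, y ≠ z → List.Disjoint (K.out y) (K.out z)
  inn_inn : ∀ y ∈ ys, ∀ z ∈ ys, y ≠ z → List.Disjoint (K.inn y) (K.inn z)
  inn_path : ∀ y ∈ ys, List.Disjoint (K.inn y) q

/-- All rewriting sequences with the same ends in a nice set of faces have the same composite. -/
theorem Rw.unique (L : K.Lab D lam) (hK : K.Ok) {s t : P} {xs ys p q : List P} {u w : C}
    (hn : K.Nice ys p q) (hw : K.Rw D lam s ys p q w) (hu : K.Rw D lam s xs p q u)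
    (hxs : ∀ x ∈ xs, x ∈ ys) (h : K.Walk s p t) : u = w := by
  classical
  induction ys generalizing p xs u w with
  | nil =>
    cases xs with
    | nil => exact hu.2.trans hw.2.symm
    | cons x xs => exact absurd (hxs x (by simp)) (by simp)
  | cons y ys ih =>
    obtain ⟨a, b, w', rfl, hw, rfl⟩ := hw
    have hy2 := hn.dim_face y (by simp)
    obtain ⟨e, l, hel⟩ := List.exists_cons_of_ne_nil (hK.inn_ne y hy2)
    have hey : e ∈ K.inn y := by simp [hel]
    have hep : e ∈ a ++ K.inn y ++ b := by simp [hey]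
    have hyxs : y ∈ xs := by
      by_contra hy
      refine hn.inn_path y (by simp) hey (hu.mem_of_forall_notMem_inn hep fun x hx hx' => ?_)
      have hne : y ≠ x := fun h => hy (h ▸ hx)
      exact hn.inn_inn y (by simp) x (hxs x hx) hne hey hx'
    have heo : ∀ x ∈ y :: ys, e ∉ K.out x := fun x hx h => hn.out_path x hx h hep
    obtain ⟨v, hv, rfl⟩ := hu.front L hK (fun x hx => hn.dim_face x (hxs x hx)) h hyxs
      (e := e) (by simp [hel]) (List.count_eq_one_of_mem hn.nodup hep)
      (fun x hx hne => hn.inn_inn y (by simp) x (hxs x hx) hne.symm) (fun x hx => heo x (hxs x hx))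
    have nd := hn.nodup
    have hnd : e ∉ a ∧ e ∉ b := by
      rw [hel] at nd
      simp only [List.nodup_append, List.nodup_cons, List.mem_append, List.mem_cons] at nd
      refine ⟨fun h => nd.1.2.2 e h e (Or.inl rfl) rfl, fun h => nd.2.2 e (by simp) e h rfl⟩
    have hye : y ∉ xs.erase y := by
      intro hy
      rcases hv.mem_or_mem_out hy hey with h' | ⟨x, hx, h'⟩
      · simp only [List.mem_append] at h'
        have := heo y (by simp)
        tauto
      · exact heo x (hxs x (List.mem_of_mem_erase hx)) h'
    congr 1
    have hop := hn.out_path y (by simp)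
    refine ih ⟨(List.nodup_cons.1 hn.nodup_faces).2, fun z hz => hn.dim_face z (by simp [hz]), ?_,
      fun z hz => hn.out_nodup z (by simp [hz]), ?_, fun z hz z' hz' => hn.out_out z (by simp [hz])
      z' (by simp [hz']), fun z hz z' hz' => hn.inn_inn z (by simp [hz]) z' (by simp [hz']),
      fun z hz => hn.inn_path z (by simp [hz])⟩ hw hv ?_ (hK.walk_step hy2 h)
    · have ho := hn.out_nodup y (by simp)
      simp only [List.nodup_append, List.mem_append] at nd ⊢
      refine ⟨⟨nd.1.1, ho, fun x hx z hz h => ?_⟩, nd.2.1, fun x hx z hz h => ?_⟩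
      · subst h; exact hop hz (by simp [hx])
      · subst h
        rcases hx with hx | hx
        · exact nd.2.2 x (Or.inl hx) x hz rfl
        · exact hop hx (by simp [hz])
    · intro z hz e' he' hm
      have h₁ := hn.out_path z (by simp [hz])
      have hne : z ≠ y := fun h => (List.nodup_cons.1 hn.nodup_faces).1 (h ▸ hz)
      have h₂ := hn.out_out z (by simp [hz]) y (by simp) hne
      simp only [List.mem_append] at hm
      rcases hm with (hm | hm) | hm
      · exact h₁ he' (by simp [hm])
      · exact h₂ he' hm
      · exact h₁ he' (by simp [hm])
    · intro x hx
      have := hxs x (List.mem_of_mem_erase hx)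
      rcases List.mem_cons.1 this with rfl | h
      · exact absurd hx hye
      · exact h

/-- Rewriting sequences with matching ends can be composed. -/
theorem Rw.append (L : K.Lab D lam) (hK : K.Ok) {s t : P} {xs ys p q r : List P} {u v : C}
    (hu : K.Rw D lam s xs p q u) (hv : K.Rw D lam s ys q r v) (h : K.Walk s p t)
    (hx : ∀ x ∈ xs, K.dim x = 2) (hy : ∀ x ∈ ys, K.dim x = 2) :
    K.Rw D lam s (xs ++ ys) p r (D.comp 1 u v) := by
  induction xs generalizing p u with
  | nil =>
    obtain ⟨rfl, rfl⟩ := hu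
    rw [← (hv.b L hK hy h).1, D.comp_unit_left]
    exact hv
  | cons x xs ih =>
    obtain ⟨a, b, u, rfl, hu, rfl⟩ := hu
    have hx2 := hx x (by simp)
    have h' := hK.walk_step hx2 h
    have hxs : ∀ z ∈ xs, K.dim z = 2 := fun z hz => hx z (by simp [hz])
    have hu' := hu.b L hK hxs h'
    have hs := hK.walk_split hx2 h
    refine ⟨a, b, _, rfl, ih hu h' hxs, ?_⟩
    rw [D.assoc]
    · rw [(L.wh_b hK hx2 hs.1 hs.2).2, hu'.1]
    · rw [hu'.2.1, (hv.b L hK hy hu'.2.2).1]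

/-- Rewriting sequences can be whiskered. -/
theorem Rw.whisker (L : K.Lab D lam) (hK : K.Ok) {s s' t' t : P} {xs p q l r : List P} {u : C}
    (hu : K.Rw D lam s' xs p q u) (hl : K.Walk s l s') (h : K.Walk s' p t') (hr : K.Walk t' r t)
    (hx : ∀ x ∈ xs, K.dim x = 2) :
    K.Rw D lam s xs (l ++ p ++ r) (l ++ q ++ r)
      (D.comp 0 (K.pv D lam s l) (D.comp 0 u (K.pv D lam t' r))) := by
  induction xs generalizing p u with
  | nil =>
    obtain ⟨rfl, rfl⟩ := hu
    refine ⟨rfl, ?_⟩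
    rw [List.append_assoc, L.pv_append hl (walk_append.2 ⟨_, h, hr⟩), L.pv_append h hr]
  | cons x xs ih =>
    obtain ⟨a, b, u, rfl, hu, rfl⟩ := hu
    have hx2 := hx x (by simp)
    have h' := hK.walk_step hx2 h
    have hxs : ∀ z ∈ xs, K.dim z = 2 := fun z hz => hx z (by simp [hz])
    have hu' := hu.b L hK hxs h'
    have hs := hK.walk_split hx2 h
    have hw := L.wh_b hK hx2 hs.1 hs.2
    have pl := L.pv_b hl
    have pr := L.pv_b hr
    have pa := L.pv_b hs.1
    have pb := L.pv_b hs.2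
    have px := L.face_b hK hx2
    refine ⟨l ++ a, b ++ r, _, by simp, by simpa using ih hu h' hxs, ?_⟩
    have e₁ : D.b Pol.plus 1 (K.wh D lam s' a x b) = D.b Pol.minus 1 u := by rw [hw.2, hu'.1]
    have wb : ∀ α, D.b α 0 (K.wh D lam s' a x b) = D.b α 0 (K.pv D lam s' (a ++ K.inn x ++ b)) :=
      fun α => by rw [← hw.1, D.b_zero_b_one]
    have ub : ∀ α, D.b α 0 u = D.b α 0 (K.pv D lam s' (a ++ K.out x ++ b)) :=
      fun α => by rw [← hu'.1, D.b_zero_b_one]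
    have e₂ : D.b Pol.plus 0 (K.wh D lam s' a x b) = D.b Pol.minus 0 (K.pv D lam t' r) := by
      rw [wb, (L.pv_b h).2.2, pr.2.1]
    have e₃ : D.b Pol.plus 0 u = D.b Pol.minus 0 (K.pv D lam t' r) := by
      rw [ub, (L.pv_b h').2.2, pr.2.1]
    have e₄ : D.comp 0 (D.comp 1 (K.wh D lam s' a x b) u) (K.pv D lam t' r) =
        D.comp 1 (D.comp 0 (K.wh D lam s' a x b) (K.pv D lam t' r))
          (D.comp 0 u (K.pv D lam t' r)) := by
      rw [← D.interchange Nat.zero_lt_one e₁ (by rw [pr.1, pr.1]) e₂, D.comp_self pr.1]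
    have e₅ : D.comp 0 (K.pv D lam s l) (D.comp 0 (K.wh D lam s' a x b) (K.pv D lam t' r)) =
        K.wh D lam s (l ++ a) x (b ++ r) := by
      have c₁ : D.b Pol.plus 0 (lam x) = D.b Pol.minus 0 (K.pv D lam (K.tgt x) b) := by
        rw [px.2, pb.2.1]
      have c₂ : D.b Pol.plus 0 (K.pv D lam s' a) =
          D.b Pol.minus 0 (D.comp 0 (lam x) (K.pv D lam (K.tgt x) b)) := by
        rw [D.b_minus_comp c₁, pa.2.2, px.1]
      have c₃ : D.b Pol.plus 0 (D.comp 0 (lam x) (K.pv D lam (K.tgt x) b)) =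
          D.b Pol.minus 0 (K.pv D lam t' r) := by
        rw [D.b_plus_comp c₁, pb.2.2, pr.2.1]
      have c₄ : D.b Pol.plus 0 (K.pv D lam (K.tgt x) b) = D.b Pol.minus 0 (K.pv D lam t' r) := by
        rw [pb.2.2, pr.2.1]
      have c₅ : D.b Pol.plus 0 (lam x) =
          D.b Pol.minus 0 (D.comp 0 (K.pv D lam (K.tgt x) b) (K.pv D lam t' r)) := by
        rw [D.b_minus_comp c₄, c₁]
      rw [wh, wh, L.pv_append hl hs.1, L.pv_append hs.2 hr, D.assoc c₂ c₃, D.assoc c₁ c₄,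
        D.assoc]
      · rw [pl.2.2, pa.2.1]
      · rw [D.b_minus_comp c₅, pa.2.2, px.1]
    rw [e₄, ← D.whisker_left pl.1, e₅]
    · rw [D.b_minus_comp e₂, wb, (L.pv_b h).2.1, pl.2.2]
    · rw [D.b_comp _ Nat.zero_lt_one e₂, D.b_comp _ Nat.zero_lt_one e₃, e₁, pr.1, pr.1]

end CxData

/-! ### Boundaries and pasting of molecules -/

section Boundaries

set_option linter.unusedSectionVars false

variable {P : Type} [OGPoset P]

open OGPoset

/-- All elements of `U` have dimension at most `n`. -/
def DimLe (U : Set P) (n : ℕ) : Prop := ∀ x ∈ U, dim x ≤ n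

theorem DimLe.mono {U V : Set P} {n : ℕ} (h : DimLe V n) (hU : U ⊆ V) : DimLe U n :=
  fun x hx => h x (hU hx)

theorem bord_subset {U : Set P} {n : ℕ} {α : Pol} (hU : IsLowerSet U) : bord n α U ⊆ U := by
  rintro x (⟨y, hy, hxy⟩ | hx)
  · exact hU hxy hy.1
  · exact hx.1

theorem bord_eq_self {U : Set P} {n : ℕ} {α : Pol} (hU : IsLowerSet U) (h : DimLe U n) :
    bord n α U = U :=
  (bord_subset hU).antisymm fun _ hx => Or.inr ⟨hx, fun y hy _ => h y hy⟩

theorem IsMolecule.isLowerSet {U : Set P} (h : IsMolecule U) : IsLowerSet U := by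
  induction h with
  | atom x => exact isLowerSet_Iic x
  | paste n U V _ _ _ _ _ _ ih ih' => exact ih.union ih'

theorem sbord_subset_bord {U : Set P} {n : ℕ} {α : Pol} : sbord n α U ⊆ bord n α U :=
  fun x hx => Or.inl ⟨x, hx, le_rfl⟩

variable [Finite P]

theorem dim_lt_dim {a b : P} (hab : a < b) : dim a < dim b := by
  induction b using WellFoundedLT.induction with
  | ind b ih =>
    obtain ⟨c, hac, hcb⟩ := exists_le_covBy_of_lt hab
    rw [dim_of_covBy c b hcb]
    rcases hac.lt_or_eq with h | rfl
    · exact (ih c hcb.lt h).trans (Nat.lt_succ_self _)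
    · exact Nat.lt_succ_self _

theorem dim_le_dim {a b : P} (hab : a ≤ b) : dim a ≤ dim b := by
  rcases hab.lt_or_eq with h | rfl
  · exact (dim_lt_dim h).le
  · exact le_rfl

theorem eq_of_le_of_dim_le {a b : P} (hab : a ≤ b) (h : dim b ≤ dim a) : a = b := by
  rcases hab.lt_or_eq with h' | rfl
  · exact absurd (dim_lt_dim h') (by omega)
  · rfl

theorem dimLe_Iic (x : P) : DimLe (Set.Iic x) (dim x) := fun _ hy => dim_le_dim hy

theorem dimLe_bord {U : Set P} {n : ℕ} {α : Pol} : DimLe (bord n α U) n := by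
  rintro x (⟨y, hy, hxy⟩ | hx)
  · exact (dim_le_dim hxy).trans hy.2.1.le
  · exact hx.2 x hx.1 le_rfl

theorem mem_sbord {U : Set P} {n : ℕ} {α : Pol} {x : P} (hx : x ∈ bord n α U) (h : dim x = n) :
    x ∈ sbord n α U := by
  rcases hx with ⟨y, hy, hxy⟩ | hx
  · rwa [eq_of_le_of_dim_le hxy (by rw [hy.2.1, h])]
  · refine ⟨hx.1, h, fun y hy hxy => ?_⟩
    have := hx.2 y hy hxy.le
    rw [dim_of_covBy x y hxy] at this
    omega

/-- Boundaries satisfy the globular relations. -/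
def Globular (U : Set P) : Prop :=
  ∀ (i j : ℕ) (α β : Pol), i < j → bord i α (bord j β U) = bord i α U

/-- A well-behaved closed subset: its boundaries are molecules, and it is globular. -/
structure Good (U : Set P) : Prop where
  globular : Globular U
  molecule : ∀ j α, IsMolecule (bord j α U)

theorem Good.isLowerSet_bord {U : Set P} (h : Good U) (j : ℕ) (α : Pol) :
    IsLowerSet (bord j α U) := (h.molecule j α).isLowerSet

theorem Good.bord_bord_of_le {U : Set P} (h : Good U) {i j : ℕ} (hij : j ≤ i) (α β : Pol) :
    bord i α (bord j β U) = bord j β U :=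
  bord_eq_self (h.isLowerSet_bord j β) fun x hx => (dimLe_bord x hx).trans hij

theorem Good.globular_bord {U : Set P} (h : Good U) (j : ℕ) (β : Pol) :
    Globular (bord j β U) := by
  intro i l α γ hil
  rcases lt_or_ge l j with hl | hl
  · rw [h.globular l j γ β hl, h.globular i l α γ hil, h.globular i j α β (hil.trans hl)]
  · rw [h.bord_bord_of_le hl]

section Paste

variable {U V : Set P} {k : ℕ}

theorem bord_union_of_lt (gU : Globular U) (gV : Globular V)
    (h₁ : U ∩ V = bord k Pol.plus U) (h₂ : U ∩ V = bord k Pol.minus V) {j : ℕ} (hj : j < k)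
    (α : Pol) : bord j α U = bord j α V ∧ bord j α (U ∪ V) = bord j α U := by
  have e : bord j α U = bord j α V := by
    rw [← gU j k α Pol.plus hj, ← h₁, h₂, gV j k α Pol.minus hj]
  have aux : ∀ x ∈ sbord j α U, x ∈ sbord j α V := fun x hx =>
    mem_sbord (e ▸ sbord_subset_bord hx) hx.2.1
  have aux' : ∀ x ∈ sbord j α V, x ∈ sbord j α U := fun x hx =>
    mem_sbord (e ▸ sbord_subset_bord hx) hx.2.1
  have s : ∀ x, x ∈ sbord j α (U ∪ V) ↔ x ∈ sbord j α U := by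
    refine fun x => ⟨fun hx => ?_, fun hx => ?_⟩
    · rcases hx.1 with h | h
      · exact ⟨h, hx.2.1, fun y hy => hx.2.2 y (Or.inl hy)⟩
      · exact aux' x ⟨h, hx.2.1, fun y hy => hx.2.2 y (Or.inr hy)⟩
    · refine ⟨Or.inl hx.1, hx.2.1, fun y hy => ?_⟩
      rcases hy with hy | hy
      · exact hx.2.2 y hy
      · exact (aux x hx).2.2 y hy
  refine ⟨e, ?_⟩
  ext x
  constructor
  · rintro (⟨y, hy, hxy⟩ | ⟨hx, h⟩)
    · exact Or.inl ⟨y, (s y).1 hy, hxy⟩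
    · rcases hx with hx | hx
      · exact Or.inr ⟨hx, fun y hy => h y (Or.inl hy)⟩
      · rw [e]; exact Or.inr ⟨hx, fun y hy => h y (Or.inr hy)⟩
  · intro hx
    have hx' := hx
    rw [e] at hx'
    rcases hx with ⟨y, hy, hxy⟩ | ⟨hx, h⟩
    · exact Or.inl ⟨y, (s y).2 hy, hxy⟩
    · rcases hx' with ⟨y, hy, hxy⟩ | ⟨-, h'⟩
      · exact Or.inl ⟨y, (s y).2 (aux' y hy), hxy⟩
      · exact Or.inr ⟨Or.inl hx, fun y hy => hy.elim (h y) (h' y)⟩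

theorem bord_union_self {α : Pol} (hV : IsLowerSet V) (h : U ∩ V = bord k α V) :
    bord k α (U ∪ V) = bord k α U := by
  have hVU : ∀ x ∈ bord k α V, x ∈ U := fun x hx => (h.symm ▸ hx : x ∈ U ∩ V).1
  have s : ∀ x, x ∈ sbord k α (U ∪ V) ↔ x ∈ sbord k α U := by
    refine fun x => ⟨fun hx => ?_, fun hx => ?_⟩
    · refine ⟨?_, hx.2.1, fun y hy => hx.2.2 y (Or.inl hy)⟩
      rcases hx.1 with h' | h'
      · exact h'
      · exact hVU x (sbord_subset_bord ⟨h', hx.2.1, fun y hy => hx.2.2 y (Or.inr hy)⟩)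
    · refine ⟨Or.inl hx.1, hx.2.1, fun y hy hxy => ?_⟩
      rcases hy with hy | hy
      · exact hx.2.2 y hy hxy
      · exact (mem_sbord (h ▸ ⟨hx.1, hV hxy.le hy⟩ : x ∈ bord k α V) hx.2.1).2.2 y hy hxy
  ext x
  constructor
  · rintro (⟨y, hy, hxy⟩ | ⟨hx, h'⟩)
    · exact Or.inl ⟨y, (s y).1 hy, hxy⟩
    · refine Or.inr ⟨?_, fun y hy => h' y (Or.inl hy)⟩
      rcases hx with hx | hx
      · exact hx
      · exact hVU x (Or.inr ⟨hx, fun y hy => h' y (Or.inr hy)⟩)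
  · rintro (⟨y, hy, hxy⟩ | ⟨hx, h'⟩)
    · exact Or.inl ⟨y, (s y).2 hy, hxy⟩
    · by_cases hxV : x ∈ V
      · rcases (h ▸ ⟨hx, hxV⟩ : x ∈ bord k α V) with ⟨z, hz, hxz⟩ | ⟨-, h''⟩
        · have hzU := hVU z (sbord_subset_bord hz)
          refine Or.inl ⟨z, (s z).2 ⟨hzU, hz.2.1, fun y hy hzy => ?_⟩, hxz⟩
          have := h' y hy (hxz.trans hzy.le)
          rw [dim_of_covBy z y hzy, hz.2.1] at this
          omega
        · exact Or.inr ⟨Or.inl hx, fun y hy => hy.elim (h' y) (h'' y)⟩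
      · exact Or.inr ⟨Or.inl hx, fun y hy hxy => hy.elim (fun hy => h' y hy hxy)
          fun hy => absurd (hV hxy hy) hxV⟩

theorem bord_union_of_gt (hU : IsLowerSet U) (hV : IsLowerSet V) (gU : Good U) (gV : Good V)
    (h₁ : U ∩ V = bord k Pol.plus U) (h₂ : U ∩ V = bord k Pol.minus V) {j : ℕ} (hj : k < j)
    (α : Pol) : bord j α (U ∪ V) = bord j α U ∪ bord j α V := by
  have hd : ∀ x ∈ U, x ∈ V → dim x ≤ k := fun x hx hx' =>
    dimLe_bord x (h₁ ▸ ⟨hx, hx'⟩ : x ∈ bord k Pol.plus U)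
  have s : ∀ x, x ∈ sbord j α (U ∪ V) ↔ x ∈ sbord j α U ∨ x ∈ sbord j α V := by
    refine fun x => ⟨fun hx => ?_, fun hx => ?_⟩
    · exact hx.1.imp (fun h => ⟨h, hx.2.1, fun y hy => hx.2.2 y (Or.inl hy)⟩)
        (fun h => ⟨h, hx.2.1, fun y hy => hx.2.2 y (Or.inr hy)⟩)
    · rcases hx with hx | hx
      · refine ⟨Or.inl hx.1, hx.2.1, fun y hy hxy => ?_⟩
        rcases hy with hy | hy
        · exact hx.2.2 y hy hxy
        · have := hd x hx.1 (hV hxy.le hy)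
          have := hx.2.1
          omega
      · refine ⟨Or.inr hx.1, hx.2.1, fun y hy hxy => ?_⟩
        rcases hy with hy | hy
        · have := hd x (hU hxy.le hy) hx.1
          have := hx.2.1
          omega
        · exact hx.2.2 y hy hxy
  have hkU : U ∩ V ⊆ bord j α U := by
    rw [h₁, ← gU.globular k j Pol.plus α hj]
    exact bord_subset (gU.isLowerSet_bord j α)
  have hkV : U ∩ V ⊆ bord j α V := by
    rw [h₂, ← gV.globular k j Pol.minus α hj]
    exact bord_subset (gV.isLowerSet_bord j α)
  ext x
  constructor
  · rintro (⟨y, hy, hxy⟩ | ⟨hx, h'⟩)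
    · exact ((s y).1 hy).imp (fun h => Or.inl ⟨y, h, hxy⟩) (fun h => Or.inl ⟨y, h, hxy⟩)
    · exact hx.imp (fun h => Or.inr ⟨h, fun y hy => h' y (Or.inl hy)⟩)
        (fun h => Or.inr ⟨h, fun y hy => h' y (Or.inr hy)⟩)
  · rintro (hx | hx)
    · rcases hx with ⟨y, hy, hxy⟩ | ⟨hx, h'⟩
      · exact Or.inl ⟨y, (s y).2 (Or.inl hy), hxy⟩
      · by_cases hxV : x ∈ V
        · rcases hkV ⟨hx, hxV⟩ with ⟨y, hy, hxy⟩ | ⟨-, h''⟩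
          · exact Or.inl ⟨y, (s y).2 (Or.inr hy), hxy⟩
          · exact Or.inr ⟨Or.inl hx, fun y hy => hy.elim (h' y) (h'' y)⟩
        · exact Or.inr ⟨Or.inl hx, fun y hy hxy => hy.elim (fun hy => h' y hy hxy)
            fun hy => absurd (hV hxy hy) hxV⟩
    · rcases hx with ⟨y, hy, hxy⟩ | ⟨hx, h'⟩
      · exact Or.inl ⟨y, (s y).2 (Or.inr hy), hxy⟩
      · by_cases hxU : x ∈ U
        · rcases hkU ⟨hxU, hx⟩ with ⟨y, hy, hxy⟩ | ⟨-, h''⟩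
          · exact Or.inl ⟨y, (s y).2 (Or.inl hy), hxy⟩
          · exact Or.inr ⟨Or.inr hx, fun y hy => hy.elim (h'' y) (h' y)⟩
        · exact Or.inr ⟨Or.inr hx, fun y hy hxy => hy.elim (fun hy => absurd (hU hxy hy) hxU)
            fun hy => h' y hy hxy⟩

theorem bord_inter_of_gt (hU : IsLowerSet U) (hV : IsLowerSet V) (gU : Good U) (gV : Good V)
    (h₁ : U ∩ V = bord k Pol.plus U) (h₂ : U ∩ V = bord k Pol.minus V) {j : ℕ} (hj : k < j)
    (α : Pol) : bord j α U ∩ bord j α V = bord k Pol.plus (bord j α U) ∧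
      bord j α U ∩ bord j α V = bord k Pol.minus (bord j α V) := by
  rw [gU.globular k j _ α hj, gV.globular k j _ α hj, ← h₁, ← h₂]
  have : bord j α U ∩ bord j α V = U ∩ V := by
    refine (Set.inter_subset_inter (bord_subset hU) (bord_subset hV)).antisymm fun x hx => ⟨?_, ?_⟩
    · rw [h₁, ← gU.globular k j Pol.plus α hj] at hx
      exact bord_subset (gU.isLowerSet_bord j α) hx
    · rw [h₂, ← gV.globular k j Pol.minus α hj] at hx
      exact bord_subset (gV.isLowerSet_bord j α) hx
  exact ⟨this, this⟩

theorem bord_minus_union (hV : IsLowerSet V) (h₂ : U ∩ V = bord k Pol.minus V) :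
    bord k Pol.minus (U ∪ V) = bord k Pol.minus U := bord_union_self hV h₂

theorem bord_plus_union (hU : IsLowerSet U) (h₁ : U ∩ V = bord k Pol.plus U) :
    bord k Pol.plus (U ∪ V) = bord k Pol.plus V := by
  rw [Set.union_comm]; exact bord_union_self hU (by rw [Set.inter_comm, h₁])

theorem IsMolecule.union (hU : IsMolecule U) (hV : IsMolecule V)
    (h₁ : U ∩ V = bord k Pol.plus U) (h₂ : U ∩ V = bord k Pol.minus V) : IsMolecule (U ∪ V) := by
  by_cases h : V ⊆ U
  · rwa [Set.union_eq_self_of_subset_right h]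
  by_cases h' : U ⊆ V
  · rwa [Set.union_eq_self_of_subset_left h']
  exact .paste k U V hU hV ⟨Set.subset_union_left, fun h'' => h fun x hx => h'' (Or.inr hx)⟩
    ⟨Set.subset_union_right, fun h'' => h' fun x hx => h'' (Or.inl hx)⟩ h₁ h₂

theorem Good.union (hU : IsLowerSet U) (hV : IsLowerSet V) (gU : Good U) (gV : Good V)
    (h₁ : U ∩ V = bord k Pol.plus U) (h₂ : U ∩ V = bord k Pol.minus V) : Good (U ∪ V) := by
  constructor
  · intro i j α β hij
    rcases lt_trichotomy j k with hj | rfl | hj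
    · rw [(bord_union_of_lt gU.globular gV.globular h₁ h₂ hj β).2, gU.globular i j α β hij,
        (bord_union_of_lt gU.globular gV.globular h₁ h₂ (hij.trans hj) α).2]
    · rw [(bord_union_of_lt gU.globular gV.globular h₁ h₂ hij α).2]
      cases β
      · rw [bord_minus_union hV h₂, gU.globular i j _ _ hij]
      · rw [bord_plus_union hU h₁, gV.globular i j _ _ hij,
          (bord_union_of_lt gU.globular gV.globular h₁ h₂ hij α).1]
    · have lU := gU.isLowerSet_bord j β
      have lV := gV.isLowerSet_bord j β
      obtain ⟨h₃, h₄⟩ := bord_inter_of_gt hU hV gU gV h₁ h₂ hj β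
      have gU' : Good (bord j β U) := ⟨gU.globular_bord j β, fun l γ => by
        rcases lt_or_ge l j with hl | hl
        · rw [gU.globular l j γ β hl]; exact gU.molecule l γ
        · rw [gU.bord_bord_of_le hl]; exact gU.molecule j β⟩
      have gV' : Good (bord j β V) := ⟨gV.globular_bord j β, fun l γ => by
        rcases lt_or_ge l j with hl | hl
        · rw [gV.globular l j γ β hl]; exact gV.molecule l γ
        · rw [gV.bord_bord_of_le hl]; exact gV.molecule j β⟩
      rw [bord_union_of_gt hU hV gU gV h₁ h₂ hj]
      rcases lt_trichotomy i k with hi | rfl | hi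
      · rw [(bord_union_of_lt gU'.globular gV'.globular h₃ h₄ hi α).2,
          (bord_union_of_lt gU.globular gV.globular h₁ h₂ hi α).2, gU.globular i j α β hij]
      · cases α
        · rw [bord_minus_union lV h₄, bord_minus_union hV h₂, gU.globular i j _ _ hij]
        · rw [bord_plus_union lU h₃, bord_plus_union hU h₁, gV.globular i j _ _ hij]
      · rw [bord_union_of_gt lU lV gU' gV' h₃ h₄ hi, bord_union_of_gt hU hV gU gV h₁ h₂ hi,
          gU.globular i j _ _ hij, gV.globular i j _ _ hij]
  · intro j α
    rcases lt_trichotomy j k with hj | rfl | hj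
    · rw [(bord_union_of_lt gU.globular gV.globular h₁ h₂ hj α).2]; exact gU.molecule j α
    · cases α
      · rw [bord_minus_union hV h₂]; exact gU.molecule j _
      · rw [bord_plus_union hU h₁]; exact gV.molecule j _
    · obtain ⟨h₃, h₄⟩ := bord_inter_of_gt hU hV gU gV h₁ h₂ hj α
      rw [bord_union_of_gt hU hV gU gV h₁ h₂ hj]
      exact (gU.molecule j α).union (gV.molecule j α) h₃ h₄

end Paste

theorem good_of_atoms {d : ℕ} (hA : ∀ x : P, dim x ≤ d → Good (Set.Iic x)) {U : Set P}
    (hU : IsMolecule U) (hd : DimLe U d) : Good U := by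
  induction hU with
  | atom x => exact hA x (hd x (Set.mem_Iic.2 le_rfl))
  | paste n U V hU hV _ _ h₁ h₂ ih ih' =>
    exact (ih (hd.mono Set.subset_union_left)).union hU.isLowerSet hV.isLowerSet
      (ih' (hd.mono Set.subset_union_right)) h₁ h₂

theorem mem_bord_of_lt {x y : P} {n : ℕ} (hx : dim x = n + 1) (h : y < x) :
    ∃ γ, y ∈ bord n γ (Set.Iic x) := by
  obtain ⟨c, hyc, hcx⟩ := exists_le_covBy_of_lt h
  refine ⟨orient hcx, Or.inl ⟨c, ⟨hcx.le, ?_, fun z hz hcz => ?_⟩, hyc⟩⟩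
  · have := dim_of_covBy c x hcx
    omega
  · have h₁ := dim_of_covBy c x hcx
    have h₂ := dim_of_covBy c z hcz
    obtain rfl := eq_of_le_of_dim_le (Set.mem_Iic.1 hz) (by omega)
    rfl

theorem bord_bord_Iic (hP : IsRDC P) {x : P} {n : ℕ} (hx : dim x = n + 1)
    (hA : ∀ y : P, dim y ≤ n → Good (Set.Iic y)) {j : ℕ} (hj : j < n) (α β : Pol) :
    bord j α (bord n β (Set.Iic x)) = bord j α (Set.Iic x) := by
  obtain ⟨m, rfl⟩ : ∃ m, n = m + 1 := ⟨n - 1, by omega⟩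
  have lI := isLowerSet_Iic x
  have gd : ∀ γ, Good (bord (m + 1) γ (Set.Iic x)) := fun γ =>
    good_of_atoms hA (hP.molecule x _ γ hx) dimLe_bord
  have eqs : ∀ γ δ, bord j α (bord (m + 1) γ (Set.Iic x)) =
      bord j α (bord (m + 1) δ (Set.Iic x)) := by
    intro γ δ
    rcases Nat.lt_or_ge j m with h | h
    · rw [← (gd γ).globular j m α Pol.plus h, ← (gd δ).globular j m α Pol.plus h,
        hP.globular x m _ γ hx, hP.globular x m _ δ hx]
    · obtain rfl : j = m := by omega
      rw [hP.globular x j α γ hx, hP.globular x j α δ hx]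
  have s : ∀ y, y ∈ sbord j α (bord (m + 1) β (Set.Iic x)) ↔ y ∈ sbord j α (Set.Iic x) := by
    refine fun y => ⟨fun hy => ?_, fun hy => ?_⟩
    · refine ⟨bord_subset lI hy.1, hy.2.1, fun z hz hyz => ?_⟩
      have hd := dim_of_covBy y z hyz
      have hzx : z < x := lt_of_le_of_ne hz fun h => by
        have := hy.2.1; subst h; omega
      obtain ⟨γ, hγ⟩ := mem_bord_of_lt hx hzx
      have := mem_sbord (eqs β γ ▸ sbord_subset_bord hy) hy.2.1
      exact this.2.2 z hγ hyz
    · have hyx : y < x := lt_of_le_of_ne hy.1 fun h => by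
        have := hy.2.1; subst h; omega
      obtain ⟨γ, hγ⟩ := mem_bord_of_lt hx hyx
      have : y ∈ sbord j α (bord (m + 1) γ (Set.Iic x)) :=
        ⟨hγ, hy.2.1, fun z hz => hy.2.2 z (bord_subset lI hz)⟩
      exact mem_sbord (eqs γ β ▸ sbord_subset_bord this) hy.2.1
  ext y
  constructor
  · rintro (⟨z, hz, hyz⟩ | ⟨hy, h⟩)
    · exact Or.inl ⟨z, (s z).1 hz, hyz⟩
    · exfalso
      rcases hy with ⟨z, hz, hyz⟩ | ⟨hy, h'⟩
      · have := h z (sbord_subset_bord hz) hyz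
        have := hz.2.1
        omega
      · have := h' x (Set.mem_Iic.2 le_rfl) hy
        omega
  · rintro (⟨z, hz, hyz⟩ | ⟨hy, h⟩)
    · exact Or.inl ⟨z, (s z).2 hz, hyz⟩
    · have := h x (Set.mem_Iic.2 le_rfl) hy
      omega

theorem good_Iic (hP : IsRDC P) (x : P) : Good (Set.Iic x) := by
  induction h : dim x using Nat.strong_induction_on generalizing x with
  | _ d ih =>
    cases d with
    | zero =>
      have e : ∀ j α, bord j α (Set.Iic x) = Set.Iic x := fun j α =>
        bord_eq_self (isLowerSet_Iic x) fun y hy => (dimLe_Iic x y hy).trans (by omega)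
      exact ⟨fun i j α β _ => by rw [e j], fun j α => by rw [e]; exact .atom x⟩
    | succ n =>
      have hA : ∀ y : P, dim y ≤ n → Good (Set.Iic y) := fun y hy => ih (dim y) (by omega) y rfl
      have e : ∀ j α, n < j → bord j α (Set.Iic x) = Set.Iic x := fun j α hj =>
        bord_eq_self (isLowerSet_Iic x) fun y hy => (dimLe_Iic x y hy).trans (by omega)
      have gd : ∀ γ, Good (bord n γ (Set.Iic x)) := fun γ =>
        good_of_atoms hA (hP.molecule x _ γ h) dimLe_bord
      constructor
      · intro i j α β hij
        rcases lt_trichotomy n j with hj | rfl | hj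
        · rw [e j β hj]
        · exact bord_bord_Iic hP h hA hij α β
        · rw [← bord_bord_Iic hP h hA hj β Pol.plus, (gd _).globular i j α β hij,
            bord_bord_Iic hP h hA (hij.trans hj)]
      · intro j α
        rcases lt_trichotomy n j with hj | rfl | hj
        · rw [e j α hj]; exact .atom x
        · exact hP.molecule x _ α h
        · rw [← bord_bord_Iic hP h hA hj α Pol.plus]; exact (gd _).molecule j α

/-- Molecules of regular directed complexes are globular and their boundaries are molecules. -/
theorem IsMolecule.good (hP : IsRDC P) {U : Set P} (hU : IsMolecule U) : Good U := by
  induction hU with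
  | atom x => exact good_Iic hP x
  | paste n U V hU hV _ _ h₁ h₂ ih ih' =>
    exact ih.union hU.isLowerSet hV.isLowerSet ih' h₁ h₂

/-- Induction on molecules of bounded dimension. -/
theorem IsMolecule.induction_dim {motive : Set P → Prop} {d : ℕ}
    (atom : ∀ x : P, dim x ≤ d → motive (Set.Iic x))
    (paste : ∀ (k : ℕ) (U V : Set P), k < d → IsMolecule U → IsMolecule V → DimLe U d → DimLe V d →
      U ∩ V = bord k Pol.plus U → U ∩ V = bord k Pol.minus V → motive U → motive V →
      motive (U ∪ V)) {U : Set P} (hU : IsMolecule U) (hd : DimLe U d) : motive U := by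
  induction hU with
  | atom x => exact atom x (hd x (Set.mem_Iic.2 le_rfl))
  | paste n U V hU hV h h' h₁ h₂ ih ih' =>
    have dU := hd.mono Set.subset_union_left
    have dV := hd.mono Set.subset_union_right
    refine paste n U V ?_ hU hV dU dV h₁ h₂ (ih dU) (ih' dV)
    by_contra hn
    rw [bord_eq_self hU.isLowerSet fun x hx => (dU x hx).trans (by omega)] at h₁
    exact h'.2 (Set.union_subset (Set.inter_eq_left.1 h₁) subset_rfl)

end Boundaries

/-! ### Molecules of dimension at most two as paths and rewriting sequences -/

section LowDim

set_option linter.unusedSectionVars false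

open OGPoset

/-- In a simple path, every path with the same ends is the whole path. -/
theorem CxData.Walk.eq_of_subset {P : Type} {K : CxData P} {s t : P} {l m : List P}
    (hl : K.Walk s l t) (nd : (l.map K.src).Nodup) (ht : ∀ e ∈ l, K.src e ≠ t)
    (hm : K.Walk s m t) (h : ∀ e ∈ m, e ∈ l) : m = l := by
  have key : ∀ (m pre suf : List P) (s : P), l = pre ++ suf → K.Walk s suf t → K.Walk s m t →
      (∀ e ∈ m, e ∈ l) → m = suf := by
    intro m
    induction m with
    | nil =>
      intro pre suf s hl hs hm _
      cases suf with
      | nil => rfl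
      | cons f suf =>
        exact absurd (hs.1.1.trans hm.1) (ht f (by simp [hl]))
    | cons e m ih =>
      intro pre suf s hl hs hm h
      cases suf with
      | nil =>
        exact absurd (hm.1.1.trans hs.1) (ht e (h e (by simp)))
      | cons f suf =>
        obtain rfl : e = f := List.inj_on_of_nodup_map nd (h e (by simp)) (by simp [hl])
          (hm.1.1.trans hs.1.1.symm)
        rw [ih (pre ++ [e]) suf (K.tgt e) (by simp [hl]) hs.2 hm.2 fun x hx => h x (by simp [hx])]
  exact key m [] l s rfl hl hm h

variable {P : Type} [OGPoset P]

/-- The unique element of a one-element subset. -/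
noncomputable def pointOf (x : P) (U : Set P) : P :=
  @Classical.epsilon P ⟨x⟩ fun v => U = {v}

theorem pointOf_eq {x v : P} {U : Set P} (h : U = {v}) : pointOf x U = v := by
  have : U = {pointOf x U} := @Classical.epsilon_spec P (fun v => U = {v}) ⟨v, h⟩
  rw [h] at this
  exact (Set.singleton_injective this).symm ▸ by rw [h]

variable (P) in
/-- The vertices and edges of an oriented graded poset. -/
noncomputable def edgeData : CxData P where
  dim := dim
  src e := pointOf e (bord 0 Pol.minus (Set.Iic e))
  tgt e := pointOf e (bord 0 Pol.plus (Set.Iic e))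
  inn _ := []
  out _ := []

/-- `U` is the closure of the simple path `l` from `s` to `t`. -/
structure PathOf (U : Set P) (s : P) (l : List P) (t : P) : Prop where
  walk : (edgeData P).Walk s l t
  mem : ∀ x, x ∈ U ↔ x = s ∨ ∃ e ∈ l, x ≤ e
  nodup : (l.map (edgeData P).src).Nodup
  ne : ∀ e ∈ l, (edgeData P).src e ≠ t

/-- The list of edges of a path. -/
noncomputable def pathList (U : Set P) : List P :=
  Classical.epsilon fun l => ∃ s t, PathOf U s l t ∧ bord 0 Pol.minus U = {s} ∧
    bord 0 Pol.plus U = {t}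

variable (P) in
/-- The combinatorial 2-dimensional data of a regular directed complex. -/
noncomputable def cx : CxData P where
  dim := dim
  src e := pointOf e (bord 0 Pol.minus (Set.Iic e))
  tgt e := pointOf e (bord 0 Pol.plus (Set.Iic e))
  inn x := pathList (bord 1 Pol.minus (Set.Iic x))
  out x := pathList (bord 1 Pol.plus (Set.Iic x))

theorem cx_walk {s t : P} {l : List P} : (cx P).Walk s l t ↔ (edgeData P).Walk s l t := by
  induction l generalizing s with
  | nil => rfl
  | cons e l ih => simp only [CxData.Walk, ih]; rfl

variable [Finite P]

theorem Good.bord_zero (hP : IsRDC P) {U : Set P} (hU : IsMolecule U) (α : Pol) :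
    ∃ v, bord 0 α U = {v} ∧ dim v = 0 := by
  have key : ∀ V : Set P, IsMolecule V → DimLe V 0 → ∃ v, V = {v} ∧ dim v = 0 := by
    intro V hV hd
    refine IsMolecule.induction_dim (d := 0) (motive := fun V => ∃ v, V = {v} ∧ dim v = 0)
      (fun x hx => ⟨x, ?_, by omega⟩) (fun k U V hk => by omega) hV hd
    ext y
    refine ⟨fun hy => eq_of_le_of_dim_le (Set.mem_Iic.1 hy) (by omega), ?_⟩
    rintro rfl
    exact Set.mem_Iic.2 le_rfl
  exact key _ ((hU.good hP).molecule 0 α) dimLe_bord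

theorem bord_zero_Iic (hP : IsRDC P) (x : P) :
    bord 0 Pol.minus (Set.Iic x) = {(cx P).src x} ∧ bord 0 Pol.plus (Set.Iic x) = {(cx P).tgt x} ∧
    dim ((cx P).src x) = 0 ∧ dim ((cx P).tgt x) = 0 := by
  obtain ⟨v, hv, dv⟩ := Good.bord_zero hP (.atom x) Pol.minus
  obtain ⟨w, hw, dw⟩ := Good.bord_zero hP (.atom x) Pol.plus
  have e₁ : (cx P).src x = v := pointOf_eq (x := x) hv
  have e₂ : (cx P).tgt x = w := pointOf_eq (x := x) hw
  rw [e₁, e₂]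
  exact ⟨hv, hw, dv, dw⟩

theorem src_ne_tgt (hP : IsRDC P) {x : P} (hx : 0 < dim x) : (cx P).src x ≠ (cx P).tgt x := by
  obtain ⟨h₁, h₂, -, -⟩ := bord_zero_Iic hP x
  have := hP.spherical_zero x hx
  rw [h₁, h₂] at this
  intro h
  rw [h, Set.inter_self] at this
  exact Set.singleton_ne_empty _ this

theorem src_le (hP : IsRDC P) (x : P) : (cx P).src x ≤ x := by
  have : (cx P).src x ∈ bord 0 Pol.minus (Set.Iic x) := by rw [(bord_zero_Iic hP x).1]; rfl
  exact bord_subset (isLowerSet_Iic x) this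

theorem tgt_le (hP : IsRDC P) (x : P) : (cx P).tgt x ≤ x := by
  have : (cx P).tgt x ∈ bord 0 Pol.plus (Set.Iic x) := by rw [(bord_zero_Iic hP x).2.1]; rfl
  exact bord_subset (isLowerSet_Iic x) this

theorem eq_of_dim_zero {x y : P} (hx : dim x = 0) (h : y ≤ x) : y = x :=
  eq_of_le_of_dim_le h (by omega)

theorem src_of_dim_zero (hP : IsRDC P) {x : P} (hx : dim x = 0) :
    (cx P).src x = x ∧ (cx P).tgt x = x :=
  ⟨eq_of_dim_zero hx (src_le hP x), eq_of_dim_zero hx (tgt_le hP x)⟩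

theorem le_edge_iff (hP : IsRDC P) {e x : P} (he : dim e = 1) :
    x ≤ e ↔ x = e ∨ x = (cx P).src e ∨ x = (cx P).tgt e := by
  constructor
  · intro h
    rcases h.lt_or_eq with h | rfl
    · right
      obtain ⟨γ, hγ⟩ := mem_bord_of_lt (n := 0) he h
      cases γ
      · rw [(bord_zero_Iic hP e).1] at hγ; exact Or.inl hγ
      · rw [(bord_zero_Iic hP e).2.1] at hγ; exact Or.inr hγ
    · exact Or.inl rfl
  · rintro (rfl | rfl | rfl)
    · exact le_rfl
    · exact src_le hP e
    · exact tgt_le hP e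

theorem PathOf.src_mem {U : Set P} {s t : P} {l : List P} (h : PathOf U s l t) : s ∈ U :=
  (h.mem s).2 (Or.inl rfl)

theorem PathOf.edge_mem {U : Set P} {s t e : P} {l : List P} (h : PathOf U s l t) (he : e ∈ l) :
    e ∈ U := (h.mem e).2 (Or.inr ⟨e, he, le_rfl⟩)

theorem PathOf.mem_list_iff {U : Set P} {s t e : P} {l : List P} (h : PathOf U s l t) :
    e ∈ l ↔ e ∈ U ∧ dim e = 1 := by
  constructor
  · exact fun he => ⟨h.edge_mem he, h.walk.dim_edge he⟩
  · rintro ⟨he, hd⟩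
    rcases (h.mem e).1 he with rfl | ⟨e', he', hle⟩
    · have h₀ : dim e = 0 := h.walk.dim_src
      omega
    · have : dim e' = 1 := h.walk.dim_edge he'
      rwa [eq_of_le_of_dim_le hle (by omega)]

theorem PathOf.mem_of_src (hP : IsRDC P) {U : Set P} {s t e : P} {l : List P}
    (h : PathOf U s l t) (he : e ∈ l) : (cx P).src e ∈ U :=
  (h.mem _).2 (Or.inr ⟨e, he, src_le hP e⟩)

theorem PathOf.tgt_mem (hP : IsRDC P) {U : Set P} {s t : P} {l : List P} (h : PathOf U s l t) :
    t ∈ U := by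
  have key : ∀ (l : List P) (s : P), (edgeData P).Walk s l t → t = s ∨ ∃ e ∈ l, t ≤ e := by
    intro l
    induction l with
    | nil => intro s h; exact Or.inl h.1.symm
    | cons e l ih =>
      intro s h
      rcases ih _ h.2 with h' | ⟨e', he', h'⟩
      · exact Or.inr ⟨e, by simp, h'.trans_le (tgt_le hP e)⟩
      · exact Or.inr ⟨e', by simp [he'], h'⟩
  exact (h.mem t).2 (key l s h.walk)

theorem PathOf.append (hP : IsRDC P) {U V : Set P} {s t r : P} {l m : List P}
    (hU : PathOf U s l t) (hV : PathOf V t m r) (h : U ∩ V = {t}) :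
    PathOf (U ∪ V) s (l ++ m) r where
  walk := CxData.walk_append.2 ⟨t, hU.walk, hV.walk⟩
  mem x := by
    rw [Set.mem_union, hU.mem, hV.mem]
    constructor
    · rintro ((rfl | ⟨e, he, h⟩) | (rfl | ⟨e, he, h⟩))
      · exact Or.inl rfl
      · exact Or.inr ⟨e, by simp [he], h⟩
      · rcases (hU.mem x).1 (hU.tgt_mem hP) with h | ⟨e, he, h⟩
        · exact Or.inl h
        · exact Or.inr ⟨e, by simp [he], h⟩
      · exact Or.inr ⟨e, by simp [he], h⟩
    · rintro (rfl | ⟨e, he, h⟩)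
      · exact Or.inl (Or.inl rfl)
      · rcases List.mem_append.1 he with he | he
        · exact Or.inl (Or.inr ⟨e, he, h⟩)
        · exact Or.inr (Or.inr ⟨e, he, h⟩)
  nodup := by
    rw [List.map_append]
    refine List.nodup_append.2 ⟨hU.nodup, hV.nodup, ?_⟩
    intro a ha b hb hab
    obtain ⟨e, he, rfl⟩ := List.mem_map.1 ha
    obtain ⟨f, hf, rfl⟩ := List.mem_map.1 hb
    have : (edgeData P).src e ∈ U ∩ V := ⟨hU.mem_of_src hP he, hab ▸ hV.mem_of_src hP hf⟩
    rw [h] at this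
    exact hU.ne e he this
  ne e he h' := by
    rcases List.mem_append.1 he with he | he
    · have : (edgeData P).src e ∈ U ∩ V := ⟨hU.mem_of_src hP he, h' ▸ hV.tgt_mem hP⟩
      rw [h] at this
      exact hU.ne e he this
    · exact hV.ne e he h'

theorem PathOf.unique {U : Set P} {s t : P} {l m : List P}
    (hl : PathOf U s l t) (hm : PathOf U s m t) : m = l :=
  hl.walk.eq_of_subset hl.nodup hl.ne hm.walk fun _ he => hl.mem_list_iff.2 (hm.mem_list_iff.1 he)

theorem pathOf_vertex {x : P} (hx : dim x = 0) : PathOf (Set.Iic x) x [] x where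
  walk := ⟨rfl, hx⟩
  mem y := by
    simp only [Set.mem_Iic, List.not_mem_nil, false_and, exists_false, or_false]
    exact ⟨eq_of_dim_zero hx, fun h => h.le⟩
  nodup := by simp
  ne := by simp

theorem pathOf_edge (hP : IsRDC P) {x : P} (hx : dim x = 1) :
    PathOf (Set.Iic x) ((cx P).src x) [x] ((cx P).tgt x) where
  walk := ⟨⟨rfl, hx, (bord_zero_Iic hP x).2.2.1⟩, rfl, (bord_zero_Iic hP x).2.2.2⟩
  mem y := by
    simp only [Set.mem_Iic, List.mem_singleton, exists_eq_left]
    exact ⟨Or.inr, fun h => h.elim (fun h => h.trans_le (src_le hP x)) id⟩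
  nodup := by simp
  ne e he := by
    obtain rfl := List.mem_singleton.1 he
    exact src_ne_tgt hP (x := e) (by omega)

theorem IsMolecule.exists_pathOf (hP : IsRDC P) {U : Set P} (hU : IsMolecule U) (hd : DimLe U 1) :
    ∃ l s t, PathOf U s l t ∧ bord 0 Pol.minus U = {s} ∧ bord 0 Pol.plus U = {t} := by
  refine IsMolecule.induction_dim (d := 1) (motive := fun U => ∃ l s t, PathOf U s l t ∧
    bord 0 Pol.minus U = {s} ∧ bord 0 Pol.plus U = {t}) ?_ ?_ hU hd
  · intro x hx
    obtain ⟨h₁, h₂, h₃, h₄⟩ := bord_zero_Iic hP x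
    rcases Nat.le_one_iff_eq_zero_or_eq_one.1 hx with h | h
    · obtain ⟨e₁, e₂⟩ := src_of_dim_zero hP h
      rw [e₁] at h₁
      rw [e₂] at h₂
      exact ⟨[], x, x, pathOf_vertex h, h₁, h₂⟩
    · exact ⟨[x], _, _, pathOf_edge hP h, h₁, h₂⟩
  · rintro k U V hk mU mV - - h₁ h₂ ⟨l, s, t, pU, sU, tU⟩ ⟨m, s', r, pV, sV, tV⟩
    obtain rfl : k = 0 := by omega
    obtain rfl : t = s' := Set.singleton_injective (by rw [← tU, ← sV, ← h₁, ← h₂])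
    exact ⟨l ++ m, s, r, pU.append hP pV (h₁.trans tU), by
      rw [bord_minus_union mV.isLowerSet h₂, sU], by rw [bord_plus_union mU.isLowerSet h₁, tV]⟩

theorem IsMolecule.pathOf (hP : IsRDC P) {U : Set P} (hU : IsMolecule U) (hd : DimLe U 1) :
    ∃ s t, PathOf U s (pathList U) t ∧ bord 0 Pol.minus U = {s} ∧ bord 0 Pol.plus U = {t} :=
  Classical.epsilon_spec (p := fun l => ∃ s t, PathOf U s l t ∧ bord 0 Pol.minus U = {s} ∧
    bord 0 Pol.plus U = {t}) (hU.exists_pathOf hP hd)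

theorem pathList_eq (hP : IsRDC P) {U : Set P} (hU : IsMolecule U) (hd : DimLe U 1) {s t : P}
    {l : List P} (h : PathOf U s l t) (hs : bord 0 Pol.minus U = {s})
    (ht : bord 0 Pol.plus U = {t}) : pathList U = l := by
  obtain ⟨s', t', h', hs', ht'⟩ := hU.pathOf hP hd
  obtain rfl : s = s' := Set.singleton_injective (hs.symm.trans hs')
  obtain rfl : t = t' := Set.singleton_injective (ht.symm.trans ht')
  exact PathOf.unique h h'

/-- The initial vertex of a molecule. -/
noncomputable def vsrc (x : P) (U : Set P) : P := pointOf x (bord 0 Pol.minus U)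

/-- The final vertex of a molecule. -/
noncomputable def vtgt (x : P) (U : Set P) : P := pointOf x (bord 0 Pol.plus U)

variable {z : P}

theorem vsrc_spec (hP : IsRDC P) {U : Set P} (hU : IsMolecule U) :
    bord 0 Pol.minus U = {vsrc z U} ∧ bord 0 Pol.plus U = {vtgt z U} ∧ dim (vsrc z U) = 0 ∧
      dim (vtgt z U) = 0 := by
  obtain ⟨v, hv, dv⟩ := Good.bord_zero hP hU Pol.minus
  obtain ⟨w, hw, dw⟩ := Good.bord_zero hP hU Pol.plus
  have e₁ : vsrc z U = v := pointOf_eq hv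
  have e₂ : vtgt z U = w := pointOf_eq hw
  rw [e₁, e₂]
  exact ⟨hv, hw, dv, dw⟩

theorem vsrc_Iic (hP : IsRDC P) (x : P) :
    vsrc z (Set.Iic x) = (cx P).src x ∧ vtgt z (Set.Iic x) = (cx P).tgt x :=
  ⟨pointOf_eq (bord_zero_Iic hP x).1, pointOf_eq (bord_zero_Iic hP x).2.1⟩

theorem pathOf_bord (hP : IsRDC P) {U : Set P} (hU : IsMolecule U) (α : Pol) :
    PathOf (bord 1 α U) (vsrc z U) (pathList (bord 1 α U)) (vtgt z U) := by
  obtain ⟨s, t, h, hs, ht⟩ := ((hU.good hP).molecule 1 α).pathOf hP dimLe_bord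
  rw [(hU.good hP).globular 0 1 _ _ Nat.zero_lt_one, (vsrc_spec (z := z) hP hU).1] at hs
  rw [(hU.good hP).globular 0 1 _ _ Nat.zero_lt_one, (vsrc_spec (z := z) hP hU).2.1] at ht
  obtain rfl := Set.singleton_injective hs
  obtain rfl := Set.singleton_injective ht
  exact h

theorem walk_bord (hP : IsRDC P) {U : Set P} (hU : IsMolecule U) (α : Pol) :
    (cx P).Walk (vsrc z U) (pathList (bord 1 α U)) (vtgt z U) :=
  cx_walk.2 (pathOf_bord hP hU α).walk

theorem mem_pathList_bord (hP : IsRDC P) {U : Set P} (hU : IsMolecule U) (α : Pol) {e : P} :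
    e ∈ pathList (bord 1 α U) ↔ e ∈ sbord 1 α U := by
  rw [(pathOf_bord (z := e) hP hU α).mem_list_iff]
  exact ⟨fun h => mem_sbord h.1 h.2, fun h => ⟨sbord_subset_bord h, h.2.1⟩⟩

theorem nodup_pathList_bord (hP : IsRDC P) {U : Set P} (hU : IsMolecule U) (α : Pol) :
    (pathList (bord 1 α U)).Nodup := by
  by_cases h : pathList (bord 1 α U) = []
  · rw [h]; exact List.nodup_nil
  · obtain ⟨z, -⟩ := List.exists_mem_of_ne_nil _ h
    exact (pathOf_bord (z := z) hP hU α).nodup.of_map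

theorem mem_sbord_Iic {x e : P} (hx : dim x = 2) (α : Pol) :
    e ∈ sbord 1 α (Set.Iic x) ↔ ∃ h : e ⋖ x, orient h = α := by
  constructor
  · rintro ⟨h₁, h₂, h₃⟩
    have hlt : e < x := lt_of_le_of_ne h₁ fun h => by subst h; omega
    obtain ⟨c, hec, hcx⟩ := exists_le_covBy_of_lt hlt
    have := dim_of_covBy c x hcx
    obtain rfl := eq_of_le_of_dim_le hec (by omega)
    exact ⟨hcx, h₃ x (Set.mem_Iic.2 le_rfl) hcx⟩
  · rintro ⟨h, rfl⟩
    have := dim_of_covBy e x h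
    refine ⟨h.le, by omega, fun y hy hey => ?_⟩
    have := dim_of_covBy e y hey
    obtain rfl := eq_of_le_of_dim_le (Set.mem_Iic.1 hy) (by omega)
    rfl

theorem mem_inn_iff (hP : IsRDC P) {x e : P} (hx : dim x = 2) :
    e ∈ (cx P).inn x ↔ ∃ h : e ⋖ x, orient h = Pol.minus :=
  (mem_pathList_bord hP (.atom x) _).trans (mem_sbord_Iic hx _)

theorem mem_out_iff (hP : IsRDC P) {x e : P} (hx : dim x = 2) :
    e ∈ (cx P).out x ↔ ∃ h : e ⋖ x, orient h = Pol.plus :=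
  (mem_pathList_bord hP (.atom x) _).trans (mem_sbord_Iic hx _)

theorem cx_ok (hP : IsRDC P) : (cx P).Ok := by
  have w : ∀ (x : P) (α : Pol), (cx P).Walk ((cx P).src x) (pathList (bord 1 α (Set.Iic x)))
      ((cx P).tgt x) := fun x α => by
    have := walk_bord (z := x) hP (.atom x) α
    rwa [(vsrc_Iic hP x).1, (vsrc_Iic hP x).2] at this
  have ne : ∀ (x : P) (α : Pol), dim x = 2 → pathList (bord 1 α (Set.Iic x)) ≠ [] := by
    intro x α hx h
    have := w x α
    rw [h] at this
    exact src_ne_tgt hP (x := x) (by omega) this.1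
  exact ⟨fun x _ => w x _, fun x _ => w x _, fun x hx => ne x _ hx, fun x hx => ne x _ hx⟩

theorem orient_ne_of_covBy {U : Set P} (hU : IsMolecule U) (hd : DimLe U 2) :
    ∀ x ∈ U, ∀ y ∈ U, dim x = 2 → dim y = 2 → x ≠ y → ∀ (e : P) (hx : e ⋖ x) (hy : e ⋖ y),
      orient hx ≠ orient hy := by
  refine IsMolecule.induction_dim (d := 2) (motive := fun U => ∀ x ∈ U, ∀ y ∈ U, dim x = 2 →
    dim y = 2 → x ≠ y → ∀ (e : P) (hx : e ⋖ x) (hy : e ⋖ y), orient hx ≠ orient hy) ?_ ?_ hU hd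
  · intro z hz x hx y hy dx dy hne
    have h₁ := eq_of_le_of_dim_le (Set.mem_Iic.1 hx) (by omega)
    have h₂ := eq_of_le_of_dim_le (Set.mem_Iic.1 hy) (by omega)
    exact absurd (h₁.trans h₂.symm) hne
  · intro k U V hk mU mV _ _ h₁ h₂ ihU ihV
    have aux : ∀ x ∈ U, ∀ y ∈ V, dim x = 2 → dim y = 2 → ∀ (e : P) (hx : e ⋖ x) (hy : e ⋖ y),
        orient hx ≠ orient hy := by
      intro x hx y hy dx dy e hex hey
      have he : e ∈ U ∩ V := ⟨mU.isLowerSet hex.le hx, mV.isLowerSet hey.le hy⟩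
      have de := dim_of_covBy e x hex
      have hp : e ∈ bord k Pol.plus U := h₁ ▸ he
      have hm : e ∈ bord k Pol.minus V := h₂ ▸ he
      have := dimLe_bord e hp
      obtain rfl : k = 1 := by omega
      rw [(mem_sbord hp (by omega)).2.2 x hx hex, (mem_sbord hm (by omega)).2.2 y hy hey]
      exact fun h => Pol.noConfusion h
    rintro x (hx | hx) y (hy | hy) dx dy hne e hex hey
    · exact ihU x hx y hy dx dy hne e hex hey
    · exact aux x hx y hy dx dy e hex hey
    · exact (aux y hy x hx dy dx e hey hex).symm
    · exact ihV x hx y hy dx dy hne e hex hey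

theorem nice_of_molecule (hP : IsRDC P) {U : Set P} (hU : IsMolecule U) (hd : DimLe U 2)
    {ys : List P} (nd : ys.Nodup) (hy : ∀ y ∈ ys, y ∈ U ∧ dim y = 2) :
    (cx P).Nice ys (pathList (bord 1 Pol.minus U)) (pathList (bord 1 Pol.plus U)) where
  nodup_faces := nd
  dim_face y h := (hy y h).2
  nodup := nodup_pathList_bord hP hU _
  out_nodup y _ := nodup_pathList_bord hP (.atom y) _
  out_path y h e he he' := by
    obtain ⟨hc, ho⟩ := (mem_out_iff hP (hy y h).2).1 he
    have := ((mem_pathList_bord hP hU _).1 he').2.2 y (hy y h).1 hc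
    rw [ho] at this
    exact Pol.noConfusion this
  out_out y h w h' hne e he he' := by
    obtain ⟨hc, ho⟩ := (mem_out_iff hP (hy y h).2).1 he
    obtain ⟨hc', ho'⟩ := (mem_out_iff hP (hy w h').2).1 he'
    exact orient_ne_of_covBy hU hd y (hy y h).1 w (hy w h').1 (hy y h).2 (hy w h').2 hne e hc hc'
      (ho.trans ho'.symm)
  inn_inn y h w h' hne e he he' := by
    obtain ⟨hc, ho⟩ := (mem_inn_iff hP (hy y h).2).1 he
    obtain ⟨hc', ho'⟩ := (mem_inn_iff hP (hy w h').2).1 he'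
    exact orient_ne_of_covBy hU hd y (hy y h).1 w (hy w h').1 (hy y h).2 (hy w h').2 hne e hc hc'
      (ho.trans ho'.symm)
  inn_path y h e he he' := by
    obtain ⟨hc, ho⟩ := (mem_inn_iff hP (hy y h).2).1 he
    have := ((mem_pathList_bord hP hU _).1 he').2.2 y (hy y h).1 hc
    rw [ho] at this
    exact Pol.noConfusion this

/-! ### The composite of a labelled molecule -/

variable {C : Type} {D : Two C} {lam : P → C}

variable (D lam) in
/-- `u` is the composite of the labels of the molecule `U` of dimension at most two. -/
def Composite (U : Set P) (u : C) : Prop :=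
  ∃ (z : P) (xs : List P), xs.Nodup ∧ (∀ x, x ∈ xs ↔ x ∈ U ∧ dim x = 2) ∧
    (cx P).Rw D lam (vsrc z U) xs (pathList (bord 1 Pol.minus U)) (pathList (bord 1 Pol.plus U)) u

theorem vsrc_eq (hP : IsRDC P) {U : Set P} (hU : IsMolecule U) (z z' : P) :
    vsrc z U = vsrc z' U ∧ vtgt z U = vtgt z' U :=
  ⟨pointOf_eq (vsrc_spec hP hU).1, pointOf_eq (vsrc_spec hP hU).2.1⟩

/-- Any rewriting sequence in a molecule computes its composite. -/
theorem Composite.eq_of_rw (hP : IsRDC P) (L : (cx P).Lab D lam) {U : Set P} (hU : IsMolecule U)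
    (hd : DimLe U 2) {u v : C} (hu : Composite D lam U u) {xs : List P}
    (hx : ∀ x ∈ xs, x ∈ U ∧ dim x = 2) {z : P}
    (hv : (cx P).Rw D lam (vsrc z U) xs (pathList (bord 1 Pol.minus U))
      (pathList (bord 1 Pol.plus U)) v) : v = u := by
  obtain ⟨z', ys, nd, hy, hu⟩ := hu
  rw [(vsrc_eq hP hU z' z).1] at hu
  exact CxData.Rw.unique L (cx_ok hP) (nice_of_molecule hP hU hd nd fun y h => (hy y).1 h) hu hv
    (fun x h => (hy x).2 (hx x h)) (walk_bord hP hU _)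

theorem Composite.unique (hP : IsRDC P) (L : (cx P).Lab D lam) {U : Set P} (hU : IsMolecule U)
    (hd : DimLe U 2) {u v : C} (hu : Composite D lam U u) (hv : Composite D lam U v) : v = u := by
  obtain ⟨z, xs, nd, hx, hv⟩ := hv
  exact hu.eq_of_rw hP L hU hd (fun x h => (hx x).1 h) hv

theorem IsMolecule.nonempty {U : Set P} (hU : IsMolecule U) : U.Nonempty := by
  induction hU with
  | atom x => exact ⟨x, Set.mem_Iic.2 le_rfl⟩
  | paste n U V _ _ _ _ _ _ ih _ => exact ih.mono Set.subset_union_left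

theorem composite_of_dimLe_one {U : Set P} (hU : IsMolecule U) (hd : DimLe U 1)
    (z : P) : Composite D lam U ((cx P).pv D lam (vsrc z U) (pathList U)) := by
  refine ⟨z, [], List.nodup_nil, fun x => ?_, ?_, ?_⟩
  · simp only [List.not_mem_nil, false_iff, not_and]
    intro hx h
    have := hd x hx
    omega
  · rw [bord_eq_self hU.isLowerSet hd, bord_eq_self hU.isLowerSet hd]
  · rw [bord_eq_self hU.isLowerSet hd]

theorem composite_Iic (hP : IsRDC P) (L : (cx P).Lab D lam) {x : P} (hx : dim x ≤ 2) :
    Composite D lam (Set.Iic x) (lam x) := by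
  obtain h | h | h : dim x = 0 ∨ dim x = 1 ∨ dim x = 2 := by omega
  · have := composite_of_dimLe_one (D := D) (lam := lam) (.atom x)
      ((dimLe_Iic x).mono subset_rfl |> fun h' y hy => (h' y hy).trans (by omega)) x
    rwa [pathList_eq hP (.atom x) (fun y hy => (dimLe_Iic x y hy).trans (by omega))
      (pathOf_vertex h) (by rw [(bord_zero_Iic hP x).1, (src_of_dim_zero hP h).1])
      (by rw [(bord_zero_Iic hP x).2.1, (src_of_dim_zero hP h).2]), (vsrc_Iic hP x).1,
      (src_of_dim_zero hP h).1] at this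
  · have := composite_of_dimLe_one (D := D) (lam := lam) (.atom x)
      (fun y hy => (dimLe_Iic x y hy).trans (by omega)) x
    rw [pathList_eq hP (.atom x) (fun y hy => (dimLe_Iic x y hy).trans (by omega))
      (pathOf_edge hP h) (bord_zero_Iic hP x).1 (bord_zero_Iic hP x).2.1] at this
    simp only [CxData.pv] at this
    rwa [← L.tgt x h, D.comp_unit_right] at this
  · refine ⟨x, [x], by simp, fun y => ?_, [], [], _, ?_, ⟨?_, rfl⟩, ?_⟩
    · simp only [List.mem_singleton, Set.mem_Iic]
      constructor
      · rintro rfl; exact ⟨le_rfl, h⟩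
      · exact fun h' => eq_of_le_of_dim_le h'.1 (by omega)
    · simp; rfl
    · simp; rfl
    · rw [(vsrc_Iic hP x).1]
      have b := L.face_b (cx_ok hP) (x := x) h
      simp only [CxData.wh, CxData.pv, List.nil_append, List.append_nil]
      rw [← b.2, D.comp_unit_right, ← b.1, D.comp_unit_left, ← L.out x h, D.comp_unit_right]

theorem Composite.b_one (hP : IsRDC P) (L : (cx P).Lab D lam) {U : Set P} (hU : IsMolecule U)
    {u : C} (hu : Composite D lam U u) (z : P) (α : Pol) :
    D.b α 1 u = (cx P).pv D lam (vsrc z U) (pathList (bord 1 α U)) := by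
  obtain ⟨z', xs, nd, hx, hu⟩ := hu
  rw [(vsrc_eq hP hU z' z).1] at hu
  have := CxData.Rw.b L (cx_ok hP) hu (fun x h => ((hx x).1 h).2) (walk_bord hP hU _)
  cases α
  · exact this.1
  · exact this.2.1

theorem Composite.b_zero (hP : IsRDC P) (L : (cx P).Lab D lam) {U : Set P} (hU : IsMolecule U)
    {u : C} (hu : Composite D lam U u) (z : P) :
    D.b Pol.minus 0 u = lam (vsrc z U) ∧ D.b Pol.plus 0 u = lam (vtgt z U) := by
  rw [← D.b_zero_b_one Pol.minus Pol.minus, ← D.b_zero_b_one Pol.plus Pol.minus,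
    hu.b_one hP L hU z]
  exact (L.pv_b (walk_bord hP hU _)).2

theorem Composite.union_one (hP : IsRDC P) (L : (cx P).Lab D lam) {U V : Set P}
    (hU : IsMolecule U) (hV : IsMolecule V)
    (h₁ : U ∩ V = bord 1 Pol.plus U) (h₂ : U ∩ V = bord 1 Pol.minus V) {u v : C}
    (hu : Composite D lam U u) (hv : Composite D lam V v) :
    Composite D lam (U ∪ V) (D.comp 1 u v) := by
  obtain ⟨z, xs, nx, hx, hu⟩ := hu
  obtain ⟨z', ys, ny, hy, hv⟩ := hv
  rw [(vsrc_eq hP hV z' z).1] at hv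
  have gU := (hU.good hP).globular
  have gV := (hV.good hP).globular
  have b0 := fun α => bord_union_of_lt gU gV h₁ h₂ Nat.zero_lt_one α
  have hs : vsrc z V = vsrc z U := by rw [vsrc, vsrc, (b0 _).1]
  have hs' : vsrc z (U ∪ V) = vsrc z U := by rw [vsrc, vsrc, (b0 _).2]
  rw [hs, ← h₂, h₁] at hv
  refine ⟨z, xs ++ ys, List.nodup_append.2 ⟨nx, ny, ?_⟩, fun x => ?_, ?_⟩
  · intro a ha b hb hab
    subst hab
    have : a ∈ bord 1 Pol.plus U := h₁ ▸ ⟨((hx a).1 ha).1, ((hy a).1 hb).1⟩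
    have := dimLe_bord a this
    have := ((hx a).1 ha).2
    omega
  · rw [List.mem_append, hx, hy, Set.mem_union]; tauto
  · rw [hs', bord_minus_union hV.isLowerSet h₂, bord_plus_union hU.isLowerSet h₁]
    exact hu.append L (cx_ok hP) hv (walk_bord hP hU _) (fun x h => ((hx x).1 h).2)
      (fun x h => ((hy x).1 h).2)

theorem Composite.union_zero (hP : IsRDC P) (L : (cx P).Lab D lam) {U V : Set P}
    (hU : IsMolecule U) (hV : IsMolecule V)
    (h₁ : U ∩ V = bord 0 Pol.plus U) (h₂ : U ∩ V = bord 0 Pol.minus V) {u v : C}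
    (hu : Composite D lam U u) (hv : Composite D lam V v) :
    Composite D lam (U ∪ V) (D.comp 0 u v) := by
  have hu' := hu
  have hv' := hv
  obtain ⟨z, xs, nx, hx, hu⟩ := hu
  obtain ⟨z', ys, ny, hy, hv⟩ := hv
  rw [(vsrc_eq hP hV z' z).1] at hv
  have gU := hU.good hP
  have gV := hV.good hP
  have lU := hU.isLowerSet
  have lV := hV.isLowerSet
  have ht : vtgt z U = vsrc z V := by rw [vsrc, vtgt, ← h₁, ← h₂]
  have hs : vsrc z (U ∪ V) = vsrc z U := by rw [vsrc, vsrc, bord_minus_union lV h₂]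
  have hp : ∀ α, pathList (bord 1 α (U ∪ V)) =
      pathList (bord 1 α U) ++ pathList (bord 1 α V) := by
    intro α
    have hm := hU.union hV h₁ h₂
    obtain ⟨h₃, h₄⟩ := bord_inter_of_gt lU lV gU gV h₁ h₂ Nat.zero_lt_one α
    have p := (pathOf_bord (z := z) hP hU α).append hP (ht ▸ pathOf_bord (z := z) hP hV α) (by
      rw [h₃, gU.globular 0 1 _ _ Nat.zero_lt_one, (vsrc_spec (z := z) hP hU).2.1])
    rw [← bord_union_of_gt lU lV gU gV h₁ h₂ Nat.zero_lt_one] at p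
    refine pathList_eq hP ((hm.good hP).molecule 1 α) dimLe_bord p ?_ ?_
    · rw [(hm.good hP).globular 0 1 _ _ Nat.zero_lt_one, bord_minus_union lV h₂,
        (vsrc_spec (z := z) hP hU).1]
    · rw [(hm.good hP).globular 0 1 _ _ Nat.zero_lt_one, bord_plus_union lU h₁,
        (vsrc_spec (z := z) hP hV).2.1]
  have dx : ∀ x ∈ xs, (cx P).dim x = 2 := fun x h => ((hx x).1 h).2
  have dy : ∀ x ∈ ys, (cx P).dim x = 2 := fun x h => ((hy x).1 h).2
  have wU := fun α => walk_bord (z := z) hP hU α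
  have wV := fun α => walk_bord (z := z) hP hV α
  have nV : (cx P).Walk (vtgt z V) [] (vtgt z V) := ⟨rfl, (vsrc_spec hP hV).2.2.2⟩
  have nU : (cx P).Walk (vsrc z U) [] (vsrc z U) := ⟨rfl, (vsrc_spec hP hU).2.2.1⟩
  have r₁ := hu.whisker L (cx_ok hP) nU (wU _) (ht ▸ wV Pol.minus) dx
  have r₂ := hv.whisker L (cx_ok hP) (ht ▸ wU Pol.plus) (wV _) nV dy
  rw [List.append_nil, List.append_nil] at r₂
  rw [List.nil_append, List.nil_append] at r₁
  have r := r₁.append L (cx_ok hP) r₂ (CxData.walk_append.2 ⟨_, wU _, ht ▸ wV _⟩) dx dy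
  refine ⟨z, xs ++ ys, List.nodup_append.2 ⟨nx, ny, ?_⟩, fun x => ?_, ?_⟩
  · intro a ha b hb hab
    subst hab
    have : a ∈ bord 0 Pol.plus U := h₁ ▸ ⟨((hx a).1 ha).1, ((hy a).1 hb).1⟩
    have := dimLe_bord a this
    have := ((hx a).1 ha).2
    omega
  · rw [List.mem_append, hx, hy, Set.mem_union]; tauto
  · rw [hs, hp, hp]
    convert r using 1
    have bu := hu'.b_one hP L hU z
    have bv := hv'.b_one hP L hV z
    have bu0 := hu'.b_zero hP L hU z
    have bv0 := hv'.b_zero hP L hV z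
    have c : D.b Pol.plus 0 u = D.b Pol.minus 0 v := by rw [bu0.2, bv0.1, ht]
    simp only [CxData.pv]
    rw [ht, ← bu, ← bv, ← bu0.1, ← bv0.2, D.comp_unit_right]
    have : D.b Pol.minus 0 u = D.b Pol.minus 0 (D.comp 0 u (D.b Pol.minus 1 v)) := by
      rw [D.b_minus_comp]
      rw [c, D.b_zero_b_one]
    rw [this, D.comp_unit_left, ← D.interchange Nat.zero_lt_one, D.comp_unit_right,
      D.comp_unit_left]
    · rw [D.b_b_le _ _ _ le_rfl]
    · rw [D.b_b_le _ _ _ le_rfl]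
    · rw [c, D.b_zero_b_one]

theorem IsMolecule.exists_composite (hP : IsRDC P) (L : (cx P).Lab D lam) {U : Set P}
    (hU : IsMolecule U) (hd : DimLe U 2) : ∃ u, Composite D lam U u := by
  refine IsMolecule.induction_dim (d := 2) (motive := fun U => ∃ u, Composite D lam U u)
    (fun x hx => ⟨_, composite_Iic hP L hx⟩) ?_ hU hd
  rintro k U V hk mU mV - - h₁ h₂ ⟨u, hu⟩ ⟨v, hv⟩
  obtain rfl | rfl : k = 0 ∨ k = 1 := by omega
  · exact ⟨_, hu.union_zero hP L mU mV h₁ h₂ hv⟩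
  · exact ⟨_, hu.union_one hP L mU mV h₁ h₂ hv⟩

theorem Composite.bord (hP : IsRDC P) (L : (cx P).Lab D lam) {U : Set P} (hU : IsMolecule U)
    (hd : DimLe U 2) {u : C} (hu : Composite D lam U u) (k : ℕ) (α : Pol) :
    Composite D lam (bord k α U) (D.b α k u) := by
  obtain ⟨z, -⟩ := hU.nonempty
  have gU := hU.good hP
  obtain rfl | rfl | hk : k = 0 ∨ k = 1 ∨ 2 ≤ k := by omega
  · have key : ∀ v, dim v = 0 → Composite D lam {v} (lam v) := by
      intro v hv
      have : Set.Iic v = {v} := by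
        ext y
        exact ⟨fun h => eq_of_dim_zero hv h, fun h => (show y = v from h).le⟩
      rw [← this]
      exact composite_Iic hP L (by omega)
    cases α
    · rw [(hu.b_zero hP L hU z).1, (vsrc_spec (z := z) hP hU).1]
      exact key _ (vsrc_spec (z := z) hP hU).2.2.1
    · rw [(hu.b_zero hP L hU z).2, (vsrc_spec (z := z) hP hU).2.1]
      exact key _ (vsrc_spec (z := z) hP hU).2.2.2
  · rw [hu.b_one hP L hU z α]
    have := composite_of_dimLe_one (D := D) (lam := lam) (gU.molecule 1 α) dimLe_bord z
    have e : vsrc z (DiagNerve.bord 1 α U) = vsrc z U := by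
      rw [vsrc, vsrc, gU.globular 0 1 _ _ Nat.zero_lt_one]
    rwa [e] at this
  · rw [D.b_two_le _ _ hk, bord_eq_self hU.isLowerSet fun x hx => (hd x hx).trans hk]
    exact hu

end LowDim

/-! ### Functors from labellings -/

section Val

set_option linter.unusedSectionVars false

open OGPoset

variable {P : Type} [OGPoset P] [Finite P] {C : Type} {D : Two C} {lam : P → C}

variable (D lam) in
/-- `u` is the common composite of the input and output 2-boundary of the molecule `U`. -/
def Val (U : Set P) (u : C) : Prop := ∀ α, Composite D lam (bord 2 α U) u

variable (D lam) in
/-- The labels of the 2-dimensional boundaries of 3-dimensional elements have equal composites. -/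
def Balanced : Prop := ∀ x : P, dim x = 3 → ∃ u, Val D lam (Set.Iic x) u

theorem Val.unique (hP : IsRDC P) (L : (cx P).Lab D lam) {U : Set P} (hU : IsMolecule U) {u v : C}
    (hu : Val D lam U u) (hv : Val D lam U v) : v = u :=
  (hu Pol.minus).unique hP L ((hU.good hP).molecule 2 _) dimLe_bord (hv Pol.minus)

theorem Val.bord (hP : IsRDC P) (L : (cx P).Lab D lam) {U : Set P} (hU : IsMolecule U) {u : C}
    (hu : Val D lam U u) (k : ℕ) (α : Pol) : Val D lam (bord k α U) (D.b α k u) := by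
  have gU := hU.good hP
  intro β
  rcases lt_trichotomy k 2 with hk | rfl | hk
  · rw [gU.bord_bord_of_le hk.le, ← gU.globular k 2 α β hk]
    exact (hu β).bord hP L (gU.molecule 2 β) dimLe_bord k α
  · rw [gU.bord_bord_of_le le_rfl, D.b_two_le _ _ le_rfl]
    exact hu α
  · rw [gU.globular 2 k β α hk, D.b_two_le _ _ hk.le]
    exact hu β

theorem Val.union (hP : IsRDC P) (L : (cx P).Lab D lam) {U V : Set P}
    (hU : IsMolecule U) (hV : IsMolecule V) {k : ℕ}
    (h₁ : U ∩ V = DiagNerve.bord k Pol.plus U) (h₂ : U ∩ V = DiagNerve.bord k Pol.minus V) {u v : C}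
    (hu : Val D lam U u) (hv : Val D lam V v) :
    D.b Pol.plus k u = D.b Pol.minus k v ∧ Val D lam (U ∪ V) (D.comp k u v) := by
  have gU := hU.good hP
  have gV := hV.good hP
  have lU := hU.isLowerSet
  have lV := hV.isLowerSet
  have e : D.b Pol.plus k u = D.b Pol.minus k v := by
    refine Val.unique hP L (gV.molecule k Pol.minus) (hv.bord hP L hV k _) ?_
    rw [← h₂, h₁]
    exact hu.bord hP L hU k _
  refine ⟨e, fun α => ?_⟩
  rcases lt_trichotomy 2 k with hk | rfl | hk
  · rw [(bord_union_of_lt gU.globular gV.globular h₁ h₂ hk α).2, D.comp_two_le _ _ hk.le]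
    exact hu α
  · rw [D.comp_two_le _ _ le_rfl]
    cases α
    · rw [bord_minus_union lV h₂]; exact hu _
    · rw [bord_plus_union lU h₁]
      rw [D.b_two_le _ _ le_rfl, D.b_two_le _ _ le_rfl] at e
      rw [e]; exact hv _
  · obtain ⟨h₃, h₄⟩ := bord_inter_of_gt lU lV gU gV h₁ h₂ hk α
    rw [bord_union_of_gt lU lV gU gV h₁ h₂ hk α]
    obtain rfl | rfl : k = 0 ∨ k = 1 := by omega
    · exact (hu α).union_zero hP L (gU.molecule 2 α) (gV.molecule 2 α) h₃ h₄ (hv α)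
    · exact (hu α).union_one hP L (gU.molecule 2 α) (gV.molecule 2 α) h₃ h₄ (hv α)

theorem val_of_atoms (hP : IsRDC P) (L : (cx P).Lab D lam) {d : ℕ}
    (hA : ∀ x : P, dim x ≤ d → ∃ u, Val D lam (Set.Iic x) u) {U : Set P} (hU : IsMolecule U)
    (hd : DimLe U d) : ∃ u, Val D lam U u := by
  induction hU with
  | atom x => exact hA x (hd x (Set.mem_Iic.2 le_rfl))
  | paste k U V hU hV _ _ h₁ h₂ ih ih' =>
    obtain ⟨u, hu⟩ := ih (hd.mono Set.subset_union_left)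
    obtain ⟨v, hv⟩ := ih' (hd.mono Set.subset_union_right)
    exact ⟨_, (hu.union hP L hU hV h₁ h₂ hv).2⟩

theorem val_of_dimLe_two {U : Set P} (hU : IsLowerSet U) (hd : DimLe U 2) {u : C}
    (hu : Composite D lam U u) : Val D lam U u := fun α => by rwa [bord_eq_self hU hd]

theorem val_Iic (hP : IsRDC P) (L : (cx P).Lab D lam) {x : P} (h : dim x ≤ 2) :
    Val D lam (Set.Iic x) (lam x) :=
  val_of_dimLe_two (isLowerSet_Iic x) (fun y hy => (dimLe_Iic x y hy).trans h)
    (composite_Iic hP L h)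

theorem exists_val_Iic (hP : IsRDC P) (L : (cx P).Lab D lam) (hB : Balanced D lam) (x : P) :
    ∃ u, Val D lam (Set.Iic x) u := by
  induction h : dim x using Nat.strong_induction_on generalizing x with
  | _ d ih =>
    obtain hd | rfl | hd : d ≤ 2 ∨ d = 3 ∨ 3 < d := by omega
    · exact ⟨_, val_Iic hP L (h.trans_le hd)⟩
    · exact hB x h
    · obtain ⟨n, rfl⟩ : ∃ n, d = n + 1 := ⟨d - 1, by omega⟩
      have g := (IsMolecule.atom x).good hP
      obtain ⟨u, hu⟩ := val_of_atoms hP L (d := n) (fun y hy => ih (dim y) (by omega) y rfl)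
        (g.molecule n Pol.plus) dimLe_bord
      refine ⟨u, fun α => ?_⟩
      rw [← g.globular 2 n α Pol.plus (by omega)]
      exact hu α

theorem IsMolecule.exists_val (hP : IsRDC P) (L : (cx P).Lab D lam) (hB : Balanced D lam)
    {U : Set P} (hU : IsMolecule U) : ∃ u, Val D lam U u := by
  induction hU with
  | atom x => exact exists_val_Iic hP L hB x
  | paste k U V hU hV _ _ h₁ h₂ ih ih' =>
    obtain ⟨u, hu⟩ := ih
    obtain ⟨v, hv⟩ := ih'
    exact ⟨_, (hu.union hP L hU hV h₁ h₂ hv).2⟩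

end Val

/-- The cell given by a generator. -/
def Presentation.gcls (p : Presentation) {n : ℕ} (g : p.G n) : p.Cell n :=
  cls (.gen g) (Rel.gen (p := p) g)

/-- The presentation of the ω-category of molecules. -/
abbrev molPres (P : Type) [OGPoset P] : Presentation := ⟨Mol P, fun s t => MolRel P s t⟩

/-- A molecule as a generator. -/
def mkMol {P : Type} [OGPoset P] {n : ℕ} (U : Set P) (hU : IsMolecule U) (hd : DimLe U n) :
    Mol P n := ⟨U, hU, hd⟩

section Lift

variable {P : Type} [OGPoset P] [Finite P]

theorem exists_molCat_functor (hP : IsRDC P) {T : OmegaCat} (hT : T.IsNCat 2) {lam : P → T.cell 2}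
    (L : (cx P).Lab T.two lam) (hB : Balanced T.two lam) :
    ∃ F : molCat P ⟶ T, ∀ {n : ℕ} (U : Mol P n), Val T.two lam U.1 (T.up (F.fn
      ((molPres P).gcls U))) := by
  choose v hv using fun (U : Set P) (hU : IsMolecule U) => hU.exists_val hP L hB
  let g : ∀ n, Mol P n → T.cell n := fun n U => T.down (v U.1 U.2.1)
  have hg : ∀ {n} (U : Mol P n), T.up (g n U) = v U.1 U.2.1 := by
    intro n U
    refine OmegaCat.up_down _ ?_
    refine Val.unique hP L U.2.1 (hv U.1 U.2.1) ?_
    have := (hv U.1 U.2.1).bord hP L U.2.1 n Pol.minus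
    rwa [bord_eq_self U.2.1.isLowerSet U.2.2] at this
  have hR : ∀ {n : ℕ} (s t : Term (Mol P) n), MolRel P s t → s.Ok T g → t.Ok T g →
      s.ev T g = t.ev T g := by
    intro n s t h hs ht
    refine OmegaCat.up_inj hT ?_
    cases h with
    | bd α h U V e =>
      simp only [Term.ev]
      rw [OmegaCat.up_bd hT, hg, hg]
      refine Val.unique hP L V.2.1 (hv V.1 V.2.1) ?_
      rw [e]
      exact (hv U.1 U.2.1).bord hP L U.2.1 _ α
    | unit h U V e =>
      simp only [Term.ev]
      rw [OmegaCat.up_unit, hg, hg]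
      refine Val.unique hP L V.2.1 (hv V.1 V.2.1) ?_
      rw [e]
      exact hv U.1 U.2.1
    | comp h U V W h₁ h₂ e =>
      simp only [Term.ev]
      have c : T.bd Pol.plus h (g _ U) = T.bd Pol.minus h (g _ V) := hs.2.2
      rw [T.tcomp_eq _ _ _ c, OmegaCat.up_comp hT, hg, hg, hg]
      refine Val.unique hP L W.2.1 (hv W.1 W.2.1) ?_
      rw [e]
      exact ((hv U.1 U.2.1).union hP L U.2.1 V.2.1 h₁ h₂ (hv V.1 V.2.1)).2
  refine ⟨Presentation.lift (p := molPres P) T g hR, fun U => ?_⟩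
  have e : (Presentation.lift (p := molPres P) T g hR).fn ((molPres P).gcls U) = g _ U :=
    Presentation.lift_cls (p := molPres P) T g hR (.gen U) (Presentation.Rel.gen (p := molPres P) U)
  rw [e, hg U]
  exact hv U.1 U.2.1

/-- The reflection of an ω-category into `N`-categories. -/
noncomputable def coskelUnit (N : ℕ) (X : OmegaCat) : X ⟶ coskel N X where
  fn x := toCoskel N X x
  fn_bd α k n h x := by
    have r : ∀ {n : ℕ} (x : X.cell n), (coskelPres N X).Rel (.gen x) (.gen x) :=
      fun x => Presentation.Rel.gen (p := coskelPres N X) x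
    refine Eq.trans ?_ (Presentation.cbd_cls (p := coskelPres N X) α h (.gen x) (r x)).symm
    exact Presentation.cls_eq.2 (.symm (.rel (.bd α h x) (.bd _ _ (r x)) (r _)))
  fn_unit h x := by
    have r : ∀ {n : ℕ} (x : X.cell n), (coskelPres N X).Rel (.gen x) (.gen x) :=
      fun x => Presentation.Rel.gen (p := coskelPres N X) x
    refine Eq.trans ?_ (Presentation.cunit_cls (p := coskelPres N X) h (.gen x) (r x)).symm
    exact Presentation.cls_eq.2 (.symm (.rel (.unit h x) (.unit _ (r x)) (r _)))
  fn_comp h x y e e' := by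
    have r : ∀ {n : ℕ} (x : X.cell n), (coskelPres N X).Rel (.gen x) (.gen x) :=
      fun x => Presentation.Rel.gen (p := coskelPres N X) x
    obtain ⟨h', q⟩ := Presentation.ccomp_cls (p := coskelPres N X) h (.gen x) (.gen y) (r x)
      (r y) e'
    refine Eq.trans ?_ q.symm
    exact Presentation.cls_eq.2 (.symm (.rel (.comp h x y e) h' (r _)))

theorem coskel_hom_ext {N : ℕ} {X T : OmegaCat} {F F' : coskel N X ⟶ T}
    (h : coskelUnit N X ≫ F = coskelUnit N X ≫ F') : F = F' :=
  Presentation.hom_ext (p := coskelPres N X) fun {n} g =>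
    congrFun (congrFun (congrArg (fun (G : X ⟶ T) (n : ℕ) => G.fn (n := n)) h) n) g

theorem exists_coskel_lift {N : ℕ} {X T : OmegaCat} (hT : T.IsNCat N) (F : X ⟶ T) :
    ∃ G : coskel N X ⟶ T, coskelUnit N X ≫ G = F := by
  let g : ∀ n, X.cell n → T.cell n := fun _ x => F.fn x
  have hR : ∀ {n : ℕ} (s t : Term X.cell n), CoskelRel N X s t → s.Ok T g → t.Ok T g →
      s.ev T g = t.ev T g := by
    intro n s t h hs ht
    cases h with
    | bd α h x => exact (F.fn_bd α h x).symm
    | unit h x => exact (F.fn_unit h x).symm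
    | comp h x y e =>
      exact (T.tcomp_eq _ _ _ hs.2.2).trans (F.fn_comp h x y e hs.2.2).symm
    | trunc h t =>
      obtain ⟨y, hy⟩ := hT h (s.ev T g)
      simp only [Term.ev]
      rw [hy, T.bd_unit_eq]
  refine ⟨Presentation.lift (p := coskelPres N X) T g hR, ?_⟩
  refine OmegaCat.Hom.ext ?_
  funext n x
  exact Presentation.lift_cls (p := coskelPres N X) T g hR _ _

end Lift

namespace RDCpx

open OGPoset

theorem rdc (Q : RDCpx) : IsRDC Q.El := Q.isRDC

variable (Q : RDCpx)

/-- The 2-category presented by the molecules of `Q`. -/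
noncomputable abbrev cat : OmegaCat := coskel 2 (molCat Q.El)

theorem cat_isNCat : Q.cat.IsNCat 2 := coskel_isNCat 2 _

/-- The cell given by a molecule. -/
noncomputable def molCell {n : ℕ} (U : Mol Q.El n) : Q.cat.cell n :=
  (coskelUnit 2 (molCat Q.El)).fn ((molPres Q.El).gcls U)

variable {Q}

theorem rel_gen {n : ℕ} (U : Mol Q.El n) : (molPres Q.El).Rel (.gen U) (.gen U) :=
  Presentation.Rel.gen (p := molPres Q.El) U

theorem bd_molCell {k n : ℕ} (α : Pol) (h : k < n) (U : Mol Q.El n) (V : Mol Q.El k)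
    (e : V.1 = bord k α U.1) : Q.cat.bd α h (Q.molCell U) = Q.molCell V := by
  refine ((coskelUnit 2 (molCat Q.El)).fn_bd α h ((molPres Q.El).gcls U)).symm.trans ?_
  refine congrArg (coskelUnit 2 (molCat Q.El)).fn ?_
  refine (Presentation.cbd_cls (p := molPres Q.El) α h (.gen U) (rel_gen U)).trans ?_
  exact Presentation.cls_eq.2 (.rel (.bd α h U V e) (.bd _ _ (rel_gen U)) (rel_gen V))

theorem unit_molCell {k n : ℕ} (h : k < n) (U : Mol Q.El k) (V : Mol Q.El n)
    (e : V.1 = U.1) : Q.cat.unit h (Q.molCell U) = Q.molCell V := by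
  refine ((coskelUnit 2 (molCat Q.El)).fn_unit h ((molPres Q.El).gcls U)).symm.trans ?_
  refine congrArg (coskelUnit 2 (molCat Q.El)).fn ?_
  refine (Presentation.cunit_cls (p := molPres Q.El) h (.gen U) (rel_gen U)).trans ?_
  exact Presentation.cls_eq.2 (.rel (.unit h U V e) (.unit _ (rel_gen U)) (rel_gen V))

theorem comp_molCell {k n : ℕ} (h : k < n) (U V W : Mol Q.El n)
    (h₁ : U.1 ∩ V.1 = bord k Pol.plus U.1) (h₂ : U.1 ∩ V.1 = bord k Pol.minus V.1)
    (e : W.1 = U.1 ∪ V.1) :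
    ∃ c, Q.cat.comp h (Q.molCell U) (Q.molCell V) c = Q.molCell W := by
  let B : Mol Q.El k := mkMol (bord k Pol.plus U.1) ((U.2.1.good Q.rdc).molecule k _) dimLe_bord
  have r₁ : (molPres Q.El).Rel (.bd Pol.plus h (.gen U)) (.gen B) :=
    .rel (.bd _ h U B rfl) (.bd _ _ (rel_gen U)) (rel_gen B)
  have r₂ : (molPres Q.El).Rel (.bd Pol.minus h (.gen V)) (.gen B) :=
    .rel (.bd _ h V B (h₁.symm.trans h₂)) (.bd _ _ (rel_gen V)) (rel_gen B)
  have c : Presentation.cbd Pol.plus h ((molPres Q.El).gcls U) =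
      Presentation.cbd Pol.minus h ((molPres Q.El).gcls V) := by
    refine (Presentation.cbd_cls (p := molPres Q.El) _ h (.gen U) (rel_gen U)).trans
      (Eq.trans ?_ (Presentation.cbd_cls (p := molPres Q.El) _ h (.gen V) (rel_gen V)).symm)
    exact Presentation.cls_eq.2 (r₁.trans r₂.symm)
  obtain ⟨h', q⟩ := Presentation.ccomp_cls (p := molPres Q.El) h (.gen U) (.gen V) (rel_gen U)
    (rel_gen V) c
  have c' : Q.cat.bd Pol.plus h (Q.molCell U) = Q.cat.bd Pol.minus h (Q.molCell V) := by
    rw [bd_molCell _ h U B rfl, bd_molCell _ h V B (h₁.symm.trans h₂)]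
  refine ⟨c', ?_⟩
  refine ((coskelUnit 2 (molCat Q.El)).fn_comp h _ _ c c').symm.trans ?_
  refine congrArg (coskelUnit 2 (molCat Q.El)).fn (q.trans ?_)
  exact Presentation.cls_eq.2 (.rel (.comp h U V W h₁ h₂ e) h' (rel_gen W))

/-- Functors out of the 2-category of molecules are determined by their values on atoms. -/
theorem hom_ext_atom {T : OmegaCat} {F F' : Q.cat ⟶ T}
    (h : ∀ {n : ℕ} (x : Q.El) (hx : dim x ≤ n), F.fn (atomCell Q x hx) = F'.fn (atomCell Q x hx)) :
    F = F' := by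
  refine coskel_hom_ext (Presentation.hom_ext fun {n} U => ?_)
  suffices key : ∀ V, ∀ (hV : IsMolecule V) (hd : DimLe V n), F.fn (Q.molCell (mkMol V hV hd)) =
      F'.fn (Q.molCell (mkMol V hV hd)) from key U.1 U.2.1 U.2.2
  intro V hV hd
  refine IsMolecule.induction_dim (d := n) (motive := fun V => ∀ (hV : IsMolecule V)
    (hd : DimLe V n), F.fn (Q.molCell (mkMol V hV hd)) = F'.fn (Q.molCell (mkMol V hV hd))) ?_ ?_ hV hd hV hd
  · intro x hx hV hd
    exact h x hx
  · intro k V W hk mV mW dV dW h₁ h₂ ihV ihW mU dU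
    obtain ⟨c, e⟩ := comp_molCell hk (mkMol V mV dV) (mkMol W mW dW) (mkMol (V ∪ W) mU dU) h₁ h₂ rfl
    have e₁ : T.bd Pol.plus hk (F.fn (Q.molCell (mkMol V mV dV))) =
        T.bd Pol.minus hk (F.fn (Q.molCell (mkMol W mW dW))) := by rw [← F.fn_bd, ← F.fn_bd, c]
    have e₂ : T.bd Pol.plus hk (F'.fn (Q.molCell (mkMol V mV dV))) =
        T.bd Pol.minus hk (F'.fn (Q.molCell (mkMol W mW dW))) := by rw [← F'.fn_bd, ← F'.fn_bd, c]
    rw [← e, F.fn_comp hk _ _ c e₁, F'.fn_comp hk _ _ c e₂]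
    exact T.comp_congr hk (ihV mV dV) (ihW mW dW) _ _

/-- A balanced labelling of `Q` in a 2-category extends to a functor. -/
theorem exists_functor {T : OmegaCat} (hT : T.IsNCat 2) {lam : Q.El → T.cell 2}
    (L : (cx Q.El).Lab T.two lam) (hB : Balanced T.two lam) :
    ∃ F : Q.cat ⟶ T, ∀ {n : ℕ} (U : Mol Q.El n), Val T.two lam U.1 (T.up (F.fn (Q.molCell U))) := by
  obtain ⟨G, hG⟩ := exists_molCat_functor Q.rdc hT L hB
  obtain ⟨F, rfl⟩ := exists_coskel_lift hT G
  exact ⟨F, fun U => hG U⟩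

variable (Q) in
theorem exists_dim_bound : ∃ N, ∀ x : Q.El, dim x ≤ N := by
  obtain ⟨N, hN⟩ := (Set.finite_range (fun x : Q.El => dim x)).bddAbove
  exact ⟨N, fun x => hN ⟨x, rfl⟩⟩

variable (Q) in
/-- The 2-cell given by a molecule. -/
noncomputable def mc (U : Set Q.El) (hU : IsMolecule U) : Q.cat.cell 2 :=
  Q.cat.up (Q.molCell (mkMol U hU fun x _ => Q.exists_dim_bound.choose_spec x))

theorem up_molCell {n : ℕ} (U : Mol Q.El n) : Q.cat.up (Q.molCell U) = Q.mc U.1 U.2.1 := by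
  have key : ∀ {n m : ℕ} (U : Mol Q.El n) (V : Mol Q.El m), V.1 = U.1 → n < m →
      Q.cat.up (Q.molCell U) = Q.cat.up (Q.molCell V) := fun U V e h => by
    rw [← unit_molCell h U V e, OmegaCat.up_unit]
  let N := Q.exists_dim_bound.choose
  let W : Mol Q.El (max n N + 1) :=
    mkMol U.1 U.2.1 fun x hx => (U.2.2 x hx).trans (by omega)
  rw [key U W rfl (by omega)]
  have hN : N < max n N + 1 := Nat.lt_succ_of_le (le_max_right n N)
  exact (key (n := N) (mkMol U.1 U.2.1 _) W rfl hN).symm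

theorem up_mkMol {n : ℕ} {U : Set Q.El} (hU : IsMolecule U) (hd : DimLe U n) :
    Q.cat.up (Q.molCell (mkMol U hU hd)) = Q.mc U hU := up_molCell _

theorem b_mc {U : Set Q.El} (hU : IsMolecule U) (k : ℕ) (α : Pol)
    {V : Set Q.El} (hV : IsMolecule V) (e : V = bord k α U) :
    Q.cat.two.b α k (Q.mc U hU) = Q.mc V hV := by
  obtain ⟨N, hN⟩ := Q.exists_dim_bound
  have h : k < max N k + 1 := by omega
  have hN' : ∀ x : Q.El, dim x ≤ max N k + 1 := fun x => (hN x).trans (by omega)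
  rw [← up_mkMol (n := max N k + 1) hU fun x _ => hN' x,
    ← OmegaCat.up_bd Q.cat_isNCat α h, bd_molCell α h (mkMol U hU fun x _ => hN' x)
      (mkMol V hV (e ▸ dimLe_bord)) e, up_mkMol]

theorem comp_mc {U V : Set Q.El} (hU : IsMolecule U) (hV : IsMolecule V) {k : ℕ}
    (h₁ : U ∩ V = bord k Pol.plus U) (h₂ : U ∩ V = bord k Pol.minus V) (hW : IsMolecule (U ∪ V)) :
    Q.cat.two.comp k (Q.mc U hU) (Q.mc V hV) = Q.mc (U ∪ V) hW := by
  obtain ⟨N, hN⟩ := Q.exists_dim_bound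
  have h : k < max N k + 1 := by omega
  have hN' : ∀ x : Q.El, dim x ≤ max N k + 1 := fun x => (hN x).trans (by omega)
  obtain ⟨c, e⟩ := comp_molCell h (mkMol U hU fun x _ => hN' x) (mkMol V hV fun x _ => hN' x)
    (mkMol (U ∪ V) hW fun x _ => hN' x) h₁ h₂ rfl
  rw [← up_mkMol (n := max N k + 1) hU fun x _ => hN' x,
    ← up_mkMol (n := max N k + 1) hV fun x _ => hN' x,
    ← up_mkMol (n := max N k + 1) hW fun x _ => hN' x, ← e,
    OmegaCat.up_comp Q.cat_isNCat]

variable (Q) in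
/-- The tautological labelling. -/
noncomputable def taut (x : Q.El) : Q.cat.cell 2 := Q.mc (Set.Iic x) (.atom x)

theorem up_atomCell {n : ℕ} (x : Q.El) (h : dim x ≤ n) :
    Q.cat.up (atomCell Q x h) = Q.taut x := up_molCell _

theorem Iic_of_dim_zero {v : Q.El} (hv : dim v = 0) : Set.Iic v = {v} := by
  ext y
  exact ⟨fun h => eq_of_dim_zero hv h, fun h => (show y = v from h).le⟩

theorem taut_edgeLab : (cx Q.El).EdgeLab Q.cat.two Q.taut where
  zero x hx α := b_mc _ 0 α _ (bord_eq_self (isLowerSet_Iic x) fun y hy =>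
    (dimLe_Iic x y hy).trans (Nat.le_of_eq hx)).symm
  one x hx α := b_mc _ 1 α _ (bord_eq_self (isLowerSet_Iic x) fun y hy =>
    (dimLe_Iic x y hy).trans (Nat.le_of_eq hx)).symm
  src x hx := b_mc _ 0 _ _ (by
    rw [(bord_zero_Iic Q.rdc x).1, Iic_of_dim_zero (bord_zero_Iic Q.rdc x).2.2.1])
  tgt x hx := b_mc _ 0 _ _ (by
    rw [(bord_zero_Iic Q.rdc x).2.1, Iic_of_dim_zero (bord_zero_Iic Q.rdc x).2.2.2])

theorem mc_eq_pv {U : Set Q.El} (hU : IsMolecule U) (hd : DimLe U 1) {s t : Q.El} {l : List Q.El}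
    (h : PathOf U s l t) (hs : bord 0 Pol.minus U = {s}) (ht : bord 0 Pol.plus U = {t}) :
    Q.mc U hU = (cx Q.El).pv Q.cat.two Q.taut s l := by
  have L := taut_edgeLab (Q := Q)
  suffices key : ∀ U, IsMolecule U → DimLe U 1 → ∃ s t l, PathOf U s l t ∧
      bord 0 Pol.minus U = {s} ∧ bord 0 Pol.plus U = {t} ∧
      ∀ hU, Q.mc U hU = (cx Q.El).pv Q.cat.two Q.taut s l by
    obtain ⟨s', t', l', h', hs', ht', e⟩ := key U hU hd
    obtain rfl : s = s' := Set.singleton_injective (hs.symm.trans hs')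
    obtain rfl : t = t' := Set.singleton_injective (ht.symm.trans ht')
    rw [PathOf.unique h' h, e hU]
  intro U hU hd
  refine IsMolecule.induction_dim (d := 1) (motive := fun U => ∃ s t l, PathOf U s l t ∧
      bord 0 Pol.minus U = {s} ∧ bord 0 Pol.plus U = {t} ∧
      ∀ hU, Q.mc U hU = (cx Q.El).pv Q.cat.two Q.taut s l) ?_ ?_ hU hd
  · intro x hx
    obtain ⟨h₁, h₂, h₃, h₄⟩ := bord_zero_Iic Q.rdc x
    rcases Nat.le_one_iff_eq_zero_or_eq_one.1 hx with h | h
    · obtain ⟨e₁, e₂⟩ := src_of_dim_zero Q.rdc h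
      rw [e₁] at h₁
      rw [e₂] at h₂
      exact ⟨x, x, [], pathOf_vertex h, h₁, h₂, fun _ => rfl⟩
    · refine ⟨_, _, [x], pathOf_edge Q.rdc h, h₁, h₂, fun _ => ?_⟩
      simp only [CxData.pv]
      rw [← L.tgt x h, Q.cat.two.comp_unit_right]
      rfl
  · rintro k U V hk mU mV - - h₁ h₂ ⟨s, t, l, pU, sU, tU, eU⟩ ⟨s', r, m, pV, sV, tV, eV⟩
    obtain rfl : k = 0 := by omega
    obtain rfl : t = s' := Set.singleton_injective (by rw [← tU, ← sV, ← h₁, ← h₂])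
    refine ⟨s, r, l ++ m, pU.append Q.rdc pV (h₁.trans tU), by
      rw [bord_minus_union mV.isLowerSet h₂, sU], by rw [bord_plus_union mU.isLowerSet h₁, tV],
      fun hW => ?_⟩
    rw [← comp_mc mU mV h₁ h₂ hW, eU, eV, L.pv_append (cx_walk.2 pU.walk) (cx_walk.2 pV.walk)]

theorem taut_lab : (cx Q.El).Lab Q.cat.two Q.taut := by
  have key : ∀ (x : Q.El) (α : Pol), Q.cat.two.b α 1 (Q.taut x) =
      (cx Q.El).pv Q.cat.two Q.taut ((cx Q.El).src x) (pathList (bord 1 α (Set.Iic x))) := by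
    intro x α
    have g := (IsMolecule.atom x).good Q.rdc
    rw [taut, b_mc (.atom x) 1 α (g.molecule 1 α) rfl]
    have p := pathOf_bord (z := x) Q.rdc (.atom x) α
    rw [(vsrc_Iic Q.rdc x).1, (vsrc_Iic Q.rdc x).2] at p
    refine mc_eq_pv _ dimLe_bord p ?_ ?_
    · rw [g.globular 0 1 _ _ Nat.zero_lt_one, (bord_zero_Iic Q.rdc x).1]
    · rw [g.globular 0 1 _ _ Nat.zero_lt_one, (bord_zero_Iic Q.rdc x).2.1]
  exact ⟨taut_edgeLab, fun x _ => key x _, fun x _ => key x _⟩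

theorem composite_mc {U : Set Q.El} (hU : IsMolecule U) (hd : DimLe U 2) :
    Composite Q.cat.two Q.taut U (Q.mc U hU) := by
  have L := taut_lab (Q := Q)
  refine IsMolecule.induction_dim (d := 2) (motive := fun U => ∀ hU,
    Composite Q.cat.two Q.taut U (Q.mc U hU)) ?_ ?_ hU hd hU
  · intro x hx _
    exact composite_Iic Q.rdc L hx
  · intro k U V hk mU mV _ _ h₁ h₂ ihU ihV mW
    rw [← comp_mc mU mV h₁ h₂ mW]
    obtain rfl | rfl : k = 0 ∨ k = 1 := by omega
    · exact (ihU mU).union_zero Q.rdc L mU mV h₁ h₂ (ihV mV)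
    · exact (ihU mU).union_one Q.rdc L mU mV h₁ h₂ (ihV mV)

theorem mc_bord_two {U : Set Q.El} (hU : IsMolecule U) {α : Pol} (hV : IsMolecule (bord 2 α U)) :
    Q.mc (bord 2 α U) hV = Q.mc U hU := by
  rw [← b_mc hU 2 α hV rfl, Q.cat.two.b_two_le _ _ le_rfl]

theorem val_mc {U : Set Q.El} (hU : IsMolecule U) : Val Q.cat.two Q.taut U (Q.mc U hU) := by
  intro α
  have := composite_mc ((hU.good Q.rdc).molecule 2 α) dimLe_bord
  rwa [mc_bord_two hU] at this

end RDCpx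

/-! ### Functoriality -/

namespace RDCpx.Hom

open OGPoset

variable {Q R : RDCpx} (f : Hom Q R)

theorem fn_src (x : Q.El) : f.fn ((cx Q.El).src x) = (cx R.El).src (f.fn x) := by
  have h := f.bord_fn x 0 Pol.minus
  rw [(bord_zero_Iic Q.rdc x).1, (bord_zero_Iic R.rdc _).1, Set.image_singleton] at h
  exact (Set.singleton_injective h).symm

theorem fn_tgt (x : Q.El) : f.fn ((cx Q.El).tgt x) = (cx R.El).tgt (f.fn x) := by
  have h := f.bord_fn x 0 Pol.plus
  rw [(bord_zero_Iic Q.rdc x).2.1, (bord_zero_Iic R.rdc _).2.1, Set.image_singleton] at h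
  exact (Set.singleton_injective h).symm

theorem dim_zero {v : Q.El} (hv : dim v = 0) : dim (f.fn v) = 0 :=
  Nat.le_zero.1 (hv ▸ f.dim_le v)

/-- The image of a list, where elements that do not have dimension `d` are dropped. -/
def img (d : ℕ) (l : List Q.El) : List R.El := (l.map f.fn).filter fun y => decide (dim y = d)

theorem img_append (d : ℕ) (l m : List Q.El) : f.img d (l ++ m) = f.img d l ++ f.img d m := by
  simp [img]

theorem img_cons_of_eq {d : ℕ} {x : Q.El} (h : dim (f.fn x) = d) (l : List Q.El) :
    f.img d (x :: l) = f.fn x :: f.img d l := by simp [img, h]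

theorem img_cons_of_ne {d : ℕ} {x : Q.El} (h : dim (f.fn x) ≠ d) (l : List Q.El) :
    f.img d (x :: l) = f.img d l := by simp [img, h]

theorem mem_img {d : ℕ} {l : List Q.El} {y : R.El} :
    y ∈ f.img d l ↔ (∃ x ∈ l, f.fn x = y) ∧ dim y = d := by
  simp [img]

theorem walk {s t : Q.El} {l : List Q.El} (h : (cx Q.El).Walk s l t) :
    (cx R.El).Walk (f.fn s) (f.img 1 l) (f.fn t) := by
  induction l generalizing s with
  | nil => exact ⟨congrArg _ h.1, f.dim_zero h.2⟩
  | cons e l ih =>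
    obtain ⟨⟨rfl, he, hs⟩, h⟩ := h
    by_cases hd : dim (f.fn e) = 1
    · rw [f.img_cons_of_eq hd]
      exact ⟨⟨(f.fn_src e).symm, hd, f.dim_zero hs⟩, f.fn_tgt e ▸ ih h⟩
    · rw [f.img_cons_of_ne hd]
      have h₀ : dim (f.fn e) = 0 := by
        have := f.dim_le e
        have he' : dim e = 1 := he
        omega
      have := ih h
      rw [f.fn_src, (src_of_dim_zero R.rdc h₀).1]
      rwa [f.fn_tgt, (src_of_dim_zero R.rdc h₀).2] at this

theorem img_pathList (x : Q.El) (α : Pol) : f.img 1 (pathList (bord 1 α (Set.Iic x))) =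
    pathList (bord 1 α (Set.Iic (f.fn x))) := by
  have p := pathOf_bord (z := f.fn x) R.rdc (.atom (f.fn x)) α
  have q := pathOf_bord (z := x) Q.rdc (.atom x) α
  have w := f.walk (cx_walk.2 q.walk)
  rw [(vsrc_Iic R.rdc _).1, (vsrc_Iic R.rdc _).2] at p
  rw [(vsrc_Iic Q.rdc _).1, (vsrc_Iic Q.rdc _).2, f.fn_src, f.fn_tgt] at w
  refine (cx_walk.2 p.walk).eq_of_subset p.nodup p.ne w fun e he => p.mem_list_iff.2 ?_
  obtain ⟨⟨e, he', rfl⟩, hd⟩ := f.mem_img.1 he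
  exact ⟨f.bord_fn x 1 α ▸ ⟨e, q.edge_mem he', rfl⟩, hd⟩

variable {C : Type} {D : Two C} {lam : R.El → C}

theorem b_one_lab (L : (cx R.El).Lab D lam) {y : R.El} (hy : dim y ≤ 2) (α : Pol) :
    D.b α 1 (lam y) =
      (cx R.El).pv D lam ((cx R.El).src y) (pathList (bord 1 α (Set.Iic y))) := by
  rw [(composite_Iic R.rdc L hy).b_one R.rdc L (.atom y) y α, (vsrc_Iic R.rdc y).1]

theorem b_one_of_dim_le (L : (cx R.El).EdgeLab D lam) {y : R.El} (hy : dim y ≤ 1) (α : Pol) :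
    D.b α 1 (lam y) = lam y := by
  rcases Nat.le_one_iff_eq_zero_or_eq_one.1 hy with h | h
  · rw [← L.zero y h α, D.b_b_le _ _ _ (Nat.zero_le _)]
  · exact L.one y h α

theorem edgeLab (L : (cx R.El).EdgeLab D lam) : (cx Q.El).EdgeLab D (lam ∘ f.fn) where
  zero x hx α := L.zero _ (f.dim_zero hx) α
  one x hx α := b_one_of_dim_le L ((f.dim_le x).trans (Nat.le_of_eq hx)) α
  src x hx := by
    rcases Nat.le_one_iff_eq_zero_or_eq_one.1 ((f.dim_le x).trans (Nat.le_of_eq hx)) with h | h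
    · simp only [Function.comp, f.fn_src, (src_of_dim_zero R.rdc h).1]
      exact L.zero _ h _
    · simp only [Function.comp, f.fn_src]
      exact L.src _ h
  tgt x hx := by
    rcases Nat.le_one_iff_eq_zero_or_eq_one.1 ((f.dim_le x).trans (Nat.le_of_eq hx)) with h | h
    · simp only [Function.comp, f.fn_tgt, (src_of_dim_zero R.rdc h).2]
      exact L.zero _ h _
    · simp only [Function.comp, f.fn_tgt]
      exact L.tgt _ h

theorem pv_img (L : (cx R.El).EdgeLab D lam) {s t : Q.El} {l : List Q.El}
    (h : (cx Q.El).Walk s l t) :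
    (cx R.El).pv D lam (f.fn s) (f.img 1 l) = (cx Q.El).pv D (lam ∘ f.fn) s l := by
  induction l generalizing s with
  | nil => rfl
  | cons e l ih =>
    obtain ⟨⟨rfl, he, hs⟩, h⟩ := h
    by_cases hd : dim (f.fn e) = 1
    · rw [f.img_cons_of_eq hd]
      simp only [CxData.pv]
      rw [← ih h, f.fn_tgt]
      rfl
    · rw [f.img_cons_of_ne hd]
      have h₀ : dim (f.fn e) = 0 := by
        have := f.dim_le e
        have he' : dim e = 1 := he
        omega
      have e₁ : f.fn ((cx Q.El).src e) = f.fn ((cx Q.El).tgt e) := by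
        rw [f.fn_src, f.fn_tgt, (src_of_dim_zero R.rdc h₀).1, (src_of_dim_zero R.rdc h₀).2]
      have e₂ : (lam ∘ f.fn) e = (lam ∘ f.fn) ((cx Q.El).tgt e) := by
        simp only [Function.comp, f.fn_tgt, (src_of_dim_zero R.rdc h₀).2]
      simp only [CxData.pv]
      rw [e₁, ih h, e₂, ← ((f.edgeLab L).pv_b h).2.1, D.comp_unit_left]

theorem lab (L : (cx R.El).Lab D lam) : (cx Q.El).Lab D (lam ∘ f.fn) := by
  have key : ∀ x : Q.El, dim x = 2 → ∀ α, D.b α 1 (lam (f.fn x)) = (cx Q.El).pv D (lam ∘ f.fn)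
      ((cx Q.El).src x) (pathList (bord 1 α (Set.Iic x))) := by
    intro x hx α
    have w := walk_bord (z := x) Q.rdc (.atom x) α
    rw [(vsrc_Iic Q.rdc x).1] at w
    rw [← f.pv_img L.toEdgeLab w, f.img_pathList, f.fn_src, b_one_lab L ((f.dim_le x).trans hx.le)]
  exact ⟨f.edgeLab L.toEdgeLab, fun x hx => key x hx _, fun x hx => key x hx _⟩

theorem rw_img (L : (cx R.El).Lab D lam) {s t : Q.El} {xs p q : List Q.El} {u : C}
    (h : (cx Q.El).Rw D (lam ∘ f.fn) s xs p q u) (hx : ∀ x ∈ xs, dim x = 2)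
    (hp : (cx Q.El).Walk s p t) :
    (cx R.El).Rw D lam (f.fn s) (f.img 2 xs) (f.img 1 p) (f.img 1 q) u := by
  have hK := cx_ok Q.rdc
  have L' := f.lab L
  induction xs generalizing p u with
  | nil =>
    obtain ⟨rfl, rfl⟩ := h
    exact ⟨rfl, (f.pv_img L.toEdgeLab hp).symm⟩
  | cons x xs ih =>
    obtain ⟨a, b, v, rfl, h, rfl⟩ := h
    have hx2 := hx x (by simp)
    obtain ⟨ha, hb⟩ := hK.walk_split hx2 hp
    have hv := ih h (fun y hy => hx y (by simp [hy])) (hK.walk_step hx2 hp)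
    have hi : f.img 1 ((cx Q.El).inn x) = (cx R.El).inn (f.fn x) := f.img_pathList x _
    have ho : f.img 1 ((cx Q.El).out x) = (cx R.El).out (f.fn x) := f.img_pathList x _
    by_cases hd : dim (f.fn x) = 2
    · rw [f.img_cons_of_eq hd]
      refine ⟨f.img 1 a, f.img 1 b, v, ?_, ?_, ?_⟩
      · rw [f.img_append, f.img_append, hi]
      · rwa [f.img_append, f.img_append, ho] at hv
      · simp only [CxData.wh]
        rw [← f.fn_tgt, f.pv_img L.toEdgeLab ha, f.pv_img L.toEdgeLab hb]
        rfl
    · rw [f.img_cons_of_ne hd]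
      have hd' : dim (f.fn x) ≤ 1 := by
        have := f.dim_le x
        omega
      have hio : (cx R.El).inn (f.fn x) = (cx R.El).out (f.fn x) := by
        have : ∀ α, bord 1 α (Set.Iic (f.fn x)) = Set.Iic (f.fn x) := fun α =>
          bord_eq_self (isLowerSet_Iic _) fun y hy => (dimLe_Iic _ y hy).trans hd'
        simp only [cx, this]
      have e₁ : (lam ∘ f.fn) x = (cx Q.El).pv D (lam ∘ f.fn) ((cx Q.El).src x) ((cx Q.El).inn x) := by
        rw [← L'.inn x hx2]
        exact (b_one_of_dim_le L.toEdgeLab hd' _).symm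
      have e₂ : (cx Q.El).wh D (lam ∘ f.fn) s a x b = D.b Pol.minus 1 v := by
        rw [(h.b L' hK (fun y hy => hx y (by simp [hy])) (hK.walk_step hx2 hp)).1, CxData.wh, e₁,
          ← L'.pv_append (hK.inn_walk x hx2) hb, ← L'.pv_append ha
          (CxData.walk_append.2 ⟨_, hK.inn_walk x hx2, hb⟩), ← List.append_assoc,
          ← f.pv_img L.toEdgeLab hp, ← f.pv_img L.toEdgeLab (hK.walk_step hx2 hp)]
        simp only [f.img_append, hi, ho, hio]
      rw [e₂, D.comp_unit_left]
      simpa only [f.img_append, hi, ho, hio] using hv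

/-- The composite of the boundary of an element agrees with that of its image. -/
theorem composite_bord (L : (cx R.El).Lab D lam) {x : Q.El} {u : C} {α : Pol}
    (hu : Composite D lam (bord 2 α (Set.Iic (f.fn x))) u) :
    Composite D (lam ∘ f.fn) (bord 2 α (Set.Iic x)) u := by
  have gx := (IsMolecule.atom x).good Q.rdc
  have gy := (IsMolecule.atom (f.fn x)).good R.rdc
  obtain ⟨v, hv⟩ := (gx.molecule 2 α).exists_composite Q.rdc (f.lab L) dimLe_bord
  suffices e : v = u from e ▸ hv
  obtain ⟨z, xs, -, hx, hr⟩ := hv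
  refine hu.eq_of_rw R.rdc L (gy.molecule 2 α) dimLe_bord (xs := f.img 2 xs) (z := f.fn x) ?_ ?_
  · intro y hy
    obtain ⟨⟨y, hy', rfl⟩, hd⟩ := f.mem_img.1 hy
    exact ⟨f.bord_fn x 2 α ▸ ⟨y, ((hx y).1 hy').1, rfl⟩, hd⟩
  · have e₁ : vsrc z (bord 2 α (Set.Iic x)) = (cx Q.El).src x := by
      refine pointOf_eq ?_
      rw [gx.globular 0 2 _ _ Nat.zero_lt_two, (bord_zero_Iic Q.rdc x).1]
    have e₂ : vsrc (f.fn x) (bord 2 α (Set.Iic (f.fn x))) = (cx R.El).src (f.fn x) := by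
      refine pointOf_eq ?_
      rw [gy.globular 0 2 _ _ Nat.zero_lt_two, (bord_zero_Iic R.rdc _).1]
    rw [gx.globular 1 2 _ _ Nat.one_lt_two, gx.globular 1 2 _ _ Nat.one_lt_two, e₁] at hr
    rw [gy.globular 1 2 _ _ Nat.one_lt_two, gy.globular 1 2 _ _ Nat.one_lt_two, e₂,
      ← f.fn_src, ← f.img_pathList, ← f.img_pathList]
    have w := walk_bord (z := x) Q.rdc (.atom x) Pol.minus
    rw [(vsrc_Iic Q.rdc x).1] at w
    exact f.rw_img L hr (fun y hy => ((hx y).1 hy).2) w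

theorem val (L : (cx R.El).Lab D lam) {x : Q.El} {u : C} (hu : Val D lam (Set.Iic (f.fn x)) u) :
    Val D (lam ∘ f.fn) (Set.Iic x) u := fun α => f.composite_bord L (hu α)

theorem balanced_taut : Balanced R.cat.two (R.taut ∘ f.fn) := fun _ _ =>
  ⟨_, f.val taut_lab (val_mc (.atom _))⟩

theorem exists_cat_functor : ∃ F : Q.cat ⟶ R.cat, ∀ {n : ℕ} (x : Q.El) (h : dim x ≤ n),
    F.fn (atomCell Q x h) = atomCell R (f.fn x) ((f.dim_le x).trans h) := by
  obtain ⟨F, hF⟩ := exists_functor R.cat_isNCat (f.lab taut_lab) f.balanced_taut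
  refine ⟨F, fun x h => OmegaCat.up_inj R.cat_isNCat ?_⟩
  rw [up_atomCell]
  exact Val.unique Q.rdc (f.lab taut_lab) (.atom x) (f.val taut_lab (val_mc (.atom _)))
    (hF (mkMol (Set.Iic x) (.atom x) fun _ hy => (dim_mono _ x hy).trans h))

end RDCpx.Hom

/-! ### A criterion for bicoloured pros -/

namespace Two

variable {C : Type} (D : Two C)

/-- The ω-category given by a one-sorted 2-category. -/
def toOmegaCat : OmegaCat where
  cell n := {x : C // ∀ α, D.b α n x = x}
  bd α k _ _ x := ⟨D.b α k x.1, fun β => D.b_b_le α β x.1 le_rfl⟩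
  unit {k n} h x := ⟨x.1, fun β => by rw [← x.2 β, D.b_b_le _ _ _ h.le]⟩
  comp {k n} h x y e := ⟨D.comp k x.1 y.1, fun β => by
    rw [D.b_comp β h (Subtype.ext_iff.1 e), x.2, y.2]⟩
  bd_bd α β j k n h h' x := Subtype.ext (D.b_b_lt _ _ _ h)
  unit_unit h h' x := rfl
  bd_unit_lt α k m n h h' x := rfl
  bd_unit_eq α m n h x := Subtype.ext (x.2 α)
  bd_unit_gt α m k n h h' x := Subtype.ext (by
    change D.b α k x.1 = x.1
    rw [← x.2 α, D.b_b_le _ _ _ h.le])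
  unit_comp h h' x y e e' := rfl
  comp_unit_right h x e := Subtype.ext (D.comp_unit_right _ _)
  comp_unit_left h x e := Subtype.ext (D.comp_unit_left _ _)
  bd_minus_comp h x y e := Subtype.ext (D.b_minus_comp (Subtype.ext_iff.1 e))
  bd_plus_comp h x y e := Subtype.ext (D.b_plus_comp (Subtype.ext_iff.1 e))
  bd_comp α k j n h h' x y e e' := Subtype.ext (D.b_comp α h (Subtype.ext_iff.1 e))
  assoc h x y z e₁ e₂ e₃ e₄ := Subtype.ext (D.assoc (Subtype.ext_iff.1 e₁) (Subtype.ext_iff.1 e₃))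
  interchange h h' x x' y y' e₁ e₂ e₃ e₄ e₅ e₆ := Subtype.ext (D.interchange h
    (Subtype.ext_iff.1 e₁) (Subtype.ext_iff.1 e₂) (Subtype.ext_iff.1 e₄))

theorem toOmegaCat_isNCat : D.toOmegaCat.IsNCat 2 := fun _ x =>
  ⟨⟨x.1, fun _ => D.b_two_le _ _ le_rfl⟩, rfl⟩

theorem toOmegaCat_b (α : Pol) (k : ℕ) (x : D.toOmegaCat.cell 2) :
    (D.toOmegaCat.two.b α k x).1 = D.b α k x.1 := by
  by_cases h : k < 2
  · rw [OmegaCat.two_b _ h]; rfl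
  · rw [D.b_two_le _ _ (by omega), Two.b_two_le _ _ _ (by omega)]

theorem toOmegaCat_comp (k : ℕ) {x y : D.toOmegaCat.cell 2}
    (e : D.b Pol.plus k x.1 = D.b Pol.minus k y.1) :
    (D.toOmegaCat.two.comp k x y).1 = D.comp k x.1 y.1 := by
  by_cases h : k < 2
  · rw [OmegaCat.two_comp _ h x y (Subtype.ext e)]; rfl
  · rw [D.comp_two_le _ _ (by omega), Two.comp_two_le _ _ _ (by omega)]

theorem toOmegaCat_up {n : ℕ} (x : D.toOmegaCat.cell n) : (D.toOmegaCat.up x).1 = x.1 := by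
  match n, x with
  | 0, _ => rfl
  | 1, _ => rfl
  | 2, _ => rfl
  | n + 3, x => exact D.b_two_le _ _ le_rfl

/-- The 2-category with one object, with a monoid as 1-cells, and with exactly one 2-cell between
any two 1-cells. -/
def chaotic (M : Type) [Monoid M] : Two (M × M) where
  b
    | _, 0, _ => 1
    | .minus, 1, x => (x.1, x.1)
    | .plus, 1, x => (x.2, x.2)
    | _, _ + 2, x => x
  comp
    | 0, x, y => x * y
    | 1, x, y => (x.1, y.2)
    | _ + 2, x, _ => x
  b_two_le α k x h := by
    obtain ⟨k, rfl⟩ := Nat.exists_eq_add_of_le' h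
    cases α <;> rfl
  b_b_lt α β j k x h := by
    rcases k with _ | _ | k
    · omega
    · obtain rfl : j = 0 := by omega
      cases α <;> cases β <;> rfl
    · cases α <;> rfl
  b_b_le α β j k x h := by
    rcases k with _ | _ | k <;> rcases j with _ | _ | j <;> first | omega | skip
    all_goals cases α <;> cases β <;> rfl
  b_minus_comp {k x y} e := by
    rcases k with _ | _ | k
    · rfl
    · rfl
    · rfl
  b_plus_comp {k x y} e := by
    rcases k with _ | _ | k
    · rfl
    · rfl
    · exact e
  b_comp α {k j x y} h e := by
    rcases k with _ | _ | k <;> rcases j with _ | _ | j <;> first | omega | skip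
    all_goals cases α <;> rfl
  comp_unit_right k x := by
    rcases k with _ | _ | k
    · exact mul_one x
    · rfl
    · rfl
  comp_unit_left k x := by
    rcases k with _ | _ | k
    · exact one_mul x
    · rfl
    · rfl
  assoc {k x y z} e e' := by
    rcases k with _ | _ | k
    · exact mul_assoc x y z
    · rfl
    · rfl
  interchange {k j x x' y y'} h e e' e'' := by
    rcases k with _ | _ | k <;> rcases j with _ | _ | j <;> first | omega | skip
    all_goals rfl
  comp_two_le {k} x y h := by
    obtain ⟨k, rfl⟩ := Nat.exists_eq_add_of_le' h
    rfl

theorem chaotic_ext {M : Type} [Monoid M] {u v : (chaotic M).toOmegaCat.cell 2}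
    (h : ∀ α, (chaotic M).toOmegaCat.two.b α 1 u = (chaotic M).toOmegaCat.two.b α 1 v) : u = v := by
  have h' := fun α => Subtype.ext_iff.1 (h α)
  simp only [toOmegaCat_b] at h'
  have h₁ : (u.1.1, u.1.1) = (v.1.1, v.1.1) := h' Pol.minus
  have h₂ : (u.1.2, u.1.2) = (v.1.2, v.1.2) := h' Pol.plus
  exact Subtype.ext (Prod.ext (Prod.ext_iff.1 h₁).1 (Prod.ext_iff.1 h₂).1)

/-- The element of the monoid given by a 1-cell. -/
def chaoticVal {M : Type} [Monoid M] (x : (chaotic M).toOmegaCat.cell 1) : M := x.1.1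

theorem chaoticVal_unit {M : Type} [Monoid M] (x : (chaotic M).toOmegaCat.cell 0) :
    chaoticVal ((chaotic M).toOmegaCat.unit Nat.zero_lt_one x) = 1 := by
  have : (1 : M × M) = x.1 := x.2 Pol.minus
  exact (Prod.ext_iff.1 this).1.symm

theorem chaoticVal_comp {M : Type} [Monoid M] (x y : (chaotic M).toOmegaCat.cell 1) (e) :
    chaoticVal ((chaotic M).toOmegaCat.comp Nat.zero_lt_one x y e) =
      chaoticVal x * chaoticVal y := rfl

end Two

/-- Induction on the cells of a presented ω-category. -/
theorem Presentation.toOmegaCat_induction {p : Presentation}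
    {motive : ∀ {n : ℕ}, p.toOmegaCat.cell n → Prop}
    (gen : ∀ {n : ℕ} (g : p.G n), motive (p.gcls g))
    (bd : ∀ (α : Pol) {k n : ℕ} (h : k < n) (x : p.toOmegaCat.cell n), motive x →
      motive (p.toOmegaCat.bd α h x))
    (unit : ∀ {k n : ℕ} (h : k < n) (x : p.toOmegaCat.cell k), motive x →
      motive (p.toOmegaCat.unit h x))
    (comp : ∀ {k n : ℕ} (h : k < n) (x y : p.toOmegaCat.cell n) (e), motive x → motive y →
      motive (p.toOmegaCat.comp h x y e)) {n : ℕ} (x : p.toOmegaCat.cell n) : motive x :=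
  cell_induction (p := p) gen bd unit comp x

/-- If the images of all generators have their 1-boundaries in a set of 1-cells closed under
composition, then so do the images of all cells. -/
theorem Presentation.b_one_mem {p : Presentation} {T : OmegaCat} (hT : T.IsNCat 2)
    (F : p.toOmegaCat ⟶ T) {S : Set (T.cell 2)} (h₀ : ∀ α x, T.two.b α 0 x ∈ S)
    (hc : ∀ x ∈ S, ∀ y ∈ S, T.two.b Pol.plus 0 x = T.two.b Pol.minus 0 y → T.two.comp 0 x y ∈ S)
    (hg : ∀ {n : ℕ} (g : p.G n) (α : Pol), T.two.b α 1 (T.up (F.fn (p.gcls g))) ∈ S)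
    {n : ℕ} (x : p.toOmegaCat.cell n) (α : Pol) : T.two.b α 1 (T.up (F.fn x)) ∈ S := by
  refine toOmegaCat_induction (motive := fun x => ∀ α, T.two.b α 1 (T.up (F.fn x)) ∈ S)
    (fun g => hg g) ?_ ?_ ?_ x α
  · intro β k n h x ih α
    rw [F.fn_bd, OmegaCat.up_bd hT]
    obtain rfl | rfl | hk : k = 0 ∨ k = 1 ∨ 2 ≤ k := by omega
    · rw [T.two.b_b_le _ _ _ (Nat.zero_le _)]; exact h₀ _ _
    · rw [T.two.b_b_le _ _ _ le_rfl]; exact ih _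
    · rw [T.two.b_two_le _ _ hk]; exact ih _
  · intro k n h x ih α
    rw [F.fn_unit, OmegaCat.up_unit]
    exact ih α
  · intro k n h x y c ihx ihy α
    have c' : T.bd Pol.plus h (F.fn x) = T.bd Pol.minus h (F.fn y) := by
      rw [← F.fn_bd, ← F.fn_bd, c]
    have c'' := (OmegaCat.cmp_up hT h).2 c'
    rw [F.fn_comp h x y c c', OmegaCat.up_comp hT]
    obtain rfl | rfl | hk : k = 0 ∨ k = 1 ∨ 2 ≤ k := by omega
    · rw [T.two.b_comp _ Nat.zero_lt_one c'']
      refine hc _ (ihx α) _ (ihy α) ?_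
      rwa [T.two.b_zero_b_one, T.two.b_zero_b_one]
    · cases α
      · rw [T.two.b_minus_comp c'']; exact ihx _
      · rw [T.two.b_plus_comp c'']; exact ihy _
    · rw [T.two.comp_two_le _ _ hk]; exact ihx α

namespace MarkedTwoCat

variable (T : MarkedTwoCat)

/-- The composites of paths of distinguished 1-cells, as 2-cells. -/
def pathSet : Set (T.cat.cell 2) := {u | ∃ (x y : T.Vertex) (q : Quiver.Path x y),
  T.cat.up (T.pathComp q).1 = u}

variable {T}

theorem up_pathComp_cons {x y z : T.Vertex} (q : Quiver.Path x y) (a : y ⟶ z) :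
    T.cat.up (T.pathComp (q.cons a)).1 = T.cat.two.comp 0 (T.cat.up (T.pathComp q).1)
      (T.cat.up a.1.1) := OmegaCat.up_comp T.isTwoCat _ _ _ _

theorem b_zero_pathComp {x y : T.Vertex} (q : Quiver.Path x y) :
    T.cat.two.b Pol.minus 0 (T.cat.up (T.pathComp q).1) = T.cat.up (n := 0) x ∧
    T.cat.two.b Pol.plus 0 (T.cat.up (T.pathComp q).1) = T.cat.up (n := 0) y := by
  rw [← OmegaCat.up_bd T.isTwoCat _ Nat.zero_lt_one, ← OmegaCat.up_bd T.isTwoCat _ Nat.zero_lt_one,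
    (T.pathComp q).2.1, (T.pathComp q).2.2]
  exact ⟨rfl, rfl⟩

theorem b_zero_gen {x y : T.Vertex} (a : x ⟶ y) :
    T.cat.two.b Pol.minus 0 (T.cat.up a.1.1) = T.cat.up (n := 0) x ∧
    T.cat.two.b Pol.plus 0 (T.cat.up a.1.1) = T.cat.up (n := 0) y := by
  rw [← OmegaCat.up_bd T.isTwoCat _ Nat.zero_lt_one, ← OmegaCat.up_bd T.isTwoCat _ Nat.zero_lt_one,
    a.1.2.1, a.1.2.2]
  exact ⟨rfl, rfl⟩

theorem up_pathComp_comp {x y z : T.Vertex} (q : Quiver.Path x y) (r : Quiver.Path y z) :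
    T.cat.up (T.pathComp (q.comp r)).1 =
      T.cat.two.comp 0 (T.cat.up (T.pathComp q).1) (T.cat.up (T.pathComp r).1) := by
  induction r with
  | nil =>
    have e : T.cat.up (T.pathComp (Quiver.Path.nil (a := y))).1 = T.cat.up (n := 0) y :=
      OmegaCat.up_unit Nat.zero_lt_one _
    rw [Quiver.Path.comp_nil, e, ← (b_zero_pathComp q).2, Two.comp_unit_right]
  | cons r a ih =>
    rw [Quiver.Path.comp_cons, up_pathComp_cons, up_pathComp_cons, ih, Two.assoc]
    · rw [(b_zero_pathComp q).2, (b_zero_pathComp r).1]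
    · rw [(b_zero_pathComp r).2, (b_zero_gen a).1]

theorem b_zero_mem_pathSet (α : Pol) (u : T.cat.cell 2) : T.cat.two.b α 0 u ∈ T.pathSet := by
  refine ⟨T.cat.bd α Nat.zero_lt_two u, T.cat.bd α Nat.zero_lt_two u, .nil, ?_⟩
  rw [OmegaCat.two_b _ Nat.zero_lt_two]
  exact OmegaCat.up_unit Nat.zero_lt_one (T.cat.bd α Nat.zero_lt_two u)

theorem up_zero_mem_pathSet (x : T.cat.cell 0) : T.cat.up x ∈ T.pathSet := by
  rw [← OmegaCat.b_up Pol.minus x]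
  exact b_zero_mem_pathSet _ _

theorem gen_mem_pathSet {a : T.cat.cell 1} (ha : a ∈ T.gen) : T.cat.up a ∈ T.pathSet := by
  refine ⟨_, _, Quiver.Hom.toPath (V := T.Vertex) (a := T.cat.bd Pol.minus Nat.zero_lt_one a)
    (b := T.cat.bd Pol.plus Nat.zero_lt_one a) ⟨⟨a, rfl, rfl⟩, ha⟩, ?_⟩
  refine (up_pathComp_cons _ _).trans ?_
  have e : T.cat.up (T.pathComp (Quiver.Path.nil
      (V := T.Vertex) (a := T.cat.bd Pol.minus Nat.zero_lt_one a))).1 =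
      T.cat.two.b Pol.minus 0 (T.cat.up a) := by
    rw [← OmegaCat.up_bd T.isTwoCat _ Nat.zero_lt_one]
    exact OmegaCat.up_unit Nat.zero_lt_one _
  rw [e]
  exact Two.comp_unit_left _ _ _

theorem comp_mem_pathSet {u v : T.cat.cell 2} (hu : u ∈ T.pathSet) (hv : v ∈ T.pathSet)
    (e : T.cat.two.b Pol.plus 0 u = T.cat.two.b Pol.minus 0 v) :
    T.cat.two.comp 0 u v ∈ T.pathSet := by
  obtain ⟨x, y, q, rfl⟩ := hu
  obtain ⟨y', z, r, rfl⟩ := hv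
  rw [(b_zero_pathComp q).2, (b_zero_pathComp r).1] at e
  obtain rfl := OmegaCat.up_inj T.isTwoCat e
  exact ⟨x, z, q.comp r, up_pathComp_comp q r⟩

theorem pathComp_surjective (h : ∀ c : T.cat.cell 1, T.cat.up c ∈ T.pathSet) (x y : T.Vertex) :
    Function.Surjective fun q : Quiver.Path x y => T.pathComp q := by
  rintro ⟨c, rfl, rfl⟩
  obtain ⟨x', y', q, hq⟩ := h c
  have e := OmegaCat.up_inj T.isTwoCat hq
  obtain rfl : x' = T.cat.bd Pol.minus Nat.zero_lt_one c := by rw [← e, (T.pathComp q).2.1]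
  obtain rfl : y' = T.cat.bd Pol.plus Nat.zero_lt_one c := by rw [← e, (T.pathComp q).2.2]
  exact ⟨q, Subtype.ext e⟩

theorem pathComp_injective {X : Type} (F : T.cat ⟶ (Two.chaotic (FreeMonoid X)).toOmegaCat)
    (i : T.cat.cell 1 → X) (hi : Set.InjOn i T.gen)
    (hF : ∀ a ∈ T.gen, Two.chaoticVal (F.fn a) = FreeMonoid.of (i a)) (x y : T.Vertex) :
    Function.Injective fun q : Quiver.Path x y => T.pathComp q := by
  let φ : ∀ {x y : T.Vertex}, T.OneCell x y → FreeMonoid X := fun c => Two.chaoticVal (F.fn c.1)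
  have hnil : ∀ x, φ (T.pathComp (Quiver.Path.nil (a := x))) = 1 := fun x => by
    refine Eq.trans (congrArg Two.chaoticVal (F.fn_unit Nat.zero_lt_one x)) ?_
    exact Two.chaoticVal_unit _
  have hcons : ∀ {x y z : T.Vertex} (q : Quiver.Path x y) (a : y ⟶ z),
      φ (T.pathComp (q.cons a)) = φ (T.pathComp q) * FreeMonoid.of (i a.1.1) := fun q a => by
    have e : T.cat.bd Pol.plus Nat.zero_lt_one (T.pathComp q).1 =
      T.cat.bd Pol.minus Nat.zero_lt_one a.1.1 := (T.pathComp q).2.2.trans a.1.2.1.symm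
    refine Eq.trans (congrArg Two.chaoticVal (F.fn_comp Nat.zero_lt_one (T.pathComp q).1 a.1.1 e
      (by rw [← F.fn_bd, ← F.fn_bd, e]))) ?_
    rw [Two.chaoticVal_comp, hF _ a.2]
  have key : ∀ {y : T.Vertex} (q q' : Quiver.Path x y),
      φ (T.pathComp q) = φ (T.pathComp q') → q = q' := by
    intro y q
    induction q with
    | nil =>
      intro q' h
      cases q' with
      | nil => rfl
      | cons q' a' =>
        rw [hnil, hcons] at h
        have := congrArg FreeMonoid.length h
        simp [FreeMonoid.length_mul] at this
    | @cons y z q a ih =>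
      intro q' h
      cases q' with
      | nil =>
        rw [hnil, hcons] at h
        have := congrArg FreeMonoid.length h
        simp [FreeMonoid.length_mul] at this
      | @cons y' _ q' a' =>
        rw [hcons, hcons] at h
        obtain ⟨h₁, h₂⟩ := List.append_inj' (congrArg FreeMonoid.toList h) rfl
        have h₃ : i a.1.1 = i a'.1.1 := List.singleton_injective h₂
        have h₄ := hi a.2 a'.2 h₃
        obtain rfl : y = y' := by rw [← a.1.2.1, ← a'.1.2.1, h₄]
        obtain rfl : a = a' := Subtype.ext (Subtype.ext h₄)
        rw [ih q' (FreeMonoid.toList.injective h₁)]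
  exact fun q q' h => key q q' (congrArg φ h)

theorem isBiPro_of (h : ∀ c : T.cat.cell 1, T.cat.up c ∈ T.pathSet) {X : Type}
    (F : T.cat ⟶ (Two.chaotic (FreeMonoid X)).toOmegaCat) (i : T.cat.cell 1 → X)
    (hi : Set.InjOn i T.gen) (hF : ∀ a ∈ T.gen, Two.chaoticVal (F.fn a) = FreeMonoid.of (i a)) :
    isBiPro T := fun x y => ⟨pathComp_injective F i hi hF x y, pathComp_surjective h x y⟩

end MarkedTwoCat

/-! ### The functor from regular directed complexes to bicoloured pros -/

namespace RDCpx

open OGPoset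

variable {Q : RDCpx}

theorem pv_mem_pathSet {s t : Q.El} {l : List Q.El} (h : (cx Q.El).Walk s l t) :
    (cx Q.El).pv Q.cat.two Q.taut s l ∈ (proObj Q).pathSet := by
  have L := taut_edgeLab (Q := Q)
  induction l generalizing s with
  | nil =>
    have e : Q.taut s = Q.cat.up (atomCell Q s (Nat.le_of_eq h.2)) := (up_atomCell s _).symm
    rw [CxData.pv, e]
    exact MarkedTwoCat.up_zero_mem_pathSet (T := proObj Q) _
  | cons e l ih =>
    obtain ⟨⟨rfl, he, -⟩, h⟩ := h
    rw [CxData.pv]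
    refine MarkedTwoCat.comp_mem_pathSet (T := proObj Q) ?_ (ih h) ?_
    · have e' : Q.taut e = Q.cat.up (atomCell Q e (Nat.le_of_eq he)) := (up_atomCell e _).symm
      rw [e']
      exact MarkedTwoCat.gen_mem_pathSet (T := proObj Q) ⟨e, he, rfl⟩
    · exact (L.tgt e he).trans (L.pv_b h).2.1.symm

theorem b_one_mem_pathSet {n : ℕ} (x : Q.cat.cell n) (α : Pol) :
    Q.cat.two.b α 1 (Q.cat.up x) ∈ (proObj Q).pathSet := by
  have h₀ := MarkedTwoCat.b_zero_mem_pathSet (T := proObj Q)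
  have hc : ∀ x ∈ (proObj Q).pathSet, ∀ y ∈ (proObj Q).pathSet,
      Q.cat.two.b Pol.plus 0 x = Q.cat.two.b Pol.minus 0 y →
      Q.cat.two.comp 0 x y ∈ (proObj Q).pathSet :=
    fun x hx y hy e => MarkedTwoCat.comp_mem_pathSet (T := proObj Q) hx hy e
  refine Presentation.b_one_mem (p := coskelPres 2 (molCat Q.El)) Q.cat_isNCat (𝟙 Q.cat) h₀ hc
    (fun {n} y α => ?_) x α
  refine Presentation.b_one_mem (p := molPres Q.El) Q.cat_isNCat (coskelUnit 2 (molCat Q.El)) h₀ hc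
    (fun {n} U α => ?_) y α
  have e : Q.cat.up ((coskelUnit 2 (molCat Q.El)).fn ((molPres Q.El).gcls U)) = Q.mc U.1 U.2.1 :=
    up_molCell U
  have g := U.2.1.good Q.rdc
  obtain ⟨z, -⟩ := U.2.1.nonempty
  have hs := vsrc_spec (z := z) Q.rdc U.2.1
  rw [e, b_mc U.2.1 1 α (g.molecule 1 α) rfl, mc_eq_pv _ dimLe_bord (pathOf_bord (z := z) Q.rdc U.2.1 α)
    (by rw [g.globular 0 1 _ _ Nat.zero_lt_one, hs.1])
    (by rw [g.globular 0 1 _ _ Nat.zero_lt_one, hs.2.1])]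
  exact pv_mem_pathSet (walk_bord Q.rdc U.2.1 α)

theorem up_mem_pathSet (c : Q.cat.cell 1) : Q.cat.up c ∈ (proObj Q).pathSet := by
  rw [← OmegaCat.b_up Pol.minus c]
  exact b_one_mem_pathSet c Pol.minus

variable (Q) in
/-- The labelling of an element by the input and output paths of edges. -/
noncomputable def pathLab (x : Q.El) : FreeMonoid Q.El × FreeMonoid Q.El :=
  if dim x = 0 then 1 else if dim x = 1 then (FreeMonoid.of x, FreeMonoid.of x) else
    (FreeMonoid.ofList ((cx Q.El).inn x), FreeMonoid.ofList ((cx Q.El).out x))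

variable (Q) in
/-- The path labelling as a labelling in the chaotic 2-category. -/
noncomputable def chaoticLab (x : Q.El) :
    (Two.chaotic (FreeMonoid Q.El)).toOmegaCat.cell 2 :=
  ⟨Q.pathLab x, fun _ => Two.b_two_le _ _ _ le_rfl⟩

theorem pathLab_zero {x : Q.El} (h : dim x = 0) : Q.pathLab x = 1 := if_pos h

theorem pathLab_one {x : Q.El} (h : dim x = 1) :
    Q.pathLab x = (FreeMonoid.of x, FreeMonoid.of x) := by
  rw [pathLab, if_neg (by omega), if_pos h]

theorem pathLab_two {x : Q.El} (h : dim x = 2) : Q.pathLab x =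
    (FreeMonoid.ofList ((cx Q.El).inn x), FreeMonoid.ofList ((cx Q.El).out x)) := by
  rw [pathLab, if_neg (by omega), if_neg (by omega)]

theorem pv_chaoticLab {s t : Q.El} {l : List Q.El} (h : (cx Q.El).Walk s l t) :
    ((cx Q.El).pv (Two.chaotic (FreeMonoid Q.El)).toOmegaCat.two Q.chaoticLab s l).1 =
      (FreeMonoid.ofList l, FreeMonoid.ofList l) := by
  induction l generalizing s with
  | nil => exact pathLab_zero h.2
  | cons e l ih =>
    obtain ⟨⟨rfl, he, -⟩, h⟩ := h
    rw [CxData.pv, Two.toOmegaCat_comp _ _ rfl, ih h]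
    have : (Q.chaoticLab e).1 = _ := pathLab_one he
    rw [this]
    rfl

theorem chaoticLab_lab :
    (cx Q.El).Lab (Two.chaotic (FreeMonoid Q.El)).toOmegaCat.two Q.chaoticLab where
  zero x hx α := Subtype.ext (by
    rw [Two.toOmegaCat_b]; exact (pathLab_zero hx).symm)
  one x hx α := Subtype.ext (by
    rw [Two.toOmegaCat_b]
    have : (Q.chaoticLab x).1 = _ := pathLab_one hx
    rw [this]
    cases α <;> rfl)
  src x hx := Subtype.ext (by
    rw [Two.toOmegaCat_b]
    exact (pathLab_zero (bord_zero_Iic Q.rdc x).2.2.1).symm)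
  tgt x hx := Subtype.ext (by
    rw [Two.toOmegaCat_b]
    exact (pathLab_zero (bord_zero_Iic Q.rdc x).2.2.2).symm)
  inn x hx := Subtype.ext (by
    rw [Two.toOmegaCat_b, pv_chaoticLab ((cx_ok Q.rdc).inn_walk x hx)]
    have : (Q.chaoticLab x).1 = _ := pathLab_two hx
    rw [this]
    rfl)
  out x hx := Subtype.ext (by
    rw [Two.toOmegaCat_b, pv_chaoticLab ((cx_ok Q.rdc).out_walk x hx)]
    have : (Q.chaoticLab x).1 = _ := pathLab_two hx
    rw [this]
    rfl)

theorem balanced_chaoticLab :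
    Balanced (Two.chaotic (FreeMonoid Q.El)).toOmegaCat.two Q.chaoticLab := by
  intro x _
  have g := (IsMolecule.atom x).good Q.rdc
  have L := chaoticLab_lab (Q := Q)
  choose u hu using fun α => (g.molecule 2 α).exists_composite Q.rdc L dimLe_bord
  refine ⟨u Pol.minus, fun α => ?_⟩
  have e : u α = u Pol.minus := by
    refine Two.chaotic_ext fun β => ?_
    rw [(hu α).b_one Q.rdc L (g.molecule 2 α) x, (hu Pol.minus).b_one Q.rdc L (g.molecule 2 _) x,
      g.globular 1 2 _ _ Nat.one_lt_two, g.globular 1 2 _ _ Nat.one_lt_two]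
    have : ∀ α, vsrc x (bord 2 α (Set.Iic x)) = (cx Q.El).src x := fun α => by
      refine pointOf_eq ?_
      rw [g.globular 0 2 _ _ Nat.zero_lt_two, (bord_zero_Iic Q.rdc x).1]
    rw [this, this]
  exact e ▸ hu α

theorem isBiPro_proObj (Q : RDCpx) : MarkedTwoCat.isBiPro (proObj Q) := by
  classical
  obtain ⟨F, hF⟩ := exists_functor (Two.toOmegaCat_isNCat _) (chaoticLab_lab (Q := Q))
    balanced_chaoticLab
  have hatom : ∀ (x : Q.El) (h : dim x = 1),
      Two.chaoticVal (F.fn (atomCell Q x h.le)) = FreeMonoid.of x := by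
    intro x h
    have e := Val.unique Q.rdc chaoticLab_lab (.atom x)
      (val_Iic Q.rdc chaoticLab_lab (h.le.trans one_le_two))
      (hF (mkMol (Set.Iic x) (.atom x) fun _ hy => (dim_mono _ x hy).trans h.le))
    have e' := Subtype.ext_iff.1 e
    rw [Two.toOmegaCat_up] at e'
    exact congrArg Prod.fst (e'.trans (pathLab_one h))
  by_cases hQ : Nonempty Q.El
  · let i : Q.cat.cell 1 → Q.El := fun c => @Classical.epsilon Q.El hQ fun x =>
      ∃ h : dim x = 1, c = atomCell Q x h.le
    have hi : ∀ a ∈ (proObj Q).gen, ∃ h : dim (i a) = 1, a = atomCell Q (i a) h.le :=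
      fun a ha => @Classical.epsilon_spec Q.El (fun x => ∃ h : dim x = 1, a = atomCell Q x h.le) ha
    refine MarkedTwoCat.isBiPro_of (T := proObj Q) up_mem_pathSet F i ?_ ?_
    · intro a ha b hb e
      obtain ⟨h, ea⟩ := hi a ha
      obtain ⟨h', eb⟩ := hi b hb
      rw [ea, eb]
      congr 1
    · intro a ha
      obtain ⟨h, ea⟩ := hi a ha
      conv_lhs => rw [ea]
      exact hatom _ h
  · refine MarkedTwoCat.isBiPro_of (T := proObj Q) (X := Q.cat.cell 1) up_mem_pathSet ?_ id
      Function.injective_id.injOn ?_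
    · exact (exists_functor (Two.toOmegaCat_isNCat _) (lam := fun x => (hQ ⟨x⟩).elim)
        ⟨⟨fun x => (hQ ⟨x⟩).elim, fun x => (hQ ⟨x⟩).elim, fun x => (hQ ⟨x⟩).elim,
          fun x => (hQ ⟨x⟩).elim⟩, fun x => (hQ ⟨x⟩).elim, fun x => (hQ ⟨x⟩).elim⟩
        (fun x => (hQ ⟨x⟩).elim)).choose
    · rintro a ⟨x, -⟩
      exact (hQ ⟨x⟩).elim

end RDCpx

/-- The functor from regular directed complexes to bicoloured pros. -/
noncomputable def proFunctor : ProFunctor where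
  isBiPro := RDCpx.isBiPro_proObj
  map {Q R} f := ⟨(RDCpx.Hom.exists_cat_functor f).choose, by
    rintro a ⟨x, hx, rfl⟩
    have e := (RDCpx.Hom.exists_cat_functor f).choose_spec x hx.le
    rcases Nat.le_one_iff_eq_zero_or_eq_one.1 ((RDCpx.Hom.dim_le f x).trans hx.le) with h | h
    · refine Or.inr ⟨atomCell R (f.fn x) h.le, e.trans ?_⟩
      exact (RDCpx.unit_molCell Nat.zero_lt_one _ _ rfl).symm
    · exact Or.inl ⟨f.fn x, h, e⟩⟩
  map_id Q := by
    refine MarkedTwoCat.Hom.ext (RDCpx.hom_ext_atom fun x h => ?_)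
    exact (RDCpx.Hom.exists_cat_functor (𝟙 Q)).choose_spec x h
  map_comp {Q R S} f g := by
    refine MarkedTwoCat.Hom.ext (RDCpx.hom_ext_atom fun x h => ?_)
    refine ((RDCpx.Hom.exists_cat_functor (f ≫ g)).choose_spec x h).trans ?_
    refine Eq.symm (Eq.trans (congrArg (RDCpx.Hom.exists_cat_functor g).choose.fn
      ((RDCpx.Hom.exists_cat_functor f).choose_spec x h)) ?_)
    exact (RDCpx.Hom.exists_cat_functor g).choose_spec _ _
  map_atom f _ x h := (RDCpx.Hom.exists_cat_functor f).choose_spec x h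

theorem ProFunctor.eq (P P' : ProFunctor) : P' = P := by
  obtain ⟨_, m, _, _, h⟩ := P
  obtain ⟨_, m', _, _, h'⟩ := P'
  have : @m' = @m := by
    funext Q R f
    refine MarkedTwoCat.Hom.ext (RDCpx.hom_ext_atom fun x hx => ?_)
    rw [h, h']
  subst this
  rfl

/-! ### Colimits of bicoloured pros -/

namespace MarkedTwoCat

variable {T : MarkedTwoCat}

/-- Every 1-boundary in a bicoloured pro is the composite of a path. -/
theorem up_mem_pathSet_of_isBiPro (hT : isBiPro T) (c : T.cat.cell 1) : T.cat.up c ∈ T.pathSet := by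
  obtain ⟨q, hq⟩ := (hT (T.cat.bd Pol.minus Nat.zero_lt_one c)
    (T.cat.bd Pol.plus Nat.zero_lt_one c)).2 ⟨c, rfl, rfl⟩
  exact ⟨_, _, q, congrArg (fun d => T.cat.up d.1) hq⟩

theorem b_one_eq_up {X : OmegaCat} (α : Pol) (u : X.cell 2) :
    X.two.b α 1 u = X.up (X.bd α Nat.one_lt_two u) := X.two_b Nat.one_lt_two α u

theorem b_one_mem_pathSet_of_isBiPro (hT : isBiPro T) (α : Pol) (u : T.cat.cell 2) :
    T.cat.two.b α 1 u ∈ T.pathSet := by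
  rw [b_one_eq_up]
  exact up_mem_pathSet_of_isBiPro hT _

theorem fn_up_pathComp_nil {S : OmegaCat} (F : T.cat ⟶ S) (x : T.Vertex) :
    F.fn (T.cat.up (T.pathComp (Quiver.Path.nil (a := x))).1) = S.up (F.fn (n := 0) x) := by
  rw [← OmegaCat.up_fn]
  exact (congrArg S.up (F.fn_unit Nat.zero_lt_one x)).trans (OmegaCat.up_unit _ _)

/-- Functors that agree on 0-cells and generating 1-cells agree on composites of paths. -/
theorem fn_eq_of_mem_pathSet {S : OmegaCat} {F G : T.cat ⟶ S}
    (h₀ : ∀ x : T.cat.cell 0, F.fn x = G.fn x) (h₁ : ∀ a ∈ T.gen, F.fn a = G.fn a)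
    {u : T.cat.cell 2} (hu : u ∈ T.pathSet) : F.fn u = G.fn u := by
  obtain ⟨x, y, q, rfl⟩ := hu
  induction q with
  | nil =>
    rw [fn_up_pathComp_nil, fn_up_pathComp_nil]
    exact congrArg S.up (h₀ x)
  | cons q a ih =>
    have e : T.cat.two.b Pol.plus 0 (T.cat.up (T.pathComp q).1) =
        T.cat.two.b Pol.minus 0 (T.cat.up a.1.1) := by
      rw [(b_zero_pathComp q).2, (b_zero_gen a).1]
    rw [up_pathComp_cons, OmegaCat.fn_comp _ _ _ _ e, OmegaCat.fn_comp _ _ _ _ e, ih,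
      ← OmegaCat.up_fn F a.1.1, ← OmegaCat.up_fn G a.1.1, h₁ _ a.2]

/-- The product of the values of the edges of a path. -/
def pathVal {M : Type} [Monoid M] (γ : T.cat.cell 1 → M) {x : T.Vertex} :
    ∀ {y : T.Vertex}, Quiver.Path x y → M
  | _, .nil => 1
  | _, .cons q a => pathVal γ q * γ a.1.1

theorem pathVal_comp {M : Type} [Monoid M] (γ : T.cat.cell 1 → M) {x y z : T.Vertex}
    (q : Quiver.Path x y) (r : Quiver.Path y z) :
    pathVal γ (q.comp r) = pathVal γ q * pathVal γ r := by
  induction r with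
  | nil => exact (mul_one _).symm
  | cons r a ih => rw [Quiver.Path.comp_cons, pathVal, pathVal, ih, mul_assoc]

theorem exists_val (hT : isBiPro T) {M : Type} [Monoid M] (γ : T.cat.cell 1 → M) :
    ∃ v : T.cat.cell 1 → M, (∀ x, v (T.cat.unit Nat.zero_lt_one x) = 1) ∧
      (∀ x y e, v (T.cat.comp Nat.zero_lt_one x y e) = v x * v y) ∧ ∀ a ∈ T.gen, v a = γ a := by
  have key : ∀ c : T.cat.cell 1, ∃ m, ∀ (x y : T.Vertex) (q : Quiver.Path x y),
      (T.pathComp q).1 = c → pathVal γ q = m := by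
    intro c
    obtain ⟨x, y, q, hq⟩ := up_mem_pathSet_of_isBiPro hT c
    have hq := OmegaCat.up_inj T.isTwoCat hq
    refine ⟨pathVal γ q, fun x' y' q' hq' => ?_⟩
    obtain rfl : x' = x := by rw [← (T.pathComp q).2.1, ← (T.pathComp q').2.1, hq, hq']
    obtain rfl : y' = y := by rw [← (T.pathComp q).2.2, ← (T.pathComp q').2.2, hq, hq']
    rw [(hT _ _).1 (Subtype.ext (hq'.trans hq.symm) : T.pathComp q' = T.pathComp q)]
  choose v hv using key
  refine ⟨v, fun x => ?_, fun c d e => ?_, fun a ha => ?_⟩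
  · exact (hv _ x x .nil rfl).symm
  · obtain ⟨x, y, q, hq⟩ := up_mem_pathSet_of_isBiPro hT c
    obtain ⟨y', z, r, hr⟩ := up_mem_pathSet_of_isBiPro hT d
    obtain rfl := OmegaCat.up_inj T.isTwoCat hq
    obtain rfl := OmegaCat.up_inj T.isTwoCat hr
    obtain rfl : y = y' := by rw [← (T.pathComp q).2.2, ← (T.pathComp r).2.1, e]
    rw [← hv _ _ _ q rfl, ← hv _ _ _ r rfl, ← pathVal_comp, hv _ _ _ (q.comp r)]
    refine OmegaCat.up_inj T.isTwoCat ?_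
    rw [up_pathComp_comp, OmegaCat.up_comp T.isTwoCat]
  · have := hv a _ _ (Quiver.Path.cons (V := T.Vertex)
      (a := T.cat.bd Pol.minus Nat.zero_lt_one a) .nil
      (c := T.cat.bd Pol.plus Nat.zero_lt_one a) ⟨⟨a, rfl, rfl⟩, ha⟩) (T.cat.comp_unit_left _ _ _)
    exact this.symm.trans (one_mul _)

theorem exists_chaotic (hT : isBiPro T) {M : Type} [Monoid M] (γ : T.cat.cell 1 → M) :
    ∃ F : T.cat ⟶ (Two.chaotic M).toOmegaCat, ∀ a ∈ T.gen, Two.chaoticVal (F.fn a) = γ a := by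
  obtain ⟨v, h₁, h₂, h₃⟩ := exists_val hT γ
  let f : T.cat.cell 2 → (Two.chaotic M).toOmegaCat.cell 2 := fun u =>
    ⟨(v (T.cat.bd Pol.minus Nat.one_lt_two u), v (T.cat.bd Pol.plus Nat.one_lt_two u)),
      fun _ => Two.b_two_le _ _ _ le_rfl⟩
  refine ⟨OmegaCat.homOfTwo T.isTwoCat (Two.toOmegaCat_isNCat _) f ?_ ?_, fun a ha => ?_⟩
  · intro α k u hk
    refine Subtype.ext ?_
    rw [Two.toOmegaCat_b, OmegaCat.two_b _ hk]
    obtain rfl | rfl : k = 0 ∨ k = 1 := by omega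
    · simp only [f]
      rw [T.cat.bd_unit_gt _ Nat.zero_lt_one Nat.one_lt_two,
        T.cat.bd_unit_gt _ Nat.zero_lt_one Nat.one_lt_two, h₁]
      rfl
    · simp only [f]
      rw [T.cat.bd_unit_eq, T.cat.bd_unit_eq]
      cases α <;> rfl
  · intro k u w hk e
    rw [OmegaCat.two_b _ hk, OmegaCat.two_b _ hk] at e
    have e := OmegaCat.unit_bd_inj _ _ e
    refine Subtype.ext ?_
    rw [OmegaCat.two_comp _ hk u w e]
    obtain rfl | rfl : k = 0 ∨ k = 1 := by omega
    · have c : ∀ α, T.cat.bd Pol.plus Nat.zero_lt_one (T.cat.bd α Nat.one_lt_two u) =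
          T.cat.bd Pol.minus Nat.zero_lt_one (T.cat.bd α Nat.one_lt_two w) := fun α => by
        rw [T.cat.bd_bd, T.cat.bd_bd]; exact e
      rw [Two.toOmegaCat_comp _ _ rfl]
      simp only [f]
      rw [T.cat.bd_comp _ Nat.zero_lt_one Nat.one_lt_two _ _ e (c _),
        T.cat.bd_comp _ Nat.zero_lt_one Nat.one_lt_two _ _ e (c _), h₂, h₂]
      rfl
    · rw [Two.toOmegaCat_comp]
      · simp only [f]
        rw [T.cat.bd_minus_comp, T.cat.bd_plus_comp]
        rfl
      · change (v (T.cat.bd Pol.plus hk u), v (T.cat.bd Pol.plus hk u)) =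
          (v (T.cat.bd Pol.minus hk w), v (T.cat.bd Pol.minus hk w))
        rw [e]
  · change v (T.cat.bd Pol.minus Nat.one_lt_two (T.cat.unit Nat.one_lt_two a)) = _
    rw [T.cat.bd_unit_eq, h₃ a ha]

theorem chaotic_hom_ext (hT : isBiPro T) {M : Type} [Monoid M]
    {F G : T.cat ⟶ (Two.chaotic M).toOmegaCat}
    (h : ∀ a ∈ T.gen, Two.chaoticVal (F.fn a) = Two.chaoticVal (G.fn a)) : F = G := by
  have h1 : ∀ x y : (Two.chaotic M).toOmegaCat.cell 1, Two.chaoticVal x = Two.chaoticVal y →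
      x = y := by
    intro x y e
    have hx : (x.1.1, x.1.1) = x.1 := x.2 Pol.minus
    have hy : (y.1.1, y.1.1) = y.1 := y.2 Pol.minus
    have e : x.1.1 = y.1.1 := e
    exact Subtype.ext (by rw [← hx, ← hy, e])
  have h0 : ∀ x y : (Two.chaotic M).toOmegaCat.cell 0, x = y := fun x y =>
    Subtype.ext ((x.2 Pol.minus).symm.trans (y.2 Pol.minus))
  refine OmegaCat.hom_ext_two (Two.toOmegaCat_isNCat _) fun u => Two.chaotic_ext fun α => ?_
  rw [← OmegaCat.fn_b, ← OmegaCat.fn_b]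
  exact fn_eq_of_mem_pathSet (fun _ => h0 _ _)
    (fun a ha => h1 _ _ (h a ha)) (b_one_mem_pathSet_of_isBiPro hT α u)

end MarkedTwoCat

namespace BiProColimit

variable {J : Type} [SmallCategory J] (D : J ⥤ BiPro)

/-- The relations defining the colimit of a diagram of bicoloured pros. -/
inductive ColimRel : ∀ {n : ℕ}, Term (fun n => Σ j, (D.obj j).obj.cat.cell n) n →
    Term (fun n => Σ j, (D.obj j).obj.cat.cell n) n → Prop
  | bd (α : Pol) {k n : ℕ} (h : k < n) (j : J) (x : (D.obj j).obj.cat.cell n) :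
      ColimRel (.bd α h (.gen ⟨j, x⟩)) (.gen ⟨j, (D.obj j).obj.cat.bd α h x⟩)
  | unit {k n : ℕ} (h : k < n) (j : J) (x : (D.obj j).obj.cat.cell k) :
      ColimRel (.unit h (.gen ⟨j, x⟩)) (.gen ⟨j, (D.obj j).obj.cat.unit h x⟩)
  | comp {k n : ℕ} (h : k < n) (j : J) (x y : (D.obj j).obj.cat.cell n) (e) :
      ColimRel (.comp h (.gen ⟨j, x⟩) (.gen ⟨j, y⟩)) (.gen ⟨j, (D.obj j).obj.cat.comp h x y e⟩)
  | map {n : ℕ} {i j : J} (f : i ⟶ j) (x : (D.obj i).obj.cat.cell n) :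
      ColimRel (.gen ⟨i, x⟩) (.gen ⟨j, (D.map f).hom.functor.fn x⟩)
  | trunc {m : ℕ} (h : 2 < m) (t : Term (fun n => Σ j, (D.obj j).obj.cat.cell n) m) :
      ColimRel t (.unit h (.bd Pol.minus h t))

/-- The presentation of the colimit. -/
def pres : Presentation := ⟨fun n => Σ j, (D.obj j).obj.cat.cell n, fun s t => ColimRel D s t⟩

/-- The colimit 2-category. -/
noncomputable def cat : OmegaCat := (pres D).toOmegaCat

theorem cat_isNCat : (cat D).IsNCat 2 := by
  intro m h x
  refine ⟨(cat D).bd Pol.minus h x, ?_⟩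
  revert x
  refine Presentation.ind fun t ht => ?_
  change _ = Presentation.cunit h (Presentation.cbd Pol.minus h (Presentation.cls t ht))
  rw [Presentation.cbd_cls, Presentation.cunit_cls]
  exact Presentation.cls_eq.2 (.rel (.trunc h t) ht (.unit h (.bd _ h ht)))

theorem rel_gen {n : ℕ} (x : Σ j, (D.obj j).obj.cat.cell n) :
    (pres D).Rel (.gen x) (.gen x) := Presentation.Rel.gen (p := pres D) x

/-- The functors into the colimit. -/
noncomputable def incl (j : J) : (D.obj j).obj.cat ⟶ cat D where
  fn {n} x := (pres D).gcls (n := n) ⟨j, x⟩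
  fn_bd α k n h x := by
    refine Eq.trans ?_ (Presentation.cbd_cls (p := pres D) α h (.gen ⟨j, x⟩) (rel_gen D _)).symm
    exact Presentation.cls_eq.2 (.symm (.rel (.bd α h j x) (.bd _ _ (rel_gen D _)) (rel_gen D _)))
  fn_unit h x := by
    refine Eq.trans ?_ (Presentation.cunit_cls (p := pres D) h (.gen ⟨j, x⟩) (rel_gen D _)).symm
    exact Presentation.cls_eq.2 (.symm (.rel (.unit h j x) (.unit _ (rel_gen D _)) (rel_gen D _)))
  fn_comp {k n} h x y e e' := by
    obtain ⟨h', q⟩ := Presentation.ccomp_cls (p := pres D) h (.gen (n := n) ⟨j, x⟩) (.gen ⟨j, y⟩)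
      (rel_gen D _) (rel_gen D _) e'
    refine Eq.trans ?_ q.symm
    exact Presentation.cls_eq.2 (.symm (.rel (.comp h j x y e) h' (rel_gen D _)))

theorem incl_map {i j : J} (f : i ⟶ j) {n : ℕ} (x : (D.obj i).obj.cat.cell n) :
    (incl D j).fn ((D.map f).hom.functor.fn x) = (incl D i).fn x :=
  Presentation.cls_eq.2 (.symm (.rel (.map f x) (rel_gen D _) (rel_gen D _)))

theorem hom_ext {T : OmegaCat} {F G : cat D ⟶ T} (h : ∀ j, incl D j ≫ F = incl D j ≫ G) : F = G :=
  Presentation.hom_ext (p := pres D) fun {n} g =>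
    congrFun (congrFun (congrArg (fun (H : (D.obj g.1).obj.cat ⟶ T) (n : ℕ) => H.fn (n := n))
      (h g.1)) n) g.2

theorem exists_desc {T : OmegaCat} (hT : T.IsNCat 2) (F : ∀ j, (D.obj j).obj.cat ⟶ T)
    (hF : ∀ {i j : J} (f : i ⟶ j), (D.map f).hom.functor ≫ F j = F i) :
    ∃ G : cat D ⟶ T, ∀ j, incl D j ≫ G = F j := by
  let g : ∀ n, (Σ j, (D.obj j).obj.cat.cell n) → T.cell n := fun _ x => (F x.1).fn x.2
  have hR : ∀ {n : ℕ} (s t : Term (fun n => Σ j, (D.obj j).obj.cat.cell n) n), ColimRel D s t →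
      s.Ok T g → t.Ok T g → s.ev T g = t.ev T g := by
    intro n s t h hs ht
    cases h with
    | bd α h j x => exact ((F j).fn_bd α h x).symm
    | unit h j x => exact ((F j).fn_unit h x).symm
    | comp h j x y e =>
      exact (T.tcomp_eq _ _ _ hs.2.2).trans ((F j).fn_comp h x y e hs.2.2).symm
    | map f x =>
      exact congrFun (congrFun (congrArg (fun (H : (D.obj _).obj.cat ⟶ T) (n : ℕ) => H.fn (n := n))
        (hF f).symm) _) x
    | trunc h t =>
      obtain ⟨y, hy⟩ := hT h (s.ev T g)
      simp only [Term.ev]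
      rw [hy, T.bd_unit_eq]
  refine ⟨Presentation.lift (p := pres D) T g hR, fun j => OmegaCat.Hom.ext ?_⟩
  funext n x
  exact Presentation.lift_cls (p := pres D) T g hR (.gen ⟨j, x⟩) (rel_gen D _)

/-- The colimit 2-category, with the non-degenerate images of generating 1-cells as generators. -/
noncomputable def marked : MarkedTwoCat where
  cat := cat D
  isTwoCat := cat_isNCat D
  gen := {a | (∃ j, ∃ g ∈ (D.obj j).obj.gen, a = (incl D j).fn g) ∧
    ¬ ∃ x, a = (cat D).unit Nat.zero_lt_one x}

theorem incl_gen {j : J} {g : (D.obj j).obj.cat.cell 1} (hg : g ∈ (D.obj j).obj.gen) :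
    (incl D j).fn g ∈ (marked D).gen ∨ ∃ x, (incl D j).fn g = (cat D).unit Nat.zero_lt_one x := by
  by_cases h : ∃ x, (incl D j).fn g = (cat D).unit Nat.zero_lt_one x
  · exact Or.inr h
  · exact Or.inl ⟨⟨j, g, hg, rfl⟩, h⟩

theorem incl_mem_pathSet {j : J} {u : (D.obj j).obj.cat.cell 2} (hu : u ∈ (D.obj j).obj.pathSet) :
    (incl D j).fn u ∈ (marked D).pathSet := by
  obtain ⟨x, y, q, rfl⟩ := hu
  induction q with
  | nil =>
    rw [MarkedTwoCat.fn_up_pathComp_nil]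
    exact MarkedTwoCat.up_zero_mem_pathSet (T := marked D) _
  | cons q a ih =>
    have e : (D.obj j).obj.cat.two.b Pol.plus 0 ((D.obj j).obj.cat.up ((D.obj j).obj.pathComp q).1) =
        (D.obj j).obj.cat.two.b Pol.minus 0 ((D.obj j).obj.cat.up a.1.1) := by
      rw [(MarkedTwoCat.b_zero_pathComp q).2, (MarkedTwoCat.b_zero_gen a).1]
    rw [MarkedTwoCat.up_pathComp_cons, OmegaCat.fn_comp _ _ _ _ e]
    refine MarkedTwoCat.comp_mem_pathSet (T := marked D) ih ?_ ?_
    · rw [← OmegaCat.up_fn]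
      rcases incl_gen D a.2 with h | ⟨x, h⟩
      · exact MarkedTwoCat.gen_mem_pathSet (T := marked D) h
      · rw [h, OmegaCat.up_unit]
        exact MarkedTwoCat.up_zero_mem_pathSet (T := marked D) _
    · exact ((OmegaCat.fn_b _ _ _ _).symm.trans (congrArg _ e)).trans (OmegaCat.fn_b _ _ _ _)

theorem up_mem_pathSet (c : (cat D).cell 1) : (cat D).up c ∈ (marked D).pathSet := by
  rw [← OmegaCat.b_up Pol.minus c]
  refine Presentation.b_one_mem (p := pres D) (cat_isNCat D) (𝟙 (cat D))
    (MarkedTwoCat.b_zero_mem_pathSet (T := marked D))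
    (fun x hx y hy e => MarkedTwoCat.comp_mem_pathSet (T := marked D) hx hy e) ?_ c Pol.minus
  rintro n ⟨j, x⟩ α
  have e : (cat D).two.b α 1 ((cat D).up ((incl D j).fn x)) =
      (incl D j).fn ((D.obj j).obj.cat.two.b α 1 ((D.obj j).obj.cat.up x)) := by
    rw [OmegaCat.up_fn, OmegaCat.fn_b]
  refine Set.mem_of_eq_of_mem e ?_
  exact incl_mem_pathSet D (MarkedTwoCat.b_one_mem_pathSet_of_isBiPro (D.obj j).property _ _)

theorem marked_isBiPro : MarkedTwoCat.isBiPro (marked D) := by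
  classical
  let γ : ∀ j, (D.obj j).obj.cat.cell 1 → FreeMonoid ((cat D).cell 1) := fun j g =>
    if ∃ x, (incl D j).fn g = (cat D).unit Nat.zero_lt_one x then 1
      else FreeMonoid.of ((incl D j).fn g)
  choose F hF using fun j => MarkedTwoCat.exists_chaotic (D.obj j).property (γ j)
  obtain ⟨G, hG⟩ := exists_desc D (Two.toOmegaCat_isNCat _) F (by
    intro i j f
    refine MarkedTwoCat.chaotic_hom_ext (D.obj i).property fun a ha => ?_
    refine Eq.trans ?_ (hF i a ha).symm
    change Two.chaoticVal ((F j).fn ((D.map f).hom.functor.fn a)) = _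
    rcases (D.map f).hom.fn_gen a ha with h | ⟨x, h⟩
    · rw [hF j _ h]
      simp only [γ, incl_map]
    · rw [h, (F j).fn_unit, Two.chaoticVal_unit]
      refine (if_pos ⟨(incl D j).fn x, ?_⟩).symm
      rw [← incl_map D f, h, (incl D j).fn_unit])
  refine MarkedTwoCat.isBiPro_of (T := marked D) (up_mem_pathSet D) G id
    Function.injective_id.injOn ?_
  rintro a ⟨⟨j, g, hg, rfl⟩, ha⟩
  have e : G.fn ((incl D j).fn g) = (F j).fn g := by rw [← hG j]; rfl
  refine (congrArg Two.chaoticVal e).trans ?_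
  rw [hF j g hg]
  exact if_neg ha

/-- The colimit cocone. -/
noncomputable def cocone : Limits.Cocone D where
  pt := ⟨marked D, marked_isBiPro D⟩
  ι :=
    { app := fun j => ObjectProperty.homMk ⟨incl D j, fun _ ha => incl_gen D ha⟩
      naturality := fun i j f => by
        refine InducedCategory.Hom.ext (MarkedTwoCat.Hom.ext (OmegaCat.Hom.ext ?_))
        funext n x
        exact incl_map D f x }

theorem exists_cocone_desc (s : Limits.Cocone D) :
    ∃ m : (cocone D).pt ⟶ s.pt, ∀ j, (cocone D).ι.app j ≫ m = s.ι.app j := by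
  obtain ⟨G, hG⟩ := exists_desc D s.pt.obj.isTwoCat (fun j => (s.ι.app j).hom.functor) (by
    intro i j f
    exact congrArg (fun h => h.hom.functor) (s.w f))
  refine ⟨ObjectProperty.homMk ⟨G, ?_⟩, fun j => ?_⟩
  · rintro a ⟨⟨j, g, hg, rfl⟩, -⟩
    have e : G.fn ((incl D j).fn g) = (s.ι.app j).hom.functor.fn g := by rw [← hG j]; rfl
    rw [e]
    exact (s.ι.app j).hom.fn_gen g hg
  · exact InducedCategory.Hom.ext (MarkedTwoCat.Hom.ext (hG j))

/-- The universal property of the colimit. -/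
noncomputable def isColimit : Limits.IsColimit (cocone D) where
  desc s := (exists_cocone_desc D s).choose
  fac s j := (exists_cocone_desc D s).choose_spec j
  uniq s m hm := by
    refine InducedCategory.Hom.ext (MarkedTwoCat.Hom.ext (hom_ext D fun j => ?_))
    have := (hm j).trans ((exists_cocone_desc D s).choose_spec j).symm
    exact congrArg (fun h => h.hom.functor) this

end BiProColimit

instance biPro_hasColimits : Limits.HasColimits BiPro where
  has_colimits_of_shape _ _ := ⟨fun D => ⟨⟨⟨_, BiProColimit.isColimit D⟩⟩⟩⟩

instance (P : ProFunctor) : embedding.HasPointwiseLeftKanExtension P.functor :=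
  fun _ => inferInstanceAs (Limits.HasColimit _)

/-! ### Morphisms out of the bicoloured pro of a regular directed complex -/

section Map

variable {P : Type} {K : CxData P} {X Y : OmegaCat} (F : X ⟶ Y) {lam : P → X.cell 2}

theorem CxData.EdgeLab.map (L : K.EdgeLab X.two lam) :
    K.EdgeLab Y.two (fun x => F.fn (lam x)) where
  zero x hx α := by rw [← OmegaCat.fn_b, L.zero x hx]
  one x hx α := by rw [← OmegaCat.fn_b, L.one x hx]
  src x hx := by rw [← OmegaCat.fn_b, L.src x hx]
  tgt x hx := by rw [← OmegaCat.fn_b, L.tgt x hx]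

theorem CxData.EdgeLab.pv_map (L : K.EdgeLab X.two lam) {s t : P} {l : List P}
    (h : K.Walk s l t) :
    K.pv Y.two (fun x => F.fn (lam x)) s l = F.fn (K.pv X.two lam s l) := by
  induction l generalizing s with
  | nil => rfl
  | cons e l ih =>
    obtain ⟨⟨rfl, he, -⟩, h⟩ := h
    rw [CxData.pv, CxData.pv, ih h, OmegaCat.fn_comp]
    rw [L.tgt e he, (L.pv_b h).2.1]

theorem CxData.Lab.map (L : K.Lab X.two lam) (hK : K.Ok) :
    K.Lab Y.two (fun x => F.fn (lam x)) where
  toEdgeLab := L.toEdgeLab.map F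
  inn x hx := by rw [← OmegaCat.fn_b, L.inn x hx, L.toEdgeLab.pv_map F (hK.inn_walk x hx)]
  out x hx := by rw [← OmegaCat.fn_b, L.out x hx, L.toEdgeLab.pv_map F (hK.out_walk x hx)]

theorem CxData.Rw.map (L : K.Lab X.two lam) (hK : K.Ok) {s t : P} {xs p q : List P} {u : X.cell 2}
    (hr : K.Rw X.two lam s xs p q u) (hx : ∀ x ∈ xs, K.dim x = 2) (h : K.Walk s p t) :
    K.Rw Y.two (fun x => F.fn (lam x)) s xs p q (F.fn u) := by
  induction xs generalizing p u with
  | nil =>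
    obtain ⟨rfl, rfl⟩ := hr
    exact ⟨rfl, (L.toEdgeLab.pv_map F h).symm⟩
  | cons x xs ih =>
    obtain ⟨a, b, v, rfl, hr, rfl⟩ := hr
    have hx2 := hx x (by simp)
    have hxs := fun y hy => hx y (List.mem_cons_of_mem x hy)
    have h' := hK.walk_split hx2 h
    have hs := hK.walk_step hx2 h
    refine ⟨a, b, F.fn v, rfl, ih hr hxs hs, ?_⟩
    have c₁ : X.two.b Pol.plus 0 (lam x) = X.two.b Pol.minus 0 (K.pv X.two lam (K.tgt x) b) := by
      rw [(L.face_b hK hx2).2, (L.pv_b h'.2).2.1]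
    rw [OmegaCat.fn_comp, wh, wh, OmegaCat.fn_comp, OmegaCat.fn_comp _ _ _ _ c₁,
      L.toEdgeLab.pv_map F h'.1, L.toEdgeLab.pv_map F h'.2]
    · rw [X.two.b_minus_comp c₁, (L.face_b hK hx2).1, (L.pv_b h'.1).2.2]
    · rw [(L.wh_b hK hx2 h'.1 h'.2).2, (hr.b L hK hxs hs).1]

end Map

theorem Composite.map {P : Type} [OGPoset P] [Finite P] (hP : IsRDC P) {X Y : OmegaCat}
    (F : X ⟶ Y) {lam : P → X.cell 2} (L : (cx P).Lab X.two lam) {U : Set P} (hU : IsMolecule U)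
    {u : X.cell 2} (h : Composite X.two lam U u) :
    Composite Y.two (fun x => F.fn (lam x)) U (F.fn u) := by
  obtain ⟨z, xs, nd, hx, hr⟩ := h
  exact ⟨z, xs, nd, hx, hr.map F L (cx_ok hP) (fun x h => ((hx x).1 h).2) (walk_bord hP hU _)⟩

/-- The generating 1-cells and the units on 0-cells, as 2-cells. -/
def MarkedTwoCat.IsLetter (T : MarkedTwoCat) (u : T.cat.cell 2) : Prop :=
  (∃ a ∈ T.gen, T.cat.up a = u) ∨ T.cat.two.b Pol.minus 0 u = u

theorem MarkedTwoCat.IsLetter.b_one {T : MarkedTwoCat} {u : T.cat.cell 2} (h : T.IsLetter u)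
    (α : Pol) : T.cat.two.b α 1 u = u := by
  rcases h with ⟨a, -, rfl⟩ | h
  · exact OmegaCat.b_up _ _
  · rw [← h, T.cat.two.b_b_le _ _ _ (Nat.zero_le 1)]

namespace RDCpx

open OGPoset

/-- A labelling of the elements of `Q` by 2-cells, such that edges are labelled by generating
1-cells or units and every element is labelled by the composite of its boundary. -/
structure Labelling (Q : RDCpx) (T : MarkedTwoCat) (lam : Q.El → T.cat.cell 2) : Prop where
  lab : (cx Q.El).Lab T.cat.two lam
  val : ∀ x, Val T.cat.two lam (Set.Iic x) (lam x)
  edge : ∀ x, dim x = 1 → T.IsLetter (lam x)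

/-- The conditions for a labelling that concern one element. -/
structure LabelledAt (Q : RDCpx) (T : MarkedTwoCat) (lam : Q.El → T.cat.cell 2) (x : Q.El) :
    Prop where
  zero : dim x = 0 → ∀ α, T.cat.two.b α 0 (lam x) = lam x
  one : dim x = 1 → T.cat.two.b Pol.minus 0 (lam x) = lam ((cx Q.El).src x) ∧
    T.cat.two.b Pol.plus 0 (lam x) = lam ((cx Q.El).tgt x) ∧ T.IsLetter (lam x)
  two : dim x = 2 → T.cat.two.b Pol.minus 1 (lam x) =
      (cx Q.El).pv T.cat.two lam ((cx Q.El).src x) ((cx Q.El).inn x) ∧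
    T.cat.two.b Pol.plus 1 (lam x) =
      (cx Q.El).pv T.cat.two lam ((cx Q.El).src x) ((cx Q.El).out x)
  val : 2 < dim x → (cx Q.El).Lab T.cat.two lam → Val T.cat.two lam (Set.Iic x) (lam x)

variable {Q R : RDCpx} {T S : MarkedTwoCat}

/-- The labelling given by a morphism. -/
noncomputable def label (m : proObj Q ⟶ T) (x : Q.El) : T.cat.cell 2 := m.functor.fn (Q.taut x)

theorem labelling_label (m : proObj Q ⟶ T) : Q.Labelling T (label m) where
  lab := taut_lab.map m.functor (cx_ok Q.rdc)
  val x α := (val_mc (.atom x) α).map Q.rdc m.functor taut_lab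
    (((IsMolecule.atom x).good Q.rdc).molecule 2 α)
  edge x hx := by
    have e : label m x = T.cat.up (m.functor.fn (atomCell Q x hx.le)) := by
      rw [label, ← up_atomCell x hx.le]
      exact (OmegaCat.up_fn m.functor _).symm
    rcases m.fn_gen (atomCell Q x hx.le) ⟨x, hx, rfl⟩ with h | ⟨v, h⟩
    · exact Or.inl ⟨_, h, e.symm⟩
    · right
      rw [e, h, OmegaCat.up_unit, OmegaCat.b_up]

theorem hom_ext_label {m m' : proObj Q ⟶ T} (h : ∀ x, label m x = label m' x) : m = m' := by
  refine MarkedTwoCat.Hom.ext (hom_ext_atom fun x hx => OmegaCat.up_inj T.isTwoCat ?_)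
  have e : ∀ F : Q.cat ⟶ T.cat, T.cat.up (F.fn (atomCell Q x hx)) = F.fn (Q.taut x) := fun F => by
    rw [OmegaCat.up_fn, up_atomCell]
  exact (e _).trans ((h x).trans (e _).symm)

theorem Labelling.exists_hom {lam : Q.El → T.cat.cell 2} (h : Q.Labelling T lam) :
    ∃ m : proObj Q ⟶ T, ∀ x, label m x = lam x := by
  obtain ⟨F, hF⟩ := exists_functor T.isTwoCat h.lab fun x _ => ⟨_, h.val x⟩
  have e : ∀ {n : ℕ} (x : Q.El) (hx : dim x ≤ n), T.cat.up (F.fn (atomCell Q x hx)) = lam x :=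
    fun x hx => Val.unique Q.rdc h.lab (.atom x) (h.val x)
      (hF (mkMol (Set.Iic x) (.atom x) fun _ hy => (dim_mono _ x hy).trans hx))
  refine ⟨⟨F, ?_⟩, fun x => ?_⟩
  · rintro a ⟨x, hx, rfl⟩
    rcases h.edge x hx with ⟨a, ha, h'⟩ | h'
    · rw [← e x hx.le] at h'
      exact Or.inl (OmegaCat.up_inj T.isTwoCat h' ▸ ha)
    · refine Or.inr ⟨T.cat.bd Pol.minus Nat.zero_lt_one (F.fn (atomCell Q x hx.le)), ?_⟩
      refine OmegaCat.up_inj T.isTwoCat ?_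
      rw [OmegaCat.up_unit, OmegaCat.up_bd T.isTwoCat, e, h']
  · rw [← e x le_rfl, OmegaCat.up_fn, up_atomCell]
    rfl

theorem label_map (P : ProFunctor) (f : Q ⟶ R) (m : proObj R ⟶ T) (x : Q.El) :
    label (P.map f ≫ m) x = label m (f.fn x) := by
  have e : (P.map f).functor.fn (Q.taut x) = R.taut (f.fn x) := by
    rw [← up_atomCell x le_rfl, ← up_atomCell (f.fn x) (Hom.dim_le f x), ← P.map_atom f x le_rfl]
    exact (OmegaCat.up_fn _ _).symm
  exact congrArg m.functor.fn e

theorem label_comp (m : proObj Q ⟶ T) (n : T ⟶ S) (x : Q.El) :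
    label (m ≫ n) x = n.functor.fn (label m x) := rfl

theorem Labelling.comp {lam : R.El → T.cat.cell 2} (h : R.Labelling T lam) (f : Q ⟶ R) :
    Q.Labelling T (lam ∘ f.fn) := by
  obtain ⟨m, hm⟩ := h.exists_hom
  have e : lam ∘ f.fn = label (proFunctor.map f ≫ m) := by
    funext x
    rw [label_map, hm]
    rfl
  exact e ▸ labelling_label _

/-- Being a labelling may be checked on single elements or on complexes covering them. -/
theorem Labelling.of_cover {lam : Q.El → T.cat.cell 2}
    (h : ∀ x : Q.El, (∃ (R : RDCpx) (f : R ⟶ Q) (t : R.El), f.fn t = x ∧ dim t = dim x ∧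
      R.Labelling T (lam ∘ f.fn)) ∨ Q.LabelledAt T lam x) : Q.Labelling T lam := by
  have L₁ : (cx Q.El).EdgeLab T.cat.two lam := by
    constructor
    · intro x hx α
      rcases h x with ⟨R, f, t, rfl, ht, L⟩ | L
      · exact L.lab.zero t (ht.trans hx) α
      · exact L.zero hx α
    · intro x hx α
      rcases h x with ⟨R, f, t, rfl, ht, L⟩ | L
      · exact L.lab.one t (ht.trans hx) α
      · exact (L.one hx).2.2.b_one α
    · intro x hx
      rcases h x with ⟨R, f, t, rfl, ht, L⟩ | L
      · exact (L.lab.src t (ht.trans hx)).trans (congrArg lam (Hom.fn_src f t))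
      · exact (L.one hx).1
    · intro x hx
      rcases h x with ⟨R, f, t, rfl, ht, L⟩ | L
      · exact (L.lab.tgt t (ht.trans hx)).trans (congrArg lam (Hom.fn_tgt f t))
      · exact (L.one hx).2.1
  have L₂ : (cx Q.El).Lab T.cat.two lam := by
    refine ⟨L₁, fun x hx => ?_, fun x hx => ?_⟩
    · rcases h x with ⟨R, f, t, rfl, ht, L⟩ | L
      · have hw := (cx_ok R.rdc).inn_walk t (ht.trans hx)
        refine (L.lab.inn t (ht.trans hx)).trans ((Hom.pv_img f L₁ hw).symm.trans ?_)
        rw [Hom.fn_src]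
        exact congrArg _ (Hom.img_pathList f t _)
      · exact (L.two hx).1
    · rcases h x with ⟨R, f, t, rfl, ht, L⟩ | L
      · have hw := (cx_ok R.rdc).out_walk t (ht.trans hx)
        refine (L.lab.out t (ht.trans hx)).trans ((Hom.pv_img f L₁ hw).symm.trans ?_)
        rw [Hom.fn_src]
        exact congrArg _ (Hom.img_pathList f t _)
      · exact (L.two hx).2
  refine ⟨L₂, fun x => ?_, fun x hx => ?_⟩
  · rcases h x with ⟨R, f, t, rfl, ht, L⟩ | L
    · intro α
      obtain ⟨u, hu⟩ := (((IsMolecule.atom (f.fn t)).good Q.rdc).molecule 2 α).exists_composite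
        Q.rdc L₂ dimLe_bord
      have e := (L.val t α).unique R.rdc L.lab (((IsMolecule.atom t).good R.rdc).molecule 2 α)
        dimLe_bord (Hom.composite_bord f L₂ hu)
      have e : u = lam (f.fn t) := e
      rwa [e] at hu
    · rcases Nat.lt_or_ge 2 (dim x) with hx | hx
      · exact L.val hx L₂
      · exact val_Iic Q.rdc L₂ hx
  · rcases h x with ⟨R, f, t, rfl, ht, L⟩ | L
    · exact L.edge t (ht.trans hx)
    · exact (L.one hx).2.2

end RDCpx

/-! ### Closed embeddings and density of atoms -/

open OGPoset

/-- Embeddings of oriented graded posets onto a closed subset. -/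
structure ClosedEmb {X P : Type} [OGPoset X] [OGPoset P] (v : X → P) : Prop where
  le_iff : ∀ {a b}, v a ≤ v b ↔ a ≤ b
  lower : IsLowerSet (Set.range v)
  dim_eq : ∀ a, dim (v a) = dim a
  orient_eq : ∀ {a b} (h : a ⋖ b) (h' : v a ⋖ v b), orient h = orient h'

namespace ClosedEmb

variable {X P : Type} [OGPoset X] [OGPoset P] {v : X → P}

theorem lt_iff (h : ClosedEmb v) {a b : X} : v a < v b ↔ a < b := by
  rw [lt_iff_le_not_ge, lt_iff_le_not_ge, h.le_iff, h.le_iff]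

theorem injective (h : ClosedEmb v) : Function.Injective v := fun _ _ e =>
  le_antisymm (h.le_iff.1 e.le) (h.le_iff.1 e.ge)

theorem covBy_iff (h : ClosedEmb v) {a b : X} : v a ⋖ v b ↔ a ⋖ b := by
  constructor
  · exact fun c => ⟨h.lt_iff.1 c.1, fun d h₁ h₂ => c.2 (h.lt_iff.2 h₁) (h.lt_iff.2 h₂)⟩
  · refine fun c => ⟨h.lt_iff.2 c.1, fun d h₁ h₂ => ?_⟩
    obtain ⟨d, rfl⟩ := h.lower h₂.le ⟨b, rfl⟩
    exact c.2 (h.lt_iff.1 h₁) (h.lt_iff.1 h₂)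

theorem preimage_Iic (h : ClosedEmb v) (a : X) : v ⁻¹' Set.Iic (v a) = Set.Iic a := by
  ext b
  exact h.le_iff

theorem Iic_subset (h : ClosedEmb v) (a : X) : Set.Iic (v a) ⊆ Set.range v :=
  fun _ hb => h.lower hb ⟨a, rfl⟩

theorem mem_sbord_iff (h : ClosedEmb v) {U : Set P} (hU : U ⊆ Set.range v) {n : ℕ} {α : Pol}
    {a : X} : a ∈ sbord n α (v ⁻¹' U) ↔ v a ∈ sbord n α U := by
  constructor
  · rintro ⟨h₁, h₂, h₃⟩
    refine ⟨h₁, (h.dim_eq a).trans h₂, fun y hy c => ?_⟩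
    obtain ⟨b, rfl⟩ := hU hy
    rw [← h.orient_eq (h.covBy_iff.1 c) c]
    exact h₃ b hy _
  · rintro ⟨h₁, h₂, h₃⟩
    refine ⟨h₁, (h.dim_eq a).symm.trans h₂, fun b hb c => ?_⟩
    rw [h.orient_eq c (h.covBy_iff.2 c)]
    exact h₃ _ hb _

theorem bord_preimage (h : ClosedEmb v) {U : Set P} (hU : U ⊆ Set.range v) (n : ℕ) (α : Pol) :
    bord n α (v ⁻¹' U) = v ⁻¹' bord n α U := by
  ext a
  constructor
  · rintro (⟨y, hy, hay⟩ | ⟨ha, hd⟩)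
    · exact Or.inl ⟨v y, (h.mem_sbord_iff hU).1 hy, h.le_iff.2 hay⟩
    · refine Or.inr ⟨ha, fun y hy hay => ?_⟩
      obtain ⟨b, rfl⟩ := hU hy
      rw [h.dim_eq]
      exact hd b hy (h.le_iff.1 hay)
  · rintro (⟨y, hy, hay⟩ | ⟨ha, hd⟩)
    · obtain ⟨b, rfl⟩ := hU hy.1
      exact Or.inl ⟨b, (h.mem_sbord_iff hU).2 hy, h.le_iff.1 hay⟩
    · refine Or.inr ⟨ha, fun y hy hay => ?_⟩
      rw [← h.dim_eq]
      exact hd _ hy (h.le_iff.2 hay)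

theorem bord_Iic (h : ClosedEmb v) (a : X) (n : ℕ) (α : Pol) :
    bord n α (Set.Iic a) = v ⁻¹' bord n α (Set.Iic (v a)) := by
  rw [← h.bord_preimage (h.Iic_subset a), h.preimage_Iic]

theorem bord_Iic_image (h : ClosedEmb v) (a : X) (n : ℕ) (α : Pol) :
    bord n α (Set.Iic (v a)) = v '' bord n α (Set.Iic a) := by
  rw [h.bord_Iic, Set.image_preimage_eq_of_subset]
  exact (bord_subset (isLowerSet_Iic _)).trans (h.Iic_subset a)

theorem isMolecule (h : ClosedEmb v) {U : Set P} (hm : IsMolecule U) (hU : U ⊆ Set.range v) :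
    IsMolecule (v ⁻¹' U) := by
  induction hm with
  | atom x =>
    obtain ⟨a, rfl⟩ := hU (Set.mem_Iic.2 le_rfl)
    rw [h.preimage_Iic]
    exact .atom a
  | paste n U V _ _ hU' hV' h₁ h₂ ih ih' =>
    have sU := Set.subset_union_left.trans hU
    have sV := Set.subset_union_right.trans hU
    have strict : ∀ W ⊂ U ∪ V, v ⁻¹' W ⊂ v ⁻¹' U ∪ v ⁻¹' V := fun W hW => by
      refine ⟨Set.preimage_mono hW.1, fun hs => hW.2 fun x hx => ?_⟩
      obtain ⟨a, rfl⟩ := hU hx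
      exact hs hx
    rw [Set.preimage_union]
    refine .paste n _ _ (ih sU) (ih' sV) (strict U hU') (strict V hV') ?_ ?_
    · rw [h.bord_preimage sU, ← h₁, Set.preimage_inter]
    · rw [h.bord_preimage sV, ← h₂, Set.preimage_inter]

theorem isRDC (h : ClosedEmb v) (hP : IsRDC P) : IsRDC X where
  spherical_zero x hx := by
    rw [h.bord_Iic, h.bord_Iic, ← Set.preimage_inter, hP.spherical_zero _ (h.dim_eq x ▸ hx),
      Set.preimage_empty]
  spherical_succ x k hk := by
    simp only [h.bord_Iic]
    rw [← Set.preimage_inter, hP.spherical_succ _ _ (h.dim_eq x ▸ hk), Set.preimage_union]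
  molecule x n α hx := by
    rw [h.bord_Iic]
    exact h.isMolecule (hP.molecule _ n α ((h.dim_eq x).trans hx))
      ((bord_subset (isLowerSet_Iic _)).trans (h.Iic_subset x))
  globular x n α β hx := by
    rw [h.bord_Iic, h.bord_Iic, h.bord_preimage ((bord_subset (isLowerSet_Iic _)).trans
      (h.Iic_subset x)), hP.globular _ n α β ((h.dim_eq x).trans hx)]

end ClosedEmb

/-- The structure of oriented graded poset induced on a closed subset. -/
abbrev OGPoset.pull {X P : Type} [OGPoset P] (v : X → P) (hv : Function.Injective v)
    (hl : IsLowerSet (Set.range v)) : OGPoset X :=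
  letI : PartialOrder X := PartialOrder.lift v hv
  have c : ∀ {a b : X}, a ⋖ b → v a ⋖ v b := fun {a b} h => ⟨h.1, fun d h₁ h₂ => by
    obtain ⟨d, rfl⟩ := hl h₂.le ⟨b, rfl⟩
    exact h.2 h₁ h₂⟩
  { dim := fun x => dim (v x)
    dim_of_isMin := fun x hx => dim_of_isMin _ fun y hy => by
      obtain ⟨y, rfl⟩ := hl hy ⟨x, rfl⟩
      exact hx hy
    dim_of_covBy := fun _ _ h => dim_of_covBy _ _ (c h)
    orient := fun h => orient (c h) }

namespace RDCpx

/-- A closed subset of a regular directed complex is the image of a closed embedding of regular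
directed complexes. -/
theorem exists_closedEmb {P : Type} [OGPoset P] [Finite P] (hP : IsRDC P) {U : Set P}
    (hU : IsLowerSet U) : ∃ (R : RDCpx) (v : R.El → P), ClosedEmb v ∧ Set.range v = U := by
  obtain ⟨m, ⟨e⟩⟩ := Finite.exists_equiv_fin U
  let v : Fin m → P := fun i => (e.symm i).1
  have hv : Function.Injective v := Subtype.val_injective.comp e.symm.injective
  have hr : Set.range v = U := by
    ext x
    exact ⟨fun ⟨i, hi⟩ => hi ▸ (e.symm i).2, fun hx => ⟨e ⟨x, hx⟩, by simp [v]⟩⟩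
  let I : OGPoset (Fin m) := OGPoset.pull v hv (hr ▸ hU)
  have hc : @ClosedEmb (Fin m) P I _ v :=
    ⟨Iff.rfl, hr ▸ hU, fun _ => rfl, fun _ _ => rfl⟩
  exact ⟨⟨m, I, @ClosedEmb.isRDC (Fin m) P I _ v hc hP⟩, v, hc, hr⟩

variable {Q R : RDCpx}

/-- The closure of an element. -/
noncomputable def cl (Q : RDCpx) (x : Q.El) : RDCpx :=
  (exists_closedEmb Q.rdc (isLowerSet_Iic x)).choose

theorem exists_clι (x : Q.El) : ∃ v : (Q.cl x).El → Q.El, ClosedEmb v ∧ Set.range v = Set.Iic x :=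
  (exists_closedEmb Q.rdc (isLowerSet_Iic x)).choose_spec

/-- The inclusion of the closure of an element. -/
noncomputable def clι (x : Q.El) : Q.cl x ⟶ Q where
  fn := (exists_clι x).choose
  bord_fn a n α := (exists_clι x).choose_spec.1.bord_Iic_image a n α

theorem clι_closedEmb (x : Q.El) : ClosedEmb (clι x).fn := (exists_clι x).choose_spec.1

theorem range_clι (x : Q.El) : Set.range (clι x).fn = Set.Iic x := (exists_clι x).choose_spec.2

theorem exists_clTop (x : Q.El) : ∃ t, (clι x).fn t = x := by
  have : x ∈ Set.range (clι x).fn := range_clι x ▸ Set.mem_Iic.2 le_rfl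
  exact this

/-- The greatest element of the closure of an element. -/
noncomputable def clTop (x : Q.El) : (Q.cl x).El := (exists_clTop x).choose

theorem clι_clTop (x : Q.El) : (clι x).fn (clTop x) = x := (exists_clTop x).choose_spec

theorem dim_clTop (x : Q.El) : dim (clTop x) = dim x := by
  rw [← (clι_closedEmb x).dim_eq, clι_clTop]

theorem le_clTop (x : Q.El) (a : (Q.cl x).El) : a ≤ clTop x := by
  rw [← (clι_closedEmb x).le_iff, clι_clTop]
  have : (clι x).fn a ∈ Set.Iic x := range_clι x ▸ ⟨a, rfl⟩
  exact this

theorem cl_isAtomShape (x : Q.El) : isAtomShape (Q.cl x) := ⟨clTop x, le_clTop x⟩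

theorem Hom.fn_mono (f : Q ⟶ R) {a b : Q.El} (h : a ≤ b) : f.fn a ≤ f.fn b := by
  obtain ⟨N, hN⟩ := Q.exists_dim_bound
  have e : ∀ (n : ℕ), N ≤ n → bord n Pol.plus (Set.Iic b) = Set.Iic b := fun n hn =>
    bord_eq_self (isLowerSet_Iic b) fun y _ => (hN y).trans hn
  have h₁ := f.bord_fn b N Pol.plus
  rw [e N le_rfl] at h₁
  have : f.fn a ∈ bord N Pol.plus (Set.Iic (f.fn b)) := h₁ ▸ ⟨a, h, rfl⟩
  exact bord_subset (isLowerSet_Iic _) this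

theorem exists_lift {Y : RDCpx} (f : R ⟶ Q) (w : Y ⟶ Q) (hw : ClosedEmb w.fn)
    (h : ∀ a, f.fn a ∈ Set.range w.fn) : ∃ g : R ⟶ Y, g ≫ w = f := by
  choose g hg using h
  refine ⟨⟨g, fun a n α => ?_⟩, Hom.ext (funext hg)⟩
  refine hw.injective.image_injective ?_
  rw [← hw.bord_Iic_image, hg, f.bord_fn, Set.image_image]
  simp only [hg]

variable (P : ProFunctor) {T : BiPro}

/-- A compatible family of morphisms from the bicoloured pros of the atoms over `Q` glues. -/
theorem exists_glue (s : ∀ (A : RDCpx), isAtomShape A → (A ⟶ Q) → (proObj A ⟶ T.obj))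
    (hs : ∀ {A B : RDCpx} (hA : isAtomShape A) (hB : isAtomShape B) (h : A ⟶ B) (g : B ⟶ Q),
      s A hA (h ≫ g) = P.map h ≫ s B hB g) :
    ∃ m : proObj Q ⟶ T.obj, ∀ (A : RDCpx) (hA : isAtomShape A) (g : A ⟶ Q),
      P.map g ≫ m = s A hA g := by
  let lam : Q.El → T.obj.cat.cell 2 := fun x =>
    label (s (Q.cl x) (cl_isAtomShape x) (clι x)) (clTop x)
  have key : ∀ (A : RDCpx) (hA : isAtomShape A) (g : A ⟶ Q) (a : A.El),
      label (s A hA g) a = lam (g.fn a) := by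
    intro A hA g a
    obtain ⟨p, hp⟩ := exists_lift (clι a ≫ g) (clι (g.fn a)) (clι_closedEmb _) fun b => by
      rw [range_clι]
      have : g.fn ((clι a).fn b) ≤ g.fn ((clι a).fn (clTop a)) :=
        Hom.fn_mono g (Hom.fn_mono (clι a) (le_clTop a b))
      rwa [clι_clTop] at this
    have hp' : p.fn (clTop a) = clTop (g.fn a) := by
      refine (clι_closedEmb (g.fn a)).injective ?_
      have : (p ≫ clι (g.fn a)).fn (clTop a) = (clι a ≫ g).fn (clTop a) := by rw [hp]
      refine this.trans ?_
      rw [clι_clTop]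
      exact congrArg g.fn (clι_clTop a)
    have h₁ := hs (cl_isAtomShape a) hA (clι a) g
    have h₂ := hs (cl_isAtomShape a) (cl_isAtomShape (g.fn a)) p (clι (g.fn a))
    rw [hp, h₁] at h₂
    have := congrArg (fun m => label m (clTop a)) h₂
    simp only [label_map, clι_clTop, hp'] at this
    exact this
  have hL : Q.Labelling T.obj lam := by
    refine Labelling.of_cover fun x =>
      Or.inl ⟨Q.cl x, clι x, clTop x, clι_clTop x, dim_clTop x, ?_⟩
    have e : lam ∘ (clι x).fn = label (s (Q.cl x) (cl_isAtomShape x) (clι x)) :=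
      funext fun a => (key _ _ _ a).symm
    exact e ▸ labelling_label _
  obtain ⟨m, hm⟩ := hL.exists_hom
  refine ⟨m, fun A hA g => hom_ext_label fun a => ?_⟩
  rw [label_map, hm, key]

theorem hom_ext_atomShape {m m' : proObj Q ⟶ T.obj} (h : ∀ (A : RDCpx), isAtomShape A →
    ∀ g : A ⟶ Q, P.map g ≫ m = P.map g ≫ m') : m = m' := by
  refine hom_ext_label fun x => ?_
  have := congrArg (fun m => label m (clTop x)) (h _ (cl_isAtomShape x) (clι x))
  simpa only [label_map, clι_clTop] using this

end RDCpx

/-- A map from an atom, as an object of the comma category. -/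
abbrev RDCpx.overAtom {A Q : RDCpx} (hA : RDCpx.isAtomShape A) (g : A ⟶ Q) :
    CostructuredArrow RDCpx.isAtomShape.ι Q :=
  CostructuredArrow.mk (S := RDCpx.isAtomShape.ι)
    (Y := (⟨A, hA⟩ : RDCpx.isAtomShape.FullSubcategory)) g

/-- The functor of bicoloured pros is determined by its values on atoms. -/
theorem isLeftKanExtension_atomShape (P : ProFunctor) :
    P.functor.IsLeftKanExtension (𝟙 (RDCpx.isAtomShape.ι ⋙ P.functor)) := by
  suffices h : Nonempty (Functor.LeftExtension.mk P.functor
      (𝟙 (RDCpx.isAtomShape.ι ⋙ P.functor))).IsPointwiseLeftKanExtension from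
    h.some.isLeftKanExtension
  refine ⟨fun Q => ?_⟩
  have ex : ∀ s : Limits.Cocone (CostructuredArrow.proj RDCpx.isAtomShape.ι Q ⋙
      RDCpx.isAtomShape.ι ⋙ P.functor), ∃ m : proObj Q ⟶ s.pt.obj, ∀ (A : RDCpx)
      (hA : RDCpx.isAtomShape A) (g : A ⟶ Q), P.map g ≫ m =
        (s.ι.app (RDCpx.overAtom hA g)).hom := by
    intro s
    refine RDCpx.exists_glue P (T := s.pt) (fun A hA g =>
      (s.ι.app (RDCpx.overAtom hA g)).hom) ?_
    intro A B hA hB h g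
    have := s.w (CostructuredArrow.homMk (ObjectProperty.homMk h) rfl :
      RDCpx.overAtom hA (h ≫ g) ⟶ RDCpx.overAtom hB g)
    exact (congrArg (fun k => k.hom) this).symm
  choose m hm using ex
  have e : ∀ {A : RDCpx} (hA : RDCpx.isAtomShape A) (g : A ⟶ Q),
      ((Functor.LeftExtension.mk P.functor (𝟙 (RDCpx.isAtomShape.ι ⋙
        P.functor))).coconeAt Q).ι.app (RDCpx.overAtom hA g) = P.functor.map g :=
    fun hA g => Category.id_comp _
  refine ⟨fun s => ObjectProperty.homMk (m s), fun s g => ?_, fun s n hn => ?_⟩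
  · refine InducedCategory.Hom.ext ?_
    refine Eq.trans ?_ (hm s g.left.obj g.left.property g.hom)
    exact congrArg (fun k => k.hom ≫ m s) (e g.left.property g.hom)
  · refine InducedCategory.Hom.ext (RDCpx.hom_ext_atomShape P (T := s.pt) fun A hA g => ?_)
    refine Eq.trans ?_ (hm s A hA g).symm
    refine Eq.trans ?_ (congrArg (fun k => k.hom) (hn (RDCpx.overAtom hA g)))
    exact (congrArg (fun k => k.hom ≫ n.hom) (e hA g)).symm

instance : atomInclusion.Full := inferInstanceAs (Functor.Full (_ ⋙ _))

instance : atomInclusion.Faithful := inferInstanceAs (Functor.Faithful (_ ⋙ _))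

theorem isLeftKanExtension_atomInclusion (P : ProFunctor) :
    P.functor.IsLeftKanExtension (𝟙 (atomInclusion ⋙ P.functor)) := by
  have h := isLeftKanExtension_atomShape P
  rw [Functor.isLeftKanExtension_iff_precomp (G := fromSkeleton
    RDCpx.isAtomShape.FullSubcategory)] at h
  have e : Functor.whiskerLeft (fromSkeleton RDCpx.isAtomShape.FullSubcategory)
      (𝟙 (RDCpx.isAtomShape.ι ⋙ P.functor)) ≫ (Functor.associator _ _ _).inv =
      𝟙 (atomInclusion ⋙ P.functor) := by
    ext A : 2
    exact Category.id_comp _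
  rw [e] at h
  exact h

/-- The embedding restricts to the Yoneda embedding on atoms. -/
noncomputable def embeddingIso : atomInclusion ⋙ embedding ≅ uliftYoneda.{0} (C := Atom) :=
  Functor.isoWhiskerLeft _ (Functor.isoWhiskerRight uliftYonedaIsoYoneda.{0}.symm _) ≪≫
    (Functor.FullyFaithful.ofFullyFaithful atomInclusion).compUliftYonedaCompWhiskeringLeft

/-- The diagrammatic nerve of bicoloured pros. -/
noncomputable abbrev nerve (P : ProFunctor) : BiPro ⥤ DgmSet :=
  Presheaf.restrictedULiftYoneda.{0} (atomInclusion ⋙ P.functor)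

theorem nonempty_adjunction (P : ProFunctor) (L : DgmSet ⥤ BiPro) (η : P.functor ⟶ embedding ⋙ L)
    (h : L.IsLeftKanExtension η) : Nonempty (L ⊣ nerve P) := by
  have := isLeftKanExtension_atomInclusion P
  let γ : atomInclusion ⋙ P.functor ⟶ uliftYoneda.{0} ⋙ L :=
    𝟙 (atomInclusion ⋙ P.functor) ≫ Functor.whiskerLeft _ η ≫ (Functor.associator _ _ _).inv ≫
      Functor.whiskerRight embeddingIso.hom L
  have : L.IsLeftKanExtension γ := (Functor.isLeftKanExtension_iff_postcompose
    (𝟙 (atomInclusion ⋙ P.functor)) uliftYoneda.{0} embeddingIso η γ rfl).1 h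
  exact ⟨Presheaf.uliftYonedaAdjunction.{0} L γ⟩

/-! ### Attaching cells -/

open OGPoset

/-- A type with an additional element. -/
inductive Adjoin (P : Type) : Type
  | old (x : P)
  | new

namespace Adjoin

variable {P : Type}

instance [Finite P] : Finite (Adjoin P) :=
  Finite.of_injective (fun x : Adjoin P => (match x with | old x => some x | new => none))
    fun x y h => by cases x <;> cases y <;> simp_all

/-- The order in which the elements below `new` are those of the closed set `W`. -/
abbrev order [PartialOrder P] (W : Set P) (hW : IsLowerSet W) : PartialOrder (Adjoin P) where
  le
    | old a, old b => a ≤ b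
    | old a, new => a ∈ W
    | new, old _ => False
    | new, new => True
  le_refl
    | old a => le_refl a
    | new => trivial
  le_trans
    | old _, old _, old _, h, h' => le_trans (α := P) h h'
    | old _, old _, new, h, h' => hW h h'
    | old _, new, new, h, _ => h
    | new, new, new, _, _ => trivial
    | old _, new, old _, _, h => h.elim
    | new, old _, _, h, _ => h.elim
    | new, new, old _, _, h => h.elim
  le_antisymm
    | old _, old _, h, h' => congrArg old (le_antisymm (α := P) h h')
    | old _, new, _, h' => h'.elim
    | new, old _, h, _ => h.elim
    | new, new, _, _ => rfl

open Classical in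
/-- The oriented graded poset obtained by adding an element of dimension `d` with input boundary
`U` and output boundary `V`. -/
noncomputable abbrev ogPoset [OGPoset P] (d : ℕ) (U V : Set P)
    (hW : IsLowerSet (U ∪ V)) (pure : ∀ x ∈ U ∪ V, ∃ y ∈ U ∪ V, x ≤ y ∧ dim y + 1 = d)
    (ne : d ≠ 0 → (U ∪ V).Nonempty) : OGPoset (Adjoin P) :=
  letI : PartialOrder (Adjoin P) := order (U ∪ V) hW
  have lt : ∀ {a b : P}, old a < old b ↔ a < b := fun {a b} => by
    rw [lt_iff_le_not_ge, lt_iff_le_not_ge]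
    exact Iff.rfl
  have c : ∀ {a b : P}, old a ⋖ old b → a ⋖ b := fun {a b} h =>
    ⟨lt.1 h.1, fun x h₁ h₂ => h.2 (c := old x) (lt.2 h₁) (lt.2 h₂)⟩
  { dim := fun x => match x with
      | old x => dim x
      | new => d
    dim_of_isMin := by
      rintro (a | _) h
      · exact dim_of_isMin a fun b hb => h (b := old b) hb
      · by_contra hd
        obtain ⟨x, hx⟩ := ne hd
        exact h (b := old x) hx
    dim_of_covBy := by
      rintro (a | _) (b | _) h
      · exact dim_of_covBy a b (c h)
      · have ha : a ∈ U ∪ V := h.1.le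
        obtain ⟨y, hy, hay, hd⟩ := pure a ha
        rcases hay.lt_or_eq with h' | rfl
        · exact (h.2 (c := old y) (lt.2 h') (lt_of_le_not_ge hy fun h => h)).elim
        · exact hd.symm
      · have : (new : Adjoin P) ≤ old b := h.1.le
        exact this.elim
      · exact absurd h.1 (lt_irrefl _)
    orient := fun {x y} h => match x, y, h with
      | old _, old _, h => orient (c h)
      | old a, new, _ => if a ∈ U then Pol.minus else Pol.plus
      | new, _, _ => Pol.plus }

theorem eq_new_or (y : Adjoin P) : y = new ∨ y ∈ Set.range old := by
  cases y
  · exact Or.inr ⟨_, rfl⟩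
  · exact Or.inl rfl

end Adjoin

namespace ClosedEmb

variable {X P : Type} [OGPoset X] [OGPoset P] {v : X → P}

theorem bord_image (h : ClosedEmb v) (U : Set X) (n : ℕ) (α : Pol) :
    bord n α (v '' U) = v '' bord n α U := by
  have e : v ⁻¹' (v '' U) = U := Set.preimage_image_eq U h.injective
  have hr : v '' U ⊆ Set.range v := Set.image_subset_range v U
  have := h.bord_preimage hr n α
  rw [e] at this
  rw [this, Set.image_preimage_eq_of_subset]
  rintro x (⟨y, hy, hxy⟩ | hx)
  · exact h.lower hxy (hr hy.1)
  · exact hr hx.1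

theorem image_Iic (h : ClosedEmb v) (a : X) : v '' Set.Iic a = Set.Iic (v a) := by
  rw [← h.preimage_Iic, Set.image_preimage_eq_of_subset (h.Iic_subset a)]

theorem isMolecule_image (h : ClosedEmb v) {U : Set X} (hU : IsMolecule U) :
    IsMolecule (v '' U) := by
  induction hU with
  | atom x => rw [h.image_Iic]; exact .atom _
  | paste n U V _ _ hU' hV' h₁ h₂ ih ih' =>
    have strict : ∀ W ⊂ U ∪ V, v '' W ⊂ v '' U ∪ v '' V := fun W hW => by
      rw [← Set.image_union]
      exact ⟨Set.image_mono hW.1, fun hs => hW.2 ((Set.image_subset_image_iff h.injective).1 hs)⟩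
    rw [Set.image_union]
    refine .paste n _ _ ih ih' (strict U hU') (strict V hV') ?_ ?_
    · rw [h.bord_image, ← h₁, Set.image_inter h.injective]
    · rw [h.bord_image, ← h₂, Set.image_inter h.injective]

theorem trans {Y : Type} [OGPoset Y] {w : P → Y} (h : ClosedEmb v) (h' : ClosedEmb w) :
    ClosedEmb (w ∘ v) where
  le_iff := h'.le_iff.trans h.le_iff
  lower := by
    rintro _ b hb ⟨a, rfl⟩
    obtain ⟨c, rfl⟩ := h'.lower hb ⟨v a, rfl⟩
    obtain ⟨d, rfl⟩ := h.lower (h'.le_iff.1 hb) ⟨a, rfl⟩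
    exact ⟨d, rfl⟩
  dim_eq a := (h'.dim_eq _).trans (h.dim_eq a)
  orient_eq c c' := (h.orient_eq c (h.covBy_iff.2 c)).trans (h'.orient_eq _ c')

/-- The conditions for a regular directed complex need only be checked on a new element. -/
theorem isRDC_of_new (h : ClosedEmb v) (hX : IsRDC X) {z : P} (hz : ∀ y, y = z ∨ y ∈ Set.range v)
    (spherical_zero : 0 < dim z → bord 0 Pol.plus (Set.Iic z) ∩ bord 0 Pol.minus (Set.Iic z) = ∅)
    (spherical_succ : ∀ k, k + 1 < dim z →
      bord (k + 1) Pol.plus (Set.Iic z) ∩ bord (k + 1) Pol.minus (Set.Iic z) =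
        bord k Pol.plus (Set.Iic z) ∪ bord k Pol.minus (Set.Iic z))
    (molecule : ∀ n α, dim z = n + 1 → IsMolecule (bord n α (Set.Iic z)))
    (globular : ∀ n α β, dim z = n + 2 →
      bord n α (bord (n + 1) β (Set.Iic z)) = bord n α (Set.Iic z)) : IsRDC P where
  spherical_zero x hx := by
    rcases hz x with rfl | ⟨a, rfl⟩
    · exact spherical_zero hx
    · rw [h.bord_Iic_image, h.bord_Iic_image, ← Set.image_inter h.injective,
        hX.spherical_zero a (h.dim_eq a ▸ hx), Set.image_empty]
  spherical_succ x k hk := by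
    rcases hz x with rfl | ⟨a, rfl⟩
    · exact spherical_succ k hk
    · simp only [h.bord_Iic_image]
      rw [← Set.image_inter h.injective, hX.spherical_succ a k (h.dim_eq a ▸ hk), Set.image_union]
  molecule x n α hx := by
    rcases hz x with rfl | ⟨a, rfl⟩
    · exact molecule n α hx
    · rw [h.bord_Iic_image]
      exact h.isMolecule_image (hX.molecule a n α ((h.dim_eq a).symm.trans hx))
  globular x n α β hx := by
    rcases hz x with rfl | ⟨a, rfl⟩
    · exact globular n α β hx
    · rw [h.bord_Iic_image, h.bord_Iic_image, h.bord_image,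
        hX.globular a n α β ((h.dim_eq a).symm.trans hx)]

end ClosedEmb

/-- The pairs of molecules that can be the input and output boundary of an element of dimension
`n + 1`. -/
structure IsCellBoundary {P : Type} [OGPoset P] (n : ℕ) (U V : Set P) : Prop where
  minus : IsMolecule U
  plus : IsMolecule V
  pure_minus : ∀ x ∈ U, ∃ y ∈ U, x ≤ y ∧ dim y = n
  pure_plus : ∀ x ∈ V, ∃ y ∈ V, x ≤ y ∧ dim y = n
  bord_eq : ∀ k < n, ∀ α, bord k α U = bord k α V
  inter_zero : n = 0 → U ∩ V = ∅
  inter_succ : ∀ k, n = k + 1 → U ∩ V = bord k Pol.plus U ∪ bord k Pol.minus U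
  spherical_zero : 0 < n → bord 0 Pol.plus U ∩ bord 0 Pol.minus U = ∅
  spherical_succ : ∀ k, k + 1 < n → bord (k + 1) Pol.plus U ∩ bord (k + 1) Pol.minus U =
    bord k Pol.plus U ∪ bord k Pol.minus U

section Attach

set_option linter.unusedSectionVars false

variable {X P : Type} [OGPoset X] [OGPoset P] [Finite X] [Finite P] {v : X → P} {z : P} {n : ℕ}
  {U V : Set X}

theorem IsCellBoundary.dim_lt (h : IsCellBoundary n U V) {x : X} (hU : x ∈ U) (hV : x ∈ V) :
    dim x < n := by
  cases n with
  | zero => exact absurd (h.inter_zero rfl ▸ ⟨hU, hV⟩ : x ∈ (∅ : Set X)) (Set.notMem_empty x)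
  | succ k =>
    rcases (h.inter_succ k rfl ▸ ⟨hU, hV⟩ : x ∈ bord k Pol.plus U ∪ bord k Pol.minus U) with h | h
    · exact Nat.lt_succ_of_le (dimLe_bord x h)
    · exact Nat.lt_succ_of_le (dimLe_bord x h)

/-- The element `z` is a new cell with the given boundaries. -/
structure IsCellOf (v : X → P) (z : P) (n : ℕ) (U V : Set X) : Prop where
  emb : ClosedEmb v
  cover : ∀ y, y = z ∨ y ∈ Set.range v
  dim_eq : dim z = n + 1
  lt_iff : ∀ x, v x ≤ z ↔ x ∈ U ∪ V
  orient_minus : ∀ x ∈ U, ∀ h : v x ⋖ z, orient h = Pol.minus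
  orient_plus : ∀ x ∈ V, x ∉ U → ∀ h : v x ⋖ z, orient h = Pol.plus

theorem IsCellOf.notMem (h : IsCellOf v z n U V) (hB : IsCellBoundary n U V) :
    z ∉ Set.range v := by
  rintro ⟨x, hx⟩
  have hd := h.dim_eq
  rw [← hx, h.emb.dim_eq] at hd
  rcases (h.lt_iff x).1 hx.le with h' | h'
  · obtain ⟨y, -, hxy, hy⟩ := hB.pure_minus x h'
    have := dim_le_dim hxy
    omega
  · obtain ⟨y, -, hxy, hy⟩ := hB.pure_plus x h'
    have := dim_le_dim hxy
    omega

theorem IsCellOf.bord_top (h : IsCellOf v z n U V) (hB : IsCellBoundary n U V) :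
    bord n Pol.minus (Set.Iic z) = v '' U ∧ bord n Pol.plus (Set.Iic z) = v '' V := by
  have cov : ∀ x ∈ U ∪ V, dim x = n → v x ⋖ z := fun x hx hd => by
    have hlt : v x < z := lt_of_le_of_ne ((h.lt_iff x).2 hx) fun e => h.notMem hB ⟨x, e⟩
    obtain ⟨c, hc, hcz⟩ := exists_le_covBy_of_lt hlt
    have := dim_of_covBy c z hcz
    rw [h.dim_eq] at this
    rwa [eq_of_le_of_dim_le hc (by rw [h.emb.dim_eq]; omega)]
  have top : ∀ x, v x ≤ z → ∀ y ∈ Set.Iic z, ∀ hy : v x ⋖ y, dim x = n → y = z := by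
    intro x _ y hy hxy hd
    have := dim_of_covBy _ y hxy
    rw [h.emb.dim_eq] at this
    exact eq_of_le_of_dim_le hy (by rw [h.dim_eq]; omega)
  have mem : ∀ α x, v x ∈ sbord n α (Set.Iic z) ↔
      x ∈ U ∪ V ∧ dim x = n ∧ ∀ c : v x ⋖ z, orient c = α := by
    intro α x
    constructor
    · rintro ⟨h₁, h₂, h₃⟩
      exact ⟨(h.lt_iff x).1 h₁, (h.emb.dim_eq x).symm.trans h₂, fun c => h₃ z le_rfl c⟩
    · rintro ⟨h₁, h₂, h₃⟩
      refine ⟨(h.lt_iff x).2 h₁, (h.emb.dim_eq x).trans h₂, fun y hy c => ?_⟩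
      obtain rfl := top x ((h.lt_iff x).2 h₁) y hy c h₂
      exact h₃ c
  have key : ∀ (α : Pol) (W : Set X), W ⊆ U ∪ V → IsLowerSet W →
      (∀ x ∈ W, ∃ y ∈ W, x ≤ y ∧ dim y = n) →
      (∀ x ∈ U ∪ V, dim x = n → ((∀ c : v x ⋖ z, orient c = α) ↔ x ∈ W)) →
      bord n α (Set.Iic z) = v '' W := by
    intro α W hW hl pure ho
    ext y
    constructor
    · rintro (⟨w, hw, hyw⟩ | ⟨hy, hd⟩)
      · rcases h.cover w with rfl | ⟨x, rfl⟩
        · have := hw.2.1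
          rw [h.dim_eq] at this
          omega
        · obtain ⟨h₁, h₂, h₃⟩ := (mem α x).1 hw
          obtain ⟨y, rfl⟩ := h.emb.lower hyw ⟨x, rfl⟩
          exact ⟨y, hl (h.emb.le_iff.1 hyw) ((ho x h₁ h₂).1 h₃), rfl⟩
      · have := hd z le_rfl hy
        rw [h.dim_eq] at this
        omega
    · rintro ⟨x, hx, rfl⟩
      obtain ⟨y, hy, hxy, hd⟩ := pure x hx
      exact Or.inl ⟨v y, (mem α y).2 ⟨hW hy, hd, (ho y (hW hy) hd).2 hy⟩, h.emb.le_iff.2 hxy⟩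
  constructor
  · refine key _ U Set.subset_union_left hB.minus.isLowerSet hB.pure_minus fun x hx hd => ?_
    refine ⟨fun ho => ?_, fun hU c => h.orient_minus x hU c⟩
    by_contra hU
    have := h.orient_plus x (hx.resolve_left hU) hU (cov x hx hd)
    rw [ho] at this
    exact Pol.noConfusion this
  · refine key _ V Set.subset_union_right hB.plus.isLowerSet hB.pure_plus fun x hx hd => ?_
    refine ⟨fun ho => ?_, fun hV c => h.orient_plus x hV (fun hU => ?_) c⟩
    · refine hx.resolve_left fun hU => ?_
      have := h.orient_minus x hU (cov x hx hd)
      rw [ho] at this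
      exact Pol.noConfusion this
    · exact absurd hd (hB.dim_lt hU hV).ne

theorem IsCellOf.bord_of_lt (h : IsCellOf v z n U V) (hB : IsCellBoundary n U V) {k : ℕ}
    (hk : k < n) (α : Pol) : bord k α (Set.Iic z) = v '' bord k α U := by
  have hz := h.notMem hB
  have lU := hB.minus.isLowerSet
  have lV := hB.plus.isLowerSet
  have mem : ∀ x, v x ∈ sbord k α (Set.Iic z) ↔ x ∈ sbord k α U := by
    intro x
    have cov : ∀ {y}, v x ⋖ y → y ≤ z → dim x = k → ∃ w ∈ U ∪ V, v w = y := by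
      intro y c hy hd
      rcases h.cover y with rfl | ⟨w, rfl⟩
      · have := dim_of_covBy _ _ c
        rw [h.dim_eq, h.emb.dim_eq] at this
        omega
      · exact ⟨w, (h.lt_iff w).1 hy, rfl⟩
    constructor
    · rintro ⟨h₁, h₂, h₃⟩
      rw [h.emb.dim_eq] at h₂
      have ho : ∀ w ∈ U ∪ V, ∀ c : x ⋖ w, orient c = α := fun w hw c => by
        rw [h.emb.orient_eq c (h.emb.covBy_iff.2 c)]
        exact h₃ _ ((h.lt_iff w).2 hw) _
      rcases (h.lt_iff x).1 h₁ with hx | hx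
      · exact ⟨hx, h₂, fun w hw => ho w (Or.inl hw)⟩
      · have : x ∈ sbord k α V := ⟨hx, h₂, fun w hw => ho w (Or.inr hw)⟩
        exact mem_sbord (hB.bord_eq k hk α ▸ sbord_subset_bord this) h₂
    · intro hx
      have hx' : x ∈ sbord k α V :=
        mem_sbord (hB.bord_eq k hk α ▸ sbord_subset_bord hx) hx.2.1
      refine ⟨(h.lt_iff x).2 (Or.inl hx.1), (h.emb.dim_eq x).trans hx.2.1, fun y hy c => ?_⟩
      obtain ⟨w, hw, rfl⟩ := cov c hy hx.2.1
      rw [← h.emb.orient_eq (h.emb.covBy_iff.1 c) c]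
      exact hw.elim (fun hw => hx.2.2 w hw _) fun hw => hx'.2.2 w hw _
  ext y
  constructor
  · rintro (⟨w, hw, hyw⟩ | ⟨hy, hd⟩)
    · rcases h.cover w with rfl | ⟨x, rfl⟩
      · have := hw.2.1
        rw [h.dim_eq] at this
        omega
      · obtain ⟨y, rfl⟩ := h.emb.lower hyw ⟨x, rfl⟩
        exact ⟨y, Or.inl ⟨x, (mem x).1 hw, h.emb.le_iff.1 hyw⟩, rfl⟩
    · have := hd z le_rfl hy
      rw [h.dim_eq] at this
      omega
  · rintro ⟨x, ⟨w, hw, hxw⟩ | ⟨hx, hd⟩, rfl⟩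
    · exact Or.inl ⟨v w, (mem w).2 hw, h.emb.le_iff.2 hxw⟩
    · obtain ⟨y, hy, hxy, hdy⟩ := hB.pure_minus x hx
      have := hd y hy hxy
      omega

theorem IsCellOf.isRDC (h : IsCellOf v z n U V) (hB : IsCellBoundary n U V) (hX : IsRDC X) :
    IsRDC P := by
  obtain ⟨b₁, b₂⟩ := h.bord_top hB
  refine h.emb.isRDC_of_new hX h.cover (fun _ => ?_) (fun k hk => ?_) (fun m α hm => ?_)
    (fun m α β hm => ?_)
  · rcases Nat.eq_zero_or_pos n with rfl | hn
    · rw [b₁, b₂, ← Set.image_inter h.emb.injective, Set.inter_comm, hB.inter_zero rfl,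
        Set.image_empty]
    · rw [h.bord_of_lt hB hn, h.bord_of_lt hB hn, ← Set.image_inter h.emb.injective,
        hB.spherical_zero hn, Set.image_empty]
  · rw [h.dim_eq] at hk
    rcases Nat.lt_or_ge (k + 1) n with hn | hn
    · rw [h.bord_of_lt hB hn, h.bord_of_lt hB hn, h.bord_of_lt hB (by omega),
        h.bord_of_lt hB (by omega), ← Set.image_inter h.emb.injective, hB.spherical_succ k hn,
        Set.image_union]
    · obtain rfl : n = k + 1 := by omega
      rw [b₁, b₂, h.bord_of_lt hB (by omega), h.bord_of_lt hB (by omega),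
        ← Set.image_inter h.emb.injective, Set.inter_comm, hB.inter_succ k rfl, Set.image_union]
  · obtain rfl : n = m := by have := h.dim_eq; omega
    cases α
    · rw [b₁]; exact h.emb.isMolecule_image hB.minus
    · rw [b₂]; exact h.emb.isMolecule_image hB.plus
  · obtain rfl : n = m + 1 := by have := h.dim_eq; omega
    rw [h.bord_of_lt hB (Nat.lt_succ_self m)]
    cases β
    · rw [b₁, h.emb.bord_image]
    · rw [b₂, h.emb.bord_image, ← hB.bord_eq m (by omega)]

theorem IsCellBoundary.exists_isCellOf (hB : IsCellBoundary n U V) :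
    ∃ (P : Type) (_ : OGPoset P) (_ : Finite P) (v : X → P) (z : P), IsCellOf v z n U V := by
  have pure : ∀ x ∈ U ∪ V, ∃ y ∈ U ∪ V, x ≤ y ∧ dim y + 1 = n + 1 := by
    rintro x (hx | hx)
    · obtain ⟨y, hy, h₁, h₂⟩ := hB.pure_minus x hx
      exact ⟨y, Or.inl hy, h₁, by omega⟩
    · obtain ⟨y, hy, h₁, h₂⟩ := hB.pure_plus x hx
      exact ⟨y, Or.inr hy, h₁, by omega⟩
  let I : OGPoset (Adjoin X) := Adjoin.ogPoset (n + 1) U V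
    (hB.minus.isLowerSet.union hB.plus.isLowerSet) pure
    fun _ => hB.minus.nonempty.mono Set.subset_union_left
  refine ⟨Adjoin X, I, inferInstance, .old, .new, ⟨Iff.rfl, ?_, fun _ => rfl, fun _ _ => rfl⟩,
    Adjoin.eq_new_or, rfl, fun _ => Iff.rfl, fun x hx c => if_pos hx, fun x _ hx c => if_neg hx⟩
  rintro _ (b | _) hb ⟨a, rfl⟩
  · exact ⟨b, rfl⟩
  · exact hb.elim

theorem IsCellOf.trans {Y : Type} [OGPoset Y] {w : P → Y} (h : IsCellOf v z n U V)
    (hw : ClosedEmb w) (hs : Function.Surjective w) : IsCellOf (w ∘ v) (w z) n U V where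
  emb := h.emb.trans hw
  cover y := by
    obtain ⟨y, rfl⟩ := hs y
    exact (h.cover y).imp (congrArg w) fun ⟨x, hx⟩ => ⟨x, congrArg w hx⟩
  dim_eq := (hw.dim_eq z).trans h.dim_eq
  lt_iff x := hw.le_iff.trans (h.lt_iff x)
  orient_minus x hx c := by
    rw [← hw.orient_eq (hw.covBy_iff.1 c) c, h.orient_minus x hx]
  orient_plus x hx hx' c := by
    rw [← hw.orient_eq (hw.covBy_iff.1 c) c, h.orient_plus x hx hx']

end Attach

namespace RDCpx

variable {Q R Y : RDCpx}

/-- Every finite oriented graded poset satisfying the conditions is isomorphic to a regular directed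
complex. -/
theorem exists_iso {P : Type} [OGPoset P] [Finite P] (hP : IsRDC P) :
    ∃ (R : RDCpx) (u : P → R.El), ClosedEmb u ∧ Function.Surjective u := by
  obtain ⟨R, w, hw, hr⟩ := exists_closedEmb hP isLowerSet_univ
  choose u hu using Set.range_eq_univ.1 hr
  have hs : Function.Surjective u := fun x => ⟨w x, hw.injective (hu _)⟩
  refine ⟨R, u, ⟨fun {a b} => ?_, ?_, fun a => ?_, fun {a b} c c' => ?_⟩, hs⟩
  · rw [← hw.le_iff, hu, hu]
  · rw [Set.range_eq_univ.2 hs]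
    exact isLowerSet_univ
  · rw [← hw.dim_eq, hu]
  · have e : ∀ (x y : P) (_ : x = a) (_ : y = b) (d : x ⋖ y), orient c = orient d := by
      rintro _ _ rfl rfl d; rfl
    rw [hw.orient_eq c' (hw.covBy_iff.2 c')]
    exact e _ _ (hu _) (hu _) _

/-- Adjoining a cell to a regular directed complex. -/
theorem exists_attach {n : ℕ} {U V : Set Q.El} (hB : IsCellBoundary n U V) :
    ∃ (R : RDCpx) (i : Q ⟶ R) (z : R.El), IsCellOf i.fn z n U V := by
  obtain ⟨P, I, hf, v, z, h⟩ := hB.exists_isCellOf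
  obtain ⟨R, u, hu, hs⟩ := exists_iso (h.isRDC hB Q.rdc)
  have h' := h.trans hu hs
  exact ⟨R, ⟨u ∘ v, fun a n α => h'.emb.bord_Iic_image a n α⟩, u z, h'⟩

/-- Adjoining a vertex to a regular directed complex. -/
theorem exists_attach_vertex (Q : RDCpx) : ∃ (R : RDCpx) (i : Q ⟶ R) (z : R.El),
    ClosedEmb i.fn ∧ (∀ y, y = z ∨ y ∈ Set.range i.fn) ∧ dim z = 0 ∧ z ∉ Set.range i.fn := by
  let I : OGPoset (Adjoin Q.El) := Adjoin.ogPoset 0 ∅ ∅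
    (isLowerSet_empty.union isLowerSet_empty) (fun x hx => by simp at hx) (fun h => absurd rfl h)
  have emb : ClosedEmb (Adjoin.old : Q.El → Adjoin Q.El) := by
    refine ⟨Iff.rfl, ?_, fun _ => rfl, fun _ _ => rfl⟩
    rintro _ (b | _) hb ⟨a, rfl⟩
    · exact ⟨b, rfl⟩
    · exact hb.elim
  have d0 : dim (Adjoin.new : Adjoin Q.El) = 0 := rfl
  have hP : IsRDC (Adjoin Q.El) := emb.isRDC_of_new Q.rdc Adjoin.eq_new_or (fun h => by omega)
    (fun k h => by omega) (fun n α h => by omega) (fun n α β h => by omega)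
  obtain ⟨R, u, hu, hs⟩ := exists_iso hP
  have emb' := emb.trans hu
  refine ⟨R, ⟨u ∘ .old, fun a n α => emb'.bord_Iic_image a n α⟩, u .new, emb', fun y => ?_,
    (hu.dim_eq _).trans d0, ?_⟩
  · obtain ⟨y, rfl⟩ := hs y
    exact (Adjoin.eq_new_or y).imp (congrArg u) fun ⟨x, hx⟩ => ⟨x, congrArg u hx⟩
  · rintro ⟨x, hx⟩
    exact nomatch hu.injective hx

end RDCpx

open OGPoset

/-! ### Attaching vertices and edges to labelled complexes -/

namespace MarkedTwoCat

variable (T : MarkedTwoCat)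

/-- `T.Word s w t`: the letters of `w` are composable, from `s` to `t`. -/
def Word : T.cat.cell 2 → List (T.cat.cell 2) → T.cat.cell 2 → Prop
  | s, [], t => s = t ∧ ∀ α, T.cat.two.b α 0 s = s
  | s, a :: w, t => (T.cat.two.b Pol.minus 0 a = s ∧ T.IsLetter a) ∧
      Word (T.cat.two.b Pol.plus 0 a) w t

/-- The composite of a word. -/
noncomputable def wordComp : T.cat.cell 2 → List (T.cat.cell 2) → T.cat.cell 2
  | s, [] => s
  | _, a :: w => T.cat.two.comp 0 a (wordComp (T.cat.two.b Pol.plus 0 a) w)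

end MarkedTwoCat

/-- Directed paths some of whose edges may be degenerate. -/
def CxData.LazyWalk {P : Type} (K : CxData P) : P → List P → P → Prop
  | s, [], t => s = t
  | s, e :: l, t => (K.src e = s ∧ K.dim e ≤ 1) ∧ LazyWalk K (K.tgt e) l t

namespace RDCpx

variable {Q R Y : RDCpx} {T : MarkedTwoCat}

theorem Hom.image_Iic (f : Q ⟶ R) (x : Q.El) : f.fn '' Set.Iic x = Set.Iic (f.fn x) := by
  have h := f.bord_fn x (dim x) Pol.plus
  rw [bord_eq_self (isLowerSet_Iic x) (dimLe_Iic x), bord_eq_self (isLowerSet_Iic _)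
    fun y hy => (dimLe_Iic _ y hy).trans (Hom.dim_le f x)] at h
  exact h.symm

/-- The complex `R` is obtained from `Q` by adding one element `z`. -/
structure IsExt (i : Q ⟶ R) (z : R.El) : Prop where
  emb : ClosedEmb i.fn
  cover : ∀ y, y = z ∨ y ∈ Set.range i.fn
  notMem : z ∉ Set.range i.fn

theorem _root_.DiagNerve.IsCellOf.isExt {i : Q ⟶ R} {z : R.El} {n : ℕ} {U V : Set Q.El}
    (h : IsCellOf i.fn z n U V) (hB : IsCellBoundary n U V) : IsExt i z :=
  ⟨h.emb, h.cover, h.notMem hB⟩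

theorem IsExt.exists_fun {i : Q ⟶ R} {z : R.El} (h : IsExt i z) {C : Type} (g : Q.El → C) (c : C) :
    ∃ g' : R.El → C, (∀ x, g' (i.fn x) = g x) ∧ g' z = c := by
  classical
  refine ⟨fun y => if hy : ∃ x, i.fn x = y then g hy.choose else c, fun x => ?_, dif_neg h.notMem⟩
  have hx : ∃ x', i.fn x' = i.fn x := ⟨x, rfl⟩
  change dite _ _ _ = _
  rw [dif_pos hx, h.emb.injective hx.choose_spec]

theorem IsExt.exists_labelling {i : Q ⟶ R} {z : R.El} (h : IsExt i z) {lam : Q.El → T.cat.cell 2}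
    (hL : Q.Labelling T lam) (u : T.cat.cell 2)
    (hz : ∀ lam' : R.El → T.cat.cell 2, (∀ x, lam' (i.fn x) = lam x) → lam' z = u →
      R.LabelledAt T lam' z) :
    ∃ lam', R.Labelling T lam' ∧ (∀ x, lam' (i.fn x) = lam x) ∧ lam' z = u := by
  obtain ⟨lam', h₁, h₂⟩ := h.exists_fun lam u
  refine ⟨lam', Labelling.of_cover fun y => ?_, h₁, h₂⟩
  rcases h.cover y with rfl | ⟨x, rfl⟩
  · exact Or.inr (hz lam' h₁ h₂)
  · refine Or.inl ⟨Q, i, x, rfl, (h.emb.dim_eq x).symm, ?_⟩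
    have : lam' ∘ i.fn = lam := funext h₁
    rwa [this]

theorem Iic_eq_insert {y : Y.El} {n : ℕ} (h : dim y ≤ n + 1) : Set.Iic y =
    insert y (bord n Pol.minus (Set.Iic y) ∪ bord n Pol.plus (Set.Iic y)) := by
  have hs : ∀ α, bord n α (Set.Iic y) ⊆ Set.Iic y := fun α => bord_subset (isLowerSet_Iic y)
  refine Set.Subset.antisymm (fun x hx => ?_) (Set.insert_subset (Set.mem_Iic.2 le_rfl)
    (Set.union_subset (hs _) (hs _)))
  rcases h.lt_or_eq with hd | hd
  · right; left
    rwa [bord_eq_self (isLowerSet_Iic y) fun z hz => (dimLe_Iic y z hz).trans (by omega)]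
  · rcases (Set.mem_Iic.1 hx).lt_or_eq with hlt | rfl
    · obtain ⟨γ, hγ⟩ := mem_bord_of_lt hd hlt
      cases γ
      · exact Or.inr (Or.inl hγ)
      · exact Or.inr (Or.inr hγ)
    · exact Or.inl rfl

/-- Maps extend to a new cell. -/
theorem exists_desc {i : Q ⟶ R} {z : R.El} {n : ℕ} {U V : Set Q.El} (h : IsCellOf i.fn z n U V)
    (hB : IsCellBoundary n U V) (g : Q ⟶ Y) {y : Y.El} (hy : dim y ≤ n + 1)
    (hU : bord n Pol.minus (Set.Iic y) = g.fn '' U) (hV : bord n Pol.plus (Set.Iic y) = g.fn '' V)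
    (hk : ∀ k < n, ∀ α, bord k α (Set.Iic y) = g.fn '' bord k α U) :
    ∃ g' : R ⟶ Y, i ≫ g' = g ∧ g'.fn z = y := by
  obtain ⟨f, hf, hz⟩ := (h.isExt hB).exists_fun g.fn y
  obtain ⟨b₁, b₂⟩ := h.bord_top hB
  have im : ∀ W, f '' (i.fn '' W) = g.fn '' W := fun W => by
    rw [Set.image_image]; simp only [hf]
  refine ⟨⟨f, fun x m α => ?_⟩, Hom.ext (funext hf), hz⟩
  rcases h.cover x with rfl | ⟨x, rfl⟩
  · rw [hz]
    rcases lt_trichotomy m n with hm | rfl | hm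
    · rw [hk m hm, h.bord_of_lt hB hm, im]
    · cases α
      · rw [hU, b₁, im]
      · rw [hV, b₂, im]
    · rw [bord_eq_self (isLowerSet_Iic y) fun w hw => (dimLe_Iic y w hw).trans (by omega),
        bord_eq_self (isLowerSet_Iic x) fun w hw => (dimLe_Iic x w hw).trans
          (by rw [h.dim_eq]; omega), Iic_eq_insert hy, Iic_eq_insert h.dim_eq.le, b₁, b₂,
        Set.image_insert_eq, Set.image_union, im, im, hz, hU, hV]
  · rw [hf, g.bord_fn, h.emb.bord_Iic_image, im]

theorem isCellBoundary_zero {s t : Q.El} (hs : dim s = 0) (ht : dim t = 0) (hst : s ≠ t) :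
    IsCellBoundary 0 (Set.Iic s) (Set.Iic t) where
  minus := .atom s
  plus := .atom t
  pure_minus x hx := ⟨x, hx, le_rfl, by rw [eq_of_dim_zero hs hx, hs]⟩
  pure_plus x hx := ⟨x, hx, le_rfl, by rw [eq_of_dim_zero ht hx, ht]⟩
  bord_eq k hk := absurd hk (Nat.not_lt_zero k)
  inter_zero _ := by
    ext x
    simp only [Set.mem_inter_iff, Set.mem_empty_iff_false, iff_false]
    exact fun h => hst ((eq_of_dim_zero hs h.1).symm.trans (eq_of_dim_zero ht h.2))
  inter_succ k hk := absurd hk (by omega)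
  spherical_zero h := absurd h (by omega)
  spherical_succ k hk := absurd hk (by omega)

theorem exists_attach_edge {s t : Q.El} (hs : dim s = 0) (ht : dim t = 0) (hst : s ≠ t) :
    ∃ (R : RDCpx) (i : Q ⟶ R) (e : R.El), IsExt i e ∧ dim e = 1 ∧ (cx R.El).src e = i.fn s ∧
      (cx R.El).tgt e = i.fn t ∧
      (∀ (Y : RDCpx) (g : Q ⟶ Y) (y : Y.El), dim y ≤ 1 → (cx Y.El).src y = g.fn s →
        (cx Y.El).tgt y = g.fn t → ∃ g' : R ⟶ Y, i ≫ g' = g ∧ g'.fn e = y) ∧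
      ∀ (T : MarkedTwoCat) (lam : Q.El → T.cat.cell 2), Q.Labelling T lam → ∀ u, T.IsLetter u →
        T.cat.two.b Pol.minus 0 u = lam s → T.cat.two.b Pol.plus 0 u = lam t →
        ∃ lam', R.Labelling T lam' ∧ (∀ x, lam' (i.fn x) = lam x) ∧ lam' e = u := by
  have hB := isCellBoundary_zero hs ht hst
  obtain ⟨R, i, e, h⟩ := exists_attach hB
  obtain ⟨b₁, b₂⟩ := h.bord_top hB
  obtain ⟨c₁, c₂, -, -⟩ := bord_zero_Iic R.rdc e
  rw [Iic_of_dim_zero hs, Set.image_singleton, c₁] at b₁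
  rw [Iic_of_dim_zero ht, Set.image_singleton, c₂] at b₂
  have hse := Set.singleton_injective b₁
  have hte := Set.singleton_injective b₂
  refine ⟨R, i, e, h.isExt hB, h.dim_eq, hse, hte, fun Y g y hy h₁ h₂ => ?_,
    fun T lam hL u hu h₁ h₂ => ?_⟩
  · refine exists_desc h hB g hy ?_ ?_ fun k hk => absurd hk (Nat.not_lt_zero k)
    · rw [(bord_zero_Iic Y.rdc y).1, h₁, Iic_of_dim_zero hs, Set.image_singleton]
    · rw [(bord_zero_Iic Y.rdc y).2.1, h₂, Iic_of_dim_zero ht, Set.image_singleton]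
  · refine (h.isExt hB).exists_labelling hL u fun lam' hl hz => ?_
    have hd := h.dim_eq
    refine ⟨fun h0 => by omega, fun _ => ?_, fun h2 => by omega, fun h2 => by omega⟩
    rw [hse, hte, hl, hl, hz]
    exact ⟨h₁, h₂, hu⟩

theorem exists_attach_point (Q : RDCpx) :
    ∃ (R : RDCpx) (i : Q ⟶ R) (v : R.El), IsExt i v ∧ dim v = 0 ∧
      (∀ (Y : RDCpx) (g : Q ⟶ Y) (y : Y.El), dim y = 0 → ∃ g' : R ⟶ Y, i ≫ g' = g ∧ g'.fn v = y) ∧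
      ∀ (T : MarkedTwoCat) (lam : Q.El → T.cat.cell 2), Q.Labelling T lam → ∀ u,
        (∀ α, T.cat.two.b α 0 u = u) →
        ∃ lam', R.Labelling T lam' ∧ (∀ x, lam' (i.fn x) = lam x) ∧ lam' v = u := by
  obtain ⟨R, i, v, h₁, h₂, hd, h₃⟩ := exists_attach_vertex Q
  have h : IsExt i v := ⟨h₁, h₂, h₃⟩
  refine ⟨R, i, v, h, hd, fun Y g y hy => ?_, fun T lam hL u hu => ?_⟩
  · obtain ⟨f, hf, hz⟩ := h.exists_fun g.fn y
    refine ⟨⟨f, fun x m α => ?_⟩, Hom.ext (funext hf), hz⟩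
    rcases h.cover x with rfl | ⟨x, rfl⟩
    · rw [hz, bord_eq_self (isLowerSet_Iic y) fun w hw => (dimLe_Iic y w hw).trans (by omega),
        bord_eq_self (isLowerSet_Iic x) fun w hw => (dimLe_Iic x w hw).trans (by omega),
        Iic_of_dim_zero hd, Iic_of_dim_zero hy, Set.image_singleton, hz]
    · rw [hf, g.bord_fn, h.emb.bord_Iic_image, Set.image_image]
      simp only [hf]
  · refine h.exists_labelling hL u fun lam' hl hz => ?_
    refine ⟨fun _ => hz ▸ hu, fun h2 => by omega, fun h2 => by omega, fun h2 => by omega⟩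

end RDCpx

open OGPoset

/-! ### Attaching paths and faces -/

section Trail

variable {P : Type} [OGPoset P]

/-- The closure of a list of edges starting from `s`. -/
def trail (s : P) (l : List P) : Set P := {x | x = s ∨ ∃ e ∈ l, x ≤ e}

theorem PathOf.eq_trail {U : Set P} {s t : P} {l : List P} (h : PathOf U s l t) : U = trail s l :=
  Set.ext h.mem

variable [Finite P]

theorem trail_cons (hP : IsRDC P) (e : P) (l : List P) :
    trail ((cx P).src e) (e :: l) = Set.Iic e ∪ trail ((cx P).tgt e) l := by
  ext x
  simp only [trail, Set.mem_ofPred_eq, List.mem_cons, exists_eq_or_imp, Set.mem_union, Set.mem_Iic]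
  constructor
  · rintro (rfl | h | h)
    · exact Or.inl (src_le hP e)
    · exact Or.inl h
    · exact Or.inr (Or.inr h)
  · rintro (h | rfl | h)
    · exact Or.inr (Or.inl h)
    · exact Or.inr (Or.inl (tgt_le hP e))
    · exact Or.inr (Or.inr h)

theorem mem_trail_iff (hP : IsRDC P) {s t x : P} {l : List P} (h : (cx P).Walk s l t) :
    x ∈ trail s l ↔ x = t ∨ ∃ e ∈ l, x = e ∨ x = (cx P).src e := by
  induction l generalizing s with
  | nil =>
    obtain rfl := h.1
    simp [trail]
  | cons e l ih =>
    obtain ⟨⟨rfl, he, -⟩, h⟩ := h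
    have he : dim e = 1 := he
    rw [trail_cons hP, Set.mem_union, ih h, Set.mem_Iic, le_edge_iff hP he]
    simp only [List.mem_cons, exists_eq_or_imp]
    have key : x = (cx P).tgt e → x = t ∨ ∃ f ∈ l, x = f ∨ x = (cx P).src f := by
      rintro rfl
      exact (ih h).1 (Or.inl rfl)
    generalize (∃ f ∈ l, x = f ∨ x = (cx P).src f) = p at key ⊢
    tauto

theorem trail_append (hP : IsRDC P) {s t : P} {l m : List P} (h : (cx P).Walk s l t) :
    trail s (l ++ m) = trail s l ∪ trail t m := by
  induction l generalizing s with
  | nil =>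
    obtain rfl := h.1
    ext x
    simp only [trail, List.nil_append, Set.mem_union, Set.mem_ofPred_eq, List.not_mem_nil,
      false_and, exists_false, or_false]
    tauto
  | cons e l ih =>
    obtain ⟨⟨rfl, he, -⟩, h⟩ := h
    rw [List.cons_append, trail_cons hP, trail_cons hP, ih h, Set.union_assoc]

theorem PathOf.exists_split (hP : IsRDC P) {U : Set P} {s t : P} {l m : List P}
    (h : PathOf U s (l ++ m) t) : ∃ v, PathOf (trail s l) s l v ∧ PathOf (trail v m) v m t ∧
      trail s l ∩ trail v m = {v} := by
  obtain ⟨v, h₁, h₂⟩ := CxData.walk_append.1 h.walk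
  have nd := h.nodup
  rw [List.map_append, List.nodup_append] at nd
  have hv : ∀ e ∈ l, (edgeData P).src e ≠ v := by
    intro e he hev
    cases m with
    | nil =>
      obtain rfl := h₂.1
      exact h.ne e (by simp [he]) hev
    | cons f m =>
      exact nd.2.2 _ (List.mem_map_of_mem he) _ (List.mem_map_of_mem (List.mem_cons_self))
        (hev.trans h₂.1.1.symm)
  refine ⟨v, ⟨h₁, fun _ => Iff.rfl, nd.1, hv⟩, ⟨h₂, fun _ => Iff.rfl, nd.2.1,
    fun e he => h.ne e (by simp [he])⟩, ?_⟩
  ext x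
  rw [Set.mem_inter_iff, mem_trail_iff hP (cx_walk.2 h₁), Set.mem_singleton_iff]
  constructor
  · rintro ⟨rfl | ⟨e, he, hx⟩, h'⟩
    · rfl
    exfalso
    rw [mem_trail_iff hP (cx_walk.2 h₂)] at h'
    have de : dim e = 1 := h₁.dim_edge he
    have ds : dim ((cx P).src e) = 0 := (bord_zero_Iic hP e).2.2.1
    rcases hx with rfl | rfl
    · rcases h' with rfl | ⟨f, hf, rfl | rfl⟩
      · have : dim x = 0 := h₂.dim_tgt
        omega
      · exact nd.2.2 _ (List.mem_map_of_mem he) _ (List.mem_map_of_mem hf) rfl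
      · have := (bord_zero_Iic hP f).2.2.1
        omega
    · rcases h' with h' | ⟨f, hf, h' | h'⟩
      · exact h.ne e (by simp [he]) h'
      · have : dim f = 1 := h₂.dim_edge hf
        rw [← h'] at this
        omega
      · exact nd.2.2 _ (List.mem_map_of_mem he) _ (List.mem_map_of_mem hf) h'
  · rintro rfl
    exact ⟨Or.inl rfl, Or.inl rfl⟩

theorem PathOf.isMolecule (hP : IsRDC P) {U : Set P} {s t : P} {l : List P} (h : PathOf U s l t) :
    IsMolecule U ∧ bord 0 Pol.minus U = {s} ∧ bord 0 Pol.plus U = {t} := by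
  obtain rfl := h.eq_trail
  induction l generalizing s with
  | nil =>
    have hs : dim s = 0 := h.walk.dim_src
    obtain rfl := h.walk.1
    have e : trail s [] = Set.Iic s := by
      ext x
      simp only [trail, List.not_mem_nil, false_and, exists_false, or_false, Set.mem_ofPred_eq,
        Set.mem_Iic]
      exact ⟨fun h => h.le, eq_of_dim_zero hs⟩
    obtain ⟨h₁, h₂, -, -⟩ := bord_zero_Iic hP s
    rw [(src_of_dim_zero hP hs).1] at h₁
    rw [(src_of_dim_zero hP hs).2] at h₂
    rw [e]
    exact ⟨.atom s, h₁, h₂⟩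
  | cons e l ih =>
    obtain ⟨v, h₁, h₂, h₃⟩ := PathOf.exists_split hP (l := [e]) h
    obtain ⟨⟨hs, he, -⟩, hv, -⟩ := h₁.walk
    obtain rfl : (cx P).src e = s := hs
    obtain rfl : (cx P).tgt e = v := hv
    have e₁ : trail ((cx P).src e) [e] = Set.Iic e := by
      rw [trail_cons hP]
      refine Set.union_eq_self_of_subset_right ?_
      rintro x (rfl | ⟨f, hf, -⟩)
      · exact tgt_le hP e
      · simp at hf
    rw [e₁] at h₃
    obtain ⟨mW, sW, tW⟩ := ih h₂
    obtain ⟨b₁, b₂, -, -⟩ := bord_zero_Iic hP e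
    rw [trail_cons hP]
    refine ⟨(IsMolecule.atom e).union mW (h₃.trans b₂.symm) (h₃.trans sW.symm), ?_, ?_⟩
    · rw [bord_minus_union mW.isLowerSet (h₃.trans sW.symm), b₁]
    · rw [bord_plus_union (isLowerSet_Iic e) (h₃.trans b₂.symm), tW]

theorem PathOf.dimLe {U : Set P} {s t : P} {l : List P} (h : PathOf U s l t) : DimLe U 1 := by
  intro x hx
  rcases (h.mem x).1 hx with rfl | ⟨e, he, hxe⟩
  · have : dim x = 0 := h.walk.dim_src
    omega
  · have : dim e = 1 := h.walk.dim_edge he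
    exact this ▸ dim_le_dim hxe

theorem PathOf.pure (hP : IsRDC P) {U : Set P} {s t : P} {l : List P} (h : PathOf U s l t)
    (hst : s ≠ t) : ∀ x ∈ U, ∃ y ∈ U, x ≤ y ∧ dim y = 1 := by
  intro x hx
  rcases (h.mem x).1 hx with rfl | ⟨e, he, hxe⟩
  · cases l with
    | nil => exact absurd h.walk.1 hst
    | cons e l =>
      exact ⟨e, h.edge_mem (by simp), h.walk.1.1 ▸ src_le hP e, h.walk.1.2.1⟩
  · exact ⟨e, h.edge_mem he, hxe, h.walk.dim_edge he⟩

theorem isCellBoundary_one (hP : IsRDC P) {U V : Set P} {s t : P} {l m : List P}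
    (hU : PathOf U s l t) (hV : PathOf V s m t) (hst : s ≠ t) (h : U ∩ V = {s, t}) :
    IsCellBoundary 1 U V := by
  obtain ⟨mU, sU, tU⟩ := hU.isMolecule hP
  obtain ⟨mV, sV, tV⟩ := hV.isMolecule hP
  refine ⟨mU, mV, hU.pure hP hst, hV.pure hP hst, fun k hk α => ?_, fun h => by omega,
    fun k hk => ?_, fun _ => ?_, fun k hk => by omega⟩
  · obtain rfl : k = 0 := by omega
    cases α
    · rw [sU, sV]
    · rw [tU, tV]
  · obtain rfl : k = 0 := by omega
    rw [h, sU, tU, Set.union_comm]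
    rfl
  · rw [sU, tU]
    ext x
    simp only [Set.mem_inter_iff, Set.mem_singleton_iff, Set.mem_empty_iff_false, iff_false]
    rintro ⟨rfl, rfl⟩
    exact hst rfl

end Trail

namespace RDCpx

variable {Q R Y : RDCpx} {T : MarkedTwoCat}

theorem image_trail (f : Q ⟶ R) (s : Q.El) (l : List Q.El) :
    f.fn '' trail s l = trail (f.fn s) (l.map f.fn) := by
  ext y
  constructor
  · rintro ⟨x, rfl | ⟨e, he, hx⟩, rfl⟩
    · exact Or.inl rfl
    · exact Or.inr ⟨f.fn e, List.mem_map_of_mem he, Hom.fn_mono f hx⟩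
  · rintro (rfl | ⟨e, he, hx⟩)
    · exact ⟨s, Or.inl rfl, rfl⟩
    · obtain ⟨e, he', rfl⟩ := List.mem_map.1 he
      have : y ∈ f.fn '' Set.Iic e := Hom.image_Iic f e ▸ hx
      obtain ⟨x, hx', rfl⟩ := this
      exact ⟨x, Or.inr ⟨e, he', hx'⟩, rfl⟩

theorem walk_map {i : Q ⟶ R} (hi : ClosedEmb i.fn) {s t : Q.El} {l : List Q.El}
    (h : (cx Q.El).Walk s l t) : (cx R.El).Walk (i.fn s) (l.map i.fn) (i.fn t) := by
  induction l generalizing s with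
  | nil => exact ⟨congrArg i.fn h.1, (hi.dim_eq s).trans h.2⟩
  | cons e l ih =>
    obtain ⟨⟨h₁, h₂, h₃⟩, h⟩ := h
    refine ⟨⟨?_, (hi.dim_eq e).trans h₂, (hi.dim_eq s).trans h₃⟩, ?_⟩
    · rw [← h₁]; exact (Hom.fn_src i e).symm
    · rw [← Hom.fn_tgt i e]; exact ih h

theorem pathOf_map {i : Q ⟶ R} (hi : ClosedEmb i.fn) {U : Set Q.El} {s t : Q.El} {l : List Q.El}
    (h : PathOf U s l t) : PathOf (i.fn '' U) (i.fn s) (l.map i.fn) (i.fn t) where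
  walk := cx_walk.1 (walk_map hi (cx_walk.2 h.walk))
  mem x := by rw [h.eq_trail, image_trail]; rfl
  nodup := by
    have e : (l.map i.fn).map (edgeData R.El).src = (l.map (edgeData Q.El).src).map i.fn := by
      rw [List.map_map, List.map_map]
      exact List.map_congr_left fun e _ => (Hom.fn_src i e).symm
    rw [e]
    exact h.nodup.map hi.injective
  ne f hf hft := by
    obtain ⟨e, he, rfl⟩ := List.mem_map.1 hf
    exact h.ne e he (hi.injective ((Hom.fn_src i e).trans hft))

/-- Adjoining a path between two vertices. -/
theorem exists_attach_path (m : ℕ) (Q : RDCpx) {s t : Q.El} (hs : dim s = 0) (ht : dim t = 0)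
    (hst : s ≠ t) :
    ∃ (R : RDCpx) (i : Q ⟶ R) (l : List R.El), ClosedEmb i.fn ∧ l.length = m + 1 ∧
      PathOf (trail (i.fn s) l) (i.fn s) l (i.fn t) ∧
      trail (i.fn s) l ∩ Set.range i.fn = {i.fn s, i.fn t} ∧
      (∀ (Y : RDCpx) (g : Q ⟶ Y) (a : List Y.El), a.length = m + 1 →
        (cx Y.El).LazyWalk (g.fn s) a (g.fn t) → ∃ g' : R ⟶ Y, i ≫ g' = g ∧ l.map g'.fn = a) ∧
      ∀ (T : MarkedTwoCat) (lam : Q.El → T.cat.cell 2), Q.Labelling T lam →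
        ∀ w, w.length = m + 1 → T.Word (lam s) w (lam t) →
        ∃ lam', R.Labelling T lam' ∧ (∀ x, lam' (i.fn x) = lam x) ∧ l.map lam' = w := by
  induction m generalizing Q s t with
  | zero =>
    obtain ⟨R, i, e, hi, de, hse, hte, hg, hl⟩ := exists_attach_edge hs ht hst
    have e₁ : trail (i.fn s) [e] = Set.Iic e := by
      rw [← hse, trail_cons R.rdc]
      refine Set.union_eq_self_of_subset_right ?_
      rintro x (rfl | ⟨f, hf, -⟩)
      · exact tgt_le R.rdc e
      · simp at hf
    refine ⟨R, i, [e], hi.emb, rfl, ?_, ?_, fun Y g a ha hw => ?_, fun T lam hL w hw h => ?_⟩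
    · rw [e₁, ← hse, ← hte]
      exact pathOf_edge R.rdc de
    · rw [e₁]
      ext x
      simp only [Set.mem_inter_iff, Set.mem_Iic, le_edge_iff R.rdc de, hse, hte,
        Set.mem_insert_iff, Set.mem_singleton_iff]
      constructor
      · rintro ⟨rfl | h, hx⟩
        · exact absurd hx hi.notMem
        · exact h
      · rintro (rfl | rfl)
        · exact ⟨by simp, s, rfl⟩
        · exact ⟨by simp, t, rfl⟩
    · obtain ⟨y, rfl⟩ := List.length_eq_one_iff.1 ha
      obtain ⟨⟨h₁, h₂⟩, h₃⟩ := hw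
      obtain ⟨g', h₄, h₅⟩ := hg Y g y h₂ h₁ h₃
      exact ⟨g', h₄, by simp [h₅]⟩
    · obtain ⟨u, rfl⟩ := List.length_eq_one_iff.1 hw
      obtain ⟨⟨h₁, h₂⟩, h₃, -⟩ := h
      obtain ⟨lam', h₄, h₅, h₆⟩ := hl T lam hL u h₂ h₁ h₃
      exact ⟨lam', h₄, h₅, by simp [h₆]⟩
  | succ m ih =>
    obtain ⟨R₀, j, p, hj, dp, hg₀, hl₀⟩ := exists_attach_point Q
    have hsp : j.fn s ≠ p := fun h => hj.notMem ⟨s, h⟩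
    obtain ⟨R₁, k, e, hk, de, hse, hte, hg₁, hl₁⟩ :=
      exists_attach_edge ((hj.emb.dim_eq s).trans hs) dp hsp
    have emb₁ := hj.emb.trans hk.emb
    have hpt : k.fn p ≠ k.fn (j.fn t) := fun h => hj.notMem ⟨t, (hk.emb.injective h).symm⟩
    obtain ⟨R, n, l, hn, hlen, hp, hr, hg, hl⟩ := ih R₁ (s := k.fn p) (t := k.fn (j.fn t))
      ((hk.emb.dim_eq p).trans dp) ((emb₁.dim_eq t).trans ht) hpt
    have emb := emb₁.trans hn
    have dne : dim (n.fn e) = 1 := (hn.dim_eq e).trans de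
    have hse' : (cx R.El).src (n.fn e) = n.fn (k.fn (j.fn s)) := by
      rw [← hse]; exact (Hom.fn_src n e).symm
    have hte' : (cx R.El).tgt (n.fn e) = n.fn (k.fn p) := by
      rw [← hte]; exact (Hom.fn_tgt n e).symm
    have he : trail (n.fn (k.fn (j.fn s))) (n.fn e :: l) =
        Set.Iic (n.fn e) ∪ trail (n.fn (k.fn p)) l := by
      rw [← hse', trail_cons R.rdc, hte']
    have old : ∀ {x}, x ∈ trail (n.fn (k.fn p)) l → x ∈ Set.range n.fn →
        x = n.fn (k.fn p) ∨ x = n.fn (k.fn (j.fn t)) := fun h₁ h₂ => hr.subset ⟨h₁, h₂⟩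
    have tmem : n.fn (k.fn (j.fn t)) ∈ trail (n.fn (k.fn p)) l := hp.tgt_mem R.rdc
    have hnotp : ∀ x, n.fn (k.fn (j.fn x)) ≠ n.fn (k.fn p) := fun x h =>
      hj.notMem ⟨x, hk.emb.injective (hn.injective h)⟩
    refine ⟨R, j ≫ k ≫ n, n.fn e :: l, emb, by simp [hlen], ?_, ?_, fun Y g a ha hw => ?_,
      fun T lam hL w hw h => ?_⟩
    · change PathOf (trail (n.fn (k.fn (j.fn s))) _) (n.fn (k.fn (j.fn s))) _
        (n.fn (k.fn (j.fn t)))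
      have := PathOf.append R.rdc (pathOf_edge R.rdc dne) (hte'.symm ▸ hp) (m := l) (by
        rw [hte']
        ext x
        simp only [Set.mem_inter_iff, Set.mem_Iic, le_edge_iff R.rdc dne, hse', hte',
          Set.mem_singleton_iff]
        constructor
        · rintro ⟨rfl | rfl | h, hx⟩
          · rcases old hx ⟨e, rfl⟩ with h | h
            · exact absurd ⟨p, (hn.injective h).symm⟩ hk.notMem
            · exact absurd ⟨j.fn t, (hn.injective h).symm⟩ hk.notMem
          · rcases old hx ⟨_, rfl⟩ with h | h
            · exact absurd h (hnotp s)
            · exact absurd (emb.injective h) hst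
          · exact h
        · rintro rfl
          exact ⟨by simp, Or.inl rfl⟩)
      rw [he, ← hse']
      rwa [hte'] at this
    · change trail (n.fn (k.fn (j.fn s))) (n.fn e :: l) ∩ Set.range (fun x => n.fn (k.fn (j.fn x)))
        = {n.fn (k.fn (j.fn s)), n.fn (k.fn (j.fn t))}
      rw [he]
      ext x
      simp only [Set.mem_inter_iff, Set.mem_union, Set.mem_Iic, le_edge_iff R.rdc dne, hse', hte',
        Set.mem_insert_iff, Set.mem_singleton_iff, Set.mem_range]
      constructor
      · rintro ⟨(rfl | rfl | rfl) | h, ⟨x', hx⟩⟩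
        · exact absurd ⟨j.fn x', hn.injective hx⟩ hk.notMem
        · exact Or.inl rfl
        · exact absurd hx (hnotp x')
        · subst hx
          rcases old h ⟨_, rfl⟩ with h | h
          · exact absurd h (hnotp x')
          · exact Or.inr h
      · rintro (rfl | rfl)
        · exact ⟨by simp, s, rfl⟩
        · exact ⟨Or.inr tmem, t, rfl⟩
    · cases a with
      | nil => simp at ha
      | cons y a =>
        obtain ⟨⟨h₁, h₂⟩, h₃⟩ := hw
        obtain ⟨g₀, e₀, c₀⟩ := hg₀ Y g ((cx Y.El).tgt y) (bord_zero_Iic Y.rdc y).2.2.2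
        subst e₀
        obtain ⟨g₁, e₁, c₁⟩ := hg₁ Y g₀ y h₂ h₁ c₀.symm
        subst e₁
        obtain ⟨g₂, e₂, c₂⟩ := hg Y g₁ a (by simpa using ha) (by
          have c₀ : g₁.fn (k.fn p) = (cx Y.El).tgt y := c₀
          rw [c₀]
          exact h₃)
        subst e₂
        have c₁ : g₂.fn (n.fn e) = y := c₁
        exact ⟨g₂, rfl, by rw [List.map_cons, c₂, c₁]⟩
    · cases w with
      | nil => simp at hw
      | cons u w =>
        obtain ⟨⟨h₁, h₂⟩, h₃⟩ := h
        obtain ⟨lam₀, L₀, e₀, c₀⟩ := hl₀ T lam hL (T.cat.two.b Pol.plus 0 u) fun α =>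
          T.cat.two.b_b_le _ _ _ le_rfl
        obtain ⟨lam₁, L₁, e₁, c₁⟩ := hl₁ T lam₀ L₀ u h₂ (h₁.trans (e₀ s).symm) c₀.symm
        obtain ⟨lam₂, L₂, e₂, c₂⟩ := hl T lam₁ L₁ w (by simpa using hw) (by
          rw [e₁, e₁, c₀, e₀]
          exact h₃)
        exact ⟨lam₂, L₂, fun x => (e₂ _).trans ((e₁ _).trans (e₀ x)), by
          rw [List.map_cons, c₂, e₂, c₁]⟩

/-- Adjoining a face between two parallel paths. -/
theorem exists_attach_face {U V : Set Q.El} {s t : Q.El} {l m : List Q.El}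
    (hU : PathOf U s l t) (hV : PathOf V s m t) (hst : s ≠ t) (h : U ∩ V = {s, t}) :
    ∃ (R : RDCpx) (i : Q ⟶ R) (x : R.El), IsExt i x ∧ dim x = 2 ∧
      (cx R.El).src x = i.fn s ∧ (cx R.El).tgt x = i.fn t ∧
      (cx R.El).inn x = l.map i.fn ∧ (cx R.El).out x = m.map i.fn ∧
      bord 1 Pol.minus (Set.Iic x) = i.fn '' U ∧ bord 1 Pol.plus (Set.Iic x) = i.fn '' V ∧
      (∀ (Y : RDCpx) (g : Q ⟶ Y) (y : Y.El), dim y ≤ 2 →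
        bord 1 Pol.minus (Set.Iic y) = g.fn '' U → bord 1 Pol.plus (Set.Iic y) = g.fn '' V →
        (cx Y.El).src y = g.fn s → (cx Y.El).tgt y = g.fn t →
        ∃ g' : R ⟶ Y, i ≫ g' = g ∧ g'.fn x = y) ∧
      ∀ (T : MarkedTwoCat) (lam : Q.El → T.cat.cell 2), Q.Labelling T lam → ∀ u,
        T.cat.two.b Pol.minus 1 u = (cx Q.El).pv T.cat.two lam s l →
        T.cat.two.b Pol.plus 1 u = (cx Q.El).pv T.cat.two lam s m →
        ∃ lam', R.Labelling T lam' ∧ (∀ x, lam' (i.fn x) = lam x) ∧ lam' x = u := by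
  have hB := isCellBoundary_one Q.rdc hU hV hst h
  obtain ⟨R, i, x, hx⟩ := exists_attach hB
  obtain ⟨b₁, b₂⟩ := hx.bord_top hB
  obtain ⟨mU, sU, tU⟩ := hU.isMolecule Q.rdc
  obtain ⟨mV, sV, tV⟩ := hV.isMolecule Q.rdc
  obtain ⟨c₁, c₂, -, -⟩ := bord_zero_Iic R.rdc x
  have c₁' := hx.bord_of_lt hB Nat.zero_lt_one Pol.minus
  have c₂' := hx.bord_of_lt hB Nat.zero_lt_one Pol.plus
  rw [sU, Set.image_singleton, c₁] at c₁'
  rw [tU, Set.image_singleton, c₂] at c₂'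
  have hs := Set.singleton_injective c₁'
  have ht := Set.singleton_injective c₂'
  have path : ∀ {W : Set Q.El} {n : List Q.El}, PathOf W s n t → pathList (i.fn '' W) =
      n.map i.fn := by
    intro W n hW
    have hW' := pathOf_map hx.emb hW
    obtain ⟨h₁, h₂, h₃⟩ := hW'.isMolecule R.rdc
    exact pathList_eq R.rdc h₁ hW'.dimLe hW' h₂ h₃
  have hinn : (cx R.El).inn x = l.map i.fn := (congrArg pathList b₁).trans (path hU)
  have hout : (cx R.El).out x = m.map i.fn := (congrArg pathList b₂).trans (path hV)
  refine ⟨R, i, x, hx.isExt hB, hx.dim_eq, hs, ht, hinn, hout, b₁, b₂,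
    fun Y g y hy h₁ h₂ h₃ h₄ => ?_, fun T lam hL u h₁ h₂ => ?_⟩
  · refine exists_desc hx hB g hy h₁ h₂ fun k hk α => ?_
    obtain rfl : k = 0 := by omega
    cases α
    · rw [sU, Set.image_singleton, (bord_zero_Iic Y.rdc y).1, h₃]
    · rw [tU, Set.image_singleton, (bord_zero_Iic Y.rdc y).2.1, h₄]
  · refine (hx.isExt hB).exists_labelling hL u fun lam' hl hz => ?_
    have hd := hx.dim_eq
    have pv : ∀ (n : List Q.El) (v : Q.El), (cx R.El).pv T.cat.two lam' (i.fn v) (n.map i.fn) =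
        (cx Q.El).pv T.cat.two lam v n := by
      intro n
      induction n with
      | nil => exact fun v => hl v
      | cons e n ih =>
        intro v
        rw [List.map_cons, CxData.pv, CxData.pv, hl, ← ih, ← Hom.fn_tgt i e]
    refine ⟨fun h0 => by omega, fun h1 => by omega, fun _ => ?_, fun h2 => by omega⟩
    rw [hz, hs, hinn, hout, pv, pv]
    exact ⟨h₁, h₂⟩

end RDCpx

open OGPoset

/-! ### Complexes for the composition of faces -/

namespace MarkedTwoCat

variable {T : MarkedTwoCat}

theorem Word.zero {s t : T.cat.cell 2} {w : List (T.cat.cell 2)} (h : T.Word s w t) (α : Pol) :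
    T.cat.two.b α 0 s = s := by
  cases w with
  | nil => exact h.2 α
  | cons a w => rw [← h.1.1, T.cat.two.b_b_le _ _ _ le_rfl]

theorem Word.append {s t u : T.cat.cell 2} {w w' : List (T.cat.cell 2)} (h : T.Word s w t)
    (h' : T.Word t w' u) : T.Word s (w ++ w') u := by
  induction w generalizing s with
  | nil => exact h.1 ▸ h'
  | cons a w ih => exact ⟨h.1, ih h.2⟩

theorem Word.comp_b {s t : T.cat.cell 2} {w : List (T.cat.cell 2)} (h : T.Word s w t) :
    (∀ α, T.cat.two.b α 1 (T.wordComp s w) = T.wordComp s w) ∧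
    T.cat.two.b Pol.minus 0 (T.wordComp s w) = s ∧ T.cat.two.b Pol.plus 0 (T.wordComp s w) = t := by
  induction w generalizing s with
  | nil =>
    refine ⟨fun α => ?_, h.2 _, (h.2 _).trans h.1⟩
    rw [wordComp, ← h.2 Pol.minus, T.cat.two.b_b_le _ _ _ (Nat.zero_le 1)]
  | cons a w ih =>
    obtain ⟨h₁, h₂, h₃⟩ := ih h.2
    rw [wordComp]
    refine ⟨fun α => ?_, ?_, ?_⟩
    · rw [T.cat.two.b_comp α Nat.zero_lt_one h₂.symm, h₁, h.1.2.b_one]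
    · rw [T.cat.two.b_minus_comp h₂.symm, h.1.1]
    · rw [T.cat.two.b_plus_comp h₂.symm, h₃]

theorem Word.comp_append {s t u : T.cat.cell 2} {w w' : List (T.cat.cell 2)} (h : T.Word s w t)
    (h' : T.Word t w' u) :
    T.wordComp s (w ++ w') = T.cat.two.comp 0 (T.wordComp s w) (T.wordComp t w') := by
  induction w generalizing s with
  | nil =>
    obtain rfl := h.1
    rw [List.nil_append, wordComp]
    have := T.cat.two.comp_unit_left 0 (T.wordComp s w')
    rw [h'.comp_b.2.1] at this
    exact this.symm
  | cons a w ih =>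
    rw [List.cons_append, wordComp, wordComp, ih h.2, T.cat.two.assoc]
    · exact h.2.comp_b.2.1.symm
    · rw [h.2.comp_b.2.2, h'.comp_b.2.1]

end MarkedTwoCat

namespace RDCpx

variable {Q R Y : RDCpx} {T : MarkedTwoCat} {lam : Q.El → T.cat.cell 2}

theorem Labelling.word (hL : Q.Labelling T lam) {s t : Q.El} {l : List Q.El}
    (h : (cx Q.El).Walk s l t) : T.Word (lam s) (l.map lam) (lam t) ∧
      (cx Q.El).pv T.cat.two lam s l = T.wordComp (lam s) (l.map lam) := by
  induction l generalizing s with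
  | nil =>
    obtain ⟨rfl, hs⟩ := h
    exact ⟨⟨rfl, hL.lab.zero s hs⟩, rfl⟩
  | cons e l ih =>
    obtain ⟨⟨rfl, he, hs⟩, h⟩ := h
    obtain ⟨h₁, h₂⟩ := ih h
    rw [← hL.lab.tgt e he] at h₁ h₂
    refine ⟨⟨⟨hL.lab.src e he, hL.edge e he⟩, h₁⟩, ?_⟩
    rw [CxData.pv, h₂]
    rfl

theorem _root_.DiagNerve.MarkedTwoCat.Word.unique {s t t' : T.cat.cell 2}
    {w : List (T.cat.cell 2)} (h : T.Word s w t) (h' : T.Word s w t') : t = t' := by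
  rw [← h.comp_b.2.2, h'.comp_b.2.2]

end RDCpx

/-- A path `w`, `c`, `q` through the vertices `x`, `v₁`, `v₂`, `y`, together with a path `p` from
`v₁` to `y` and a path `r` from `x` to `v₂`, which meet only where they have to. -/
structure Frame {P : Type} [OGPoset P] (x v₁ v₂ y : P) (w c q p r : List P) : Prop where
  pw : PathOf (trail x w) x w v₁
  pc : PathOf (trail v₁ c) v₁ c v₂
  pq : PathOf (trail v₂ q) v₂ q y
  pp : PathOf (trail v₁ p) v₁ p y
  pr : PathOf (trail x r) x r v₂
  wc : trail x w ∩ trail v₁ c ⊆ {v₁}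
  wq : trail x w ∩ trail v₂ q ⊆ {v₁}
  cq : trail v₁ c ∩ trail v₂ q ⊆ {v₂}
  old_p : trail v₁ p ∩ (trail x w ∪ trail v₁ c ∪ trail v₂ q) ⊆ {v₁, y}
  old_r : trail x r ∩ (trail x w ∪ trail v₁ c ∪ trail v₂ q ∪ trail v₁ p) ⊆ {x, v₂}
  ne_c : v₁ ≠ v₂
  ne_p : v₁ ≠ y
  ne_r : x ≠ v₂

namespace Frame

section

variable {P : Type} [OGPoset P] [Finite P] {x v₁ v₂ y : P} {w c q p r : List P}

theorem ne (h : Frame x v₁ v₂ y w c q p r) (hP : IsRDC P) : x ≠ y := by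
  rintro rfl
  exact h.ne_p (h.wq ⟨h.pw.src_mem, h.pq.tgt_mem hP⟩).symm

theorem path_out (h : Frame x v₁ v₂ y w c q p r) (hP : IsRDC P) :
    PathOf (trail v₁ c ∪ trail v₂ q) v₁ (c ++ q) y :=
  h.pc.append hP h.pq (h.cq.antisymm (by
    rintro _ rfl; exact ⟨h.pc.tgt_mem hP, h.pq.src_mem⟩))

theorem path_inn (h : Frame x v₁ v₂ y w c q p r) (hP : IsRDC P) :
    PathOf (trail x w ∪ trail v₁ c) x (w ++ c) v₂ :=
  h.pw.append hP h.pc (h.wc.antisymm (by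
    rintro _ rfl; exact ⟨h.pw.tgt_mem hP, h.pc.src_mem⟩))

theorem path_inn' (h : Frame x v₁ v₂ y w c q p r) (hP : IsRDC P) :
    PathOf (trail x w ∪ trail v₁ p) x (w ++ p) y := by
  refine h.pw.append hP h.pp (Set.Subset.antisymm ?_ ?_)
  · rintro z ⟨h₁, h₂⟩
    rcases h.old_p ⟨h₂, Or.inl (Or.inl h₁)⟩ with h' | rfl
    · exact h'
    · exact h.wq ⟨h₁, h.pq.tgt_mem hP⟩
  · rintro _ rfl; exact ⟨h.pw.tgt_mem hP, h.pp.src_mem⟩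

theorem path_out' (h : Frame x v₁ v₂ y w c q p r) (hP : IsRDC P) :
    PathOf (trail x r ∪ trail v₂ q) x (r ++ q) y := by
  refine h.pr.append hP h.pq (Set.Subset.antisymm ?_ ?_)
  · rintro z ⟨h₁, h₂⟩
    rcases h.old_r ⟨h₁, Or.inl (Or.inr h₂)⟩ with rfl | h'
    · have := h.wq ⟨h.pw.src_mem, h₂⟩
      exact h.cq ⟨this ▸ h.pc.src_mem, h₂⟩
    · exact h'
  · rintro _ rfl; exact ⟨h.pr.tgt_mem hP, h.pq.src_mem⟩

theorem inter_p (h : Frame x v₁ v₂ y w c q p r) (hP : IsRDC P) :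
    trail v₁ p ∩ (trail v₁ c ∪ trail v₂ q) = {v₁, y} := by
  refine Set.Subset.antisymm ?_ ?_
  · rintro z ⟨h₁, h₂⟩
    exact h.old_p ⟨h₁, h₂.elim (fun h => Or.inl (Or.inr h)) Or.inr⟩
  · rintro z (rfl | rfl)
    · exact ⟨h.pp.src_mem, Or.inl h.pc.src_mem⟩
    · exact ⟨h.pp.tgt_mem hP, Or.inr (h.pq.tgt_mem hP)⟩

theorem inter_r (h : Frame x v₁ v₂ y w c q p r) (hP : IsRDC P) :
    (trail x w ∪ trail v₁ c) ∩ trail x r = {x, v₂} := by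
  refine Set.Subset.antisymm ?_ ?_
  · rintro z ⟨h₁, h₂⟩
    exact h.old_r ⟨h₂, Or.inl (Or.inl h₁)⟩
  · rintro z (rfl | rfl)
    · exact ⟨Or.inl h.pw.src_mem, h.pr.src_mem⟩
    · exact ⟨Or.inr (h.pc.tgt_mem hP), h.pr.tgt_mem hP⟩

theorem inter_pr (h : Frame x v₁ v₂ y w c q p r) (hP : IsRDC P) :
    (trail x w ∪ trail v₁ p) ∩ (trail x r ∪ trail v₂ q) = {x, y} := by
  refine Set.Subset.antisymm ?_ ?_
  · have hv : v₁ ∉ trail v₂ q := fun hv => h.ne_c (h.cq ⟨h.pc.src_mem, hv⟩)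
    rintro z ⟨h₁ | h₁, h₂ | h₂⟩
    · rcases h.old_r ⟨h₂, Or.inl (Or.inl (Or.inl h₁))⟩ with rfl | rfl
      · exact Or.inl rfl
      · exact absurd (h.wc ⟨h₁, h.pc.tgt_mem hP⟩).symm h.ne_c
    · obtain rfl := h.wq ⟨h₁, h₂⟩
      exact absurd h₂ hv
    · rcases h.old_r ⟨h₂, Or.inr h₁⟩ with rfl | rfl
      · exact Or.inl rfl
      · rcases h.old_p ⟨h₁, Or.inl (Or.inr (h.pc.tgt_mem hP))⟩ with h' | h'
        · exact absurd h'.symm h.ne_c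
        · exact Or.inr h'
    · rcases h.old_p ⟨h₁, Or.inr h₂⟩ with rfl | rfl
      · exact absurd h₂ hv
      · exact Or.inr rfl
  · rintro z (rfl | rfl)
    · exact ⟨Or.inl h.pw.src_mem, Or.inl h.pr.src_mem⟩
    · exact ⟨Or.inr (h.pp.tgt_mem hP), Or.inr (h.pq.tgt_mem hP)⟩

end

theorem map {Q R : RDCpx} {i : Q ⟶ R} (hi : ClosedEmb i.fn) {x v₁ v₂ y : Q.El}
    {w c q p r : List Q.El} (h : Frame x v₁ v₂ y w c q p r) :
    Frame (i.fn x) (i.fn v₁) (i.fn v₂) (i.fn y) (w.map i.fn) (c.map i.fn) (q.map i.fn)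
      (p.map i.fn) (r.map i.fn) := by
  have hs : ∀ {U V W : Set Q.El}, U ∩ V ⊆ W → i.fn '' U ∩ i.fn '' V ⊆ i.fn '' W := by
    intro U V W h
    rw [← Set.image_inter hi.injective]
    exact Set.image_mono h
  have ne : ∀ {a b}, a ≠ b → i.fn a ≠ i.fn b := fun h => hi.injective.ne h
  constructor <;> try simp only [← RDCpx.image_trail, ← Set.image_union]
  · exact RDCpx.pathOf_map hi h.pw
  · exact RDCpx.pathOf_map hi h.pc
  · exact RDCpx.pathOf_map hi h.pq
  · exact RDCpx.pathOf_map hi h.pp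
  · exact RDCpx.pathOf_map hi h.pr
  · simpa using hs h.wc
  · simpa using hs h.wq
  · simpa using hs h.cq
  · simpa only [Set.image_pair] using hs h.old_p
  · simpa only [Set.image_pair] using hs h.old_r
  · exact ne h.ne_c
  · exact ne h.ne_p
  · exact ne h.ne_r

end Frame

namespace RDCpx

variable {Q R Y : RDCpx}

/-- The empty complex. -/
theorem exists_empty : ∃ Q : RDCpx, IsEmpty Q.El := by
  let I : OGPoset (Fin 0) :=
    { dim := fun x => x.elim0
      dim_of_isMin := fun x => x.elim0
      dim_of_covBy := fun x => x.elim0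
      orient := fun {x} => x.elim0 }
  exact ⟨⟨0, I, ⟨fun x => x.elim0, fun x => x.elim0, fun x => x.elim0, fun x => x.elim0⟩⟩,
    inferInstanceAs (IsEmpty (Fin 0))⟩

/-- Two vertices. -/
theorem exists_two_points : ∃ (Q : RDCpx) (x y : Q.El), dim x = 0 ∧ dim y = 0 ∧ x ≠ y ∧
    (∀ (Y : RDCpx) (a b : Y.El), dim a = 0 → dim b = 0 → ∃ g : Q ⟶ Y, g.fn x = a ∧ g.fn y = b) ∧
    ∀ (T : MarkedTwoCat) (s t : T.cat.cell 2), (∀ α, T.cat.two.b α 0 s = s) →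
      (∀ α, T.cat.two.b α 0 t = t) → ∃ lam, Q.Labelling T lam ∧ lam x = s ∧ lam y = t := by
  obtain ⟨E, hE⟩ := exists_empty
  obtain ⟨Q₁, i, x, hi, hx, g₁, l₁⟩ := exists_attach_point E
  obtain ⟨Q, j, y, hj, hy, g₂, l₂⟩ := exists_attach_point Q₁
  refine ⟨Q, j.fn x, y, (hj.emb.dim_eq x).trans hx, hy, fun h => hj.notMem ⟨x, h⟩,
    fun Y a b ha hb => ?_, fun T s t hs ht => ?_⟩
  · obtain ⟨g', -, e₁⟩ := g₁ Y ⟨fun z => hE.elim z, fun z => hE.elim z⟩ a ha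
    obtain ⟨g, e₂, e₃⟩ := g₂ Y g' b hb
    subst e₂
    exact ⟨g, e₁, e₃⟩
  · obtain ⟨lam', L', -, e₁⟩ := l₁ T (fun z => hE.elim z) (Labelling.of_cover fun z => hE.elim z)
      s hs
    obtain ⟨lam, L, e₂, e₃⟩ := l₂ T lam' L' t ht
    exact ⟨lam, L, (e₂ x).trans e₁, e₃⟩

theorem exists_frame (j l n m k : ℕ) : ∃ (Q : RDCpx) (x v₁ v₂ y : Q.El) (w c q p r : List Q.El),
    Frame x v₁ v₂ y w c q p r ∧ 
    ∀ (T : MarkedTwoCat) (s₀ s₁ s₂ s₃ : T.cat.cell 2) (W C B A D : List (T.cat.cell 2)),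
      W.length = j → C.length = l + 1 → B.length = n → A.length = m + 1 → D.length = k + 1 →
      T.Word s₀ W s₁ → T.Word s₁ C s₂ → T.Word s₂ B s₃ → T.Word s₁ A s₃ → T.Word s₀ D s₂ →
      ∃ lam, Q.Labelling T lam ∧ lam x = s₀ ∧ lam v₁ = s₁ ∧ lam v₂ = s₂ ∧ w.map lam = W ∧
        c.map lam = C ∧ q.map lam = B ∧ p.map lam = A ∧ r.map lam = D := by
  obtain ⟨Q₀, x, y, dx, dy, hxy, -, l₀⟩ := exists_two_points
  obtain ⟨Q₁, i, l', hi, len, hl, -, -, l₁⟩ := exists_attach_path (j + l + n) Q₀ dx dy hxy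
  obtain ⟨w, d, rfl, hw⟩ : ∃ w d, l' = w ++ d ∧ w.length = j :=
    ⟨l'.take j, l'.drop j, (List.take_append_drop j l').symm, by rw [List.length_take]; omega⟩
  rw [List.length_append] at len
  obtain ⟨c, q, rfl, hc⟩ : ∃ c q, d = c ++ q ∧ c.length = l + 1 :=
    ⟨d.take (l + 1), d.drop (l + 1), (List.take_append_drop _ d).symm, by
      rw [List.length_take]; omega⟩
  rw [List.length_append] at len
  obtain ⟨v₁, pw, pcq, i₁⟩ := hl.exists_split Q₁.rdc
  obtain ⟨v₂, pc, pq, i₂⟩ := pcq.exists_split Q₁.rdc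
  have dv₁ : dim v₁ = 0 := pcq.walk.dim_src
  have dv₂ : dim v₂ = 0 := pq.walk.dim_src
  have dx₁ : dim (i.fn x) = 0 := pw.walk.dim_src
  have dy₁ : dim (i.fn y) = 0 := pq.walk.dim_tgt
  have ne_of : ∀ {U : Set Q₁.El} {a b : Q₁.El} {o : List Q₁.El}, PathOf U a o b → o ≠ [] →
      a ≠ b := by
    intro U a b o ho hne
    cases o with
    | nil => exact absurd rfl hne
    | cons e o => exact ho.walk.1.1 ▸ ho.ne e (by simp)
  have hcne : c ≠ [] := fun h => by simp [h] at hc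
  have ne_p : v₁ ≠ i.fn y := ne_of pcq (by simp [hcne])
  have ne_c : v₁ ≠ v₂ := ne_of pc hcne
  rw [trail_append Q₁.rdc (cx_walk.2 pc.walk)] at i₁
  have ne_r : i.fn x ≠ v₂ := by
    intro h
    have : v₂ ∈ trail (i.fn x) w ∩ (trail v₁ c ∪ trail v₂ q) :=
      ⟨h ▸ pw.src_mem, Or.inl (pc.tgt_mem Q₁.rdc)⟩
    rw [i₁] at this
    exact ne_c this.symm
  obtain ⟨Q₂, i', p, hi', lenp, hp, op, -, l₂⟩ := exists_attach_path m Q₁ dv₁ dy₁ ne_p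
  obtain ⟨Q, i'', r, hi'', lenr, hr, or, -, l₃⟩ := exists_attach_path k Q₂
    (s := i'.fn (i.fn x)) (t := i'.fn v₂) ((hi'.dim_eq _).trans dx₁) ((hi'.dim_eq _).trans dv₂)
    (hi'.injective.ne ne_r)
  have im' : ∀ s (o : List Q₁.El), i'.fn '' trail s o = trail (i'.fn s) (o.map i'.fn) :=
    fun s o => image_trail i' s o
  have im'' : ∀ s (o : List Q₂.El), i''.fn '' trail s o = trail (i''.fn s) (o.map i''.fn) :=
    fun s o => image_trail i'' s o
  have sub : ∀ {U V : Set Q₁.El} {a : Q₁.El}, U ∩ V ⊆ {a} →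
      i''.fn '' (i'.fn '' U) ∩ i''.fn '' (i'.fn '' V) ⊆ {i''.fn (i'.fn a)} := by
    intro U V a h
    rw [← Set.image_inter hi''.injective, ← Set.image_inter hi'.injective]
    simpa using Set.image_mono (f := i''.fn) (Set.image_mono (f := i'.fn) h)
  refine ⟨Q, i''.fn (i'.fn (i.fn x)), i''.fn (i'.fn v₁), i''.fn (i'.fn v₂), i''.fn (i'.fn (i.fn y)),
    (w.map i'.fn).map i''.fn, (c.map i'.fn).map i''.fn, (q.map i'.fn).map i''.fn, p.map i''.fn, r,
    ?_, ?_⟩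
  · constructor
    · simpa only [im', im''] using pathOf_map hi'' (pathOf_map hi' pw)
    · simpa only [im', im''] using pathOf_map hi'' (pathOf_map hi' pc)
    · simpa only [im', im''] using pathOf_map hi'' (pathOf_map hi' pq)
    · simpa only [im', im''] using pathOf_map hi'' hp
    · exact hr
    · have : trail (i.fn x) w ∩ trail v₁ c ⊆ {v₁} :=
        (Set.inter_subset_inter_right _ Set.subset_union_left).trans i₁.subset
      simpa only [im', im''] using sub this
    · have : trail (i.fn x) w ∩ trail v₂ q ⊆ {v₁} :=
        (Set.inter_subset_inter_right _ Set.subset_union_right).trans i₁.subset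
      simpa only [im', im''] using sub this
    · simpa only [im', im''] using sub i₂.subset
    · have : trail (i'.fn v₁) p ∩ (i'.fn '' trail (i.fn x) w ∪ i'.fn '' trail v₁ c ∪
          i'.fn '' trail v₂ q) ⊆ {i'.fn v₁, i'.fn (i.fn y)} := by
        rw [← op, ← Set.image_union, ← Set.image_union]
        exact Set.inter_subset_inter_right _ (Set.image_subset_range _ _)
      have := Set.image_mono (f := i''.fn) this
      rw [Set.image_inter hi''.injective, Set.image_pair] at this
      simpa only [Set.image_union, im', im''] using this
    · rw [← or, ← im'', ← im'', ← im'', ← im'', ← Set.image_union, ← Set.image_union,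
        ← Set.image_union]
      exact Set.inter_subset_inter_right _ (Set.image_subset_range _ _)
    · exact (hi''.injective.comp hi'.injective).ne ne_c
    · exact (hi''.injective.comp hi'.injective).ne ne_p
    · exact (hi''.injective.comp hi'.injective).ne ne_r
  · intro T s₀ s₁ s₂ s₃ W C B A D lW lC lB lA lD hW hC hB hA hD
    have z₃ : ∀ α, T.cat.two.b α 0 s₃ = s₃ := fun α => by
      rw [← hB.comp_b.2.2, T.cat.two.b_b_le _ _ _ le_rfl]
    obtain ⟨lam₀, L₀, e₀, e₀'⟩ := l₀ T s₀ s₃ hW.zero z₃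
    obtain ⟨lam₁, L₁, e₁, c₁⟩ := l₁ T lam₀ L₀ (W ++ (C ++ B)) (by simp; omega) (by
      rw [e₀, e₀']; exact hW.append (hC.append hB))
    rw [List.map_append, List.map_append] at c₁
    obtain ⟨cw, c₁⟩ := List.append_inj c₁ (by simp [hw, lW])
    obtain ⟨cc, cq⟩ := List.append_inj c₁ (by simp [hc, lC])
    have ex : lam₁ (i.fn x) = s₀ := (e₁ x).trans e₀
    have ey : lam₁ (i.fn y) = s₃ := (e₁ y).trans e₀'
    have ev₁ : lam₁ v₁ = s₁ := by
      have := (L₁.word (cx_walk.2 pw.walk)).1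
      rw [cw, ex] at this
      exact this.unique hW
    have ev₂ : lam₁ v₂ = s₂ := by
      have := (L₁.word (cx_walk.2 pc.walk)).1
      rw [cc, ev₁] at this
      exact this.unique hC
    obtain ⟨lam₂, L₂, e₂, c₂⟩ := l₂ T lam₁ L₁ A lA (by rw [ev₁, ey]; exact hA)
    obtain ⟨lam, L, e₃, c₃⟩ := l₃ T lam₂ L₂ D lD (by rw [e₂, e₂, ex, ev₂]; exact hD)
    have mm : ∀ o : List Q₁.El, ((o.map i'.fn).map i''.fn).map lam = o.map lam₁ := by
      intro o
      rw [List.map_map, List.map_map]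
      exact List.map_congr_left fun e _ => (e₃ _).trans (e₂ _)
    refine ⟨lam, L, ?_, ?_, ?_, (mm w).trans cw, (mm c).trans cc, (mm q).trans cq, ?_, c₃⟩
    · rw [e₃, e₂, ex]
    · rw [e₃, e₂, ev₁]
    · rw [e₃, e₂, ev₂]
    · rw [List.map_map, ← c₂]
      exact List.map_congr_left fun e _ => e₃ _

end RDCpx

open OGPoset

/-! ### Three-dimensional cells relating composites of faces -/

namespace RDCpx

variable {Q R : RDCpx}

theorem Hom.img_eq_map {i : Q ⟶ R} (hi : ClosedEmb i.fn) {d : ℕ} {l : List Q.El}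
    (h : ∀ x ∈ l, dim x = d) : Hom.img i d l = l.map i.fn := by
  refine List.filter_eq_self.2 fun y hy => ?_
  obtain ⟨x, hx, rfl⟩ := List.mem_map.1 hy
  simp [hi.dim_eq, h x hx]

theorem composite_image {C : Type} {D : Two C} {mu : R.El → C} (L : (cx R.El).Lab D mu)
    {i : Q ⟶ R} (hi : ClosedEmb i.fn) {U : Set Q.El} (hU : IsMolecule U) {u : C}
    (h : Composite D (mu ∘ i.fn) U u) : Composite D mu (i.fn '' U) u := by
  obtain ⟨z, xs, nd, hx, hr⟩ := h
  have hU' := hi.isMolecule_image hU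
  have path : ∀ α, pathList (bord 1 α (i.fn '' U)) = Hom.img i 1 (pathList (bord 1 α U)) := by
    intro α
    have p := pathOf_bord (z := z) Q.rdc hU α
    rw [Hom.img_eq_map hi fun e he => p.walk.dim_edge he, hi.bord_image]
    have p' := pathOf_map hi p
    obtain ⟨h₁, h₂, h₃⟩ := p'.isMolecule R.rdc
    exact pathList_eq R.rdc h₁ p'.dimLe p' h₂ h₃
  have hs : vsrc (i.fn z) (i.fn '' U) = i.fn (vsrc z U) := by
    refine pointOf_eq ?_
    rw [hi.bord_image, (vsrc_spec (z := z) Q.rdc hU).1, Set.image_singleton]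
  refine ⟨i.fn z, xs.map i.fn, nd.map hi.injective, fun y => ?_, ?_⟩
  · constructor
    · intro hy
      obtain ⟨x, hx', rfl⟩ := List.mem_map.1 hy
      exact ⟨⟨x, ((hx x).1 hx').1, rfl⟩, (hi.dim_eq x).trans ((hx x).1 hx').2⟩
    · rintro ⟨⟨x, hxU, rfl⟩, hd⟩
      exact List.mem_map_of_mem ((hx x).2 ⟨hxU, (hi.dim_eq x).symm.trans hd⟩)
  · have := Hom.rw_img i L hr (fun x h => ((hx x).1 h).2) (walk_bord Q.rdc hU _)
    rw [hs, path, path]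
    rwa [Hom.img_eq_map hi fun x h => ((hx x).1 h).2] at this

/-- Adjoining a three-dimensional cell. -/
theorem exists_attach_three {U V : Set Q.El} (hB : IsCellBoundary 2 U V) :
    ∃ (R : RDCpx) (i : Q ⟶ R),
      (∀ (T : MarkedTwoCat) (lam : Q.El → T.cat.cell 2), Q.Labelling T lam → ∀ u,
        Composite T.cat.two lam U u → Composite T.cat.two lam V u →
        ∃ lam', R.Labelling T lam' ∧ ∀ x, lam' (i.fn x) = lam x) ∧
      ∀ (T : MarkedTwoCat) (mu : R.El → T.cat.cell 2), R.Labelling T mu → ∀ u v,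
        Composite T.cat.two (mu ∘ i.fn) U u → Composite T.cat.two (mu ∘ i.fn) V v → u = v := by
  obtain ⟨R, i, x, h⟩ := exists_attach hB
  obtain ⟨b₁, b₂⟩ := h.bord_top hB
  have mo := fun α => ((IsMolecule.atom x).good R.rdc).molecule 2 α
  refine ⟨R, i, fun T lam hL u hu hv => ?_, fun T mu hL u v hu hv => ?_⟩
  · obtain ⟨lam', L, e, -⟩ := (h.isExt hB).exists_labelling hL u fun lam' hl hz => by
      have hd := h.dim_eq
      refine ⟨fun h0 => by omega, fun h1 => by omega, fun h2 => by omega, fun _ L α => ?_⟩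
      have e : lam' ∘ i.fn = lam := funext hl
      rw [hz]
      cases α
      · rw [b₁]; exact composite_image L h.emb hB.minus (e ▸ hu)
      · rw [b₂]; exact composite_image L h.emb hB.plus (e ▸ hv)
    exact ⟨lam', L, e⟩
  · have hu' := composite_image hL.lab h.emb hB.minus hu
    have hv' := composite_image hL.lab h.emb hB.plus hv
    rw [← b₁] at hu'
    rw [← b₂] at hv'
    rw [(hL.val x Pol.minus).unique R.rdc hL.lab (mo _) dimLe_bord hu',
      (hL.val x Pol.plus).unique R.rdc hL.lab (mo _) dimLe_bord hv']

end RDCpx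

section

variable {P : Type} [OGPoset P] [Finite P]

theorem isCellBoundary_two (hP : IsRDC P) {U : Set P} (hU : IsMolecule U) {C : P} (hC : dim C = 2)
    (hCU : C ∉ U) (pure : ∀ x ∈ U, ∃ y ∈ U, x ≤ y ∧ dim y = 2)
    (h : ∀ α, bord 1 α U = bord 1 α (Set.Iic C)) : IsCellBoundary 2 U (Set.Iic C) := by
  have h₀ : ∀ α, bord 0 α U = bord 0 α (Set.Iic C) := fun α => by
    rw [← (hU.good hP).globular 0 1 α α Nat.zero_lt_one, h,
      ((IsMolecule.atom C).good hP).globular 0 1 α α Nat.zero_lt_one]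
  refine ⟨hU, .atom C, pure, fun x hx => ⟨C, le_rfl, hx, hC⟩, fun k hk α => ?_, fun h => by omega,
    fun k hk => ?_, fun _ => ?_, fun k hk => ?_⟩
  · obtain rfl | rfl : k = 0 ∨ k = 1 := by omega
    · exact h₀ α
    · exact h α
  · obtain rfl : k = 1 := by omega
    refine Set.Subset.antisymm ?_ (Set.union_subset (Set.subset_inter
      (bord_subset hU.isLowerSet) ?_) (Set.subset_inter (bord_subset hU.isLowerSet) ?_))
    · rintro x ⟨hx, hxC⟩
      rcases (Set.mem_Iic.1 hxC).lt_or_eq with hlt | rfl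
      · obtain ⟨γ, hγ⟩ := mem_bord_of_lt hC hlt
        rw [← h] at hγ
        cases γ
        · exact Or.inr hγ
        · exact Or.inl hγ
      · exact absurd hx hCU
    · rw [h]; exact bord_subset (isLowerSet_Iic C)
    · rw [h]; exact bord_subset (isLowerSet_Iic C)
  · rw [h₀, h₀]
    exact hP.spherical_zero C (by omega)
  · obtain rfl : k = 0 := by omega
    rw [h, h, h₀, h₀]
    exact hP.spherical_succ C 0 (by omega)

/-- Two faces `A : p ⇒ c q` and `B : w c ⇒ r` that meet along the path `c`, and a face
`C : w p ⇒ r q`. -/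
structure Exchange (x v₁ v₂ y : P) (w c q p r : List P) (A B C : P) : Prop extends
    Frame x v₁ v₂ y w c q p r where
  dimA : dim A = 2
  dimB : dim B = 2
  dimC : dim C = 2
  innA : bord 1 Pol.minus (Set.Iic A) = trail v₁ p
  outA : bord 1 Pol.plus (Set.Iic A) = trail v₁ c ∪ trail v₂ q
  innB : bord 1 Pol.minus (Set.Iic B) = trail x w ∪ trail v₁ c
  outB : bord 1 Pol.plus (Set.Iic B) = trail x r
  innC : bord 1 Pol.minus (Set.Iic C) = trail x w ∪ trail v₁ p
  outC : bord 1 Pol.plus (Set.Iic C) = trail x r ∪ trail v₂ q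
  neA : C ≠ A
  neB : C ≠ B
  neAB : A ≠ B

namespace Exchange

variable {x v₁ v₂ y : P} {w c q p r : List P} {A B C : P}

theorem mem_A (h : Exchange x v₁ v₂ y w c q p r A B C) {z : P} (hz : z ≤ A) :
    z = A ∨ z ∈ trail v₁ p ∨ z ∈ trail v₁ c ∨ z ∈ trail v₂ q := by
  rcases hz.lt_or_eq with hlt | rfl
  · obtain ⟨γ, hγ⟩ := mem_bord_of_lt h.dimA hlt
    cases γ
    · rw [h.innA] at hγ; exact Or.inr (Or.inl hγ)
    · rw [h.outA] at hγ; exact Or.inr (Or.inr hγ)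
  · exact Or.inl rfl

theorem mem_B (h : Exchange x v₁ v₂ y w c q p r A B C) {z : P} (hz : z ≤ B) :
    z = B ∨ (z ∈ trail x w ∨ z ∈ trail v₁ c) ∨ z ∈ trail x r := by
  rcases hz.lt_or_eq with hlt | rfl
  · obtain ⟨γ, hγ⟩ := mem_bord_of_lt h.dimB hlt
    cases γ
    · rw [h.innB] at hγ; exact Or.inr (Or.inl hγ)
    · rw [h.outB] at hγ; exact Or.inr (Or.inr hγ)
  · exact Or.inl rfl

theorem src_A (h : Exchange x v₁ v₂ y w c q p r A B C) (hP : IsRDC P) :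
    bord 0 Pol.minus (Set.Iic A) = {v₁} ∧ bord 0 Pol.plus (Set.Iic A) = {y} := by
  have g := ((IsMolecule.atom A).good hP).globular
  obtain ⟨-, h₁, h₂⟩ := h.pp.isMolecule hP
  rw [← g 0 1 _ Pol.minus Nat.zero_lt_one, ← g 0 1 _ Pol.minus Nat.zero_lt_one, h.innA]
  exact ⟨h₁, h₂⟩

theorem src_B (h : Exchange x v₁ v₂ y w c q p r A B C) (hP : IsRDC P) :
    bord 0 Pol.minus (Set.Iic B) = {x} ∧ bord 0 Pol.plus (Set.Iic B) = {v₂} := by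
  have g := ((IsMolecule.atom B).good hP).globular
  obtain ⟨-, h₁, h₂⟩ := h.pr.isMolecule hP
  rw [← g 0 1 _ Pol.plus Nat.zero_lt_one, ← g 0 1 _ Pol.plus Nat.zero_lt_one, h.outB]
  exact ⟨h₁, h₂⟩

theorem inter_A (h : Exchange x v₁ v₂ y w c q p r A B C) (hP : IsRDC P) :
    trail x w ∩ Set.Iic A = {v₁} := by
  refine Set.Subset.antisymm ?_ ?_
  · rintro z ⟨h₁, h₂⟩
    rcases h.mem_A h₂ with rfl | h₂ | h₂ | h₂
    · have := h.pw.dimLe z h₁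
      have := h.dimA
      omega
    · rcases h.old_p ⟨h₂, Or.inl (Or.inl h₁)⟩ with h' | rfl
      · exact h'
      · exact h.wq ⟨h₁, h.pq.tgt_mem hP⟩
    · exact h.wc ⟨h₁, h₂⟩
    · exact h.wq ⟨h₁, h₂⟩
  · rintro _ rfl
    exact ⟨h.pw.tgt_mem hP, bord_subset (isLowerSet_Iic A) ((h.src_A hP).1.superset rfl)⟩

theorem inter_B (h : Exchange x v₁ v₂ y w c q p r A B C) (hP : IsRDC P) :
    Set.Iic B ∩ trail v₂ q = {v₂} := by
  refine Set.Subset.antisymm ?_ ?_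
  · rintro z ⟨h₁, h₂⟩
    rcases h.mem_B h₁ with rfl | (h₁ | h₁) | h₁
    · have := h.pq.dimLe z h₂
      have := h.dimB
      omega
    · have := h.wq ⟨h₁, h₂⟩
      exact h.cq ⟨this ▸ h.pc.src_mem, h₂⟩
    · exact h.cq ⟨h₁, h₂⟩
    · rcases h.old_r ⟨h₁, Or.inl (Or.inr h₂)⟩ with rfl | h'
      · have := h.wq ⟨h.pw.src_mem, h₂⟩
        exact h.cq ⟨this ▸ h.pc.src_mem, h₂⟩
      · exact h'
  · rintro _ rfl
    exact ⟨bord_subset (isLowerSet_Iic B) ((h.src_B hP).2.superset rfl), h.pq.src_mem⟩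

theorem paste (h : Exchange x v₁ v₂ y w c q p r A B C) (hP : IsRDC P) :
    IsMolecule (trail x w ∪ Set.Iic A) ∧ IsMolecule (Set.Iic B ∪ trail v₂ q) ∧
    bord 1 Pol.minus (trail x w ∪ Set.Iic A) = trail x w ∪ trail v₁ p ∧
    bord 1 Pol.plus (Set.Iic B ∪ trail v₂ q) = trail x r ∪ trail v₂ q ∧
    (trail x w ∪ Set.Iic A) ∩ (Set.Iic B ∪ trail v₂ q) =
      bord 1 Pol.plus (trail x w ∪ Set.Iic A) ∧
    (trail x w ∪ Set.Iic A) ∩ (Set.Iic B ∪ trail v₂ q) =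
      bord 1 Pol.minus (Set.Iic B ∪ trail v₂ q) := by
  obtain ⟨mw, -, tw⟩ := h.pw.isMolecule hP
  obtain ⟨mq, sq, -⟩ := h.pq.isMolecule hP
  have a₁ := (h.inter_A hP).trans tw.symm
  have a₂ := (h.inter_A hP).trans (h.src_A hP).1.symm
  have b₁ := (h.inter_B hP).trans (h.src_B hP).2.symm
  have b₂ := (h.inter_B hP).trans sq.symm
  have bw : ∀ α, bord 1 α (trail x w) = trail x w := fun α =>
    bord_eq_self mw.isLowerSet h.pw.dimLe
  have bq : ∀ α, bord 1 α (trail v₂ q) = trail v₂ q := fun α =>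
    bord_eq_self mq.isLowerSet h.pq.dimLe
  have eA : ∀ α, bord 1 α (trail x w ∪ Set.Iic A) = trail x w ∪ bord 1 α (Set.Iic A) := fun α => by
    rw [bord_union_of_gt mw.isLowerSet (isLowerSet_Iic A) (mw.good hP)
      ((IsMolecule.atom A).good hP) a₁ a₂ Nat.zero_lt_one, bw]
  have eB : ∀ α, bord 1 α (Set.Iic B ∪ trail v₂ q) = bord 1 α (Set.Iic B) ∪ trail v₂ q := fun α => by
    rw [bord_union_of_gt (isLowerSet_Iic B) mq.isLowerSet ((IsMolecule.atom B).good hP)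
      (mq.good hP) b₁ b₂ Nat.zero_lt_one, bq]
  have leA : ∀ {z}, z ∈ trail v₁ c ∪ trail v₂ q → z ≤ A := fun hz =>
    bord_subset (isLowerSet_Iic A) (h.outA.symm ▸ hz)
  have leB : ∀ {z}, z ∈ trail x w ∪ trail v₁ c → z ≤ B := fun hz =>
    bord_subset (isLowerSet_Iic B) (h.innB.symm ▸ hz)
  have key : (trail x w ∪ Set.Iic A) ∩ (Set.Iic B ∪ trail v₂ q) =
      trail x w ∪ trail v₁ c ∪ trail v₂ q := by
    refine Set.Subset.antisymm ?_ ?_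
    · rintro z ⟨h₁ | h₁, h₂ | h₂⟩
      · exact Or.inl (Or.inl h₁)
      · exact Or.inr h₂
      · rcases h.mem_A h₁ with rfl | h₁' | h₁' | h₁'
        · have := h.dimA
          rcases h.mem_B h₂ with rfl | (h₂ | h₂) | h₂
          · exact absurd rfl h.neAB
          · have := h.pw.dimLe z h₂
            omega
          · have := h.pc.dimLe z h₂
            omega
          · have := h.pr.dimLe z h₂
            omega
        · rcases h.mem_B h₂ with rfl | (h₂ | h₂) | h₂
          · have := h.pp.dimLe z h₁'
            have := h.dimB
            omega
          · exact Or.inl (Or.inl h₂)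
          · exact Or.inl (Or.inr h₂)
          · rcases h.old_r ⟨h₂, Or.inr h₁'⟩ with rfl | rfl
            · exact Or.inl (Or.inl h.pw.src_mem)
            · exact Or.inr h.pq.src_mem
        · exact Or.inl (Or.inr h₁')
        · exact Or.inr h₁'
      · exact Or.inr h₂
    · rintro z ((hz | hz) | hz)
      · exact ⟨Or.inl hz, Or.inl (leB (Or.inl hz))⟩
      · exact ⟨Or.inr (leA (Or.inl hz)), Or.inl (leB (Or.inr hz))⟩
      · exact ⟨Or.inr (leA (Or.inr hz)), Or.inr hz⟩
  refine ⟨mw.union (.atom A) a₁ a₂, (IsMolecule.atom B).union mq b₁ b₂, ?_, ?_, ?_, ?_⟩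
  · rw [eA, h.innA]
  · rw [eB, h.outB]
  · rw [eA, h.outA, key, Set.union_assoc]
  · rw [eB, h.innB, key]

set_option linter.unusedSectionVars false in
theorem union_eq (h : Exchange x v₁ v₂ y w c q p r A B C) :
    Set.Iic A ∪ Set.Iic B = (trail x w ∪ Set.Iic A) ∪ (Set.Iic B ∪ trail v₂ q) := by
  have leA : trail v₂ q ⊆ Set.Iic A := fun z hz =>
    bord_subset (isLowerSet_Iic A) (h.outA.superset (Or.inr hz))
  have leB : trail x w ⊆ Set.Iic B := fun z hz =>
    bord_subset (isLowerSet_Iic B) (h.innB.superset (Or.inl hz))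
  refine Set.Subset.antisymm ?_ ?_
  · exact Set.union_subset_union Set.subset_union_right Set.subset_union_left
  · exact Set.union_subset (Set.union_subset (leB.trans Set.subset_union_right)
      Set.subset_union_left) (Set.union_subset Set.subset_union_right
        (leA.trans Set.subset_union_left))

theorem isCellBoundary (h : Exchange x v₁ v₂ y w c q p r A B C) (hP : IsRDC P) :
    IsCellBoundary 2 (Set.Iic A ∪ Set.Iic B) (Set.Iic C) := by
  obtain ⟨m₁, m₂, e₁, e₂, i₁, i₂⟩ := h.paste hP
  have hu := h.union_eq
  have hm := m₁.union m₂ i₁ i₂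
  rw [← hu] at hm
  refine isCellBoundary_two hP hm h.dimC ?_ ?_ ?_
  · rintro (hC | hC)
    · exact h.neA (eq_of_le_of_dim_le hC (by rw [h.dimA, h.dimC]))
    · exact h.neB (eq_of_le_of_dim_le hC (by rw [h.dimB, h.dimC]))
  · rintro z (hz | hz)
    · exact ⟨A, Or.inl le_rfl, hz, h.dimA⟩
    · exact ⟨B, Or.inr le_rfl, hz, h.dimB⟩
  · rw [hu]
    rintro (_ | _)
    · rw [bord_minus_union m₂.isLowerSet i₂, e₁, h.innC]
    · rw [bord_plus_union m₁.isLowerSet i₁, e₂, h.outC]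

theorem composite (h : Exchange x v₁ v₂ y w c q p r A B C) (hP : IsRDC P) {K : Type} {D : Two K}
    {lam : P → K} (L : (cx P).Lab D lam) : Composite D lam (Set.Iic A ∪ Set.Iic B)
      (D.comp 1 (D.comp 0 ((cx P).pv D lam x w) (lam A))
        (D.comp 0 (lam B) ((cx P).pv D lam v₂ q))) := by
  obtain ⟨m₁, m₂, e₁, e₂, i₁, i₂⟩ := h.paste hP
  obtain ⟨mw, sw, tw⟩ := h.pw.isMolecule hP
  obtain ⟨mq, sq, tq⟩ := h.pq.isMolecule hP
  have cw := composite_of_dimLe_one (D := D) (lam := lam) mw h.pw.dimLe x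
  have cq := composite_of_dimLe_one (D := D) (lam := lam) mq h.pq.dimLe x
  rw [pathList_eq hP mw h.pw.dimLe h.pw sw tw, vsrc, pointOf_eq sw] at cw
  rw [pathList_eq hP mq h.pq.dimLe h.pq sq tq, vsrc, pointOf_eq sq] at cq
  rw [h.union_eq]
  refine Composite.union_one hP L m₁ m₂ i₁ i₂ ?_ ?_
  · exact cw.union_zero hP L mw (.atom A) ((h.inter_A hP).trans tw.symm)
      ((h.inter_A hP).trans (h.src_A hP).1.symm) (composite_Iic hP L h.dimA.le)
  · exact (composite_Iic hP L h.dimB.le).union_zero hP L (.atom B) mq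
      ((h.inter_B hP).trans (h.src_B hP).2.symm) ((h.inter_B hP).trans sq.symm) cq

end Exchange

end

open OGPoset

namespace RDCpx

variable {Q R : RDCpx}

theorem inn_eq {x s t : Q.El} {U : Set Q.El} {l : List Q.El} {α : Pol}
    (h : bord 1 α (Set.Iic x) = U) (hU : PathOf U s l t) :
    pathList (bord 1 α (Set.Iic x)) = l := by
  obtain ⟨h₁, h₂, h₃⟩ := hU.isMolecule Q.rdc
  rw [h]
  exact pathList_eq Q.rdc h₁ hU.dimLe hU h₂ h₃

/-- There are complexes of three faces `A : p ⇒ c q`, `B : w c ⇒ r` and `C : w p ⇒ r q` with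
arbitrary labels. -/
theorem exists_exchange (j l n m k : ℕ) : ∃ (Q : RDCpx) (x v₁ v₂ y : Q.El)
    (w c q p r : List Q.El) (A B C : Q.El), Exchange x v₁ v₂ y w c q p r A B C ∧
    ∀ (T : MarkedTwoCat) (s₀ s₁ s₂ s₃ : T.cat.cell 2) (W C' B' A' D : List (T.cat.cell 2))
      (a b d : T.cat.cell 2),
      W.length = j → C'.length = l + 1 → B'.length = n → A'.length = m + 1 → D.length = k + 1 →
      T.Word s₀ W s₁ → T.Word s₁ C' s₂ → T.Word s₂ B' s₃ → T.Word s₁ A' s₃ → T.Word s₀ D s₂ →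
      T.cat.two.b Pol.minus 1 a = T.wordComp s₁ A' →
      T.cat.two.b Pol.plus 1 a = T.wordComp s₁ (C' ++ B') →
      T.cat.two.b Pol.minus 1 b = T.wordComp s₀ (W ++ C') →
      T.cat.two.b Pol.plus 1 b = T.wordComp s₀ D →
      T.cat.two.b Pol.minus 1 d = T.wordComp s₀ (W ++ A') →
      T.cat.two.b Pol.plus 1 d = T.wordComp s₀ (D ++ B') →
      ∃ lam, Q.Labelling T lam ∧ lam x = s₀ ∧ lam v₁ = s₁ ∧ lam v₂ = s₂ ∧ w.map lam = W ∧
        c.map lam = C' ∧ q.map lam = B' ∧ p.map lam = A' ∧ r.map lam = D ∧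
        lam A = a ∧ lam B = b ∧ lam C = d := by
  obtain ⟨Q, x, v₁, v₂, y, w, c, q, p, r, F, l₀⟩ := exists_frame j l n m k
  obtain ⟨Q₁, i₁, A, h₁, dA, -, -, -, -, nA, oA, -, l₁⟩ := exists_attach_face F.pp
    (F.path_out Q.rdc) F.ne_p (F.inter_p Q.rdc)
  have F₁ := F.map h₁.emb
  obtain ⟨Q₂, i₂, B, h₂, dB, -, -, -, -, nB, oB, -, l₂⟩ := exists_attach_face
    (F₁.path_inn Q₁.rdc) F₁.pr F₁.ne_r (F₁.inter_r Q₁.rdc)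
  have F₂ := F₁.map h₂.emb
  obtain ⟨Q₃, i₃, C, h₃, dC, -, -, -, -, nC, oC, -, l₃⟩ := exists_attach_face
    (F₂.path_inn' Q₂.rdc) (F₂.path_out' Q₂.rdc) (F₂.ne Q₂.rdc) (F₂.inter_pr Q₂.rdc)
  have F₃ := F₂.map h₃.emb
  have em : ∀ {Q R : RDCpx} (i : Q ⟶ R) {x : Q.El} {z : R.El}, IsExt i z → i.fn x ≠ z :=
    fun i x z h e => h.notMem ⟨x, e⟩
  refine ⟨Q₃, _, _, _, _, _, _, _, _, _, i₃.fn (i₂.fn A), i₃.fn B, C, ⟨F₃, ?_, ?_, dC, ?_, ?_, ?_,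
    ?_, ?_, ?_, (em i₃ h₃).symm, (em i₃ h₃).symm, h₃.emb.injective.ne (em i₂ h₂)⟩, ?_⟩
  · rw [h₃.emb.dim_eq, h₂.emb.dim_eq, dA]
  · rw [h₃.emb.dim_eq, dB]
  · rw [h₃.emb.bord_Iic_image, h₂.emb.bord_Iic_image, nA]
    simp only [image_trail]
  · rw [h₃.emb.bord_Iic_image, h₂.emb.bord_Iic_image, oA]
    simp only [image_trail, Set.image_union]
  · rw [h₃.emb.bord_Iic_image, nB]
    simp only [image_trail, Set.image_union]
  · rw [h₃.emb.bord_Iic_image, oB]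
    simp only [image_trail]
  · rw [nC]
    simp only [image_trail, Set.image_union]
  · rw [oC]
    simp only [image_trail, Set.image_union]
  · intro T s₀ s₁ s₂ s₃ W C' B' A' D a b d lW lC lB lA lD hW hC hB hA hD ha ha' hb hb' hd hd'
    obtain ⟨lam₀, L₀, ex, ev₁, ev₂, ew, ec, eq, ep, er⟩ :=
      l₀ T s₀ s₁ s₂ s₃ W C' B' A' D lW lC lB lA lD hW hC hB hA hD
    obtain ⟨lam₁, L₁, e₁, eA⟩ := l₁ T lam₀ L₀ a
      (by rw [(L₀.word (cx_walk.2 F.pp.walk)).2, ev₁, ep, ha])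
      (by rw [(L₀.word (cx_walk.2 (F.path_out Q.rdc).walk)).2, ev₁, List.map_append, ec, eq, ha'])
    have m₁ : ∀ o : List Q.El, (o.map i₁.fn).map lam₁ = o.map lam₀ := fun o => by
      rw [List.map_map]; exact List.map_congr_left fun e _ => e₁ e
    obtain ⟨lam₂, L₂, e₂, eB⟩ := l₂ T lam₁ L₁ b
      (by rw [(L₁.word (cx_walk.2 (F₁.path_inn Q₁.rdc).walk)).2, List.map_append, m₁, m₁, e₁, ex,
        ew, ec, hb])
      (by rw [(L₁.word (cx_walk.2 F₁.pr.walk)).2, m₁, e₁, ex, er, hb'])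
    have m₂ : ∀ o : List Q₁.El, (o.map i₂.fn).map lam₂ = o.map lam₁ := fun o => by
      rw [List.map_map]; exact List.map_congr_left fun e _ => e₂ e
    obtain ⟨lam₃, L₃, e₃, eC⟩ := l₃ T lam₂ L₂ d
      (by rw [(L₂.word (cx_walk.2 (F₂.path_inn' Q₂.rdc).walk)).2, List.map_append, m₂, m₂, m₁, m₁,
        e₂, e₁, ex, ew, ep, hd])
      (by rw [(L₂.word (cx_walk.2 (F₂.path_out' Q₂.rdc).walk)).2, List.map_append, m₂, m₂, m₁, m₁,
        e₂, e₁, ex, er, eq, hd'])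
    have m₃ : ∀ o : List Q₂.El, (o.map i₃.fn).map lam₃ = o.map lam₂ := fun o => by
      rw [List.map_map]; exact List.map_congr_left fun e _ => e₃ e
    exact ⟨lam₃, L₃, by rw [e₃, e₂, e₁, ex], by rw [e₃, e₂, e₁, ev₁], by rw [e₃, e₂, e₁, ev₂],
      by rw [m₃, m₂, m₁, ew], by rw [m₃, m₂, m₁, ec], by rw [m₃, m₂, m₁, eq],
      by rw [m₃, m₂, m₁, ep], by rw [m₃, m₂, m₁, er], by rw [e₃, e₂, eA], by rw [e₃, eB], eC⟩

/-- There are globes of all shapes, with arbitrary labels and maps out of them. -/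
theorem exists_globe (m n : ℕ) : ∃ (Q : RDCpx) (x : Q.El), dim x = 2 ∧
    ((cx Q.El).inn x).length = m + 1 ∧ ((cx Q.El).out x).length = n + 1 ∧
    (∀ (Y : RDCpx) (y : Y.El) (a b : List Y.El), dim y ≤ 2 → a.length = m + 1 → b.length = n + 1 →
      (cx Y.El).LazyWalk ((cx Y.El).src y) a ((cx Y.El).tgt y) →
      (cx Y.El).LazyWalk ((cx Y.El).src y) b ((cx Y.El).tgt y) →
      bord 1 Pol.minus (Set.Iic y) = trail ((cx Y.El).src y) a →
      bord 1 Pol.plus (Set.Iic y) = trail ((cx Y.El).src y) b →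
      ∃ g : Q ⟶ Y, g.fn x = y ∧ ((cx Q.El).inn x).map g.fn = a ∧
        ((cx Q.El).out x).map g.fn = b) ∧
    ∀ (T : MarkedTwoCat) (s t : T.cat.cell 2) (w w' : List (T.cat.cell 2)) (u : T.cat.cell 2),
      w.length = m + 1 → w'.length = n + 1 → T.Word s w t → T.Word s w' t →
      T.cat.two.b Pol.minus 1 u = T.wordComp s w → T.cat.two.b Pol.plus 1 u = T.wordComp s w' →
      ∃ lam, Q.Labelling T lam ∧ lam x = u ∧ lam ((cx Q.El).src x) = s ∧
        ((cx Q.El).inn x).map lam = w ∧ ((cx Q.El).out x).map lam = w' := by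
  obtain ⟨Q₀, s, t, ds, dt, hst, g₀, l₀⟩ := exists_two_points
  obtain ⟨Q₁, i₁, p, h₁, lp, pp, -, g₁, l₁⟩ := exists_attach_path m Q₀ ds dt hst
  obtain ⟨Q₂, i₂, q, h₂, lq, pq, oq, g₂, l₂⟩ := exists_attach_path n Q₁
    ((h₁.dim_eq s).trans ds) ((h₁.dim_eq t).trans dt) (h₁.injective.ne hst)
  have pp' := pathOf_map h₂ pp
  rw [image_trail] at pp'
  have inter : trail (i₂.fn (i₁.fn s)) (p.map i₂.fn) ∩ trail (i₂.fn (i₁.fn s)) q =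
      {i₂.fn (i₁.fn s), i₂.fn (i₁.fn t)} := by
    refine Set.Subset.antisymm ?_ ?_
    · rw [← oq, ← image_trail, Set.inter_comm]
      exact Set.inter_subset_inter_right _ (Set.image_subset_range _ _)
    · rintro z (rfl | rfl)
      · exact ⟨pp'.src_mem, pq.src_mem⟩
      · exact ⟨pp'.tgt_mem Q₂.rdc, pq.tgt_mem Q₂.rdc⟩
  obtain ⟨Q, i, x, hi, dx, sx, tx, innx, outx, -, -, g₃, l₃⟩ := exists_attach_face pp' pq
    ((h₂.injective.comp h₁.injective).ne hst) inter
  refine ⟨Q, x, dx, by simp [innx, lp], by simp [outx, lq], ?_, ?_⟩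
  · intro Y y a b hy la lb ha hb ba bb
    obtain ⟨f₀, es, et⟩ := g₀ Y _ _ (bord_zero_Iic Y.rdc y).2.2.1 (bord_zero_Iic Y.rdc y).2.2.2
    rw [← es, ← et] at ha hb
    obtain ⟨f₁, e₁, c₁⟩ := g₁ Y f₀ a la ha
    subst e₁
    obtain ⟨f₂, e₂, c₂⟩ := g₂ Y f₁ b lb hb
    subst e₂
    have c₁' : (p.map i₂.fn).map f₂.fn = a := by rw [List.map_map]; exact c₁
    obtain ⟨f, e₃, c₃⟩ := g₃ Y f₂ y hy
      (by rw [image_trail, c₁', ba]; exact congrArg (trail · a) es.symm)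
      (by rw [image_trail, c₂, bb]; exact congrArg (trail · b) es.symm) es.symm et.symm
    subst e₃
    refine ⟨f, c₃, ?_, ?_⟩
    · rw [innx, List.map_map]; exact c₁'
    · rw [outx, List.map_map]; exact c₂
  · intro T s' t' w w' u lw lw' hw hw' hu hu'
    have z : ∀ α, T.cat.two.b α 0 t' = t' := fun α => by
      rw [← hw.comp_b.2.2, T.cat.two.b_b_le _ _ _ le_rfl]
    obtain ⟨lam₀, L₀, es, et⟩ := l₀ T s' t' hw.zero z
    obtain ⟨lam₁, L₁, e₁, c₁⟩ := l₁ T lam₀ L₀ w lw (by rw [es, et]; exact hw)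
    obtain ⟨lam₂, L₂, e₂, c₂⟩ := l₂ T lam₁ L₁ w' lw' (by rw [e₁, e₁, es, et]; exact hw')
    have c₁' : (p.map i₂.fn).map lam₂ = w := by
      rw [List.map_map, ← c₁]; exact List.map_congr_left fun e _ => e₂ e
    obtain ⟨lam, L, e₃, c₃⟩ := l₃ T lam₂ L₂ u
      (by rw [(L₂.word (cx_walk.2 pp'.walk)).2, c₁', e₂, e₁, es, hu])
      (by rw [(L₂.word (cx_walk.2 pq.walk)).2, c₂, e₂, e₁, es, hu'])
    refine ⟨lam, L, c₃, by rw [sx, e₃, e₂, e₁, es], ?_, ?_⟩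
    · rw [innx, List.map_map, ← c₁']; exact List.map_congr_left fun e _ => e₃ e
    · rw [outx, List.map_map, ← c₂]; exact List.map_congr_left fun e _ => e₃ e

end RDCpx

open OGPoset

/-! ### Natural operations on labellings -/

/-- An operation that turns labellings in `T` into labellings in `S`, naturally in the complex. -/
structure LabelMap (T S : MarkedTwoCat) where
  app : ∀ Q : RDCpx, (Q.El → T.cat.cell 2) → Q.El → S.cat.cell 2
  labelling : ∀ {Q : RDCpx} {lam : Q.El → T.cat.cell 2}, Q.Labelling T lam →
    Q.Labelling S (app Q lam)
  natural : ∀ {Q R : RDCpx} (f : Q ⟶ R) {lam : R.El → T.cat.cell 2}, R.Labelling T lam →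
    app Q (lam ∘ f.fn) = app R lam ∘ f.fn

namespace RDCpx

variable {Q R : RDCpx} {T : MarkedTwoCat}

theorem bord_one_Iic (x : Q.El) :
    bord 1 Pol.minus (Set.Iic x) = trail ((cx Q.El).src x) ((cx Q.El).inn x) ∧
    bord 1 Pol.plus (Set.Iic x) = trail ((cx Q.El).src x) ((cx Q.El).out x) := by
  have h := fun α => (pathOf_bord (z := x) Q.rdc (.atom x) α).eq_trail
  rw [(vsrc_Iic Q.rdc x).1] at h
  exact ⟨h _, h _⟩

/-- The labels below a face are determined by the labels of the face and of its edges. -/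
theorem Labelling.eqOn_Iic {lam lam' : Q.El → T.cat.cell 2} (L : Q.Labelling T lam)
    (L' : Q.Labelling T lam') {x : Q.El} (hx : dim x = 2) (h : lam x = lam' x)
    (h₁ : ((cx Q.El).inn x).map lam = ((cx Q.El).inn x).map lam')
    (h₂ : ((cx Q.El).out x).map lam = ((cx Q.El).out x).map lam') :
    Set.EqOn lam lam' (Set.Iic x) := by
  have ok := cx_ok Q.rdc
  have key : ∀ {l : List Q.El}, (cx Q.El).Walk ((cx Q.El).src x) l ((cx Q.El).tgt x) →
      l.map lam = l.map lam' → ∀ y ∈ trail ((cx Q.El).src x) l, lam y = lam' y := by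
    intro l hl e y hy
    rw [List.map_inj_left] at e
    rcases (mem_trail_iff Q.rdc hl).1 hy with rfl | ⟨f, hf, rfl | rfl⟩
    · rw [← (L.lab.face_b ok hx).2, ← (L'.lab.face_b ok hx).2, h]
    · exact e _ hf
    · have hd := hl.dim_edge hf
      rw [← L.lab.src f hd, ← L'.lab.src f hd, e f hf]
  intro y hy
  rcases (Set.mem_Iic.1 hy).lt_or_eq with hlt | rfl
  · obtain ⟨γ, hγ⟩ := mem_bord_of_lt hx hlt
    cases γ
    · rw [(bord_one_Iic x).1] at hγ
      exact key (ok.inn_walk x hx) h₁ y hγ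
    · rw [(bord_one_Iic x).2] at hγ
      exact key (ok.out_walk x hx) h₂ y hγ
  · exact h

theorem lazyWalk_of_walk {s t : Q.El} {l : List Q.El} (h : (cx Q.El).Walk s l t) :
    (cx Q.El).LazyWalk s l t := by
  induction l generalizing s with
  | nil => exact h.1
  | cons e l ih => exact ⟨⟨h.1.1, h.1.2.1.le⟩, ih h.2⟩

theorem lazyWalk_replicate {y : Q.El} (hy : dim y ≤ 1) (i j : ℕ) :
    (cx Q.El).LazyWalk ((cx Q.El).src y) (List.replicate i ((cx Q.El).src y) ++
      y :: List.replicate j ((cx Q.El).tgt y)) ((cx Q.El).tgt y) := by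
  obtain ⟨-, -, h₁, h₂⟩ := bord_zero_Iic Q.rdc y
  have s₁ := src_of_dim_zero Q.rdc h₁
  have s₂ := src_of_dim_zero Q.rdc h₂
  have h₁ : (cx Q.El).dim ((cx Q.El).src y) ≤ 1 := h₁.le.trans zero_le_one
  have h₂ : (cx Q.El).dim ((cx Q.El).tgt y) ≤ 1 := h₂.le.trans zero_le_one
  induction i with
  | zero =>
    refine ⟨⟨rfl, hy⟩, ?_⟩
    induction j with
    | zero => rfl
    | succ j ih => exact ⟨⟨s₂.1, h₂⟩, by rw [s₂.2]; exact ih⟩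
  | succ i ih => exact ⟨⟨s₁.1, h₁⟩, by rw [s₁.2]; exact ih⟩

theorem bord_one_eq_trail_replicate {y : Q.El} (hy : dim y ≤ 1) (α : Pol) (i j : ℕ) :
    bord 1 α (Set.Iic y) = trail ((cx Q.El).src y) (List.replicate i ((cx Q.El).src y) ++
      y :: List.replicate j ((cx Q.El).tgt y)) := by
  rw [bord_eq_self (isLowerSet_Iic y) fun z hz => (dimLe_Iic y z hz).trans hy]
  ext z
  constructor
  · exact fun h => Or.inr ⟨y, by simp, h⟩
  · rintro (rfl | ⟨e, he, h⟩)
    · exact src_le Q.rdc y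
    · simp only [List.mem_append, List.mem_cons, List.mem_replicate] at he
      rcases he with ⟨-, rfl⟩ | rfl | ⟨-, rfl⟩
      · exact h.trans (src_le Q.rdc y)
      · exact h
      · exact h.trans (tgt_le Q.rdc y)

end RDCpx

namespace LabelMap

open RDCpx

variable {T S : MarkedTwoCat} (Φ : LabelMap T S) {Q R : RDCpx}

theorem congr {lam lam' : Q.El → T.cat.cell 2} (L : Q.Labelling T lam) (L' : Q.Labelling T lam')
    {x : Q.El} (h : Set.EqOn lam lam' (Set.Iic x)) : Φ.app Q lam x = Φ.app Q lam' x := by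
  have e : lam ∘ (clι x).fn = lam' ∘ (clι x).fn := funext fun y => h (by
    rw [← range_clι]
    exact ⟨y, rfl⟩)
  have h₁ := congrFun (Φ.natural (clι x) L) (clTop x)
  have h₂ := congrFun (Φ.natural (clι x) L') (clTop x)
  rw [e, h₂] at h₁
  simpa only [Function.comp, clι_clTop] using h₁.symm

/-- The value at a face only depends on the labels of the face and its edges, and may be computed
on a degenerate face. -/
theorem app_eq_app {lam : Q.El → T.cat.cell 2} {mu : R.El → T.cat.cell 2} (L : Q.Labelling T lam)
    (M : R.Labelling T mu) {x : Q.El} {y : R.El} (hx : dim x = 2) (hy : dim y ≤ 2)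
    {a b : List R.El} (ha : (cx R.El).LazyWalk ((cx R.El).src y) a ((cx R.El).tgt y))
    (hb : (cx R.El).LazyWalk ((cx R.El).src y) b ((cx R.El).tgt y))
    (ba : bord 1 Pol.minus (Set.Iic y) = trail ((cx R.El).src y) a)
    (bb : bord 1 Pol.plus (Set.Iic y) = trail ((cx R.El).src y) b)
    (e : lam x = mu y) (e₁ : ((cx Q.El).inn x).map lam = a.map mu)
    (e₂ : ((cx Q.El).out x).map lam = b.map mu) : Φ.app Q lam x = Φ.app R mu y := by
  have ok := cx_ok Q.rdc
  obtain ⟨m, hm⟩ := Nat.exists_eq_succ_of_ne_zero (List.length_pos_of_ne_nil (ok.inn_ne x hx)).ne'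
  obtain ⟨n, hn⟩ := Nat.exists_eq_succ_of_ne_zero (List.length_pos_of_ne_nil (ok.out_ne x hx)).ne'
  have la := congrArg List.length e₁
  have lb := congrArg List.length e₂
  rw [List.length_map, List.length_map] at la lb
  obtain ⟨G, z, dz, -, -, uz, -⟩ := exists_globe m n
  obtain ⟨f, fz, f₁, f₂⟩ := uz Q x _ _ hx.le hm hn (lazyWalk_of_walk (ok.inn_walk x hx))
    (lazyWalk_of_walk (ok.out_walk x hx)) (bord_one_Iic x).1 (bord_one_Iic x).2
  obtain ⟨g, gz, g₁, g₂⟩ := uz R y a b hy (la.symm.trans hm) (lb.symm.trans hn) ha hb ba bb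
  have h := Φ.congr (L.comp f) (M.comp g) ((L.comp f).eqOn_Iic (M.comp g) dz
    (by rw [Function.comp, Function.comp, fz, gz, e])
    (by rw [← List.map_map, ← List.map_map, f₁, g₁, e₁])
    (by rw [← List.map_map, ← List.map_map, f₂, g₂, e₂]))
  rw [Φ.natural f L, Φ.natural g M] at h
  rwa [Function.comp, Function.comp, fz, gz] at h

/-- The face labelled by `u`, with edges labelled by the words `w` and `w'`, is sent to a face
labelled by `v`. -/
def Sends (w w' : List (T.cat.cell 2)) (u : T.cat.cell 2) (v : S.cat.cell 2) : Prop :=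
  ∃ (Q : RDCpx) (lam : Q.El → T.cat.cell 2) (x : Q.El), Q.Labelling T lam ∧ dim x = 2 ∧
    ((cx Q.El).inn x).map lam = w ∧ ((cx Q.El).out x).map lam = w' ∧ lam x = u ∧
    Φ.app Q lam x = v

variable {Φ} {w w' : List (T.cat.cell 2)} {u : T.cat.cell 2} {v v' : S.cat.cell 2}

theorem Sends.unique (h : Φ.Sends w w' u v) (h' : Φ.Sends w w' u v') : v = v' := by
  obtain ⟨Q, lam, x, L, hx, h₁, h₂, h₃, rfl⟩ := h
  obtain ⟨R, mu, y, M, hy, g₁, g₂, g₃, rfl⟩ := h'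
  have ok := cx_ok R.rdc
  exact Φ.app_eq_app L M hx hy.le (lazyWalk_of_walk (ok.inn_walk y hy))
    (lazyWalk_of_walk (ok.out_walk y hy)) (bord_one_Iic y).1 (bord_one_Iic y).2 (h₃.trans g₃.symm)
    (h₁.trans g₁.symm) (h₂.trans g₂.symm)

variable (Φ) in
theorem exists_sends {s t : T.cat.cell 2} (hw : T.Word s w t) (hw' : T.Word s w' t) (ne : w ≠ [])
    (ne' : w' ≠ []) (h : T.cat.two.b Pol.minus 1 u = T.wordComp s w)
    (h' : T.cat.two.b Pol.plus 1 u = T.wordComp s w') : ∃ v, Φ.Sends w w' u v := by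
  obtain ⟨m, hm⟩ := Nat.exists_eq_succ_of_ne_zero (List.length_pos_of_ne_nil ne).ne'
  obtain ⟨n, hn⟩ := Nat.exists_eq_succ_of_ne_zero (List.length_pos_of_ne_nil ne').ne'
  obtain ⟨G, z, dz, -, -, -, lz⟩ := exists_globe m n
  obtain ⟨lam, L, e, -, e₁, e₂⟩ := lz T s t w w' u hm hn hw hw' h h'
  exact ⟨_, G, lam, z, L, dz, e₁, e₂, e, rfl⟩

/-- Degenerate faces. -/
theorem Sends.eq_app {lam : Q.El → T.cat.cell 2} (L : Q.Labelling T lam) {y : Q.El}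
    (hy : dim y ≤ 1) {i j i' j' : ℕ}
    (h : Φ.Sends (List.replicate i (T.cat.two.b Pol.minus 0 (lam y)) ++
      lam y :: List.replicate j (T.cat.two.b Pol.plus 0 (lam y)))
      (List.replicate i' (T.cat.two.b Pol.minus 0 (lam y)) ++
      lam y :: List.replicate j' (T.cat.two.b Pol.plus 0 (lam y))) (lam y) v) :
    v = Φ.app Q lam y := by
  obtain ⟨R, mu, x, M, hx, h₁, h₂, h₃, rfl⟩ := h
  have b : T.cat.two.b Pol.minus 0 (lam y) = lam ((cx Q.El).src y) ∧
      T.cat.two.b Pol.plus 0 (lam y) = lam ((cx Q.El).tgt y) := by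
    obtain hd | hd : dim y = 0 ∨ dim y = 1 := by omega
    · rw [(src_of_dim_zero Q.rdc hd).1, (src_of_dim_zero Q.rdc hd).2]
      exact ⟨L.lab.zero y hd _, L.lab.zero y hd _⟩
    · exact ⟨L.lab.src y hd, L.lab.tgt y hd⟩
  rw [b.1, b.2] at h₁ h₂
  refine Φ.app_eq_app M L hx (hy.trans one_le_two) (lazyWalk_replicate hy i j)
    (lazyWalk_replicate hy i' j') (bord_one_eq_trail_replicate hy _ i j)
    (bord_one_eq_trail_replicate hy _ i' j') h₃ ?_ ?_
  · rw [h₁, List.map_append, List.map_cons, List.map_replicate, List.map_replicate]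
  · rw [h₂, List.map_append, List.map_cons, List.map_replicate, List.map_replicate]

theorem _root_.DiagNerve.MarkedTwoCat.word_singleton {a : T.cat.cell 2} (ha : T.IsLetter a) :
    T.Word (T.cat.two.b Pol.minus 0 a) [a] (T.cat.two.b Pol.plus 0 a) :=
  ⟨⟨rfl, ha⟩, rfl, fun _ => T.cat.two.b_b_le _ _ _ le_rfl⟩

theorem _root_.DiagNerve.MarkedTwoCat.wordComp_singleton (s a : T.cat.cell 2) :
    T.wordComp s [a] = a :=
  T.cat.two.comp_unit_right 0 a

variable (Φ) in
theorem exists_sends_letter {a : T.cat.cell 2} (ha : T.IsLetter a) : ∃ v, Φ.Sends [a] [a] a v := by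
  have h := MarkedTwoCat.word_singleton ha
  refine Φ.exists_sends h h (List.cons_ne_nil _ _) (List.cons_ne_nil _ _) ?_ ?_ <;>
    rw [MarkedTwoCat.wordComp_singleton, ha.b_one]

theorem _root_.DiagNerve.MarkedTwoCat.isLetter_b_zero (T : MarkedTwoCat) (α : Pol)
    (u : T.cat.cell 2) : T.IsLetter (T.cat.two.b α 0 u) :=
  Or.inr (T.cat.two.b_b_le _ _ _ le_rfl)

open Classical in
variable (Φ) in
/-- The action on letters (with an irrelevant value elsewhere). -/
noncomputable def letter (a : T.cat.cell 2) : S.cat.cell 2 :=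
  if h : T.IsLetter a then (Φ.exists_sends_letter h).choose
  else (Φ.exists_sends_letter (T.isLetter_b_zero Pol.minus a)).choose

theorem sends_letter {a : T.cat.cell 2} (ha : T.IsLetter a) : Φ.Sends [a] [a] a (Φ.letter a) := by
  rw [letter, dif_pos ha]
  exact (Φ.exists_sends_letter ha).choose_spec

theorem app_eq_letter {lam : Q.El → T.cat.cell 2} (L : Q.Labelling T lam) {y : Q.El}
    (hy : dim y ≤ 1) : Φ.app Q lam y = Φ.letter (lam y) := by
  have h : T.IsLetter (lam y) := by
    obtain hd | hd : dim y = 0 ∨ dim y = 1 := by omega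
    · exact Or.inr (L.lab.zero y hd _)
    · exact L.edge y hd
  exact (Sends.eq_app (i := 0) (j := 0) (i' := 0) (j' := 0) L hy (sends_letter h)).symm

theorem map_app_eq {lam : Q.El → T.cat.cell 2} (L : Q.Labelling T lam) {s t : Q.El}
    {l : List Q.El} (h : (cx Q.El).Walk s l t) :
    l.map (Φ.app Q lam) = (l.map lam).map Φ.letter := by
  rw [List.map_map]
  exact List.map_congr_left fun e he => app_eq_letter L (h.dim_edge he).le

theorem pv_app_eq {lam : Q.El → T.cat.cell 2} (L : Q.Labelling T lam) {s t : Q.El}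
    {l : List Q.El} (h : (cx Q.El).Walk s l t) :
    (cx Q.El).pv S.cat.two (Φ.app Q lam) s l =
      S.wordComp (Φ.letter (lam s)) ((l.map lam).map Φ.letter) := by
  rw [((Φ.labelling L).word h).2, map_app_eq L h, app_eq_letter L (h.dim_src.le.trans zero_le_one)]

theorem exists_edge {a : T.cat.cell 2} (ha : T.IsLetter a) :
    ∃ (Q : RDCpx) (lam : Q.El → T.cat.cell 2) (e : Q.El), Q.Labelling T lam ∧ dim e = 1 ∧
      lam e = a := by
  have hw := MarkedTwoCat.word_singleton ha
  obtain ⟨G, z, dz, -, -, -, lz⟩ := exists_globe 0 0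
  obtain ⟨lam, L, -, -, e₁, -⟩ := lz T _ _ [a] [a] a rfl rfl hw hw
    (by rw [MarkedTwoCat.wordComp_singleton, ha.b_one])
    (by rw [MarkedTwoCat.wordComp_singleton, ha.b_one])
  obtain ⟨e, he, rfl⟩ := List.mem_map.1 (e₁ ▸ List.mem_singleton_self a)
  exact ⟨G, lam, e, L, ((cx_ok G.rdc).inn_walk z dz).dim_edge he, rfl⟩

theorem isLetter_letter {a : T.cat.cell 2} (ha : T.IsLetter a) : S.IsLetter (Φ.letter a) ∧
    S.cat.two.b Pol.minus 0 (Φ.letter a) = Φ.letter (T.cat.two.b Pol.minus 0 a) ∧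
    S.cat.two.b Pol.plus 0 (Φ.letter a) = Φ.letter (T.cat.two.b Pol.plus 0 a) := by
  obtain ⟨Q, lam, e, L, he, rfl⟩ := exists_edge ha
  obtain ⟨-, -, h₁, h₂⟩ := bord_zero_Iic Q.rdc e
  have L' := Φ.labelling L
  rw [← app_eq_letter L he.le, L.lab.src e he, L.lab.tgt e he, ← app_eq_letter L (by omega),
    ← app_eq_letter L (by omega)]
  exact ⟨L'.edge e he, L'.lab.src e he, L'.lab.tgt e he⟩

theorem letter_of_zero {s : T.cat.cell 2} (hs : ∀ α, T.cat.two.b α 0 s = s) (α : Pol) :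
    S.cat.two.b α 0 (Φ.letter s) = Φ.letter s := by
  have h := isLetter_letter (Φ := Φ) (Or.inr (hs Pol.minus))
  rw [hs, hs] at h
  cases α
  · exact h.2.1
  · exact h.2.2

theorem word_letter {s t : T.cat.cell 2} (h : T.Word s w t) :
    S.Word (Φ.letter s) (w.map Φ.letter) (Φ.letter t) := by
  induction w generalizing s with
  | nil => exact ⟨congrArg _ h.1, letter_of_zero h.2⟩
  | cons a w ih =>
    obtain ⟨h₁, h₂, h₃⟩ := isLetter_letter (Φ := Φ) h.1.2
    refine ⟨⟨by rw [h₂, h.1.1], h₁⟩, ?_⟩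
    rw [h₃]
    exact ih h.2

theorem Sends.exists_word (h : Φ.Sends w w' u v) : ∃ s t, T.Word s w t ∧ T.Word s w' t ∧ w ≠ [] ∧
    w' ≠ [] ∧ T.cat.two.b Pol.minus 1 u = T.wordComp s w ∧
    T.cat.two.b Pol.plus 1 u = T.wordComp s w' ∧
    S.cat.two.b Pol.minus 1 v = S.wordComp (Φ.letter s) (w.map Φ.letter) ∧
    S.cat.two.b Pol.plus 1 v = S.wordComp (Φ.letter s) (w'.map Φ.letter) := by
  obtain ⟨Q, lam, x, L, hx, rfl, rfl, rfl, rfl⟩ := h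
  have ok := cx_ok Q.rdc
  have hi := ok.inn_walk x hx
  have ho := ok.out_walk x hx
  have L' := Φ.labelling L
  refine ⟨_, _, (L.word hi).1, (L.word ho).1, by simpa using ok.inn_ne x hx,
    by simpa using ok.out_ne x hx, ?_, ?_, ?_, ?_⟩
  · rw [L.lab.inn x hx, (L.word hi).2]
  · rw [L.lab.out x hx, (L.word ho).2]
  · rw [L'.lab.inn x hx, pv_app_eq L hi]
  · rw [L'.lab.out x hx, pv_app_eq L ho]

theorem _root_.DiagNerve.MarkedTwoCat.Word.eq_of_ne_nil {s t s' t' : T.cat.cell 2}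
    (h : T.Word s w t) (h' : T.Word s' w t') (hw : w ≠ []) : s = s' ∧ t = t' := by
  obtain rfl : s = s' := by
    obtain ⟨a, w, rfl⟩ := List.exists_cons_of_ne_nil hw
    exact h.1.1.symm.trans h'.1.1
  exact ⟨rfl, h.unique h'⟩

theorem Sends.b_one (h : Φ.Sends w w' u v) {s t : T.cat.cell 2} (hw : T.Word s w t) :
    T.Word s w' t ∧ w ≠ [] ∧ w' ≠ [] ∧ T.cat.two.b Pol.minus 1 u = T.wordComp s w ∧
    T.cat.two.b Pol.plus 1 u = T.wordComp s w' ∧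
    S.cat.two.b Pol.minus 1 v = S.wordComp (Φ.letter s) (w.map Φ.letter) ∧
    S.cat.two.b Pol.plus 1 v = S.wordComp (Φ.letter s) (w'.map Φ.letter) := by
  obtain ⟨s', t', h₁, h₂⟩ := h.exists_word
  obtain ⟨rfl, rfl⟩ := h₁.eq_of_ne_nil hw h₂.2.1
  exact h₂

theorem app_exchange {lam : Q.El → T.cat.cell 2} (L : Q.Labelling T lam) {x v₁ v₂ y : Q.El}
    {w c q p r : List Q.El} {A B C : Q.El} (E : Exchange x v₁ v₂ y w c q p r A B C)
    (h : lam C = T.cat.two.comp 1 (T.cat.two.comp 0 ((cx Q.El).pv T.cat.two lam x w) (lam A))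
      (T.cat.two.comp 0 (lam B) ((cx Q.El).pv T.cat.two lam v₂ q))) :
    Φ.app Q lam C = S.cat.two.comp 1
      (S.cat.two.comp 0 ((cx Q.El).pv S.cat.two (Φ.app Q lam) x w) (Φ.app Q lam A))
      (S.cat.two.comp 0 (Φ.app Q lam B) ((cx Q.El).pv S.cat.two (Φ.app Q lam) v₂ q)) := by
  obtain ⟨R, i, ex, un⟩ := exists_attach_three (E.isCellBoundary Q.rdc)
  obtain ⟨mu, M, e⟩ := ex T lam L _ (E.composite Q.rdc L.lab)
    (h ▸ composite_Iic Q.rdc L.lab E.dimC.le)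
  have e : mu ∘ i.fn = lam := funext e
  have n := Φ.natural i M
  rw [e] at n
  have L' := (Φ.labelling L).lab
  exact (un S _ (Φ.labelling M) _ _ (n ▸ E.composite Q.rdc L')
    (n ▸ composite_Iic Q.rdc L' E.dimC.le)).symm

theorem _root_.DiagNerve.MarkedTwoCat.Word.composable {s₀ s₁ s₂ s₃ : T.cat.cell 2}
    {W C B : List (T.cat.cell 2)} {a b : T.cat.cell 2} (hW : T.Word s₀ W s₁) (hC : T.Word s₁ C s₂)
    (hB : T.Word s₂ B s₃) (ha : T.cat.two.b Pol.plus 1 a = T.wordComp s₁ (C ++ B))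
    (hb : T.cat.two.b Pol.minus 1 b = T.wordComp s₀ (W ++ C)) :
    T.cat.two.b Pol.plus 0 (T.wordComp s₀ W) = T.cat.two.b Pol.minus 0 a ∧
    T.cat.two.b Pol.plus 0 b = T.cat.two.b Pol.minus 0 (T.wordComp s₂ B) ∧
    T.cat.two.b Pol.plus 1 (T.cat.two.comp 0 (T.wordComp s₀ W) a) =
      T.cat.two.b Pol.minus 1 (T.cat.two.comp 0 b (T.wordComp s₂ B)) := by
  have a₀ : T.cat.two.b Pol.plus 0 (T.wordComp s₀ W) = T.cat.two.b Pol.minus 0 a := by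
    rw [← T.cat.two.b_b_lt Pol.plus Pol.minus a Nat.zero_lt_one, ha, hW.comp_b.2.2,
      (hC.append hB).comp_b.2.1]
  have b₀ : T.cat.two.b Pol.plus 0 b = T.cat.two.b Pol.minus 0 (T.wordComp s₂ B) := by
    rw [← T.cat.two.b_b_lt Pol.minus Pol.plus b Nat.zero_lt_one, hb, (hW.append hC).comp_b.2.2,
      hB.comp_b.2.1]
  refine ⟨a₀, b₀, ?_⟩
  rw [T.cat.two.b_comp _ Nat.zero_lt_one a₀, T.cat.two.b_comp _ Nat.zero_lt_one b₀, ha, hb,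
    hW.comp_b.1, hB.comp_b.1, ← hW.comp_append (hC.append hB), ← (hW.append hC).comp_append hB,
    List.append_assoc]

/-- The action on a composite of two whiskered faces. -/
theorem Sends.exchange {s₀ s₁ s₂ s₃ : T.cat.cell 2} {W C B A D : List (T.cat.cell 2)}
    {a b : T.cat.cell 2} {a' b' : S.cat.cell 2} (hW : T.Word s₀ W s₁) (hC : T.Word s₁ C s₂)
    (hB : T.Word s₂ B s₃) (neC : C ≠ []) (ha : Φ.Sends A (C ++ B) a a')
    (hb : Φ.Sends (W ++ C) D b b') :
    Φ.Sends (W ++ A) (D ++ B)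
      (T.cat.two.comp 1 (T.cat.two.comp 0 (T.wordComp s₀ W) a)
        (T.cat.two.comp 0 b (T.wordComp s₂ B)))
      (S.cat.two.comp 1 (S.cat.two.comp 0 (S.wordComp (Φ.letter s₀) (W.map Φ.letter)) a')
        (S.cat.two.comp 0 b' (S.wordComp (Φ.letter s₂) (B.map Φ.letter)))) := by
  obtain ⟨s, t, wA, wCB, neA, -, mA, pA, -, -⟩ := ha.exists_word
  obtain ⟨rfl, rfl⟩ := wCB.eq_of_ne_nil (hC.append hB) (by simp [neC])
  obtain ⟨wD, -, neD, mB, pB, -, -⟩ := hb.b_one (hW.append hC)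
  obtain ⟨l, lC⟩ := Nat.exists_eq_succ_of_ne_zero (List.length_pos_of_ne_nil neC).ne'
  obtain ⟨m, lA⟩ := Nat.exists_eq_succ_of_ne_zero (List.length_pos_of_ne_nil neA).ne'
  obtain ⟨k, lD⟩ := Nat.exists_eq_succ_of_ne_zero (List.length_pos_of_ne_nil neD).ne'
  obtain ⟨a₀, b₀, m₁⟩ := hW.composable hC hB pA mB
  obtain ⟨Q, x, v₁, v₂, y, w, c, q, p, r, A', B', C', E, ex⟩ := exists_exchange W.length l B.length m k
  obtain ⟨lam, L, e₀, e₁, e₂, ew, ec, eq, ep, er, eA, eB, eC⟩ := ex T s₀ _ s₂ _ W C B A D a b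
    (T.cat.two.comp 1 (T.cat.two.comp 0 (T.wordComp s₀ W) a)
        (T.cat.two.comp 0 b (T.wordComp s₂ B))) rfl lC rfl lA lD hW hC hB wA wD mA pA mB pB
    (by rw [T.cat.two.b_minus_comp m₁, T.cat.two.b_comp _ Nat.zero_lt_one a₀, mA, hW.comp_b.1,
          hW.comp_append wA])
    (by rw [T.cat.two.b_plus_comp m₁, T.cat.two.b_comp _ Nat.zero_lt_one b₀, pB, hB.comp_b.1,
          wD.comp_append hB])
  have pw := cx_walk.2 E.pw.walk
  have pq := cx_walk.2 E.pq.walk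
  have val := app_exchange (Φ := Φ) L E (by
    rw [eC, (L.word pw).2, (L.word pq).2, e₀, e₂, ew, eq, eA, eB])
  rw [pv_app_eq L pw, pv_app_eq L pq, e₀, e₂, ew, eq] at val
  have sA : Φ.Sends A (C ++ B) a (Φ.app Q lam A') := ⟨Q, lam, A', L, E.dimA,
    (congrArg _ (inn_eq E.innA E.pp)).trans ep,
    (congrArg _ (inn_eq E.outA (E.path_out Q.rdc))).trans (by rw [List.map_append, ec, eq]), eA, rfl⟩
  have sB : Φ.Sends (W ++ C) D b (Φ.app Q lam B') := ⟨Q, lam, B', L, E.dimB,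
    (congrArg _ (inn_eq E.innB (E.path_inn Q.rdc))).trans (by rw [List.map_append, ew, ec]),
    (congrArg _ (inn_eq E.outB E.pr)).trans er, eB, rfl⟩
  rw [sA.unique ha, sB.unique hb] at val
  exact ⟨Q, lam, C', L, E.dimC,
    (congrArg _ (inn_eq E.innC (E.path_inn' Q.rdc))).trans (by rw [List.map_append, ew, ep]),
    (congrArg _ (inn_eq E.outC (E.path_out' Q.rdc))).trans (by rw [List.map_append, er, eq]), eC, val⟩

end LabelMap

open OGPoset

/-! ### The action on identities -/

theorem Two.b_one_comp {C : Type} (D : Two C) {x a b y : C} (hx : ∀ α, D.b α 1 x = x)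
    (ha : ∀ α, D.b α 1 a = a) (hb : ∀ α, D.b α 1 b = b) (hy : ∀ α, D.b α 1 y = y)
    (h₁ : D.b Pol.plus 0 x = D.b Pol.minus 0 a) (h₂ : D.b Pol.plus 0 b = D.b Pol.minus 0 y)
    (h : D.b Pol.plus 1 (D.comp 0 x a) = D.b Pol.minus 1 (D.comp 0 b y)) (α : Pol) :
    D.b α 1 (D.comp 1 (D.comp 0 x a) (D.comp 0 b y)) = D.comp 1 (D.comp 0 x a) (D.comp 0 b y) := by
  have e : ∀ α, D.b α 1 (D.comp 0 x a) = D.comp 0 x a := fun α => by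
    rw [D.b_comp _ Nat.zero_lt_one h₁, hx, ha]
  have e' : ∀ α, D.b α 1 (D.comp 0 b y) = D.comp 0 b y := fun α => by
    rw [D.b_comp _ Nat.zero_lt_one h₂, hb, hy]
  rw [e, e'] at h
  have := D.comp_unit_right 1 (D.comp 0 x a)
  rw [e] at this
  rw [← h, this, e]

namespace MarkedTwoCat

variable {T : MarkedTwoCat} {s t s' t' : T.cat.cell 2} {w w' : List (T.cat.cell 2)}

theorem Word.split (h : T.Word s (w ++ w') t) : ∃ r, T.Word s w r ∧ T.Word r w' t := by
  induction w generalizing s with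
  | nil => exact ⟨s, ⟨rfl, Word.zero h⟩, h⟩
  | cons a w ih =>
    obtain ⟨r, h₁, h₂⟩ := ih h.2
    exact ⟨r, ⟨h.1, h₁⟩, h₂⟩

open Classical in
/-- The letters of a word that are not units. -/
noncomputable def core (w : List (T.cat.cell 2)) : List (T.cat.cell 2) :=
  w.filter fun a => T.cat.two.b Pol.minus 0 a ≠ a

theorem core_append : core (w ++ w') = core w ++ core w' := List.filter_append ..

theorem core_cons_of_zero {a : T.cat.cell 2} (h : T.cat.two.b Pol.minus 0 a = a) :
    core (a :: w) = core w :=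
  List.filter_cons_of_neg (by simpa using h)

theorem core_cons_of_ne {a : T.cat.cell 2} (h : T.cat.two.b Pol.minus 0 a ≠ a) :
    core (a :: w) = a :: core w :=
  List.filter_cons_of_pos (by simpa using h)

theorem plus_zero_eq {a : T.cat.cell 2} (h : T.cat.two.b Pol.minus 0 a = a) :
    T.cat.two.b Pol.plus 0 a = a := by
  rw [← h, T.cat.two.b_b_le _ _ _ le_rfl]

theorem Word.comp_core (h : T.Word s w t) : T.wordComp s (core w) = T.wordComp s w := by
  induction w generalizing s with
  | nil => rfl
  | cons a w ih =>
    obtain ⟨⟨rfl, ha⟩, h⟩ := h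
    by_cases h₀ : T.cat.two.b Pol.minus 0 a = a
    · have e := plus_zero_eq h₀
      have := T.cat.two.comp_unit_left 0 (T.wordComp a w)
      rw [e] at h
      rw [h.comp_b.2.1] at this
      rw [core_cons_of_zero h₀, h₀, ih h, wordComp, e, this]
    · rw [core_cons_of_ne h₀, wordComp, wordComp, ih h]

theorem Word.eq_replicate (h : T.Word s w t) (hw : core w = []) :
    w = List.replicate w.length s ∧ s = t := by
  induction w generalizing s with
  | nil => exact ⟨rfl, h.1⟩
  | cons a w ih =>
    obtain ⟨⟨rfl, ha⟩, h⟩ := h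
    have h₀ : T.cat.two.b Pol.minus 0 a = a := by
      by_contra h₀
      rw [core_cons_of_ne h₀] at hw
      exact List.cons_ne_nil _ _ hw
    rw [core_cons_of_zero h₀] at hw
    rw [plus_zero_eq h₀] at h
    obtain ⟨h₁, rfl⟩ := ih h hw
    rw [h₀]
    refine ⟨?_, rfl⟩
    rw [List.length_cons, List.replicate_succ, ← h₁]

theorem Word.exists_split {a : T.cat.cell 2} {g : List (T.cat.cell 2)} (h : T.Word s w t)
    (hw : core w = a :: g) : s = T.cat.two.b Pol.minus 0 a ∧ T.IsLetter a ∧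
      T.cat.two.b Pol.minus 0 a ≠ a ∧ ∃ i p, w = List.replicate i s ++ a :: p ∧ core p = g ∧
      T.Word s (List.replicate i s) s ∧ T.Word (T.cat.two.b Pol.plus 0 a) p t := by
  obtain ⟨l, p, rfl, hl, ha, hp⟩ := List.filter_eq_cons_iff.1 hw
  obtain ⟨r, h₁, ⟨rfl, ha'⟩, h₂⟩ := h.split
  obtain ⟨e, rfl⟩ := h₁.eq_replicate (List.filter_eq_nil_iff.2 hl)
  exact ⟨rfl, ha', by simpa using ha, _, p, congrArg (· ++ a :: p) e, hp, e ▸ h₁, h₂⟩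

theorem exists_core (hT : isBiPro T) : ∃ V : T.cat.cell 2 → List (T.cat.cell 2),
    ∀ {s t w}, T.Word s w t → V (T.wordComp s w) = core w := by
  obtain ⟨v, v₁, v₂, v₃⟩ := exists_val hT (fun a => FreeMonoid.of (T.cat.up a))
  have h₀ : ∀ u, T.cat.two.b Pol.minus 0 u = u → v (T.cat.bd Pol.minus Nat.one_lt_two u) = 1 := by
    intro u hu
    rw [← hu, T.cat.two_b Nat.zero_lt_two,
      T.cat.bd_unit_gt Pol.minus Nat.zero_lt_one Nat.one_lt_two, v₁]
  have h₁ : ∀ a, v (T.cat.bd Pol.minus Nat.one_lt_two (T.cat.up (n := 1) a)) = v a := fun a =>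
    congrArg v (T.cat.bd_unit_eq _ _ _)
  refine ⟨fun u => FreeMonoid.toList (v (T.cat.bd Pol.minus Nat.one_lt_two u)), ?_⟩
  intro s t w h
  induction w generalizing s with
  | nil => exact congrArg FreeMonoid.toList (h₀ _ (h.2 _))
  | cons a w ih =>
    obtain ⟨⟨rfl, ha⟩, h⟩ := h
    have e : T.cat.bd Pol.plus Nat.zero_lt_two a = T.cat.bd Pol.minus Nat.zero_lt_two
        (T.wordComp (T.cat.two.b Pol.plus 0 a) w) := by
      have := h.comp_b.2.1.symm
      rw [T.cat.two_b Nat.zero_lt_two, T.cat.two_b Nat.zero_lt_two] at this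
      exact T.cat.unit_bd_inj _ this
    have e' : T.cat.bd Pol.plus Nat.zero_lt_one (T.cat.bd Pol.minus Nat.one_lt_two a) =
        T.cat.bd Pol.minus Nat.zero_lt_one (T.cat.bd Pol.minus Nat.one_lt_two
          (T.wordComp (T.cat.two.b Pol.plus 0 a) w)) := by
      rw [T.cat.bd_bd, T.cat.bd_bd]; exact e
    have key : FreeMonoid.toList (v (T.cat.bd Pol.minus Nat.one_lt_two
        (T.wordComp (T.cat.two.b Pol.minus 0 a) (a :: w)))) =
        FreeMonoid.toList (v (T.cat.bd Pol.minus Nat.one_lt_two a)) ++ core w := by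
      rw [wordComp, T.cat.two_comp Nat.zero_lt_two _ _ e,
        T.cat.bd_comp Pol.minus Nat.zero_lt_one Nat.one_lt_two _ _ e e', v₂,
        FreeMonoid.toList_mul]
      exact congrArg _ (ih h)
    refine key.trans ?_
    by_cases hz : T.cat.two.b Pol.minus 0 a = a
    · rw [core_cons_of_zero hz, h₀ a hz]; rfl
    · rw [core_cons_of_ne hz]
      obtain ⟨c, hc, rfl⟩ := ha.resolve_right hz
      rw [h₁, v₃ c hc]; rfl

theorem exists_word (hT : isBiPro T) (α : Pol) (u : T.cat.cell 2) : ∃ w, w ≠ [] ∧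
    T.Word (T.cat.two.b Pol.minus 0 u) w (T.cat.two.b Pol.plus 0 u) ∧
    T.cat.two.b α 1 u = T.wordComp (T.cat.two.b Pol.minus 0 u) w := by
  obtain ⟨x, y, q, hq⟩ := b_one_mem_pathSet_of_isBiPro hT α u
  have hb := b_zero_pathComp q
  rw [hq, T.cat.two.b_b_lt _ _ _ Nat.zero_lt_one, T.cat.two.b_b_lt _ _ _ Nat.zero_lt_one] at hb
  rw [← hq, hb.1, hb.2]
  clear hb hq
  induction q with
  | nil =>
    have e : T.cat.up (T.pathComp (Quiver.Path.nil (a := x))).1 = T.cat.up (n := 0) x :=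
      OmegaCat.up_unit Nat.zero_lt_one _
    have h : T.cat.two.b Pol.minus 0 (T.cat.up (n := 0) x) = T.cat.up (n := 0) x :=
      OmegaCat.b_up _ _
    have hw := word_singleton (T := T) (Or.inr h)
    rw [h, plus_zero_eq h] at hw
    exact ⟨_, List.cons_ne_nil _ _, hw, by rw [wordComp_singleton, e]⟩
  | cons r a ih =>
    obtain ⟨w, hw, h, e⟩ := ih
    have hw' := word_singleton (T := T) (Or.inl ⟨a.1.1, a.2, rfl⟩)
    rw [(b_zero_gen a).1, (b_zero_gen a).2] at hw'
    refine ⟨_, by simp [hw], h.append hw', ?_⟩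
    rw [h.comp_append hw', wordComp_singleton, ← e, up_pathComp_cons]

end MarkedTwoCat

namespace LabelMap

open MarkedTwoCat

variable {T S : MarkedTwoCat} {Φ : LabelMap T S} {s t : T.cat.cell 2}
  {w w' : List (T.cat.cell 2)} {u : T.cat.cell 2} {v v' : S.cat.cell 2}

theorem Sends.b_one_of_degenerate {i j i' j' : ℕ} {a : T.cat.cell 2} (ha : T.IsLetter a)
    (h : Φ.Sends (List.replicate i (T.cat.two.b Pol.minus 0 a) ++
      a :: List.replicate j (T.cat.two.b Pol.plus 0 a))
      (List.replicate i' (T.cat.two.b Pol.minus 0 a) ++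
      a :: List.replicate j' (T.cat.two.b Pol.plus 0 a)) a v) (α : Pol) :
    S.cat.two.b α 1 v = v := by
  obtain ⟨Q, lam, e, L, he, rfl⟩ := exists_edge ha
  rw [h.eq_app L he.le]
  exact (Φ.labelling L).lab.one e he α

theorem Sends.b_one_of_core_singleton {a : T.cat.cell 2} (hv : Φ.Sends w w' (T.wordComp s w) v)
    (h : T.Word s w t) (hc : core w = [a]) (hc' : core w' = [a]) (α : Pol) :
    S.cat.two.b α 1 v = v := by
  obtain ⟨h', -⟩ := hv.b_one h
  rw [← h.comp_core, hc, wordComp_singleton] at hv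
  obtain ⟨rfl, ha, -, i, p, rfl, cp, -, hp⟩ := h.exists_split hc
  obtain ⟨-, -, -, j, q, rfl, cq, -, hq⟩ := h'.exists_split hc'
  rw [(hp.eq_replicate cp).1, (hq.eq_replicate cq).1] at hv
  exact hv.b_one_of_degenerate ha α

/-- Identity faces are sent to identities. -/
theorem Sends.b_one_of_identity (h : T.Word s w t) (hc : core w = core w')
    (hv : Φ.Sends w w' (T.wordComp s w) v) : ∀ α, S.cat.two.b α 1 v = v := by
  generalize hg : core w = g at hc
  induction g generalizing s t w w' v with
  | nil =>
    obtain ⟨h', ne, ne', -⟩ := hv.b_one h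
    have z := h.zero
    rw [← h.comp_core, hg] at hv
    obtain ⟨e, -⟩ := h.eq_replicate hg
    obtain ⟨e', -⟩ := h'.eq_replicate hc.symm
    obtain ⟨i, hi⟩ := Nat.exists_eq_succ_of_ne_zero (List.length_pos_of_ne_nil ne).ne'
    obtain ⟨j, hj⟩ := Nat.exists_eq_succ_of_ne_zero (List.length_pos_of_ne_nil ne').ne'
    rw [hi, List.replicate_succ] at e
    rw [hj, List.replicate_succ] at e'
    refine Sends.b_one_of_degenerate (Φ := Φ) (a := s) (i := 0) (i' := 0) (j := i) (j' := j)
      (Or.inr (z _)) ?_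
    rw [z, z, List.replicate_zero, List.nil_append, ← e, List.nil_append, ← e']
    exact hv
  | cons a g ih =>
    cases g with
    | nil => exact hv.b_one_of_core_singleton h hg hc.symm
    | cons c g =>
    obtain ⟨h', -⟩ := hv.b_one h
    obtain ⟨rfl, ha, ha', i, p, rfl, cp, hi, hp⟩ := h.exists_split hg
    obtain ⟨-, -, -, j, q, rfl, cq, hj, hq⟩ := h'.exists_split hc.symm
    have z : ∀ α, T.cat.two.b α 0 (T.cat.two.b Pol.plus 0 a) = T.cat.two.b Pol.plus 0 a :=
      fun α => T.cat.two.b_b_le _ _ _ le_rfl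
    have hW := hi.append (word_singleton ha)
    have hD := hj.append (word_singleton ha)
    have hC := word_singleton (T := T) (Or.inr (z Pol.minus))
    rw [z, z] at hC
    have core_C : core [T.cat.two.b Pol.plus 0 a] = [] := core_cons_of_zero (z _)
    have core_rep : ∀ k, core (List.replicate k (T.cat.two.b Pol.minus 0 a)) = [] := fun k =>
      List.filter_eq_nil_iff.2 fun x hx => by
        obtain ⟨-, rfl⟩ := List.mem_replicate.1 hx
        simpa using T.cat.two.b_b_le Pol.minus Pol.minus a (le_refl 0)
    have core_a : core [a] = [a] := core_cons_of_ne ha'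
    have np : p ≠ [] := by rintro rfl; cases cp
    obtain ⟨a', sa⟩ := Φ.exists_sends (u := T.wordComp _ p) hp (hC.append hq) np (by simp)
      (by rw [hp.comp_b.1]) (by
        rw [hp.comp_b.1, ← hp.comp_core, ← (hC.append hq).comp_core, core_append, core_C, cp, cq]
        rfl)
    obtain ⟨b', sb⟩ := Φ.exists_sends (u := T.wordComp _ _) (hW.append hC) hD (by simp) (by simp)
      (by rw [(hW.append hC).comp_b.1]) (by
        rw [(hW.append hC).comp_b.1, ← (hW.append hC).comp_core, ← hD.comp_core]
        simp only [core_append, core_C, core_a, core_rep, List.nil_append, List.append_nil])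
    have ia := ih hp sa cp (by rw [core_append, core_C, cq]; rfl)
    have ib := fun α => sb.b_one_of_core_singleton (a := a) (hW.append hC)
      (by simp only [core_append, core_C, core_a, core_rep, List.nil_append, List.append_nil])
      (by simp only [core_append, core_a, core_rep, List.nil_append]) α
    have sc := Sends.exchange hW hC hq (by simp) sa sb
    have l₁ : ∀ (k : ℕ) (o : List (T.cat.cell 2)), List.replicate k (T.cat.two.b Pol.minus 0 a) ++
        [a] ++ o = List.replicate k (T.cat.two.b Pol.minus 0 a) ++ a :: o := fun k o => by
      rw [List.append_assoc]; rfl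
    have e : T.wordComp (T.cat.two.b Pol.minus 0 a)
        (List.replicate i (T.cat.two.b Pol.minus 0 a) ++ [a] ++ [T.cat.two.b Pol.plus 0 a] ++ q) =
        T.wordComp (T.cat.two.b Pol.minus 0 a)
          (List.replicate i (T.cat.two.b Pol.minus 0 a) ++ a :: p) := by
      rw [← h.comp_core, ← ((hW.append hC).append hq).comp_core, hg]
      simp only [core_append, core_C, core_a, core_rep, List.nil_append, List.append_nil, cq]
      rfl
    have e₁ := T.cat.two.comp_unit_right 1 (T.wordComp (T.cat.two.b Pol.minus 0 a)
      (List.replicate i (T.cat.two.b Pol.minus 0 a) ++ a :: p))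
    rw [h.comp_b.1] at e₁
    rw [← hW.comp_append hp, ← (hW.append hC).comp_append hq, e, l₁, l₁, e₁] at sc
    rw [hv.unique sc]
    obtain ⟨-, -, -, -, -, -, pa⟩ := sa.b_one hp
    obtain ⟨-, -, -, -, -, mb, -⟩ := sb.b_one (hW.append hC)
    rw [List.map_append] at pa mb
    obtain ⟨a₀, b₀, m₁⟩ := (word_letter (Φ := Φ) hW).composable (word_letter hC) (word_letter hq)
      pa mb
    exact S.cat.two.b_one_comp (word_letter hW).comp_b.1 ia ib (word_letter hq).comp_b.1 a₀ b₀ m₁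

end LabelMap

open OGPoset

section Congr

variable {P C : Type} {K : CxData P} {D : Two C} {lam mu : P → C}

theorem CxData.pv_congr (h : ∀ x, K.dim x ≤ 2 → lam x = mu x) {s t : P} {l : List P}
    (hl : K.Walk s l t) : K.pv D lam s l = K.pv D mu s l := by
  induction l generalizing s with
  | nil => exact h s (by rw [hl.2]; exact Nat.zero_le 2)
  | cons e l ih => rw [CxData.pv, CxData.pv, ih hl.2, h e (by rw [hl.1.2.1]; exact one_le_two)]

theorem CxData.Rw.congr (hK : K.Ok) (h : ∀ x, K.dim x ≤ 2 → lam x = mu x) {s t : P}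
    {xs p q : List P} {u : C} (hr : K.Rw D lam s xs p q u) (hx : ∀ x ∈ xs, K.dim x = 2)
    (hp : K.Walk s p t) : K.Rw D mu s xs p q u := by
  induction xs generalizing p u with
  | nil =>
    obtain ⟨rfl, rfl⟩ := hr
    exact ⟨rfl, CxData.pv_congr h hp⟩
  | cons x xs ih =>
    obtain ⟨a, b, v, rfl, hr, rfl⟩ := hr
    have hx2 := hx x (by simp)
    have h' := hK.walk_split hx2 hp
    refine ⟨a, b, v, rfl, ih hr (fun y hy => hx y (List.mem_cons_of_mem x hy))
      (hK.walk_step hx2 hp), ?_⟩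
    rw [wh, wh, CxData.pv_congr h h'.1, CxData.pv_congr h h'.2, h x hx2.le]

end Congr

/-- Labellings are determined by the labels of the elements of dimension at most 2. -/
theorem RDCpx.Labelling.ext_of_dim_le_two {Q : RDCpx} {T : MarkedTwoCat}
    {lam mu : Q.El → T.cat.cell 2} (L : Q.Labelling T lam) (M : Q.Labelling T mu)
    (h : ∀ x, dim x ≤ 2 → lam x = mu x) (x : Q.El) : lam x = mu x := by
  have hm := ((IsMolecule.atom x).good Q.rdc).molecule 2 Pol.minus
  obtain ⟨z, xs, nd, hx, hr⟩ := L.val x Pol.minus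
  have hr := hr.congr (cx_ok Q.rdc) h (fun y hy => ((hx y).1 hy).2) (walk_bord Q.rdc hm _)
  exact (M.val x Pol.minus).unique Q.rdc M.lab hm dimLe_bord ⟨z, xs, nd, hx, hr⟩

/-! ### The functor induced by a natural operation on labellings -/

namespace LabelMap

open MarkedTwoCat RDCpx

variable {T S : MarkedTwoCat} {Φ : LabelMap T S} {s t : T.cat.cell 2}
  {w w' z z' : List (T.cat.cell 2)} {u u' : T.cat.cell 2} {v v' : S.cat.cell 2}

theorem Sends.b_zero (h : Φ.Sends w w' u v) (hw : T.Word s w t) :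
    (T.cat.two.b Pol.minus 0 u = s ∧ T.cat.two.b Pol.plus 0 u = t) ∧
    S.cat.two.b Pol.minus 0 v = Φ.letter s ∧ S.cat.two.b Pol.plus 0 v = Φ.letter t := by
  obtain ⟨-, -, -, h₁, -, h₂, -⟩ := h.b_one hw
  rw [← T.cat.two.b_b_lt Pol.minus Pol.minus u Nat.zero_lt_one,
    ← T.cat.two.b_b_lt Pol.minus Pol.plus u Nat.zero_lt_one,
    ← S.cat.two.b_b_lt Pol.minus Pol.minus v Nat.zero_lt_one,
    ← S.cat.two.b_b_lt Pol.minus Pol.plus v Nat.zero_lt_one, h₁, h₂]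
  exact ⟨hw.comp_b.2, (word_letter hw).comp_b.2⟩

theorem Sends.vcomp (h : Φ.Sends w z u v) (h' : Φ.Sends z w' u' v') :
    Φ.Sends w w' (T.cat.two.comp 1 u u') (S.cat.two.comp 1 v v') := by
  obtain ⟨s, t, hw, hz, -, nz, -⟩ := h.exists_word
  obtain ⟨⟨e₁, -⟩, e₂, -⟩ := h.b_zero hw
  obtain ⟨⟨-, e₃⟩, -, e₄⟩ := h'.b_zero hz
  have hs : T.Word s [] s := ⟨rfl, hz.zero⟩
  have ht : T.Word t [] t := ⟨rfl, fun α => by rw [← e₃, T.cat.two.b_b_le _ _ _ le_rfl]⟩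
  have key := Sends.exchange (Φ := Φ) (B := []) hs hz ht nz (by rwa [List.append_nil]) h'
  rw [List.append_nil, List.nil_append, wordComp, wordComp, ← e₁, ← e₃, Two.comp_unit_left,
    Two.comp_unit_right, e₁, e₃, List.map_nil, wordComp, wordComp, ← e₂, ← e₄, Two.comp_unit_left,
    Two.comp_unit_right] at key
  exact key

theorem Sends.b_one_of_eq (hT : isBiPro T) (hw : T.Word s w t) (hz : T.Word s z t)
    (e : T.wordComp s w = T.wordComp s z) (h : Φ.Sends w z (T.wordComp s w) v) (α : Pol) :
    S.cat.two.b α 1 v = v := by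
  obtain ⟨V, hV⟩ := exists_core hT
  exact Sends.b_one_of_identity hw (by rw [← hV hw, e, hV hz]) h α

theorem Sends.change_inn (hT : isBiPro T) (h : Φ.Sends z z' u v) (hz : T.Word s z t)
    (hw : T.Word s w t) (nw : w ≠ []) (e : T.wordComp s w = T.wordComp s z) :
    Φ.Sends w z' u v := by
  obtain ⟨-, nz, -, h₁, -, h₂, -⟩ := h.b_one hz
  obtain ⟨i, hi⟩ := Φ.exists_sends (u := T.wordComp s w) hw hz nw nz (hw.comp_b.1 _)
    (by rw [hw.comp_b.1, e])
  have hb := hi.b_one_of_eq hT hw hz e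
  have key := hi.vcomp h
  obtain ⟨-, -, -, -, -, -, h₃⟩ := hi.b_one hw
  rw [hb, ← h₂] at h₃
  rwa [e, ← h₁, h₃, Two.comp_unit_left, Two.comp_unit_left] at key

theorem Sends.change_out (hT : isBiPro T) (h : Φ.Sends z' z u v) (hz : T.Word s z t)
    (hw : T.Word s w t) (nw : w ≠ []) (e : T.wordComp s w = T.wordComp s z) :
    Φ.Sends z' w u v := by
  obtain ⟨s', t', hz', hz₂, -, nz, -, h₁, -, h₂⟩ := h.exists_word
  obtain ⟨rfl, rfl⟩ := hz₂.eq_of_ne_nil hz nz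
  obtain ⟨i, hi⟩ := Φ.exists_sends (u := T.wordComp _ z) hz hw nz nw (hz.comp_b.1 _)
    (by rw [hz.comp_b.1, e])
  have hb := hi.b_one_of_eq hT hz hw e.symm
  have key := h.vcomp hi
  obtain ⟨-, -, -, -, -, h₃, -⟩ := hi.b_one hz
  rw [hb, ← h₂] at h₃
  rwa [← h₁, h₃, Two.comp_unit_right, Two.comp_unit_right] at key

/-- The value at a face only depends on the label of the face. -/
theorem Sends.unique_of_isBiPro (hT : isBiPro T) (h : Φ.Sends w w' u v) (h' : Φ.Sends z z' u v') :
    v = v' := by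
  obtain ⟨s, t, hw, hw', nw, nw', e₁, e₂, -⟩ := h.exists_word
  obtain ⟨r, q, hz, hz', nz, nz', e₃, e₄, -⟩ := h'.exists_word
  obtain ⟨⟨rfl, rfl⟩, -⟩ := h.b_zero hw
  obtain ⟨⟨rfl, rfl⟩, -⟩ := h'.b_zero hz
  exact (h'.change_inn hT hz hw nw (e₁.symm.trans e₃)).change_out hT hz' hw' nw'
    (e₂.symm.trans e₄) |> h.unique

variable (Φ) in
theorem exists_sends_of_isBiPro (hT : isBiPro T) (u : T.cat.cell 2) :
    ∃ v w w', Φ.Sends w w' u v := by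
  obtain ⟨w, nw, hw, e⟩ := exists_word hT Pol.minus u
  obtain ⟨w', nw', hw', e'⟩ := exists_word hT Pol.plus u
  obtain ⟨v, h⟩ := Φ.exists_sends hw hw' nw nw' e e'
  exact ⟨v, w, w', h⟩

variable (Φ) in
/-- The action on 2-cells. -/
noncomputable def fn (hT : isBiPro T) (u : T.cat.cell 2) : S.cat.cell 2 :=
  (Φ.exists_sends_of_isBiPro hT u).choose

variable (hT : isBiPro T)

theorem Sends.eq_fn (h : Φ.Sends w w' u v) : v = Φ.fn hT u := by
  obtain ⟨z, z', h'⟩ := (Φ.exists_sends_of_isBiPro hT u).choose_spec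
  exact h.unique_of_isBiPro hT h'

theorem sends_fn (hw : T.Word s w t) (hw' : T.Word s w' t) (ne : w ≠ [])
    (ne' : w' ≠ []) (h : T.cat.two.b Pol.minus 1 u = T.wordComp s w)
    (h' : T.cat.two.b Pol.plus 1 u = T.wordComp s w') : Φ.Sends w w' u (Φ.fn hT u) := by
  obtain ⟨v, hv⟩ := Φ.exists_sends hw hw' ne ne' h h'
  rwa [← hv.eq_fn hT]

theorem letter_eq_fn {a : T.cat.cell 2} (ha : T.IsLetter a) : Φ.letter a = Φ.fn hT a :=
  (sends_letter ha).eq_fn hT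

theorem app_eq_fn {Q : RDCpx} {lam : Q.El → T.cat.cell 2} (L : Q.Labelling T lam) {x : Q.El}
    (hx : dim x ≤ 2) : Φ.app Q lam x = Φ.fn hT (lam x) := by
  rcases hx.lt_or_eq with h | h
  · rw [app_eq_letter L (by omega)]
    refine letter_eq_fn hT ?_
    obtain h | h : dim x = 0 ∨ dim x = 1 := by omega
    · exact Or.inr (L.lab.zero x h _)
    · exact L.edge x h
  · exact Sends.eq_fn hT ⟨Q, lam, x, L, h, rfl, rfl, rfl, rfl⟩

theorem fn_b_zero (α : Pol) (u : T.cat.cell 2) :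
    Φ.fn hT (T.cat.two.b α 0 u) = S.cat.two.b α 0 (Φ.fn hT u) := by
  obtain ⟨v, w, w', h⟩ := Φ.exists_sends_of_isBiPro hT u
  obtain ⟨s, t, hw, -⟩ := h.exists_word
  obtain ⟨⟨rfl, rfl⟩, h₁, h₂⟩ := h.b_zero hw
  rw [← letter_eq_fn hT (T.isLetter_b_zero α u), ← h.eq_fn hT]
  cases α
  · exact h₁.symm
  · exact h₂.symm

theorem fn_wordComp (hw : T.Word s w t) (ne : w ≠ []) :
    Φ.fn hT (T.wordComp s w) = S.wordComp (Φ.letter s) (w.map Φ.letter) := by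
  have h := sends_fn (Φ := Φ) hT (u := T.wordComp s w) hw hw ne ne (hw.comp_b.1 _)
    (hw.comp_b.1 _)
  rw [← h.b_one_of_identity hw rfl Pol.minus]
  exact (h.b_one hw).2.2.2.2.2.1

theorem fn_b_one (α : Pol) (u : T.cat.cell 2) :
    Φ.fn hT (T.cat.two.b α 1 u) = S.cat.two.b α 1 (Φ.fn hT u) := by
  obtain ⟨v, w, w', h⟩ := Φ.exists_sends_of_isBiPro hT u
  obtain ⟨s, t, hw, hw', ne, ne', h₁, h₂, h₃, h₄⟩ := h.exists_word
  rw [← h.eq_fn hT]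
  cases α
  · rw [h₁, h₃, fn_wordComp hT hw ne]
  · rw [h₂, h₄, fn_wordComp hT hw' ne']

theorem fn_comp_one (e : T.cat.two.b Pol.plus 1 u = T.cat.two.b Pol.minus 1 u') :
    Φ.fn hT (T.cat.two.comp 1 u u') = S.cat.two.comp 1 (Φ.fn hT u) (Φ.fn hT u') := by
  obtain ⟨v, w, z, h⟩ := Φ.exists_sends_of_isBiPro hT u
  obtain ⟨v', z', w', h'⟩ := Φ.exists_sends_of_isBiPro hT u'
  obtain ⟨s, t, hw, hz, -, nz, -, h₁, -⟩ := h.exists_word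
  obtain ⟨s', t', hz', -, -, -, h₂, -⟩ := h'.exists_word
  rw [e, h₂] at h₁
  have e₁ := hz.comp_b
  rw [← h₁] at e₁
  obtain rfl := e₁.2.1.symm.trans hz'.comp_b.2.1
  obtain rfl := e₁.2.2.symm.trans hz'.comp_b.2.2
  have h'' := h'.change_inn hT hz' hz nz h₁.symm
  rw [← h.eq_fn hT, ← h'.eq_fn hT]
  exact ((h.vcomp h'').eq_fn hT).symm

theorem fn_comp_zero (e : T.cat.two.b Pol.plus 0 u = T.cat.two.b Pol.minus 0 u') :
    Φ.fn hT (T.cat.two.comp 0 u u') = S.cat.two.comp 0 (Φ.fn hT u) (Φ.fn hT u') := by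
  obtain ⟨v, w, w', h⟩ := Φ.exists_sends_of_isBiPro hT u
  obtain ⟨v', p, p', h'⟩ := Φ.exists_sends_of_isBiPro hT u'
  obtain ⟨s, m, hw, hw', nw, nw', h₁, h₂, h₃, -⟩ := h.exists_word
  obtain ⟨m', t, hp, hp', np, np', g₁, g₂, -, g₃⟩ := h'.exists_word
  obtain rfl : m = m' := by rw [← (h.b_zero hw).1.2, e, (h'.b_zero hp).1.1]
  have z := hp.zero
  have hm := word_singleton (T := T) (Or.inr (z Pol.minus))
  rw [z, z] at hm
  have e₁ : T.wordComp s (w ++ [m]) = T.wordComp s w := by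
    rw [hw.comp_append hm, wordComp_singleton]
    have := T.cat.two.comp_unit_right 0 (T.wordComp s w)
    rwa [hw.comp_b.2.2] at this
  have e₂ : T.wordComp m ([m] ++ p') = T.wordComp m p' := by
    rw [hm.comp_append hp', wordComp_singleton]
    have := T.cat.two.comp_unit_left 0 (T.wordComp m p')
    rwa [hp'.comp_b.2.1] at this
  have sa := h'.change_out hT hp' (hm.append hp') (by simp) e₂
  have sb := h.change_inn hT hw (hw.append hm) (by simp) e₁
  have key := (Sends.exchange hw hm hp' (by simp) sa sb).eq_fn hT
  have e' : S.cat.two.b Pol.plus 0 v = S.cat.two.b Pol.minus 0 v' := by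
    rw [(h.b_zero hw).2.2, (h'.b_zero hp).2.1]
  have ic : ∀ {C : Type} (D : Two C) {x y : C}, D.b Pol.plus 0 x = D.b Pol.minus 0 y →
      D.comp 1 (D.comp 0 (D.b Pol.minus 1 x) y) (D.comp 0 x (D.b Pol.plus 1 y)) =
        D.comp 0 x y := fun D x y e => by
    rw [← D.interchange Nat.zero_lt_one, D.comp_unit_left, D.comp_unit_right]
    · rw [D.b_b_le _ _ _ le_rfl]
    · rw [D.b_b_le _ _ _ le_rfl]
    · rw [D.b_b_lt _ _ _ Nat.zero_lt_one, e]
  rw [← h₁, ← g₂, ← h₃, ← g₃, ic _ e, ic _ e'] at key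
  rw [← key, ← h.eq_fn hT, ← h'.eq_fn hT]

variable (Φ) in
/-- The induced functor. -/
noncomputable def functor : T.cat ⟶ S.cat :=
  OmegaCat.homOfTwo T.isTwoCat S.isTwoCat (Φ.fn hT)
    (fun α k u hk => by
      obtain rfl | rfl : k = 0 ∨ k = 1 := by omega
      · exact fn_b_zero hT α u
      · exact fn_b_one hT α u)
    (fun k u u' hk e => by
      obtain rfl | rfl : k = 0 ∨ k = 1 := by omega
      · exact fn_comp_zero hT e
      · exact fn_comp_one hT e)

theorem functor_fn (u : T.cat.cell 2) : (Φ.functor hT).fn u = Φ.fn hT u := by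
  rw [functor]
  rfl

variable (Φ) in
/-- The induced morphism of bicoloured pros. -/
noncomputable def hom : T ⟶ S where
  functor := Φ.functor hT
  fn_gen a ha := by
    have e : S.cat.up ((Φ.functor hT).fn a) = Φ.letter (T.cat.up a) := by
      rw [OmegaCat.up_fn, functor_fn, letter_eq_fn hT (Or.inl ⟨a, ha, rfl⟩)]
    rcases (isLetter_letter (Φ := Φ) (Or.inl ⟨a, ha, rfl⟩)).1 with ⟨b, hb, h⟩ | h
    · exact Or.inl (OmegaCat.up_inj S.isTwoCat (h.trans e.symm) ▸ hb)
    · refine Or.inr ⟨S.cat.bd Pol.minus Nat.zero_lt_one ((Φ.functor hT).fn a), ?_⟩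
      refine OmegaCat.up_inj S.isTwoCat ?_
      rw [OmegaCat.up_unit, OmegaCat.up_bd S.isTwoCat, e, h]

theorem app_eq_hom {Q : RDCpx} {lam : Q.El → T.cat.cell 2} (L : Q.Labelling T lam) (x : Q.El) :
    Φ.app Q lam x = (Φ.hom hT).functor.fn (lam x) := by
  obtain ⟨m, hm⟩ := L.exists_hom
  obtain rfl : label m = lam := funext hm
  refine (Φ.labelling L).ext_of_dim_le_two (labelling_label (m ≫ Φ.hom hT)) (fun y hy => ?_) x
  rw [app_eq_fn hT L hy, label_comp]
  exact (functor_fn hT _).symm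

end LabelMap

open OGPoset Opposite

/-! ### The nerve is full and faithful -/

theorem RDCpx.exists_atom {B : RDCpx} (hB : RDCpx.isAtomShape B) :
    ∃ A : Atom, Nonempty (atomInclusion.obj A ≅ B) :=
  ⟨toSkeleton ⟨B, hB⟩, ⟨RDCpx.isAtomShape.ι.mapIso (fromSkeletonToSkeletonIso _)⟩⟩

theorem isAtomShape_atomInclusion (A : Atom) : RDCpx.isAtomShape (atomInclusion.obj A) :=
  ((fromSkeleton RDCpx.isAtomShape.FullSubcategory).obj A).property

section

variable (P : ProFunctor) {T S : BiPro}

/-- The action of a map of nerves on labelled atoms. -/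
noncomputable def atomAct (τ : (nerve P).obj T ⟶ (nerve P).obj S) (A : Atom)
    (m : proObj (atomInclusion.obj A) ⟶ T.obj) : proObj (atomInclusion.obj A) ⟶ S.obj :=
  InducedCategory.Hom.hom (X := P.functor.obj (atomInclusion.obj A)) (Y := S)
    (τ.app (op A) ⟨(ObjectProperty.homMk m : P.functor.obj (atomInclusion.obj A) ⟶ T)⟩).down

theorem atomAct_map (τ : (nerve P).obj T ⟶ (nerve P).obj S) {A B : Atom} (f : A ⟶ B)
    (m : proObj (atomInclusion.obj B) ⟶ T.obj) :
    atomAct P τ A (P.map (atomInclusion.map f) ≫ m) =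
      P.map (atomInclusion.map f) ≫ atomAct P τ B m := by
  have h := τ.naturality_apply f.op
    ⟨(ObjectProperty.homMk m : P.functor.obj (atomInclusion.obj B) ⟶ T)⟩
  exact congrArg (fun x : ULift (P.functor.obj (atomInclusion.obj A) ⟶ S) => x.down.hom) h

theorem exists_shapeAct (τ : (nerve P).obj T ⟶ (nerve P).obj S) :
    ∃ s : ∀ B : RDCpx, RDCpx.isAtomShape B → (proObj B ⟶ T.obj) → (proObj B ⟶ S.obj),
      (∀ {B C : RDCpx} (hB : RDCpx.isAtomShape B) (hC : RDCpx.isAtomShape C) (h : B ⟶ C)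
        (m : proObj C ⟶ T.obj), s B hB (P.map h ≫ m) = P.map h ≫ s C hC m) ∧
      ∀ (A : Atom) (m : proObj (atomInclusion.obj A) ⟶ T.obj),
        s _ (isAtomShape_atomInclusion A) m = atomAct P τ A m := by
  choose A e using fun (B : RDCpx) (hB : RDCpx.isAtomShape B) => RDCpx.exists_atom hB
  have e := fun B hB => (e B hB).some
  refine ⟨fun B hB m => P.map (e B hB).inv ≫ atomAct P τ (A B hB) (P.map (e B hB).hom ≫ m), ?_, ?_⟩
  · intro B C hB hC h m
    obtain ⟨k, hk⟩ := atomInclusion.map_surjective ((e B hB).hom ≫ h ≫ (e C hC).inv)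
    have h₁ : P.map (e B hB).hom ≫ P.map h ≫ m =
        P.map (atomInclusion.map k) ≫ P.map (e C hC).hom ≫ m := by
      rw [← Category.assoc, ← P.map_comp, ← Category.assoc, ← P.map_comp, hk, Category.assoc,
        Category.assoc, Iso.inv_hom_id, Category.comp_id]
    change P.map _ ≫ atomAct P τ _ (P.map (e B hB).hom ≫ P.map h ≫ m) = _
    rw [h₁, atomAct_map, hk, ← Category.assoc, ← P.map_comp, Iso.inv_hom_id_assoc, P.map_comp,
      Category.assoc]
  · intro B m
    obtain ⟨k, hk⟩ := atomInclusion.map_surjective (e _ (isAtomShape_atomInclusion B)).hom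
    change P.map _ ≫ atomAct P τ _ (P.map (e _ (isAtomShape_atomInclusion B)).hom ≫ m) = _
    rw [← hk, atomAct_map, hk, ← Category.assoc, ← P.map_comp, Iso.inv_hom_id, P.map_id,
      Category.id_comp]

theorem exists_act (τ : (nerve P).obj T ⟶ (nerve P).obj S) :
    ∃ s : ∀ Q : RDCpx, (proObj Q ⟶ T.obj) → (proObj Q ⟶ S.obj),
      (∀ {Q R : RDCpx} (f : Q ⟶ R) (m : proObj R ⟶ T.obj),
        s Q (P.map f ≫ m) = P.map f ≫ s R m) ∧
      ∀ (A : Atom) (m : proObj (atomInclusion.obj A) ⟶ T.obj), s _ m = atomAct P τ A m := by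
  obtain ⟨s₀, h₁, h₂⟩ := exists_shapeAct P τ
  have h : ∀ (Q : RDCpx) (m : proObj Q ⟶ T.obj), ∃ m' : proObj Q ⟶ S.obj,
      ∀ (A : RDCpx) (hA : RDCpx.isAtomShape A) (g : A ⟶ Q),
        P.map g ≫ m' = s₀ A hA (P.map g ≫ m) := fun Q m =>
    RDCpx.exists_glue P (fun A hA g => s₀ A hA (P.map g ≫ m)) fun hA hB h g => by
      rw [P.map_comp, Category.assoc, h₁ hA hB]
  choose s hs using h
  refine ⟨s, fun {Q R} f m => RDCpx.hom_ext_atomShape P fun A hA g => ?_, fun A m => ?_⟩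
  · rw [hs _ _ _ hA, ← Category.assoc, ← Category.assoc, ← P.map_comp, hs _ _ _ hA]
  · have := hs _ m _ (isAtomShape_atomInclusion A) (𝟙 _)
    rwa [P.map_id, Category.id_comp, Category.id_comp, h₂] at this

open RDCpx in
theorem exists_labelMap (τ : (nerve P).obj T ⟶ (nerve P).obj S) :
    ∃ Φ : LabelMap T.obj S.obj, ∀ (A : Atom) (m : proObj (atomInclusion.obj A) ⟶ T.obj) (x),
      Φ.app _ (label m) x = label (atomAct P τ A m) x := by
  classical
  obtain ⟨s, h₁, h₂⟩ := exists_act P τ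
  have ne : ∀ u : T.obj.cat.cell 2, Nonempty (S.obj.cat.cell 2) := fun u => by
    obtain ⟨Q, lam, e, L, -⟩ := LabelMap.exists_edge (T.obj.isLetter_b_zero Pol.minus u)
    exact ⟨label (s Q L.exists_hom.choose) e⟩
  let app : ∀ Q : RDCpx, (Q.El → T.obj.cat.cell 2) → Q.El → S.obj.cat.cell 2 := fun Q lam x =>
    if h : Q.Labelling T.obj lam then label (s Q h.exists_hom.choose) x else (ne (lam x)).some
  have key : ∀ {Q : RDCpx} (m : proObj Q ⟶ T.obj), app Q (label m) = label (s Q m) := fun {Q} m => by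
    have h := labelling_label m
    have e : h.exists_hom.choose = m := hom_ext_label h.exists_hom.choose_spec
    funext x
    exact (dif_pos h).trans (congrArg (fun m => label (s Q m) x) e)
  refine ⟨⟨app, fun {Q lam} L => ?_, fun {Q R} f {lam} L => ?_⟩, fun A m x => ?_⟩
  · obtain ⟨m, hm⟩ := L.exists_hom
    obtain rfl : label m = lam := funext hm
    rw [key]
    exact labelling_label _
  · obtain ⟨m, hm⟩ := L.exists_hom
    obtain rfl : label m = lam := funext hm
    have e : label m ∘ f.fn = label (P.map f ≫ m) := funext fun x => (label_map P f m x).symm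
    rw [e, key, key, h₁]
    exact funext fun x => label_map P f _ x
  · change app _ (label m) x = _
    rw [key, h₂]

theorem nerve_full (P : ProFunctor) : (nerve P).Full where
  map_surjective {T S} τ := by
    obtain ⟨Φ, hΦ⟩ := exists_labelMap P τ
    refine ⟨ObjectProperty.homMk (Φ.hom T.property), ?_⟩
    ext A m
    obtain ⟨m⟩ := m
    have key : ∀ m : proObj (atomInclusion.obj A.unop) ⟶ T.obj,
        m ≫ Φ.hom T.property = atomAct P τ A.unop m := fun m => by
      refine RDCpx.hom_ext_label fun x => ?_
      rw [← hΦ, RDCpx.label_comp, LabelMap.app_eq_hom T.property (RDCpx.labelling_label _)]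
    exact congrArg ULift.up (InducedCategory.Hom.ext (key m.hom))

theorem exists_label_eq {T : MarkedTwoCat} (hT : T.isBiPro) (u : T.cat.cell 2) :
    ∃ (Q : RDCpx) (m : proObj Q ⟶ T) (x : Q.El), RDCpx.label m x = u := by
  obtain ⟨-, -, -, Q, lam, x, L, -, -, -, h, -⟩ :=
    LabelMap.exists_sends_of_isBiPro (S := T) ⟨fun _ lam => lam, id, fun _ _ _ => rfl⟩ hT u
  obtain ⟨m, hm⟩ := L.exists_hom
  exact ⟨Q, m, x, (hm x).trans h⟩

theorem nerve_faithful (P : ProFunctor) : (nerve P).Faithful where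
  map_injective {T S} F G h := by
    refine InducedCategory.Hom.ext (MarkedTwoCat.Hom.ext
      (OmegaCat.hom_ext_two S.obj.isTwoCat fun u => ?_))
    obtain ⟨Q, m, x, rfl⟩ := exists_label_eq T.property u
    have key : m ≫ F.hom = m ≫ G.hom := by
      refine RDCpx.hom_ext_atomShape P fun B hB g => ?_
      obtain ⟨A, ⟨e⟩⟩ := RDCpx.exists_atom hB
      have h₁ : (P.map (e.hom ≫ g) ≫ m) ≫ F.hom = (P.map (e.hom ≫ g) ≫ m) ≫ G.hom :=
        congrArg (fun τ : (nerve P).obj T ⟶ (nerve P).obj S =>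
          atomAct P τ A (P.map (e.hom ≫ g) ≫ m)) h
      have h₂ := congrArg (fun k => P.map e.inv ≫ k) h₁
      simpa only [← Category.assoc, ← P.map_comp, Iso.inv_hom_id, Category.id_comp] using h₂
    exact congrArg (fun k => RDCpx.label k x) key

end

end DiagNerve

theorem mainTheorem3 :
    ∃ P : DiagNerve.ProFunctor, (∀ P' : DiagNerve.ProFunctor, P' = P) ∧
      DiagNerve.embedding.HasLeftKanExtension P.functor ∧
      ∀ (L : DiagNerve.DgmSet ⥤ DiagNerve.BiPro) (η : P.functor ⟶ DiagNerve.embedding ⋙ L),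
        L.IsLeftKanExtension η →
          L.IsLeftAdjoint ∧
          ∀ N : DiagNerve.BiPro ⥤ DiagNerve.DgmSet, (L ⊣ N) → N.Full ∧ N.Faithful := by
  refine ⟨DiagNerve.proFunctor, fun P' => DiagNerve.ProFunctor.eq _ _, inferInstance,
    fun L η h => ?_⟩
  obtain ⟨adj⟩ := DiagNerve.nonempty_adjunction _ L η h
  refine ⟨adj.isLeftAdjoint, fun N adj' => ?_⟩
  have := DiagNerve.nerve_full DiagNerve.proFunctor
  have := DiagNerve.nerve_faithful DiagNerve.proFunctor
  exact ⟨Functor.Full.of_iso (adj.rightAdjointUniq adj'),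
    Functor.Faithful.of_iso (adj.rightAdjointUniq adj')⟩
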